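/- Let $d\ge 2$, let $\xi^-\ne\xi^+$ be points of the unit sphere $\mathbb S^{d-1}\subset\mathbb R^d$ and let $V_{\min}>0$. Let $\mathcal S$ be the set of $V\in C^2(\mathbb S^{d-1})$ with $V(s)\ge V(\xi^\pm)=V_{\min}$ for all $s$, and such that for some $\delta,\mu>0$ one has $V(s)-V(\xi^\pm)\ge\mu|s-\xi^\pm|^2$ whenever $|s-\xi^\pm|<\delta$. Let $\mathcal P$ be the set of pairs $(V,\alpha)$ with $V\in\mathcal S$, $\alpha\in(0,2)$, with the product of the $C^2$ distance and the usual distance. Identify $(V,\alpha)\in\mathcal P$ with the potential $V(x)=V(x/|x|)/|x|^{\alpha}$ on $\mathbb R^d\setminus\{0\}$ (and $V(0)=+\infty$), and put $\alpha_*=(2-\alpha)/2$. For $a<b$ and $x\in H^1((a,b);\mathbb R^d)$ let $$\mathcal A([a,b];x)=\int_a^b\Big(\tfrac12|\dot x(t)|^2+V(x(t))\Big)\,dt\in[0,+\infty].$$ * Let $c(V)$ be the infimum of $\mathcal A([a,b];x)$ over all $a<b$ and $x\in H^1(a,b)$ with $x(a)=\xi^-$, $x(b)=\xi^+$. Let $\mathrm{In}$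 (resp. $\mathrm{Out}$) be the set of $V\in\mathcal P$ with $c(V)=4\sqrt{2V_{\min}}/(2-\alpha)$ (resp. $c(V)<4\sqrt{2V_{\min}}/(2-\alpha)$), and let $\Pi=\partial\,\mathrm{In}\cap\partial\,\mathrm{Out}$, boundaries being taken in $\mathcal P$. * For $\varepsilon\in[0,1]$ let $m(V,\varepsilon)$ be the infimum of $\mathcal A([-T,T];x)$ over all $T>0$ and $x\in H^1(-T,T)$ with $x(-T)=\xi^-$, $x(T)=\xi^+$ and $\min_{[-T,T]}|x|=\varepsilon$. For $\varepsilon\in(0,1]$ let $\gamma(V,\varepsilon)=(m(V,\varepsilon)-m(V,0))/\varepsilon^{\alpha_*}$, and let $\gamma(V,0^+)=\lim_{\varepsilon\to0^+}\gamma(V,\varepsilon)$. * A free parabolic Morse minimizer of $V$ is an $x\in H^1_{\rm loc}(\mathbb R;\mathbb R^d)$ with $\min_{\mathbb R}|x|>0$, with $|x(t)|\to+\infty$ and $x(t)/|x(t)|\to\xi^\pm$ as $t\to\pm\infty$, and such that $\mathcal A([a,b];x)\le\mathcal A([a',b'];z)$ for all $a<b$, $a'<b'$ and $z\in H^1(a',b')$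 with $z(a')=x(a)$, $z(b')=x(b)$. * For $\varepsilon>0$, an $\varepsilon$-constrained Morse minimizer of $V$ is an $x\in H^1_{\rm loc}(\mathbb R;\mathbb R^d)$ with $\min_{\mathbb R}|x|=\varepsilon$, with the same asymptotic behaviour, and such that the same inequality holds for all those $z$ that satisfy in addition $\min_{[a',b']}|z|=\min_{[a,b]}|x|$. If $[t_*,t_{**}]=\{t:|x(t)|=\varepsilon\}$, its jumps are $$\Delta_{\rm pos}(x)=\frac{|x(t_{**})-x(t_*)|}{\varepsilon},\qquad \Delta_{\rm vel}(x)=\frac{\dot x(t_{**}^+)\cdot x(t_{**})-\dot x(t_*^-)\cdot x(t_*)}{\varepsilon^{-\alpha/2}\,\varepsilon}.$$ The equalities $\Delta_{\rm pos}(V)=\Delta_{\rm vel}(V)=0$ mean that for every $\varepsilon>0$ there are $\varepsilon$-constrained Morse minimizers $x$ of $V$, and that all of them satisfy $\Delta_{\rm pos}(x)=\Delta_{\rm vel}(x)=0$. Then, for every $V\in\mathcal P$, the following are equivalent: 1. $V\in\Pi$; 2. $V$ has a free parabolic Morse minimizer; 3. for every $\varepsilon>0$, every $\varepsilon$-constrained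 Morse minimizer of $V$ is a free parabolic Morse minimizer of $V$; 4. $\Delta_{\rm pos}(V)=\Delta_{\rm vel}(V)=0$; 5. $\gamma(V,0^+)=0$. -/

import Mathlib

open Set Filter Topology MeasureTheory
open scoped Manifold ENNReal UniformConvergence

noncomputable section

namespace AnisotropicKepler

/-- The configuration space `ℝ^d`, with `d = n + 1`. -/
abbrev Space (n : ℕ) := EuclideanSpace ℝ (Fin (n + 1))

/-- The unit sphere of `ℝ^d`. -/
abbrev USphere (n : ℕ) := Metric.sphere (0 : Space n) 1

/-- The direction `x / |x|` of a nonzero vector, as a point of the sphere. -/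
def dir {n : ℕ} (x : Space n) (hx : x ≠ 0) : USphere n :=
  ⟨‖x‖⁻¹ • x, by
    rw [mem_sphere_zero_iff_norm, norm_smul, norm_inv, norm_norm,
      inv_mul_cancel₀ (norm_ne_zero_iff.2 hx)]⟩

open Classical in
/-- The extension of `V : S^{d-1} → ℝ`, homogeneous of degree `0`, to `ℝ^d ∖ {0}`. -/
def radialExt {n : ℕ} (V : USphere n → ℝ) (x : Space n) : ℝ :=
  if hx : x = 0 then 0 else V (dir x hx)

/-- The value, gradient and Hessian on the sphere of the degree `0` extension, as an element of the
space of functions on the sphere with the distance of uniform convergence. -/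
def jet {n : ℕ} (V : USphere n → ℝ) :
    USphere n →ᵤ (ℝ × (Space n →L[ℝ] ℝ) × (Space n →L[ℝ] Space n →L[ℝ] ℝ)) :=
  UniformFun.ofFun fun s =>
    (V s, fderiv ℝ (radialExt V) s, fderiv ℝ (fderiv ℝ (radialExt V)) s)

/-- `ξ` is a non-degenerate minimum of `V`: `V(s) - V(ξ) ≥ μ |s - ξ|²` near `ξ`. -/
def NondegenerateAt {n : ℕ} (V : USphere n → ℝ) (ξ : USphere n) : Prop :=
  ∃ δ > 0, ∃ μ > 0, ∀ s : USphere n, dist s ξ < δ → μ * dist s ξ ^ 2 ≤ V s - V ξ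

/-- The class `𝒮` of angular potentials, for fixed `ξ⁻`, `ξ⁺` and `V_min`. -/
structure IsAngular {n : ℕ} (ξm ξp : USphere n) (Vmin : ℝ) (V : USphere n → ℝ) : Prop where
  contMDiff : ContMDiff (𝓡 n) 𝓘(ℝ, ℝ) 2 V
  min_left : V ξm = Vmin
  min_right : V ξp = Vmin
  le : ∀ s, Vmin ≤ V s
  nondeg_left : NondegenerateAt V ξm
  nondeg_right : NondegenerateAt V ξp

/-- The class `𝒫` of pairs `(V, α)` with `V ∈ 𝒮` and `α ∈ (0, 2)`. -/
structure Potential {n : ℕ} (ξm ξp : USphere n) (Vmin : ℝ) where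
  ang : USphere n → ℝ
  α : ℝ
  isAngular : IsAngular ξm ξp Vmin ang
  α_mem : α ∈ Ioo (0 : ℝ) 2

/-- The product of the `C²` distance on the sphere and the usual distance of exponents. -/
instance {n : ℕ} {ξm ξp : USphere n} {Vmin : ℝ} :
    PseudoEMetricSpace (Potential ξm ξp Vmin) :=
  PseudoEMetricSpace.induced (fun V => (jet V.ang, V.α)) inferInstance

/-- `x ∈ H¹((a, b); ℝ^d)`, for the continuous representative: `x` is on `[a, b]` the primitive of
its (almost everywhere) derivative, which is square integrable. -/
def IsH1 {n : ℕ} (a b : ℝ) (x : ℝ → Space n) : Prop :=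
  MemLp (deriv x) 2 (volume.restrict (Ioc a b)) ∧
    ∀ t ∈ Icc a b, x t = x a + ∫ s in a..t, deriv x s

/-- `min_{t ∈ S} |x(t)|` exists and equals `ρ`. -/
def HasMinNorm {n : ℕ} (x : ℝ → Space n) (S : Set ℝ) (ρ : ℝ) : Prop :=
  IsLeast ((fun t => ‖x t‖) '' S) ρ

/-- The jumps on the constraint `|x| = ε` of a path `x` whose contact set is `[t_*, t_**]`:
`p` is the normalized position-jump, `v` the normalized velocity-jump
(for a potential of degree `-α`). -/
def HasPathJumps {n : ℕ} (α ε : ℝ) (x : ℝ → Space n) (p v : ℝ) : Prop :=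
  ∃ (t₁ t₂ : ℝ) (w₁ w₂ : Space n), t₁ ≤ t₂ ∧ {t | ‖x t‖ = ε} = Icc t₁ t₂ ∧
    Tendsto (deriv x) (𝓝[<] t₁) (𝓝 w₁) ∧ Tendsto (deriv x) (𝓝[>] t₂) (𝓝 w₂) ∧
    p = ‖x t₂ - x t₁‖ / ε ∧
    v = (inner ℝ w₂ (x t₂) - inner ℝ w₁ (x t₁)) / (ε ^ (-α / 2) * ε)

/-- `|x(t)| → ∞` and `x(t) / |x(t)| → ξ^±` as `t → ±∞`. -/
def HasAsymptotics {n : ℕ} (ξm ξp : USphere n) (x : ℝ → Space n) : Prop :=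
  Tendsto (fun t => ‖x t‖) atBot atTop ∧ Tendsto (fun t => ‖x t‖) atTop atTop ∧
    Tendsto (fun t => ‖x t‖⁻¹ • x t) atBot (𝓝 (ξm : Space n)) ∧
    Tendsto (fun t => ‖x t‖⁻¹ • x t) atTop (𝓝 (ξp : Space n))

namespace Potential

variable {n : ℕ} {ξm ξp : USphere n} {Vmin : ℝ} (V : Potential ξm ξp Vmin)

open Classical in
/-- The potential `V(x) = V(x/|x|) / |x|^α`, infinite at the origin. -/
def eval (x : Space n) : ℝ≥0∞ :=
  if hx : x = 0 then ⊤ else ENNReal.ofReal (V.ang (dir x hx) / ‖x‖ ^ V.α)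

/-- The (possibly infinite) action `𝒜([a, b]; x)`. -/
def action (a b : ℝ) (x : ℝ → Space n) : ℝ≥0∞ :=
  ∫⁻ t in Ioc a b, (ENNReal.ofReal (‖deriv x t‖ ^ 2 / 2) + V.eval (x t))

/-- The free fixed-endpoints level `c(V)`. -/
def c : ℝ≥0∞ :=
  sInf {A | ∃ (a b : ℝ) (x : ℝ → Space n), a < b ∧ IsH1 a b x ∧
    x a = (ξm : Space n) ∧ x b = (ξp : Space n) ∧ A = V.action a b x}

/-- The level `m(V, ε)` of paths from `ξ⁻` to `ξ⁺` with `min |x| = ε`. -/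
def m (ε : ℝ) : ℝ≥0∞ :=
  sInf {A | ∃ (T : ℝ) (x : ℝ → Space n), 0 < T ∧ IsH1 (-T) T x ∧
    x (-T) = (ξm : Space n) ∧ x T = (ξp : Space n) ∧
    HasMinNorm x (Icc (-T) T) ε ∧ A = V.action (-T) T x}

/-- `γ(V, ε) = (m(V, ε) - m(V, 0)) / ε^{α_*}`, where `α_* = (2 - α) / 2`. -/
def gamma (ε : ℝ) : ℝ :=
  ((V.m ε).toReal - (V.m 0).toReal) / ε ^ ((2 - V.α) / 2)

/-- Free minimizers of parabolic type, in the sense of Morse. -/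
structure IsFreeMorse (x : ℝ → Space n) : Prop where
  h1 : ∀ a b : ℝ, a < b → IsH1 a b x
  min_pos : ∃ ρ > 0, HasMinNorm x univ ρ
  asymptotics : HasAsymptotics ξm ξp x
  minimal : ∀ (a b a' b' : ℝ) (z : ℝ → Space n), a < b → a' < b' → IsH1 a' b' z →
    z a' = x a → z b' = x b → V.action a b x ≤ V.action a' b' z

/-- `ε`-constrained Morse minimizers. -/
structure IsConstrainedMorse (ε : ℝ) (x : ℝ → Space n) : Prop where
  h1 : ∀ a b : ℝ, a < b → IsH1 a b x
  min_eq : HasMinNorm x univ ε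
  asymptotics : HasAsymptotics ξm ξp x
  minimal : ∀ (a b a' b' : ℝ) (z : ℝ → Space n), a < b → a' < b' → IsH1 a' b' z →
    z a' = x a → z b' = x b →
    (∃ ρ, HasMinNorm z (Icc a' b') ρ ∧ HasMinNorm x (Icc a b) ρ) →
    V.action a b x ≤ V.action a' b' z

/-- `Δ_pos(V) = p` and `Δ_vel(V) = v`: for every `ε > 0` there are `ε`-constrained Morse minimizers
of `V`, and all of them have position-jump `p` and velocity-jump `v`. -/
def HasJumps (p v : ℝ) : Prop :=
  ∀ ε : ℝ, 0 < ε → (∃ x, V.IsConstrainedMorse ε x) ∧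
    ∀ x, V.IsConstrainedMorse ε x → HasPathJumps V.α ε x p v

end Potential

/-- Potentials with inner minimizers. -/
def In {n : ℕ} (ξm ξp : USphere n) (Vmin : ℝ) : Set (Potential ξm ξp Vmin) :=
  {V | V.c = ENNReal.ofReal (4 * √(2 * Vmin) / (2 - V.α))}

/-- Potentials with outer minimizers. -/
def Out {n : ℕ} (ξm ξp : USphere n) (Vmin : ℝ) : Set (Potential ξm ξp Vmin) :=
  {V | V.c < ENNReal.ofReal (4 * √(2 * Vmin) / (2 - V.α))}

/-- The common boundary of `In` and `Out` in `𝒫`. -/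
def separatingSet {n : ℕ} (ξm ξp : USphere n) (Vmin : ℝ) : Set (Potential ξm ξp Vmin) :=
  frontier (In ξm ξp Vmin) ∩ frontier (Out ξm ξp Vmin)

end AnisotropicKepler

end

/-! The whole theorem is reduced to the sign of one real number, `V.excess`.

Write β = (2 - α)/2. The function `V.rad ‖x‖` satisfies |∇Φ|² ≤ 2V, so along a path it changes by at
most the action (`calibration`, `rad_sub_le`), and the zero energy motion on the rays through ξ⁻ and
ξ⁺ attains equality (`Reach.radial`). A path from R ξ⁻ to R ξ⁺ through the origin therefore costs 2
`V.rad R`, up to an arbitrarily small error. The excess is the infimum of the difference between the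
action and 2 `V.rad R` over paths whose minimal distance from the origin is 1. It is unaffected by
enlarging R, and a homothety of ratio ε multiplies actions by ε^β; hence γ(V, ε) tends to the excess
(`tendsto_gamma`), and Out is the set of negative excess, with In as its complement
(`mem_out_iff_excess`, `mem_in_iff`).

Π is the set of zero excess. Out is open, since a path of negative excess can be reused for nearby
potentials (`isOpen_out`). On the closure of Out the excess is at most 0: non-degeneracy of the
minima forces paths of bounded excess to come very close to the rays at bounded radii, uniformly for
potentials near V, and there the tail can be replaced by a ray (`excess_le_of_mem_closure`). If the
excess is 0, flattening the angular part slightly makes it negative, because a near minimizer has a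
definite amount of angular potential to lose (`mem_closure_out`).

Constrained Morse minimizers exist for every ε by the direct method (`exists_isConstrainedMorse`).
Off the constraint they solve ẍ = ∇V(x) at energy zero, so that d/dt ⟨x, ẋ⟩ = 2βV is β times the
Lagrangian. At arbitrarily late times such a solution is almost radial (`frequently_almost_radial`);
between two such times a and b on opposite sides of the contact, the action is close to `V.rad ‖x a‖
+ V.rad ‖x b‖ + ε^β · excess`, while ⟨x, ẋ⟩/β at the two ends is close to -`V.rad ‖x a‖` and `V.rad
‖x b‖`. If the jumps vanish, the action equals the difference of the boundary terms, and the excess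
is 0. If the excess is 0, a competitor better than x on some interval could be spliced into a path
cheaper than 2 `V.rad R`, which would put V in Out; so x is free. Finally a free minimizer is smooth
and ⟨x, ẋ⟩ is strictly increasing along it, so it touches the sphere of minimal radius once and has
no jumps. -/

noncomputable section

namespace AnisotropicKepler

/-! ### Extension of angular functions by homogeneity of degree zero. -/

section RadialExt

variable {n : ℕ} {U : USphere n → ℝ}

theorem radialExt_of_ne {x : Space n} (hx : x ≠ 0) : radialExt U x = U (dir x hx) := dif_neg hx

theorem coe_ne_zero (s : USphere n) : (s : Space n) ≠ 0 := ne_zero_of_mem_unit_sphere s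

theorem norm_coe (s : USphere n) : ‖(s : Space n)‖ = 1 := norm_eq_of_mem_sphere s

theorem dir_smul {c : ℝ} (hc : 0 < c) {x : Space n} (hx : x ≠ 0) (hcx : c • x ≠ 0) :
    dir (c • x) hcx = dir x hx := by
  ext1
  simp only [dir, norm_smul, Real.norm_eq_abs, abs_of_pos hc, smul_smul]
  congr 1
  field_simp

theorem dir_coe (s : USphere n) : dir (s : Space n) (coe_ne_zero s) = s := by
  ext1
  simp [dir]

theorem norm_smul_dir {x : Space n} (hx : x ≠ 0) : ‖x‖ • (dir x hx : Space n) = x := by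
  simp [dir, smul_smul, norm_ne_zero_iff.2 hx]

theorem radialExt_coe (s : USphere n) : radialExt U (s : Space n) = U s := by
  rw [radialExt_of_ne (coe_ne_zero s), dir_coe]

theorem radialExt_smul {c : ℝ} (hc : 0 < c) (x : Space n) :
    radialExt U (c • x) = radialExt U x := by
  by_cases hx : x = 0
  · simp [hx]
  · have hcx : c • x ≠ 0 := smul_ne_zero hc.ne' hx
    rw [radialExt_of_ne hx, radialExt_of_ne hcx, dir_smul hc hx hcx]

/-- On the open manifold of nonzero vectors the extension is `U` composed with the normalization, a
smooth map into the sphere. This converts regularity in charts of the sphere into regularity in the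
ambient space. -/
theorem contDiffAt_radialExt (hU : ContMDiff (𝓡 n) 𝓘(ℝ, ℝ) 2 U) {x : Space n} (hx : x ≠ 0) :
    ContDiffAt ℝ 2 (radialExt U) x := by
  let O : TopologicalSpace.Opens (Space n) := ⟨{0}ᶜ, isOpen_compl_singleton⟩
  have hf : ContMDiff 𝓘(ℝ, Space n) 𝓘(ℝ, Space n) 2
      (fun y : O => ‖(y : Space n)‖⁻¹ • (y : Space n)) := by
    intro y
    have hy : (y : Space n) ≠ 0 := y.2
    refine (contMDiffAt_subtype_iff (f := fun y : Space n => ‖y‖⁻¹ • y)).2 ?_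
    refine ContDiffAt.contMDiffAt ?_
    exact ((contDiffAt_norm ℝ hy).inv (norm_ne_zero_iff.2 hy)).smul contDiffAt_id
  have hmem : ∀ y : O, ‖(y : Space n)‖⁻¹ • (y : Space n) ∈ Metric.sphere (0 : Space n) 1 :=
    fun y => (dir (y : Space n) y.2).2
  have := Fact.mk (@finrank_euclideanSpace_fin ℝ _ (n + 1))
  have hg := ContMDiff.codRestrict_sphere (n := n) hf hmem
  have hVg := hU.comp hg
  have h1 : ContMDiffAt 𝓘(ℝ, Space n) 𝓘(ℝ, ℝ) 2 (radialExt U) ((⟨x, hx⟩ : O) : Space n) := by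
    rw [← contMDiffAt_subtype_iff (U := O)]
    refine (hVg ⟨x, hx⟩).congr_of_eventuallyEq (Eventually.of_forall fun y => ?_)
    simp only [Function.comp]
    rw [radialExt_of_ne y.2]
    rfl
  exact contMDiffAt_iff_contDiffAt.1 h1

theorem differentiableAt_radialExt (hU : ContMDiff (𝓡 n) 𝓘(ℝ, ℝ) 2 U) {x : Space n} (hx : x ≠ 0) :
    DifferentiableAt ℝ (radialExt U) x :=
  (contDiffAt_radialExt hU hx).differentiableAt (by norm_num)

theorem fderiv_radialExt_smul {c : ℝ} (hc : 0 < c) (x : Space n) :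
    fderiv ℝ (radialExt U) (c • x) = c⁻¹ • fderiv ℝ (radialExt U) x := by
  have h : (fun y => radialExt U (c • y)) = radialExt U := funext fun y => radialExt_smul hc y
  have h2 := fderiv_comp_smul (𝕜 := ℝ) (f := radialExt U) (x := x) c
  rw [h] at h2
  rw [h2, smul_smul, inv_mul_cancel₀ hc.ne', one_smul]

/-- Euler's relation in degree 0. It lets derivatives in the direction of the minimum be traded for
derivatives in the direction of the displacement from it. -/
theorem fderiv_radialExt_self (hU : ContMDiff (𝓡 n) 𝓘(ℝ, ℝ) 2 U) {x : Space n} (hx : x ≠ 0) :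
    fderiv ℝ (radialExt U) x x = 0 := by
  have h1 : HasDerivAt (fun c : ℝ => c • x) ((1 : ℝ) • x) 1 := (hasDerivAt_id (1 : ℝ)).smul_const x
  have h2 : HasFDerivAt (radialExt U) (fderiv ℝ (radialExt U) x) ((1 : ℝ) • x) := by
    rw [one_smul]; exact (differentiableAt_radialExt hU hx).hasFDerivAt
  have h3 := h2.comp_hasDerivAt (1 : ℝ) h1
  rw [one_smul] at h3
  have h4 : HasDerivAt (radialExt U ∘ fun c : ℝ => c • x) 0 1 := by
    refine (hasDerivAt_const (1 : ℝ) (radialExt U x)).congr_of_eventuallyEq ?_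
    filter_upwards [lt_mem_nhds (zero_lt_one' ℝ)] with c hc
    exact radialExt_smul hc x
  exact h3.unique h4

theorem continuousAt_fderiv_radialExt (hU : ContMDiff (𝓡 n) 𝓘(ℝ, ℝ) 2 U) {x : Space n}
    (hx : x ≠ 0) : ContinuousAt (fderiv ℝ (radialExt U)) x :=
  ((contDiffAt_radialExt hU hx).fderiv_right (m := 1) (by norm_num)).continuousAt

end RadialExt

/-! ### Second-order behaviour at an angular minimum. -/

section Taylor

variable {n : ℕ} {U : USphere n → ℝ} {Vmin : ℝ} {ξ : USphere n}

/-- Because the extension is constant along rays, a minimum on the sphere is an unconstrained local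
minimum, and no Lagrange multiplier appears. -/
theorem fderiv_radialExt_min (hle : ∀ s, Vmin ≤ U s) (hξ : U ξ = Vmin) :
    fderiv ℝ (radialExt U) (ξ : Space n) = 0 := by
  apply IsLocalMin.fderiv_eq_zero
  filter_upwards [isOpen_compl_singleton.mem_nhds (coe_ne_zero ξ)] with y hy
  rw [radialExt_coe, hξ, radialExt_of_ne hy]
  exact hle _

/-- Near a minimum the derivative is `D²F(ξ)(y - ξ)` up to `η |y - ξ|`, and the increment is half of
the Hessian term up to `η |y - ξ|²`. -/
theorem exists_taylor_min (hU : ContMDiff (𝓡 n) 𝓘(ℝ, ℝ) 2 U) (hle : ∀ s, Vmin ≤ U s)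
    (hξ : U ξ = Vmin) {η : ℝ} (hη : 0 < η) :
    ∃ δ > 0, δ < 1 ∧ ∀ y : Space n, dist y ξ < δ →
      ‖fderiv ℝ (radialExt U) y - fderiv ℝ (fderiv ℝ (radialExt U)) ξ (y - ξ)‖ ≤ η * ‖y - ξ‖ ∧
      |radialExt U y - Vmin - fderiv ℝ (fderiv ℝ (radialExt U)) ξ (y - ξ) (y - ξ) / 2|
        ≤ η * ‖y - ξ‖ ^ 2 := by
  set F := radialExt U
  set H := fderiv ℝ (fderiv ℝ F) (ξ : Space n)
  have hd : HasFDerivAt (fderiv ℝ F) H (ξ : Space n) :=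
    (((contDiffAt_radialExt hU (coe_ne_zero ξ)).fderiv_right (m := 1)
      (by norm_num)).differentiableAt (by norm_num)).hasFDerivAt
  have hlo := (hasFDerivAt_iff_isLittleO.1 hd).def hη
  obtain ⟨δ, hδ, hball⟩ := Metric.eventually_nhds_iff.1 hlo
  have hF0 : fderiv ℝ F (ξ : Space n) = 0 := fderiv_radialExt_min hle hξ
  have key : ∀ y : Space n, dist y (ξ : Space n) < min δ (1 / 2) →
      ‖fderiv ℝ F y - H (y - ξ)‖ ≤ η * ‖y - ξ‖ := by
    intro y hy
    have := hball (lt_of_lt_of_le hy (min_le_left _ _))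
    simpa [hF0] using this
  refine ⟨min δ (1 / 2), by positivity, lt_of_le_of_lt (min_le_right _ _) (by norm_num), ?_⟩
  intro y hy
  refine ⟨key y hy, ?_⟩
  set v : Space n := y - ξ
  have hv : ‖v‖ < min δ (1 / 2) := by rwa [dist_eq_norm] at hy
  -- The remainder is estimated by the mean value inequality on the segment: after subtracting the
  -- quadratic term, the derivative in τ is controlled by the expansion of the gradient. The bound
  -- 1/2 on the radius keeps the segment away from the origin.
  have hline : ∀ τ ∈ Icc (0 : ℝ) 1, HasDerivWithinAt
      (fun τ : ℝ => F (ξ + τ • v) - τ ^ 2 / 2 * H v v)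
      (fderiv ℝ F (ξ + τ • v) v - τ * H v v) (Icc 0 1) τ := by
    intro τ hτ
    have hne : (ξ : Space n) + τ • v ≠ 0 := by
      intro h0
      have : ‖(ξ : Space n)‖ ≤ ‖v‖ := by
        rw [eq_neg_of_add_eq_zero_left h0, norm_neg, norm_smul, Real.norm_eq_abs, abs_of_nonneg hτ.1]
        exact mul_le_of_le_one_left (norm_nonneg _) hτ.2
      rw [norm_coe] at this
      have := hv.trans_le (min_le_right _ _)
      linarith
    have h1 : HasDerivAt (fun τ : ℝ => (ξ : Space n) + τ • v) v τ := by
      simpa using ((hasDerivAt_id τ).smul_const v).const_add (ξ : Space n)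
    have h2 := (differentiableAt_radialExt hU hne).hasFDerivAt.comp_hasDerivAt τ h1
    have h3 : HasDerivAt (fun τ : ℝ => τ ^ 2 / 2 * H v v) (τ * H v v) τ := by
      have := ((hasDerivAt_pow 2 τ).div_const 2).mul_const (H v v)
      exact this.congr_deriv (by push_cast; ring)
    exact (h2.sub h3).hasDerivWithinAt
  have hbd : ∀ τ ∈ Icc (0 : ℝ) 1, ‖fderiv ℝ F (ξ + τ • v) v - τ * H v v‖ ≤ η * ‖v‖ ^ 2 := by
    intro τ hτ
    have hn : ‖(ξ + τ • v) - (ξ : Space n)‖ ≤ ‖v‖ := by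
      rw [add_sub_cancel_left, norm_smul, Real.norm_eq_abs, abs_of_nonneg hτ.1]
      exact mul_le_of_le_one_left (norm_nonneg _) hτ.2
    have h := key (ξ + τ • v) (by rw [dist_eq_norm]; exact hn.trans_lt hv)
    have e : fderiv ℝ F (ξ + τ • v) v - τ * H v v
        = (fderiv ℝ F (ξ + τ • v) - H ((ξ + τ • v) - ξ)) v := by
      simp
    rw [e]
    calc _ ≤ ‖fderiv ℝ F (ξ + τ • v) - H ((ξ + τ • v) - ξ)‖ * ‖v‖ :=
          ContinuousLinearMap.le_opNorm _ _
      _ ≤ (η * ‖v‖) * ‖v‖ := by gcongr; exact h.trans (by gcongr)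
      _ = η * ‖v‖ ^ 2 := by ring
  have := (convex_Icc (0 : ℝ) 1).norm_image_sub_le_of_norm_hasDerivWithin_le hline hbd
    (left_mem_Icc.2 zero_le_one) (right_mem_Icc.2 zero_le_one)
  have hy' : (ξ : Space n) + v = y := by simp [v]
  have hFξ : F (ξ : Space n) = Vmin := by rw [← hξ]; exact radialExt_coe ξ
  simp only [one_smul, zero_smul, add_zero, hy', hFξ, Real.norm_eq_abs] at this
  refine le_trans (le_of_eq ?_) (this.trans (by simp))
  congr 1
  ring

theorem exists_radialExt_le (hU : ContMDiff (𝓡 n) 𝓘(ℝ, ℝ) 2 U) (hle : ∀ s, Vmin ≤ U s)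
    (hξ : U ξ = Vmin) :
    ∃ δ > 0, δ < 1 ∧ ∃ C > 0, ∀ y : Space n, dist y ξ < δ →
      radialExt U y ≤ Vmin + C * ‖y - ξ‖ ^ 2 := by
  obtain ⟨δ, hδ, hδ1, h⟩ := exists_taylor_min hU hle hξ one_pos
  set H := fderiv ℝ (fderiv ℝ (radialExt U)) (ξ : Space n)
  refine ⟨δ, hδ, hδ1, ‖H‖ + 1, by positivity, fun y hy => ?_⟩
  have h2 := (abs_le.1 (h y hy).2).2
  have h3 : H (y - ξ) (y - ξ) ≤ ‖H‖ * ‖y - (ξ : Space n)‖ ^ 2 := by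
    refine (le_abs_self _).trans ?_
    have := H.le_opNorm₂ (y - ξ) (y - (ξ : Space n))
    rw [Real.norm_eq_abs] at this
    nlinarith
  have : 0 ≤ ‖H‖ * ‖y - (ξ : Space n)‖ ^ 2 := by positivity
  nlinarith

/-- At a non-degenerate minimum, moving towards `ξ` decreases the angular potential. -/
theorem exists_fderiv_radialExt_le (hU : ContMDiff (𝓡 n) 𝓘(ℝ, ℝ) 2 U) (hle : ∀ s, Vmin ≤ U s)
    (hξ : U ξ = Vmin) (hnd : NondegenerateAt U ξ) :
    ∃ δ > 0, δ < 1 ∧ ∃ c > 0, ∀ s : USphere n, dist s ξ < δ →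
      fderiv ℝ (radialExt U) (s : Space n) (ξ : Space n) ≤ -c * dist s ξ ^ 2 := by
  obtain ⟨δ₀, hδ₀, μ, hμ, hnd⟩ := hnd
  -- With the tolerance μ/4 non-degeneracy gives H v v ≥ 3μ|v|²/2, then a derivative along v of at
  -- least 5μ|v|²/4; this leaves room for the constant μ.
  obtain ⟨δ, hδ, hδ1, h⟩ := exists_taylor_min hU hle hξ (η := μ / 4) (by positivity)
  set H := fderiv ℝ (fderiv ℝ (radialExt U)) (ξ : Space n)
  refine ⟨min δ δ₀, by positivity, (min_le_left _ _).trans_lt hδ1, μ, hμ, fun s hs => ?_⟩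
  have hsδ : dist (s : Space n) ξ < δ := hs.trans_le (min_le_left _ _)
  obtain ⟨h1, h2⟩ := h s hsδ
  have h3 := hnd s (hs.trans_le (min_le_right _ _))
  have hds : dist s ξ = ‖(s : Space n) - ξ‖ := by rw [Subtype.dist_eq, dist_eq_norm]
  rw [hds] at h3 ⊢
  set v := (s : Space n) - ξ
  rw [radialExt_coe] at h2
  have h2' := (abs_le.1 h2).2
  have h4 : (fderiv ℝ (radialExt U) (s : Space n) - H v) v ≥ - (μ / 4 * ‖v‖ ^ 2) := by
    have := (fderiv ℝ (radialExt U) (s : Space n) - H v).le_opNorm v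
    rw [Real.norm_eq_abs] at this
    have h5 : ‖fderiv ℝ (radialExt U) (s : Space n) - H v‖ * ‖v‖ ≤ μ / 4 * ‖v‖ ^ 2 := by
      calc _ ≤ (μ / 4 * ‖v‖) * ‖v‖ := by gcongr
        _ = _ := by ring
    linarith [(abs_le.1 (this.trans h5)).1]
  -- Since ξ = s - v and the derivative at s in the direction s vanishes, only the direction -v
  -- remains.
  have h6 : fderiv ℝ (radialExt U) (s : Space n) (ξ : Space n)
      = - fderiv ℝ (radialExt U) (s : Space n) v := by
    have : (ξ : Space n) = s - v := by simp [v]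
    rw [this, map_sub, fderiv_radialExt_self hU (coe_ne_zero s)]
    ring
  rw [h6]
  have h7 : (fderiv ℝ (radialExt U) (s : Space n) - H v) v
      = fderiv ℝ (radialExt U) (s : Space n) v - H v v := by simp
  rw [h7] at h4
  rw [hξ] at h3
  nlinarith [sq_nonneg ‖v‖]

end Taylor

end AnisotropicKepler

end

/-! ### The homogeneous potential and the radial Jacobi length. -/

noncomputable section

namespace AnisotropicKepler

namespace Potential

variable {n : ℕ} {ξm ξp : USphere n} {Vmin : ℝ} (V : Potential ξm ξp Vmin)

/-- The potential as a real-valued function, with value `0` at the origin. -/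
def pot (x : Space n) : ℝ := radialExt V.ang x * ‖x‖ ^ (-V.α)

/-- The exponent `α_* = (2 - α) / 2`. -/
def β : ℝ := (2 - V.α) / 2

/-- The Jacobi length `√(2 V_min) r^{α_*} / α_*` of the segment from the origin to `r ξ^±`. -/
def rad (r : ℝ) : ℝ := √(2 * Vmin) * (r ^ V.β / V.β)

theorem α_pos : 0 < V.α := V.α_mem.1

theorem α_lt_two : V.α < 2 := V.α_mem.2

theorem β_pos : 0 < V.β := by have := V.α_lt_two; unfold β; linarith

theorem β_lt_one : V.β < 1 := by have := V.α_pos; unfold β; linarith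

theorem α_eq : V.α = 2 - 2 * V.β := by unfold β; ring

variable {V}

theorem eval_of_ne {x : Space n} (hx : x ≠ 0) : V.eval x = ENNReal.ofReal (V.pot x) := by
  rw [eval, dif_neg hx, pot, radialExt_of_ne hx, Real.rpow_neg (norm_nonneg x), div_eq_mul_inv]

theorem eval_zero : V.eval (0 : Space n) = ⊤ := dif_pos rfl

theorem le_radialExt {x : Space n} (hx : x ≠ 0) : Vmin ≤ radialExt V.ang x := by
  rw [radialExt_of_ne hx]; exact V.isAngular.le _

theorem le_pot {x : Space n} (hx : x ≠ 0) : Vmin * ‖x‖ ^ (-V.α) ≤ V.pot x :=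
  mul_le_mul_of_nonneg_right (le_radialExt hx) (Real.rpow_nonneg (norm_nonneg x) _)

theorem pot_pos (hV : 0 < Vmin) {x : Space n} (hx : x ≠ 0) : 0 < V.pot x :=
  lt_of_lt_of_le (mul_pos hV (Real.rpow_pos_of_pos (norm_pos_iff.2 hx) _)) (le_pot hx)

theorem pot_nonneg (hV : 0 < Vmin) (x : Space n) : 0 ≤ V.pot x := by
  by_cases hx : x = 0
  · simp [pot, hx, radialExt]
  · exact (pot_pos hV hx).le

theorem exists_ang_le (V : Potential ξm ξp Vmin) : ∃ C > 0, ∀ s, V.ang s ≤ C := by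
  have : CompactSpace (USphere n) := isCompact_iff_compactSpace.1 (isCompact_sphere _ _)
  have hc : Continuous V.ang := V.isAngular.contMDiff.continuous
  obtain ⟨C, hC⟩ := (isCompact_range hc).bddAbove
  exact ⟨max C 1, by positivity, fun s => (hC ⟨s, rfl⟩).trans (le_max_left _ _)⟩

theorem pot_smul {c : ℝ} (hc : 0 < c) (x : Space n) : V.pot (c • x) = c ^ (-V.α) * V.pot x := by
  rw [pot, pot, radialExt_smul hc, norm_smul, Real.norm_eq_abs, abs_of_pos hc,
    Real.mul_rpow hc.le (norm_nonneg x)]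
  ring

theorem contDiffAt_pot {x : Space n} (hx : x ≠ 0) : ContDiffAt ℝ 2 V.pot x :=
  (contDiffAt_radialExt V.isAngular.contMDiff hx).mul
    ((contDiffAt_norm ℝ hx).rpow_const_of_ne (norm_ne_zero_iff.2 hx))

theorem continuousAt_pot {x : Space n} (hx : x ≠ 0) : ContinuousAt V.pot x :=
  (contDiffAt_pot hx).continuousAt

theorem differentiableAt_pot {x : Space n} (hx : x ≠ 0) : DifferentiableAt ℝ V.pot x :=
  (contDiffAt_pot hx).differentiableAt (by norm_num)

theorem continuousAt_fderiv_pot {x : Space n} (hx : x ≠ 0) : ContinuousAt (fderiv ℝ V.pot) x :=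
  ((contDiffAt_pot hx).fderiv_right (m := 1) (by norm_num)).continuousAt

theorem hasFDerivAt_norm_rpow {x : Space n} (hx : x ≠ 0) (p : ℝ) :
    HasFDerivAt (fun y : Space n => ‖y‖ ^ p) ((p * ‖x‖ ^ (p - 2)) • innerSL ℝ x) x := by
  have h1 : HasFDerivAt (fun y : Space n => ‖y‖ ^ 2) ((2 : ℝ) • innerSL ℝ x) x := by
    have := (hasStrictFDerivAt_norm_sq x).hasFDerivAt
    rwa [two_nsmul, ← two_smul ℝ] at this
  have hpos : 0 < ‖x‖ := norm_pos_iff.2 hx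
  have h2 := h1.rpow_const (p := p / 2) (Or.inl (by positivity))
  have h3 : (fun y : Space n => (‖y‖ ^ 2) ^ (p / 2)) = fun y => ‖y‖ ^ p := by
    ext y
    rw [← Real.rpow_natCast, ← Real.rpow_mul (norm_nonneg y)]
    congr 1; push_cast; ring
  rw [h3] at h2
  refine h2.congr_fderiv ?_
  rw [smul_smul, ← Real.rpow_natCast, ← Real.rpow_mul (norm_nonneg x)]
  congr 1
  have : ((2 : ℕ) : ℝ) * (p / 2 - 1) = p - 2 := by push_cast; ring
  rw [this]; ring

theorem fderiv_pot_apply {x : Space n} (hx : x ≠ 0) (v : Space n) :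
    fderiv ℝ V.pot x v = ‖x‖ ^ (-V.α) * fderiv ℝ (radialExt V.ang) x v
      - V.α * ‖x‖ ^ (-V.α - 2) * radialExt V.ang x * inner ℝ x v := by
  have h := (differentiableAt_radialExt V.isAngular.contMDiff hx).hasFDerivAt.mul
    (hasFDerivAt_norm_rpow hx (-V.α))
  have h' : fderiv ℝ V.pot x = _ := h.fderiv
  rw [h']
  simp
  ring

theorem fderiv_pot_self {x : Space n} (hx : x ≠ 0) : fderiv ℝ V.pot x x = -V.α * V.pot x := by
  rw [fderiv_pot_apply hx, fderiv_radialExt_self V.isAngular.contMDiff hx,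
    real_inner_self_eq_norm_sq, pot]
  have hpos : 0 < ‖x‖ := norm_pos_iff.2 hx
  have : ‖x‖ ^ (-V.α - 2) * ‖x‖ ^ 2 = ‖x‖ ^ (-V.α) := by
    rw [← Real.rpow_natCast, ← Real.rpow_add hpos]; congr 1; push_cast; ring
  rw [← this]; ring

theorem rad_nonneg {r : ℝ} (hr : 0 ≤ r) : 0 ≤ V.rad r := by
  have := V.β_pos
  exact mul_nonneg (Real.sqrt_nonneg _) (div_nonneg (Real.rpow_nonneg hr _) this.le)

theorem rad_mono {r s : ℝ} (hr : 0 ≤ r) (h : r ≤ s) : V.rad r ≤ V.rad s := by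
  have := V.β_pos
  unfold rad
  gcongr

theorem rad_zero : V.rad 0 = 0 := by simp [rad, Real.zero_rpow V.β_pos.ne']

theorem rad_mul {c r : ℝ} (hc : 0 ≤ c) (hr : 0 ≤ r) : V.rad (c * r) = c ^ V.β * V.rad r := by
  rw [rad, rad, Real.mul_rpow hc hr]; ring

theorem continuous_rad : Continuous V.rad := by
  unfold rad
  exact continuous_const.mul ((Real.continuous_rpow_const V.β_pos.le).div_const _)

theorem two_rad_one : 2 * V.rad 1 = 4 * √(2 * Vmin) / (2 - V.α) := by
  have := V.α_lt_two
  rw [rad, β, Real.one_rpow]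
  have h : (2 - V.α) ≠ 0 := by linarith
  field_simp
  ring

theorem tendsto_rad (hV : 0 < Vmin) : Tendsto V.rad atTop atTop := by
  have h : 0 < √(2 * Vmin) := Real.sqrt_pos.2 (by positivity)
  exact ((tendsto_rpow_atTop V.β_pos).atTop_div_const V.β_pos).const_mul_atTop h

end Potential

end AnisotropicKepler

end

/-! ### Paths of class H¹, time changes, and reachability at given cost. -/

noncomputable section

namespace AnisotropicKepler

section Affine

/-- The correspondence of intervals is expressed by a preimage, so that translations, dilations and
reversal of time are covered at once; the passage through closed intervals is needed because
reversal exchanges the open and the closed end. -/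
theorem lintegral_comp_affine {k : ℝ} (hk : k ≠ 0) (h : ℝ) (f : ℝ → ℝ≥0∞) {a b a' b' : ℝ}
    (hmap : (fun t => k * t + h) ⁻¹' Icc a' b' = Icc a b) :
    ∫⁻ t in Ioc a b, f (k * t + h) = ENNReal.ofReal |k⁻¹| * ∫⁻ t in Ioc a' b', f t := by
  have hmeas : Measure.map (fun t : ℝ => k * t + h) volume = ENNReal.ofReal |k⁻¹| • volume := by
    have h1 : (fun t : ℝ => k * t + h) = (fun t => t + h) ∘ (fun t => k * t) := rfl
    rw [h1, ← Measure.map_map (by fun_prop) (by fun_prop), Real.map_volume_mul_left hk,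
      Measure.map_smul, map_add_right_eq_self]
  have hemb : MeasurableEmbedding (fun t : ℝ => k * t + h) :=
    (measurableEmbedding_addRight h).comp (measurableEmbedding_mulLeft₀ hk)
  rw [setLIntegral_congr (Ioc_ae_eq_Icc (a := a)), setLIntegral_congr (Ioc_ae_eq_Icc (a := a')),
    ← hmap, ← smul_eq_mul, ← lintegral_smul_measure, ← Measure.restrict_smul, ← hmeas, hemb.restrict_map,
    hemb.lintegral_map]

end Affine

namespace IsH1

variable {n : ℕ} {a b c : ℝ} {x y : ℝ → Space n}

/-- Finiteness of a lower Lebesgue integral is the convenient form: it is stable under concatenation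
and changes of variables without any discussion of integrability. -/
theorem memLp_deriv_iff {a b : ℝ} {x : ℝ → Space n} :
    MemLp (deriv x) 2 (volume.restrict (Ioc a b)) ↔
      ∫⁻ t in Ioc a b, ENNReal.ofReal (‖deriv x t‖ ^ 2 / 2) < ⊤ := by
  have hm : AEStronglyMeasurable (deriv x) (volume.restrict (Ioc a b)) :=
    (stronglyMeasurable_deriv x).aestronglyMeasurable
  rw [memLp_two_iff_integrable_sq_norm hm]
  have hmeas : Measurable fun t => ‖deriv x t‖ ^ 2 := (measurable_deriv x).norm.pow_const 2
  have h1 : Integrable (fun t => ‖deriv x t‖ ^ 2) (volume.restrict (Ioc a b)) ↔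
      Integrable (fun t => ‖deriv x t‖ ^ 2 / 2) (volume.restrict (Ioc a b)) :=
    ⟨fun h => h.div_const 2, fun h => by simpa using h.mul_const 2⟩
  rw [h1, lt_top_iff_ne_top]
  exact (lintegral_ofReal_ne_top_iff_integrable (hmeas.div_const 2).aestronglyMeasurable
    (Eventually.of_forall fun t => by positivity)).symm

theorem intervalIntegrable (hx : IsH1 a b x) (hab : a ≤ b) :
    IntervalIntegrable (deriv x) volume a b := by
  rw [intervalIntegrable_iff_integrableOn_Ioc_of_le hab]
  exact hx.1.integrable (by norm_num)

theorem sub_eq (hx : IsH1 a b x) {s t : ℝ} (hs : s ∈ Icc a b) (ht : t ∈ Icc a b) :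
    x t - x s = ∫ τ in s..t, deriv x τ := by
  have hab : a ≤ b := hs.1.trans hs.2
  have hi := hx.intervalIntegrable hab
  have his : IntervalIntegrable (deriv x) volume a s :=
    hi.mono_set (by rw [uIcc_of_le hs.1, uIcc_of_le hab]; exact Icc_subset_Icc_right hs.2)
  have hit : IntervalIntegrable (deriv x) volume a t :=
    hi.mono_set (by rw [uIcc_of_le ht.1, uIcc_of_le hab]; exact Icc_subset_Icc_right ht.2)
  rw [hx.2 t ht, hx.2 s hs, ← intervalIntegral.integral_interval_sub_left hit his]
  abel

theorem of_sub (hm : MemLp (deriv x) 2 (volume.restrict (Ioc a b)))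
    (h : ∀ t ∈ Icc a b, x t - x a = ∫ τ in a..t, deriv x τ) : IsH1 a b x :=
  ⟨hm, fun t ht => by rw [← h t ht]; abel⟩

theorem continuousOn (hx : IsH1 a b x) : ContinuousOn x (Icc a b) := by
  by_cases hab : a ≤ b
  · have hi : IntegrableOn (deriv x) (uIcc a b) := by
      rw [uIcc_of_le hab, integrableOn_Icc_iff_integrableOn_Ioc]
      exact hx.1.integrable (by norm_num)
    have := (intervalIntegral.continuousOn_primitive_interval hi).const_add (x a)
    rw [uIcc_of_le hab] at this
    exact this.congr hx.2
  · rw [Icc_eq_empty hab]; exact continuousOn_empty x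

theorem mono (hx : IsH1 a b x) {a' b' : ℝ} (ha : a ≤ a') (hb : b' ≤ b) : IsH1 a' b' x := by
  refine of_sub (hx.1.mono_measure (Measure.restrict_mono (Ioc_subset_Ioc ha hb) le_rfl)) ?_
  intro t ht
  exact hx.sub_eq ⟨ha, ht.1.trans (ht.2.trans hb)⟩ ⟨ha.trans ht.1, ht.2.trans hb⟩

theorem deriv_eqOn (h : EqOn x y (Icc a b)) : EqOn (deriv x) (deriv y) (Ioo a b) := fun t ht =>
  EventuallyEq.deriv_eq (by filter_upwards [Icc_mem_nhds ht.1 ht.2] with s hs using h hs)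

theorem deriv_ae_eq (h : EqOn x y (Icc a b)) :
    deriv x =ᵐ[volume.restrict (Ioc a b)] deriv y := by
  rw [← restrict_Ioo_eq_restrict_Ioc]
  exact (ae_restrict_mem measurableSet_Ioo).mono fun t ht => deriv_eqOn h ht

theorem congr (hx : IsH1 a b x) (h : EqOn x y (Icc a b)) : IsH1 a b y := by
  refine of_sub (hx.1.ae_eq (deriv_ae_eq h)) fun t ht => ?_
  have ha : a ∈ Icc a b := ⟨le_rfl, ht.1.trans ht.2⟩
  rw [← h ht, ← h ha, hx.sub_eq ha ht]
  refine intervalIntegral.integral_congr_ae_restrict ?_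
  rw [uIoc_of_le ht.1]
  exact deriv_ae_eq (h.mono (Icc_subset_Icc_right ht.2))

theorem concat (h₁ : IsH1 a b x) (h₂ : IsH1 b c x) (hab : a ≤ b) (hbc : b ≤ c) : IsH1 a c x := by
  refine of_sub ?_ fun t ht => ?_
  · rw [memLp_deriv_iff, ← Ioc_union_Ioc_eq_Ioc hab hbc]
    exact (lintegral_union_le _ _ _).trans_lt
      (ENNReal.add_lt_top.2 ⟨memLp_deriv_iff.1 h₁.1, memLp_deriv_iff.1 h₂.1⟩)
  · rcases le_total t b with htb | hbt
    · exact h₁.sub_eq ⟨le_rfl, hab⟩ ⟨ht.1, htb⟩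
    · have e1 := h₁.sub_eq ⟨le_rfl, hab⟩ ⟨hab, le_rfl⟩
      have e2 := h₂.sub_eq ⟨le_rfl, hbc⟩ ⟨hbt, ht.2⟩
      have i2 : IntervalIntegrable (deriv x) volume b t :=
        (h₂.mono le_rfl ht.2).intervalIntegrable hbt
      rw [← intervalIntegral.integral_add_adjacent_intervals (h₁.intervalIntegrable hab) i2,
        ← e1, ← e2]
      abel

theorem deriv_affine (x : ℝ → Space n) (lam k h t : ℝ) :
    deriv (fun t => lam • x (k * t + h)) t = (lam * k) • deriv x (k * t + h) := by
  have h1 : (fun t => lam • x (k * t + h)) = lam • fun t => (fun s => x (s + h)) (k * t) := rfl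
  rw [h1, deriv_const_smul_field, deriv_comp_mul_left k (fun s => x (s + h)), deriv_comp_add_const, smul_smul]

theorem affine {k h a' b' : ℝ} (hx : IsH1 a' b' x) (hk : k ≠ 0)
    (hmap : (fun t => k * t + h) ⁻¹' Icc a' b' = Icc a b) (lam : ℝ) :
    IsH1 a b fun t => lam • x (k * t + h) := by
  refine of_sub ?_ fun t ht => ?_
  · rw [memLp_deriv_iff]
    have h1 : ∀ t, ENNReal.ofReal (‖deriv (fun t => lam • x (k * t + h)) t‖ ^ 2 / 2)
        = ENNReal.ofReal ((lam * k) ^ 2) *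
          (fun s => ENNReal.ofReal (‖deriv x s‖ ^ 2 / 2)) (k * t + h) := by
      intro t
      rw [deriv_affine, norm_smul, mul_pow, Real.norm_eq_abs, sq_abs, ← ENNReal.ofReal_mul
        (by positivity), mul_div_assoc]
    simp_rw [h1]
    rw [lintegral_const_mul' _ _ ENNReal.ofReal_ne_top,
      lintegral_comp_affine hk h (fun s => ENNReal.ofReal (‖deriv x s‖ ^ 2 / 2)) hmap]
    exact ENNReal.mul_lt_top ENNReal.ofReal_lt_top
      (ENNReal.mul_lt_top ENNReal.ofReal_lt_top (memLp_deriv_iff.1 hx.1))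
  · have hmem : ∀ s ∈ Icc a b, k * s + h ∈ Icc a' b' := fun s hs => by
      rw [← hmap] at hs; exact hs
    have ha : a ∈ Icc a b := ⟨le_rfl, ht.1.trans ht.2⟩
    simp_rw [deriv_affine]
    rw [intervalIntegral.integral_smul, intervalIntegral.integral_comp_mul_add _ hk,
      ← hx.sub_eq (hmem a ha) (hmem t ht), smul_smul, mul_assoc, mul_inv_cancel₀ hk, mul_one,
      smul_sub]

end IsH1

namespace Potential

variable {n : ℕ} {ξm ξp : USphere n} {Vmin : ℝ} {V : Potential ξm ξp Vmin}
  {a b c : ℝ} {x y : ℝ → Space n}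

theorem eval_smul {c : ℝ} (hc : 0 < c) (p : Space n) :
    V.eval (c • p) = ENNReal.ofReal (c ^ (-V.α)) * V.eval p := by
  have hpos : 0 < c ^ (-V.α) := Real.rpow_pos_of_pos hc _
  by_cases hp : p = 0
  · rw [hp, smul_zero, eval_zero, ENNReal.mul_top (by simpa using hpos)]
  · rw [eval_of_ne hp, eval_of_ne (smul_ne_zero hc.ne' hp), pot_smul hc, ENNReal.ofReal_mul hpos.le]

theorem action_congr (h : EqOn x y (Icc a b)) : V.action a b x = V.action a b y := by
  refine lintegral_congr_ae ?_
  filter_upwards [IsH1.deriv_ae_eq h, ae_restrict_mem measurableSet_Ioc] with t ht hmem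
  rw [ht, h (Ioc_subset_Icc_self hmem)]

theorem action_add (hab : a ≤ b) (hbc : b ≤ c) :
    V.action a c x = V.action a b x + V.action b c x := by
  rw [action, ← Ioc_union_Ioc_eq_Ioc hab hbc,
    lintegral_union measurableSet_Ioc (Ioc_disjoint_Ioc_of_le le_rfl)]
  rfl

theorem action_mono {a' b' : ℝ} (ha : a ≤ a') (hb : b' ≤ b) :
    V.action a' b' x ≤ V.action a b x :=
  lintegral_mono_set (Ioc_subset_Ioc ha hb)

theorem action_self : V.action a a x = 0 := by simp [action]

theorem action_affine {k h a' b' lam : ℝ} (hk : k ≠ 0)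
    (hmap : (fun t => k * t + h) ⁻¹' Icc a' b' = Icc a b) :
    V.action a b (fun t => lam • x (k * t + h)) = ENNReal.ofReal |k⁻¹| *
      ∫⁻ t in Ioc a' b', (ENNReal.ofReal ((lam * k) ^ 2) * ENNReal.ofReal (‖deriv x t‖ ^ 2 / 2)
        + V.eval (lam • x t)) := by
  rw [← lintegral_comp_affine hk h _ hmap, action]
  refine lintegral_congr fun t => ?_
  rw [IsH1.deriv_affine, norm_smul, mul_pow, Real.norm_eq_abs, sq_abs, mul_div_assoc,
    ENNReal.ofReal_mul (by positivity)]

theorem preimage_affine_of_pos {k h : ℝ} (hk : 0 < k) (a b : ℝ) :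
    (fun t => k * t + h) ⁻¹' Icc (k * a + h) (k * b + h) = Icc a b := by
  ext t
  simp [hk]

theorem preimage_neg (a b : ℝ) : (fun t : ℝ => (-1) * t + 0) ⁻¹' Icc (-b) (-a) = Icc a b := by
  ext t
  simp only [mem_preimage, mem_Icc]
  constructor <;> rintro ⟨h1, h2⟩ <;> constructor <;> linarith

theorem action_comp_add (h : ℝ) :
    V.action a b (fun t => x (t + h)) = V.action (a + h) (b + h) x := by
  have hm : (fun t => 1 * t + h) ⁻¹' Icc (a + h) (b + h) = Icc a b := by
    simpa using preimage_affine_of_pos (h := h) one_pos a b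
  simpa [action] using action_affine (V := V) (x := x) (lam := 1) one_ne_zero hm

theorem action_comp_neg : V.action a b (fun t => x (-t)) = V.action (-b) (-a) x := by
  have := action_affine (V := V) (x := x) (lam := 1) (neg_ne_zero.2 one_ne_zero) (preimage_neg a b)
  simpa [action] using this

/-- The time factor is the one for which the kinetic and the potential terms are both multiplied by
lam^(-α); the change of dt then turns this into lam^β. -/
theorem action_scale {k lam : ℝ} (hlam : 0 < lam) (hk : k = lam ^ (-((2 + V.α) / 2))) :
    V.action a b (fun t => lam • x (k * t)) =
      ENNReal.ofReal (lam ^ V.β) * V.action (k * a) (k * b) x := by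
  have hkpos : 0 < k := hk ▸ Real.rpow_pos_of_pos hlam _
  have hm : (fun t => k * t + 0) ⁻¹' Icc (k * a) (k * b) = Icc a b := by
    simpa using preimage_affine_of_pos (h := 0) hkpos a b
  have h1 := action_affine (V := V) (x := x) (lam := lam) hkpos.ne' hm
  simp only [add_zero] at h1
  have hlk : (lam * k) ^ 2 = lam ^ (-V.α) := by
    rw [hk, mul_pow, ← Real.rpow_natCast, ← Real.rpow_natCast, ← Real.rpow_mul hlam.le,
      ← Real.rpow_add hlam]
    congr 1; push_cast; ring
  have hki : |k⁻¹| * lam ^ (-V.α) = lam ^ V.β := by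
    rw [abs_of_pos (inv_pos.2 hkpos), hk, ← Real.rpow_neg hlam.le, ← Real.rpow_add hlam]
    congr 1; unfold β; ring
  rw [h1, hlk]
  simp_rw [eval_smul hlam, ← mul_add]
  rw [lintegral_const_mul' _ _ ENNReal.ofReal_ne_top, ← mul_assoc,
    ← ENNReal.ofReal_mul (abs_nonneg _), hki]
  rfl

/-- The Lagrangian along a path, as a real number. -/
def lag (V : Potential ξm ξp Vmin) (x : ℝ → Space n) (t : ℝ) : ℝ :=
  ‖deriv x t‖ ^ 2 / 2 + V.pot (x t)

theorem integrableOn_kinetic (hx : IsH1 a b x) :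
    IntegrableOn (fun t => ‖deriv x t‖ ^ 2 / 2) (Ioc a b) :=
  ((memLp_two_iff_integrable_sq_norm
    (stronglyMeasurable_deriv x).aestronglyMeasurable).1 hx.1).div_const 2

theorem continuousOn_pot_comp (hx : IsH1 a b x) (h0 : ∀ t ∈ Icc a b, x t ≠ 0) :
    ContinuousOn (fun t => V.pot (x t)) (Icc a b) := fun t ht =>
  ContinuousAt.comp_continuousWithinAt (continuousAt_pot (h0 t ht)) (hx.continuousOn t ht)

theorem integrableOn_pot (hx : IsH1 a b x) (h0 : ∀ t ∈ Icc a b, x t ≠ 0) :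
    IntegrableOn (fun t => V.pot (x t)) (Ioc a b) :=
  ((continuousOn_pot_comp hx h0).integrableOn_Icc).mono_set Ioc_subset_Icc_self

theorem integrableOn_lag (hx : IsH1 a b x) (h0 : ∀ t ∈ Icc a b, x t ≠ 0) :
    IntegrableOn (V.lag x) (Ioc a b) :=
  (integrableOn_kinetic hx).add (integrableOn_pot hx h0)

theorem lag_nonneg (hV : 0 < Vmin) (x : ℝ → Space n) (t : ℝ) : 0 ≤ V.lag x t :=
  add_nonneg (by positivity) (pot_nonneg hV _)

theorem action_eq (hV : 0 < Vmin) (hab : a ≤ b) (hx : IsH1 a b x) (h0 : ∀ t ∈ Icc a b, x t ≠ 0) :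
    V.action a b x = ENNReal.ofReal (∫ t in a..b, V.lag x t) := by
  rw [intervalIntegral.integral_of_le hab, ofReal_integral_eq_lintegral_ofReal
    (integrableOn_lag hx h0) (Eventually.of_forall fun t => lag_nonneg hV x t), action]
  refine setLIntegral_congr_fun measurableSet_Ioc fun t ht => ?_
  rw [eval_of_ne (h0 t (Ioc_subset_Icc_self ht)), ← ENNReal.ofReal_add (by positivity)
    (pot_nonneg hV _)]
  rfl

/-- There is a path from `p` to `q`, outside the ball of radius `ρ`, of action at most `A`. -/
def Reach (V : Potential ξm ξp Vmin) (ρ : ℝ) (p q : Space n) (A : ℝ) : Prop :=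
  0 ≤ A ∧ ∃ T : ℝ, 0 ≤ T ∧ ∃ z : ℝ → Space n, IsH1 0 T z ∧ z 0 = p ∧ z T = q ∧
    (∀ t ∈ Icc 0 T, ρ ≤ ‖z t‖) ∧ V.action 0 T z ≤ ENNReal.ofReal A

namespace Reach

variable {ρ ρ' A B : ℝ} {p q r : Space n}

theorem of_path (hab : a ≤ b) (hx : IsH1 a b x) (hρ : ∀ t ∈ Icc a b, ρ ≤ ‖x t‖) (hA : 0 ≤ A)
    (hact : V.action a b x ≤ ENNReal.ofReal A) : V.Reach ρ (x a) (x b) A := by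
  have hm : (fun t => 1 * t + a) ⁻¹' Icc a b = Icc 0 (b - a) := by
    simpa using preimage_affine_of_pos (h := a) one_pos 0 (b - a)
  refine ⟨hA, b - a, sub_nonneg.2 hab, fun t => x (t + a), ?_, by simp, by simp, ?_, ?_⟩
  · simpa using hx.affine one_ne_zero hm 1
  · intro t ht
    exact hρ _ ⟨by linarith [ht.1], by linarith [ht.2]⟩
  · rw [action_comp_add]
    simpa using hact

theorem refl (h : ρ ≤ ‖p‖) : V.Reach ρ p p 0 := by
  have : IsH1 0 0 (fun _ : ℝ => p) := by
    refine IsH1.of_sub (by simp) fun t ht => ?_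
    simp
  refine of_path le_rfl this (fun _ _ => h) le_rfl ?_
  rw [action_self]; simp

theorem mono (h : V.Reach ρ p q A) (hρ : ρ' ≤ ρ) (hA : A ≤ B) : V.Reach ρ' p q B := by
  obtain ⟨h0, T, hT, z, hz, h1, h2, h3, h4⟩ := h
  exact ⟨h0.trans hA, T, hT, z, hz, h1, h2, fun t ht => hρ.trans (h3 t ht),
    h4.trans (ENNReal.ofReal_le_ofReal hA)⟩

/-- The junction point is recorded as visited: when it lies on the sphere of radius ρ, the minimal
distance of the concatenated path is exactly ρ. -/
theorem exists_concat (h₁ : V.Reach ρ p q A) (h₂ : V.Reach ρ q r B) :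
    ∃ T : ℝ, 0 ≤ T ∧ ∃ f : ℝ → Space n, IsH1 0 T f ∧ f 0 = p ∧ f T = r ∧
      (∃ t ∈ Icc 0 T, f t = q) ∧ (∀ t ∈ Icc 0 T, ρ ≤ ‖f t‖) ∧
      V.action 0 T f ≤ ENNReal.ofReal (A + B) := by
  obtain ⟨hA, T, hT, z, hz, z0, zT, hzρ, hzA⟩ := h₁
  obtain ⟨hB, S, hS, w, hw, w0, wS, hwρ, hwB⟩ := h₂
  set f : ℝ → Space n := fun t => if t ≤ T then z t else w (t + -T)
  have e1 : EqOn z f (Icc 0 T) := fun t ht => by simp [f, ht.2]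
  have e2 : EqOn (fun t => w (t + -T)) f (Icc T (T + S)) := fun t ht => by
    rcases ht.1.eq_or_lt with h | h
    · simp [f, ← h, zT, w0]
    · simp [f, not_le.2 h]
  have hm : (fun t => 1 * t + -T) ⁻¹' Icc 0 S = Icc T (T + S) := by
    have := preimage_affine_of_pos (h := -T) one_pos T (T + S)
    simpa using this
  have hw' : IsH1 T (T + S) (fun t => w (t + -T)) := by
    simpa using hw.affine one_ne_zero hm 1
  have hf1 := hz.congr e1
  have hf2 := hw'.congr e2
  have hf := hf1.concat hf2 hT (by linarith)
  have hp : f 0 = p := by simp [f, hT, z0]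
  have hr : f (T + S) = r := by
    rw [← e2 ⟨by linarith, le_rfl⟩]; simp [wS]
  refine ⟨T + S, by positivity, f, hf, hp, hr, ⟨T, ⟨hT, by linarith⟩, by simp [f, zT]⟩, ?_, ?_⟩
  · intro t ht
    rcases le_total t T with h | h
    · rw [← e1 ⟨ht.1, h⟩]; exact hzρ t ⟨ht.1, h⟩
    · rw [← e2 ⟨h, ht.2⟩]; exact hwρ _ ⟨by linarith, by linarith [ht.2]⟩
  · rw [action_add hT (by linarith : T ≤ T + S), ← action_congr e1, ← action_congr e2,
      action_comp_add, ENNReal.ofReal_add hA hB]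
    refine add_le_add hzA ?_
    simpa using hwB

theorem trans (h₁ : V.Reach ρ p q A) (h₂ : V.Reach ρ q r B) : V.Reach ρ p r (A + B) := by
  obtain ⟨T, hT, f, hf, h0, hT', -, hρ, hA⟩ := h₁.exists_concat h₂
  exact ⟨add_nonneg h₁.1 h₂.1, T, hT, f, hf, h0, hT', hρ, hA⟩

theorem symm (h : V.Reach ρ p q A) : V.Reach ρ q p A := by
  obtain ⟨hA, T, hT, z, hz, z0, zT, hzρ, hzA⟩ := h
  have hm : (fun t : ℝ => (-1) * t + 0) ⁻¹' Icc 0 T = Icc (-T) 0 := by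
    have := preimage_neg (-T) 0
    simpa using this
  have h1 : IsH1 (-T) 0 (fun t => z (-t)) := by
    simpa using hz.affine (neg_ne_zero.2 one_ne_zero) hm 1
  have h2 := of_path (V := V) (ρ := ρ) (A := A) (neg_nonpos.2 hT) h1
    (fun t ht => hzρ _ ⟨by linarith [ht.2], by linarith [ht.1]⟩) hA
    (by rw [action_comp_neg]; simpa using hzA)
  simpa [z0, zT] using h2

theorem scale {lam : ℝ} (hlam : 0 < lam) (h : V.Reach ρ p q A) :
    V.Reach (lam * ρ) (lam • p) (lam • q) (lam ^ V.β * A) := by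
  obtain ⟨hA, T, hT, z, hz, z0, zT, hzρ, hzA⟩ := h
  have hβ : 0 ≤ lam ^ V.β := Real.rpow_nonneg hlam.le _
  obtain ⟨k, hk⟩ : ∃ k, k = lam ^ (-((2 + V.α) / 2)) := ⟨_, rfl⟩
  have hkpos : 0 < k := hk ▸ Real.rpow_pos_of_pos hlam _
  have hm : (fun t => k * t + 0) ⁻¹' Icc 0 T = Icc 0 (T / k) := by
    have := preimage_affine_of_pos (h := 0) hkpos 0 (T / k)
    simpa [mul_div_cancel₀, hkpos.ne'] using this
  have h1 : IsH1 0 (T / k) (fun t => lam • z (k * t)) := by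
    simpa using hz.affine hkpos.ne' hm lam
  have hkT : k * (T / k) = T := by field_simp
  have h2 := of_path (V := V) (ρ := lam * ρ) (A := lam ^ V.β * A) (by positivity) h1
    (fun t ht => by
      rw [norm_smul, Real.norm_eq_abs, abs_of_pos hlam]
      refine mul_le_mul_of_nonneg_left (hzρ _ ⟨by have := ht.1; positivity, ?_⟩) hlam.le
      have := mul_le_mul_of_nonneg_left ht.2 hkpos.le
      rwa [hkT] at this) (by positivity)
    (by
      rw [action_scale hlam hk, mul_zero, hkT, ENNReal.ofReal_mul hβ]
      gcongr)
  simpa [z0, zT, hkT] using h2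

end Reach

end Potential

end AnisotropicKepler

end

/-! ### Calibrations: lower bounds for the action. -/

noncomputable section

namespace AnisotropicKepler

/-- The squared distance between the direction of `y` and `ξ`. -/
def dev {n : ℕ} (ξ : USphere n) (y : Space n) : ℝ := ‖‖y‖⁻¹ • y - (ξ : Space n)‖ ^ 2

section Dev

variable {n : ℕ} {ξ : USphere n} {y : Space n}

theorem dev_nonneg : 0 ≤ dev ξ y := sq_nonneg _

theorem dev_eq_dist (hy : y ≠ 0) : dev ξ y = dist (dir y hy) ξ ^ 2 := by
  rw [Subtype.dist_eq, dist_eq_norm]; rfl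

theorem dev_eq (hy : y ≠ 0) : dev ξ y = 2 - 2 * (inner ℝ (ξ : Space n) y * ‖y‖⁻¹) := by
  have hn : ‖‖y‖⁻¹ • y‖ = 1 := norm_coe (dir y hy)
  rw [dev, norm_sub_sq_real, hn, norm_coe, real_inner_smul_left, real_inner_comm]
  ring

theorem dev_smul {c : ℝ} (hc : 0 < c) : dev ξ (c • y) = dev ξ y := by
  rw [dev, dev, norm_smul, Real.norm_eq_abs, abs_of_pos hc, smul_smul, mul_inv_rev, mul_assoc,
    inv_mul_cancel₀ hc.ne', mul_one]

theorem dev_coe (s : USphere n) : dev ξ (s : Space n) = dist s ξ ^ 2 := by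
  rw [dev_eq_dist (coe_ne_zero s), dir_coe]

theorem dev_smul_self {c : ℝ} (hc : 0 < c) : dev ξ (c • (ξ : Space n)) = 0 := by
  rw [dev_smul hc, dev_coe, dist_self, sq, mul_zero]

theorem dev_le_four : dev ξ y ≤ 4 := by
  by_cases hy : y = 0
  · simp [dev, hy]
  · have hn : ‖‖y‖⁻¹ • y‖ = 1 := norm_coe (dir y hy)
    have : ‖‖y‖⁻¹ • y - (ξ : Space n)‖ ≤ 2 := by
      refine (norm_sub_le _ _).trans ?_
      rw [hn, norm_coe]; norm_num
    rw [dev]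
    nlinarith [norm_nonneg (‖y‖⁻¹ • y - (ξ : Space n))]

theorem continuousAt_dev (hy : y ≠ 0) : ContinuousAt (dev ξ) y :=
  (((continuous_norm.continuousAt.inv₀ (norm_ne_zero_iff.2 hy)).smul
    continuousAt_id).sub continuousAt_const).norm.pow 2

end Dev

namespace Potential

variable {n : ℕ} {ξm ξp : USphere n} {Vmin : ℝ} {V : Potential ξm ξp Vmin}
  {a b : ℝ} {x : ℝ → Space n}

theorem intervalIntegrable_lag (hab : a ≤ b) (hx : IsH1 a b x) (h0 : ∀ t ∈ Icc a b, x t ≠ 0) :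
    IntervalIntegrable (V.lag x) volume a b := by
  rw [intervalIntegrable_iff_integrableOn_Ioc_of_le hab]
  exact integrableOn_lag hx h0

/-- A function whose gradient is bounded by `√(2 V)` grows along a path by at most the action. -/
theorem calibration (hab : a ≤ b) (hx : IsH1 a b x) (h0 : ∀ t ∈ Icc a b, x t ≠ 0)
    {Φ : Space n → ℝ} {Φ' : ℝ → Space n →L[ℝ] ℝ} (hΦ : ∀ t ∈ Icc a b, HasFDerivAt Φ (Φ' t) (x t))
    (hle : ∀ t ∈ Icc a b, ‖Φ' t‖ ^ 2 ≤ 2 * V.pot (x t)) :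
    Φ (x b) - Φ (x a) ≤ ∫ t in a..b, V.lag x t := by
  -- The slack η pays for the two local approximations below, the linearization of Φ at `x t` and
  -- the oscillation of the potential; it is removed at the end.
  suffices H : ∀ η > 0, Φ (x b) - Φ (x a) ≤ (∫ t in a..b, V.lag x t) + η * (b - a) by
    refine le_of_forall_pos_le_add fun e he => ?_
    have := H (e / (b - a + 1)) (by have := sub_nonneg.2 hab; positivity)
    refine this.trans (add_le_add le_rfl ?_)
    have h1 : 0 < b - a + 1 := by linarith
    rw [div_mul_eq_mul_div, div_le_iff₀ h1]
    nlinarith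
  intro η hη
  have hInt : ∀ {s t}, s ∈ Icc a b → t ∈ Icc a b → s ≤ t →
      IntervalIntegrable (V.lag x) volume s t := fun hs ht hst =>
    intervalIntegrable_lag hst (hx.mono hs.1 ht.2)
      fun τ hτ => h0 τ ⟨hs.1.trans hτ.1, hτ.2.trans ht.2⟩
  set G : ℝ → ℝ := fun t => (∫ τ in a..t, V.lag x τ) + η * (t - a) - Φ (x t)
  have hGc : ContinuousOn G (Icc a b) := by
    have hi : IntegrableOn (V.lag x) (uIcc a b) := by
      rw [uIcc_of_le hab, integrableOn_Icc_iff_integrableOn_Ioc]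
      exact integrableOn_lag hx h0
    have h1 := intervalIntegral.continuousOn_primitive_interval hi
    rw [uIcc_of_le hab] at h1
    refine (h1.add (by fun_prop)).sub ?_
    exact fun t ht => (hΦ t ht).continuousAt.comp_continuousWithinAt (hx.continuousOn t ht)
  -- Continuous induction from the left end: the inequality holds on a closed set and propagates a
  -- little to the right of each of its points. No derivative of the composition of Φ with the path
  -- is needed.
  have hsub : Icc a b ⊆ {t | G a ≤ G t} := by
    refine IsClosed.Icc_subset_of_forall_exists_gt ?_ (by simp) ?_
    · have : {t | G a ≤ G t} ∩ Icc a b = Icc a b ∩ G ⁻¹' Ici (G a) := by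
        ext t; simp [and_comm]
      rw [this]
      exact hGc.preimage_isClosed_of_isClosed isClosed_Icc isClosed_Ici
    · rintro t ⟨hGt, htab⟩ y hy
      have ht : t ∈ Icc a b := Ico_subset_Icc_self htab
      set N := ‖Φ' t‖
      have hN : 0 ≤ N := norm_nonneg _
      obtain ⟨e, he, hNe⟩ : ∃ e > 0, (N + e) ^ 2 / 2 < N ^ 2 / 2 + η / 2 := by
        have hcont : Tendsto (fun e : ℝ => (N + e) ^ 2 / 2) (𝓝[>] 0) (𝓝 ((N + 0) ^ 2 / 2)) :=
          ((by fun_prop : Continuous fun e : ℝ => (N + e) ^ 2 / 2).tendsto 0).mono_left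
            nhdsWithin_le_nhds
        have := hcont.eventually_lt_const (show (N + 0) ^ 2 / 2 < N ^ 2 / 2 + η / 2 by
          rw [add_zero]; linarith)
        obtain ⟨e, h1, h2⟩ := (this.and self_mem_nhdsWithin).exists
        exact ⟨e, h2, h1⟩
      have hxt : ContinuousWithinAt x (Icc a b) t := hx.continuousOn t ht
      have hlo := (hasFDerivAt_iff_isLittleO.1 (hΦ t ht)).def he
      have ev1 : ∀ᶠ s in 𝓝[Icc a b] t, Φ (x s) - Φ (x t) ≤ (N + e) * ‖x s - x t‖ := by
        filter_upwards [hxt.eventually hlo] with s hs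
        have h1 := (abs_le.1 (show |Φ (x s) - Φ (x t) - Φ' t (x s - x t)| ≤ _ from hs)).2
        have h2 : Φ' t (x s - x t) ≤ N * ‖x s - x t‖ :=
          (le_abs_self _).trans ((Φ' t).le_opNorm _)
        linarith
      have ev2 : ∀ᶠ s in 𝓝[Icc a b] t, V.pot (x t) - η / 2 < V.pot (x s) :=
        ((continuousAt_pot (h0 t ht)).comp_continuousWithinAt hxt).eventually
          (lt_mem_nhds (by simp only [Function.comp]; linarith))
      obtain ⟨r, hr, hball⟩ := Metric.mem_nhdsWithin_iff.1 (ev1.and ev2)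
      set s := min (min b y) (t + r / 2)
      have hts : t < s := by
        simp only [s, lt_min_iff]; exact ⟨⟨htab.2, hy⟩, by linarith⟩
      have hsb : s ≤ b := (min_le_left _ _).trans (min_le_left _ _)
      have hsab : s ∈ Icc a b := ⟨ht.1.trans hts.le, hsb⟩
      have hmem : ∀ τ ∈ Icc t s, τ ∈ Metric.ball t r ∩ Icc a b := fun τ hτ => by
        refine ⟨?_, ht.1.trans hτ.1, hτ.2.trans hsb⟩
        rw [Metric.mem_ball, Real.dist_eq, abs_of_nonneg (sub_nonneg.2 hτ.1)]
        have : s ≤ t + r / 2 := min_le_right _ _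
        linarith [hτ.2]
      refine ⟨s, ?_, hts, (min_le_left _ _).trans (min_le_right _ _)⟩
      rw [mem_ofPred_eq] at hGt ⊢
      refine le_trans hGt ?_
      have hadd : (∫ τ in a..s, V.lag x τ) = (∫ τ in a..t, V.lag x τ) + ∫ τ in t..s, V.lag x τ :=
        (intervalIntegral.integral_add_adjacent_intervals
          (hInt ⟨le_rfl, hab⟩ ht ht.1) (hInt ht hsab hts.le)).symm
      have hxs := hx.mono ht.1 hsb
      have hnorm : ‖x s - x t‖ ≤ ∫ τ in t..s, ‖deriv x τ‖ := by
        rw [hx.sub_eq ht hsab]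
        exact intervalIntegral.norm_integral_le_integral_norm hts.le
      have hii := hxs.intervalIntegrable hts.le
      -- Young's inequality: (N + e)|ẋ| ≤ |ẋ|²/2 + (N + e)²/2, and the last term is at most the
      -- potential plus η.
      have hmain : (N + e) * (∫ τ in t..s, ‖deriv x τ‖) ≤ ∫ τ in t..s, (V.lag x τ + η) := by
        rw [← intervalIntegral.integral_const_mul]
        refine intervalIntegral.integral_mono_on hts.le (hii.norm.const_mul _)
          ((hInt ht hsab hts.le).add intervalIntegrable_const) fun τ hτ => ?_
        have h1 := (hball (hmem τ hτ)).2
        have h2 := hle t ht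
        have h3 : N ^ 2 ≤ 2 * V.pot (x t) := h2
        unfold lag
        nlinarith [sq_nonneg (N + e - ‖deriv x τ‖)]
      have hsplit : (∫ τ in t..s, (V.lag x τ + η)) = (∫ τ in t..s, V.lag x τ) + η * (s - t) := by
        rw [intervalIntegral.integral_add (hInt ht hsab hts.le) intervalIntegrable_const]
        simp [mul_comm]
      have h5 := (hball (hmem s ⟨hts.le, le_rfl⟩)).1
      have h6 : (N + e) * ‖x s - x t‖ ≤ (N + e) * ∫ τ in t..s, ‖deriv x τ‖ :=
        mul_le_mul_of_nonneg_left hnorm (by positivity)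
      simp only [G, hadd]
      linarith
  have := hsub (right_mem_Icc.2 hab)
  simp only [mem_ofPred_eq, G, intervalIntegral.integral_same, sub_self, mul_zero] at this
  linarith

/-- Up to a constant the calibrating function is f(|x|) + 2g c, with c the cosine of the angle to ξ.
Its gradient splits orthogonally into a radial part f' and an angular part of square 4g²(1 -
c²)/|x|², and 1 - c² ≤ 2 - 2c = dev. All the lower bounds below are instances. -/
theorem calibration_polar (hab : a ≤ b) (hx : IsH1 a b x) (h0 : ∀ t ∈ Icc a b, x t ≠ 0)
    (ξ : USphere n) {f f' : ℝ → ℝ} {g : ℝ} (hf : ∀ t ∈ Icc a b, HasDerivAt f (f' ‖x t‖) ‖x t‖)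
    (hle : ∀ t ∈ Icc a b,
      f' ‖x t‖ ^ 2 + 4 * g ^ 2 * dev ξ (x t) / ‖x t‖ ^ 2 ≤ 2 * V.pot (x t)) :
    (f ‖x b‖ - g * dev ξ (x b)) - (f ‖x a‖ - g * dev ξ (x a)) ≤ ∫ t in a..b, V.lag x t := by
  set c : Space n → ℝ := fun y => inner ℝ (ξ : Space n) y * ‖y‖⁻¹
  set G : Space n → Space n := fun y =>
    (f' ‖y‖ * ‖y‖⁻¹) • y + (2 * g * ‖y‖⁻¹) • ((ξ : Space n) - (c y * ‖y‖⁻¹) • y)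
  have key : ∀ t ∈ Icc a b, HasFDerivAt (fun y => f ‖y‖ + 2 * g * c y) (innerSL ℝ (G (x t))) (x t) := by
    intro t ht
    have hne := h0 t ht
    have hpos : 0 < ‖x t‖ := norm_pos_iff.2 hne
    have hn := hasFDerivAt_norm_rpow hne 1
    simp only [Real.rpow_one] at hn
    have hi := hasFDerivAt_norm_rpow hne (-1)
    simp only [Real.rpow_neg_one] at hi
    have h1 := (hf t ht).comp_hasFDerivAt (x t) hn
    have h2 : HasFDerivAt (fun y => inner ℝ (ξ : Space n) y) (innerSL ℝ (ξ : Space n)) (x t) :=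
      (innerSL ℝ (ξ : Space n)).hasFDerivAt
    have h3 := h1.add ((h2.mul hi).const_mul (2 * g))
    refine h3.congr_fderiv ?_
    ext v
    have e1 : ‖x t‖ ^ (1 - 2 : ℝ) = ‖x t‖⁻¹ := by
      rw [show (1 - 2 : ℝ) = -1 by norm_num, Real.rpow_neg_one]
    have e2 : ‖x t‖ ^ (-1 - 2 : ℝ) = ‖x t‖⁻¹ ^ 3 := by
      rw [show (-1 - 2 : ℝ) = -(3 : ℕ) by norm_num, Real.rpow_neg hpos.le, Real.rpow_natCast, inv_pow]
    simp [e1, e2, G, c]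
    ring
  have hnorm : ∀ t ∈ Icc a b, ‖innerSL ℝ (G (x t))‖ ^ 2 ≤ 2 * V.pot (x t) := by
    intro t ht
    refine le_trans ?_ (hle t ht)
    have hne := h0 t ht
    have hpos : 0 < ‖x t‖ := norm_pos_iff.2 hne
    rw [innerSL_apply_norm, dev_eq hne, ← real_inner_self_eq_norm_sq]
    have exx : inner ℝ (x t) (x t) = ‖x t‖ ^ 2 := real_inner_self_eq_norm_sq _
    have eξξ : inner ℝ (ξ : Space n) (ξ : Space n) = (1 : ℝ) := by
      rw [real_inner_self_eq_norm_sq, norm_coe]; norm_num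
    have exξ : inner ℝ (x t) (ξ : Space n) = inner ℝ (ξ : Space n) (x t) := real_inner_comm _ _
    have eG : inner ℝ (G (x t)) (G (x t))
        = f' ‖x t‖ ^ 2 + 4 * g ^ 2 * (1 - c (x t) ^ 2) / ‖x t‖ ^ 2 := by
      simp only [G, c, inner_add_left, inner_sub_left, real_inner_smul_left, inner_add_right,
        inner_sub_right, real_inner_smul_right, exx, eξξ, exξ]
      field_simp
      ring
    rw [eG]
    have : (1 - c (x t) ^ 2) ≤ 2 - 2 * c (x t) := by nlinarith [sq_nonneg (1 - c (x t))]
    gcongr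
  have := calibration (V := V) hab hx h0 key hnorm
  have ha := dev_eq (ξ := ξ) (h0 a ⟨le_rfl, hab⟩)
  have hb := dev_eq (ξ := ξ) (h0 b ⟨hab, le_rfl⟩)
  refine le_trans (le_of_eq ?_) this
  rw [ha, hb]
  ring

theorem hasDerivAt_rad {r : ℝ} (hr : 0 < r) :
    HasDerivAt V.rad (√(2 * Vmin) * r ^ (-V.α / 2)) r := by
  have h := ((Real.hasDerivAt_rpow_const (x := r) (p := V.β) (Or.inl hr.ne')).div_const
    V.β).const_mul √(2 * Vmin)
  refine h.congr_deriv ?_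
  rw [mul_div_cancel_left₀ _ V.β_pos.ne', show V.β - 1 = -V.α / 2 by unfold β; ring]

theorem rpow_half_sq {r : ℝ} (hr : 0 < r) (p : ℝ) : (r ^ (p / 2)) ^ 2 = r ^ p := by
  rw [← Real.rpow_natCast, ← Real.rpow_mul hr.le]; congr 1; push_cast; ring

theorem sqrt_sq_two (hV : 0 < Vmin) : √(2 * Vmin) ^ 2 = 2 * Vmin := Real.sq_sqrt (by positivity)

/-- Here |∇Φ|² = 2 Vmin |x|^(-α), which the potential dominates because its angular part is at least
Vmin. -/
theorem rad_sub_le (hV : 0 < Vmin) (hab : a ≤ b) (hx : IsH1 a b x)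
    (h0 : ∀ t ∈ Icc a b, x t ≠ 0) :
    V.rad ‖x b‖ - V.rad ‖x a‖ ≤ ∫ t in a..b, V.lag x t := by
  have := calibration_polar (V := V) (f := V.rad) (f' := fun r => √(2 * Vmin) * r ^ (-V.α / 2))
    (g := 0) hab hx h0 ξm (fun t ht => hasDerivAt_rad (norm_pos_iff.2 (h0 t ht))) (fun t ht => by
      have := le_pot (V := V) (h0 t ht)
      rw [mul_pow, sqrt_sq_two hV, rpow_half_sq (norm_pos_iff.2 (h0 t ht))]
      simp only [ne_eq, OfNat.ofNat_ne_zero, not_false_eq_true, zero_pow, mul_zero, zero_mul,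
        zero_div, add_zero]
      linarith)
  simpa using this

theorem rad_sub_le' (hV : 0 < Vmin) (hab : a ≤ b) (hx : IsH1 a b x)
    (h0 : ∀ t ∈ Icc a b, x t ≠ 0) :
    V.rad ‖x a‖ - V.rad ‖x b‖ ≤ ∫ t in a..b, V.lag x t := by
  have := calibration_polar (V := V) (f := fun r => -V.rad r)
    (f' := fun r => -(√(2 * Vmin) * r ^ (-V.α / 2)))
    (g := 0) hab hx h0 ξm (fun t ht => (hasDerivAt_rad (norm_pos_iff.2 (h0 t ht))).neg)
    (fun t ht => by
      have := le_pot (V := V) (h0 t ht)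
      rw [neg_sq, mul_pow, sqrt_sq_two hV, rpow_half_sq (norm_pos_iff.2 (h0 t ht))]
      simp only [ne_eq, OfNat.ofNat_ne_zero, not_false_eq_true, zero_pow, mul_zero, zero_mul,
        zero_div, add_zero]
      linarith)
  simp only [zero_mul, sub_zero] at this
  linarith

theorem le_pot_of_nondeg {ξ : USphere n} {δ μ : ℝ} (hδ : 0 < δ)
    (hnd : ∀ s : USphere n, dist s ξ < δ → μ * dist s ξ ^ 2 ≤ V.ang s - Vmin) {y : Space n}
    (hy : y ≠ 0) (hdev : dev ξ y < δ ^ 2) :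
    (Vmin + μ * dev ξ y) * ‖y‖ ^ (-V.α) ≤ V.pot y := by
  rw [dev_eq_dist hy] at hdev ⊢
  have h := hnd _ (lt_of_pow_lt_pow_left₀ 2 hδ.le hdev)
  rw [pot, radialExt_of_ne hy]
  exact mul_le_mul_of_nonneg_right (by linarith) (Real.rpow_nonneg (norm_nonneg _) _)

/-- The surplus μ dev |x|^(-α) of the potential near ξ pays for an angular term in the calibration.
The resulting cost of turning towards ξ grows like r₀^β, so paths of bounded excess are confined to
narrow cones far away. -/
theorem rad_sub_add_dev_le (hV : 0 < Vmin) {ξ : USphere n} {δ μ r₀ : ℝ} (hδ : 0 < δ) (hμ : 0 < μ)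
    (hr₀ : 0 < r₀) (hnd : ∀ s : USphere n, dist s ξ < δ → μ * dist s ξ ^ 2 ≤ V.ang s - Vmin)
    (hab : a ≤ b) (hx : IsH1 a b x) (hr : ∀ t ∈ Icc a b, r₀ ≤ ‖x t‖)
    (hdev : ∀ t ∈ Icc a b, dev ξ (x t) < δ ^ 2) :
    V.rad ‖x b‖ - V.rad ‖x a‖ + √(μ / 2) * r₀ ^ V.β * (dev ξ (x a) - dev ξ (x b))
      ≤ ∫ t in a..b, V.lag x t := by
  have h0 : ∀ t ∈ Icc a b, x t ≠ 0 := fun t ht => norm_pos_iff.1 (hr₀.trans_le (hr t ht))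
  have := calibration_polar (V := V) (f := V.rad) (f' := fun r => √(2 * Vmin) * r ^ (-V.α / 2))
    (g := √(μ / 2) * r₀ ^ V.β) hab hx h0 ξ
    (fun t ht => hasDerivAt_rad (norm_pos_iff.2 (h0 t ht))) (fun t ht => by
      have hp := le_pot_of_nondeg hδ hnd (h0 t ht) (hdev t ht)
      have hpos := norm_pos_iff.2 (h0 t ht)
      rw [mul_pow, sqrt_sq_two hV, rpow_half_sq hpos, mul_pow, Real.sq_sqrt (by positivity)]
      have h1 : (r₀ ^ V.β) ^ 2 / ‖x t‖ ^ 2 ≤ ‖x t‖ ^ (-V.α) := by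
        rw [div_le_iff₀ (by positivity)]
        have e : ‖x t‖ ^ (-V.α) * ‖x t‖ ^ 2 = (‖x t‖ ^ V.β) ^ 2 := by
          rw [← Real.rpow_natCast, ← Real.rpow_natCast, ← Real.rpow_add hpos,
            ← Real.rpow_mul hpos.le]
          congr 1; push_cast; unfold β; ring
        rw [e]
        have := V.β_pos
        have := hr t ht
        gcongr
      have h2 : 4 * (μ / 2 * (r₀ ^ V.β) ^ 2) * dev ξ (x t) / ‖x t‖ ^ 2
          = 2 * μ * dev ξ (x t) * ((r₀ ^ V.β) ^ 2 / ‖x t‖ ^ 2) := by ring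
      have h3 : 2 * μ * dev ξ (x t) * ((r₀ ^ V.β) ^ 2 / ‖x t‖ ^ 2)
          ≤ 2 * μ * dev ξ (x t) * ‖x t‖ ^ (-V.α) := by
        have := dev_nonneg (ξ := ξ) (y := x t)
        gcongr
      rw [h2]
      linarith)
  linarith

/-- As long as r^β dev ≥ σ, the surplus of the potential pays for an additional slope cσ/r of the
calibrating function. A path of bounded excess cannot keep this up over a long range of radii, since
the logarithm diverges. -/
theorem rad_sub_add_log_le (hV : 0 < Vmin) {ξ : USphere n} {δ μ σ c : ℝ} (hδ : 0 < δ)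
    (hσ : 0 < σ) (hc : 0 < c) (hcμ : 2 * √(2 * Vmin) * c + 4 * c ^ 2 ≤ 2 * μ)
    (hnd : ∀ s : USphere n, dist s ξ < δ → μ * dist s ξ ^ 2 ≤ V.ang s - Vmin)
    (hab : a ≤ b) (hx : IsH1 a b x) (h0 : ∀ t ∈ Icc a b, x t ≠ 0)
    (hdev : ∀ t ∈ Icc a b, dev ξ (x t) < δ ^ 2)
    (hσx : ∀ t ∈ Icc a b, σ ≤ ‖x t‖ ^ V.β * dev ξ (x t)) :
    V.rad ‖x b‖ - V.rad ‖x a‖ + c * σ * (Real.log ‖x b‖ - Real.log ‖x a‖)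
      ≤ ∫ t in a..b, V.lag x t := by
  have := calibration_polar (V := V) (f := fun r => V.rad r + c * σ * Real.log r)
    (f' := fun r => √(2 * Vmin) * r ^ (-V.α / 2) + c * σ * r⁻¹) (g := 0) hab hx h0 ξ
    (fun t ht => (hasDerivAt_rad (norm_pos_iff.2 (h0 t ht))).add
      ((Real.hasDerivAt_log (norm_ne_zero_iff.2 (h0 t ht))).const_mul _)) (fun t ht => by
      have hp := le_pot_of_nondeg hδ hnd (h0 t ht) (hdev t ht)
      have hpos := norm_pos_iff.2 (h0 t ht)
      have hd0 := dev_nonneg (ξ := ξ) (y := x t)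
      have hd4 := dev_le_four (ξ := ξ) (y := x t)
      have hs := hσx t ht
      set d := dev ξ (x t)
      set r := ‖x t‖
      have hinv : r⁻¹ = r ^ (-V.α / 2) * (r ^ V.β)⁻¹ := by
        rw [← Real.rpow_neg hpos.le, ← Real.rpow_add hpos, ← Real.rpow_neg_one]
        congr 1; unfold β; ring
      have hb : 0 < r ^ V.β := Real.rpow_pos_of_pos hpos _
      have h1 : σ * (r ^ V.β)⁻¹ ≤ d := by
        rw [← div_eq_mul_inv, div_le_iff₀ hb]; linarith
      have h2 : 0 ≤ σ * (r ^ V.β)⁻¹ := by positivity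
      have hP : 0 ≤ r ^ (-V.α) := Real.rpow_nonneg hpos.le _
      have hκ : 0 ≤ √(2 * Vmin) := Real.sqrt_nonneg _
      -- After factoring out r^(-α/2) the bracket is at most √(2 Vmin) + c d; its square is bounded
      -- linearly in d by means of d ≤ 4, which is the origin of the condition on c.
      have e : √(2 * Vmin) * r ^ (-V.α / 2) + c * σ * r⁻¹
          = r ^ (-V.α / 2) * (√(2 * Vmin) + c * (σ * (r ^ V.β)⁻¹)) := by rw [hinv]; ring
      rw [e, mul_pow, rpow_half_sq hpos]
      have h3 : (√(2 * Vmin) + c * (σ * (r ^ V.β)⁻¹)) ^ 2 ≤ 2 * Vmin + 2 * μ * d := by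
        calc (√(2 * Vmin) + c * (σ * (r ^ V.β)⁻¹)) ^ 2 ≤ (√(2 * Vmin) + c * d) ^ 2 := by gcongr
          _ = √(2 * Vmin) ^ 2 + 2 * √(2 * Vmin) * c * d + c ^ 2 * (d * d) := by ring
          _ ≤ 2 * Vmin + 2 * √(2 * Vmin) * c * d + c ^ 2 * (4 * d) := by
            rw [sqrt_sq_two hV]; gcongr
          _ = 2 * Vmin + (2 * √(2 * Vmin) * c + 4 * c ^ 2) * d := by ring
          _ ≤ 2 * Vmin + 2 * μ * d := by gcongr
      have h4 := mul_le_mul_of_nonneg_left h3 hP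
      simp only [ne_eq, OfNat.ofNat_ne_zero, not_false_eq_true, zero_pow, mul_zero, zero_mul,
        zero_div, add_zero]
      linarith)
  simp only [zero_mul, sub_zero] at this
  linarith

end Potential

end AnisotropicKepler

end

/-! ### Paths of small excess: confinement and closeness to the ray. -/

noncomputable section

namespace AnisotropicKepler

section Crossing

theorem exists_last_eq {f : ℝ → ℝ} {a b r : ℝ} (hab : a ≤ b) (hf : ContinuousOn f (Icc a b))
    (ha : f a ≤ r) (hb : r ≤ f b) : ∃ t ∈ Icc a b, f t = r ∧ ∀ s ∈ Icc t b, r ≤ f s := by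
  have hc : IsCompact (Icc a b ∩ f ⁻¹' Iic r) :=
    isCompact_Icc.of_isClosed_subset (hf.preimage_isClosed_of_isClosed isClosed_Icc isClosed_Iic)
      inter_subset_left
  obtain ⟨t, ⟨ht, htr⟩, hmax⟩ := hc.exists_isGreatest ⟨a, ⟨le_rfl, hab⟩, ha⟩
  have key : ∀ s ∈ Icc t b, s ≠ t → r < f s := fun s hs hst => by
    by_contra h
    exact hst (le_antisymm (hmax ⟨⟨ht.1.trans hs.1, hs.2⟩, not_lt.1 h⟩) hs.1)
  have hle : r ≤ f t := by
    obtain ⟨s, hs, hsr⟩ := intermediate_value_Icc ht.2 (hf.mono (Icc_subset_Icc_left ht.1))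
      (show r ∈ Icc (f t) (f b) from ⟨htr, hb⟩)
    by_cases hst : s = t
    · rw [← hst, hsr]
    · exact absurd hsr (key s hs hst).ne'
  refine ⟨t, ht, le_antisymm htr hle, fun s hs => ?_⟩
  by_cases hst : s = t
  · rw [hst]; exact hle
  · exact (key s hs hst).le

theorem exists_first_eq {f : ℝ → ℝ} {a b r : ℝ} (hab : a ≤ b) (hf : ContinuousOn f (Icc a b))
    (ha : f a ≤ r) (hb : r ≤ f b) : ∃ t ∈ Icc a b, f t = r ∧ ∀ s ∈ Icc a t, f s ≤ r := by
  have hf' : ContinuousOn (fun t => -f (-t)) (Icc (-b) (-a)) := by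
    refine (hf.comp continuous_neg.continuousOn fun t ht => ?_).neg
    exact ⟨by linarith [ht.2], by linarith [ht.1]⟩
  obtain ⟨t, ht, htr, hs⟩ := exists_last_eq (r := -r) (neg_le_neg hab) hf' (by simpa) (by simpa)
  refine ⟨-t, ⟨by linarith [ht.2], by linarith [ht.1]⟩, by linarith, fun s hs' => ?_⟩
  have := hs (-s) ⟨by linarith [hs'.2], by linarith [hs'.1]⟩
  simp only [neg_neg] at this
  linarith

end Crossing

namespace Potential

variable {n : ℕ} {ξm ξp : USphere n} {Vmin : ℝ} {V : Potential ξm ξp Vmin}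
  {a b : ℝ} {x : ℝ → Space n}

theorem integral_lag_add {c : ℝ} (hab : a ≤ b) (hbc : b ≤ c) (hx : IsH1 a c x)
    (h0 : ∀ t ∈ Icc a c, x t ≠ 0) :
    (∫ t in a..c, V.lag x t) = (∫ t in a..b, V.lag x t) + ∫ t in b..c, V.lag x t :=
  (intervalIntegral.integral_add_adjacent_intervals
    (intervalIntegrable_lag hab (hx.mono le_rfl hbc) fun t ht => h0 t ⟨ht.1, ht.2.trans hbc⟩)
    (intervalIntegrable_lag hbc (hx.mono hab le_rfl)
      fun t ht => h0 t ⟨hab.trans ht.1, ht.2⟩)).symm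

theorem integral_lag_nonneg (hV : 0 < Vmin) (hab : a ≤ b) : 0 ≤ ∫ t in a..b, V.lag x t :=
  intervalIntegral.integral_nonneg hab fun t _ => lag_nonneg hV x t

theorem Reach.of_path_lag (hV : 0 < Vmin) {ρ : ℝ} (hρ0 : 0 < ρ) (hab : a ≤ b) (hx : IsH1 a b x)
    (hρ : ∀ t ∈ Icc a b, ρ ≤ ‖x t‖) : V.Reach ρ (x a) (x b) (∫ t in a..b, V.lag x t) :=
  Reach.of_path hab hx hρ (integral_lag_nonneg hV hab)
    (action_eq hV hab hx fun t ht => norm_pos_iff.1 (hρ0.trans_le (hρ t ht))).le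

theorem Reach.exists_path (hV : 0 < Vmin) {ρ A : ℝ} {p q : Space n} (hρ0 : 0 < ρ)
    (h : V.Reach ρ p q A) : ∃ T : ℝ, 0 ≤ T ∧ ∃ z : ℝ → Space n, IsH1 0 T z ∧ z 0 = p ∧ z T = q ∧
      (∀ t ∈ Icc 0 T, ρ ≤ ‖z t‖) ∧ ∫ t in (0 : ℝ)..T, V.lag z t ≤ A := by
  obtain ⟨hA, T, hT, z, hz, z0, zT, hzρ, hzA⟩ := h
  refine ⟨T, hT, z, hz, z0, zT, hzρ, ?_⟩
  rw [action_eq hV hT hz fun t ht => norm_pos_iff.1 (hρ0.trans_le (hzρ t ht))] at hzA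
  exact (ENNReal.ofReal_le_ofReal_iff hA).1 hzA

theorem Reach.rad_sub_le (hV : 0 < Vmin) {ρ A : ℝ} {p q : Space n} (hρ0 : 0 < ρ)
    (h : V.Reach ρ p q A) : V.rad ‖q‖ - V.rad ‖p‖ ≤ A := by
  obtain ⟨T, hT, z, hz, z0, zT, hzρ, hzA⟩ := h.exists_path hV hρ0
  rw [← z0, ← zT]
  exact (Potential.rad_sub_le hV hT hz
    fun t ht => norm_pos_iff.1 (hρ0.trans_le (hzρ t ht))).trans hzA

/-- A path reaching the origin pays at least the radial action. -/
theorem rad_le_action (hV : 0 < Vmin) (hab : a ≤ b) (hx : IsH1 a b x) (hb : x b = 0) :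
    ENNReal.ofReal (V.rad ‖x a‖) ≤ V.action a b x := by
  obtain ⟨t₀, ht₀, hz, hfirst⟩ : ∃ t₀ ∈ Icc a b, x t₀ = 0 ∧ ∀ s ∈ Ico a t₀, x s ≠ 0 := by
    have hc : IsCompact (Icc a b ∩ x ⁻¹' {0}) :=
      isCompact_Icc.of_isClosed_subset
        (hx.continuousOn.preimage_isClosed_of_isClosed isClosed_Icc isClosed_singleton)
        inter_subset_left
    obtain ⟨t, ⟨ht, htr⟩, hmin⟩ := hc.exists_isLeast ⟨b, ⟨hab, le_rfl⟩, hb⟩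
    exact ⟨t, ht, htr, fun s hs h0 =>
      absurd (hmin ⟨⟨hs.1, hs.2.le.trans ht.2⟩, h0⟩) (not_le.2 hs.2)⟩
  rcases ht₀.1.eq_or_lt with h | h
  · rw [h, hz, norm_zero, rad_zero]; simp
  -- The calibration is available only away from the origin, hence up to times before the first zero
  -- t₀; the bound is then passed to the limit.
  · have hlim : Tendsto (fun t => ENNReal.ofReal (V.rad ‖x a‖ - V.rad ‖x t‖)) (𝓝[<] t₀)
        (𝓝 (ENNReal.ofReal (V.rad ‖x a‖ - V.rad ‖x t₀‖))) := by
      refine ENNReal.tendsto_ofReal (tendsto_const_nhds.sub ?_)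
      refine (continuous_rad.tendsto _).comp ?_
      have : Tendsto x (𝓝[<] t₀) (𝓝 (x t₀)) :=
        ((hx.continuousOn t₀ ht₀).mono_of_mem_nhdsWithin
          (mem_of_superset (Ico_mem_nhdsLT h) fun s hs => ⟨hs.1, hs.2.le.trans ht₀.2⟩))
      exact this.norm
    rw [hz, norm_zero, rad_zero, sub_zero] at hlim
    refine le_of_tendsto hlim ?_
    filter_upwards [Ico_mem_nhdsLT h] with t ht
    have hxt := hx.mono le_rfl (ht.2.le.trans ht₀.2)
    have h0 : ∀ s ∈ Icc a t, x s ≠ 0 := fun s hs => hfirst s ⟨hs.1, hs.2.trans_lt ht.2⟩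
    refine le_trans ?_ (action_mono le_rfl (ht.2.le.trans ht₀.2))
    rw [action_eq hV ht.1 hxt h0]
    exact ENNReal.ofReal_le_ofReal (rad_sub_le' hV ht.1 hxt h0)

theorem Reach.rad_le_of_zero (hV : 0 < Vmin) {ρ A : ℝ} {p : Space n} (h : V.Reach ρ p 0 A) :
    V.rad ‖p‖ ≤ A := by
  obtain ⟨hA, T, hT, z, hz, z0, zT, hzρ, hzA⟩ := h
  have := (rad_le_action hV hT hz zT).trans hzA
  rwa [z0, ENNReal.ofReal_le_ofReal_iff hA] at this

/-- A path with small excess, ending in the direction `ξ`, stays close to the direction `ξ`. -/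
theorem dev_lt_of_lag_lt (hV : 0 < Vmin) {ξ : USphere n} {δ μ r₀ d : ℝ} (hδ : 0 < δ) (hμ : 0 < μ)
    (hr₀ : 0 < r₀) (hnd : ∀ s : USphere n, dist s ξ < δ → μ * dist s ξ ^ 2 ≤ V.ang s - Vmin)
    (hd : 0 < d) (hdδ : d < δ ^ 2)
    (hx : IsH1 a b x) (hr : ∀ t ∈ Icc a b, r₀ ≤ ‖x t‖) (hb : dev ξ (x b) = 0)
    (hlag : (∫ t in a..b, V.lag x t) < V.rad ‖x b‖ - V.rad ‖x a‖ + √(μ / 2) * r₀ ^ V.β * d) :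
    ∀ t ∈ Icc a b, dev ξ (x t) < d := by
  have h0 : ∀ t ∈ Icc a b, x t ≠ 0 := fun t ht => norm_pos_iff.1 (hr₀.trans_le (hr t ht))
  by_contra! hcon
  obtain ⟨t, ht, htd⟩ := hcon
  have hcd : ContinuousOn (fun t => dev ξ (x t)) (Icc a b) := fun s hs =>
    (continuousAt_dev (h0 s hs)).comp_continuousWithinAt (hx.continuousOn s hs)
  -- After the last time with deviation d the path turns from deviation d to 0, which costs more
  -- than the excess at its disposal; before that time the radial bound suffices.
  obtain ⟨t₁, ht₁, he, hs⟩ := exists_last_eq (f := fun t => -dev ξ (x t)) (r := -d) ht.2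
    ((hcd.mono (Icc_subset_Icc_left ht.1)).neg) (by simpa using htd) (by simp [hb, hd.le])
  have hmem : t₁ ∈ Icc a b := ⟨ht.1.trans ht₁.1, ht₁.2⟩
  have h1 := rad_sub_add_dev_le hV hδ hμ hr₀ hnd hmem.2 (hx.mono hmem.1 le_rfl)
    (fun s hs' => hr s ⟨hmem.1.trans hs'.1, hs'.2⟩)
    (fun s hs' => by have := hs s hs'; linarith)
  have h2 := rad_sub_le (V := V) hV hmem.1 (hx.mono le_rfl hmem.2)
    (fun s hs' => h0 s ⟨hs'.1, hs'.2.trans hmem.2⟩)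
  have h3 := integral_lag_add (V := V) hmem.1 hmem.2 hx h0
  have h4 : dev ξ (x t₁) = d := by linarith
  rw [hb, h4, sub_zero] at h1
  linarith

/-- A path of small excess from `q` to `R ξ` passes, between the radii `r₀` and `r₁`, at a point
whose deviation from the direction `ξ` is small. -/
theorem Reach.exists_near (hV : 0 < Vmin) {ξ : USphere n} {δ μ r₀ r₁ R d σ c ρ A K : ℝ}
    {q : Space n} (hδ : 0 < δ) (hμ : 0 < μ)
    (hnd : ∀ s : USphere n, dist s ξ < δ → μ * dist s ξ ^ 2 ≤ V.ang s - Vmin)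
    (hd : 0 < d) (hdδ : d < δ ^ 2) (hσ : 0 < σ) (hc : 0 < c)
    (hcμ : 2 * √(2 * Vmin) * c + 4 * c ^ 2 ≤ 2 * μ)
    (hρ : 0 < ρ) (hq : ‖q‖ ≤ r₀) (hr₀ : 0 < r₀) (hr : r₀ ≤ r₁) (hR : r₁ ≤ R)
    (h : V.Reach ρ q (R • (ξ : Space n)) A) (hA : A < V.rad R - V.rad ‖q‖ + K)
    (hK₁ : K ≤ √(μ / 2) * r₀ ^ V.β * d) (hK₂ : K ≤ c * σ * (Real.log r₁ - Real.log r₀)) :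
    ∃ y : Space n, r₀ ≤ ‖y‖ ∧ ‖y‖ ≤ r₁ ∧ ‖y‖ ^ V.β * dev ξ y < σ ∧ dev ξ y < d ∧
      V.Reach ρ q y (A - (V.rad R - V.rad ‖y‖)) := by
  obtain ⟨T, hT, z, hz, z0, zT, hzρ, hzA⟩ := h.exists_path hV hρ
  have hRpos : 0 < R := hr₀.trans_le (hr.trans hR)
  have h0 : ∀ t ∈ Icc 0 T, z t ≠ 0 := fun t ht => norm_pos_iff.1 (hρ.trans_le (hzρ t ht))
  have hzTn : ‖z T‖ = R := by rw [zT, norm_smul, norm_coe, mul_one, Real.norm_eq_abs, abs_of_pos hRpos]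
  have hcn : ContinuousOn (fun t => ‖z t‖) (Icc 0 T) := hz.continuousOn.norm
  -- Past the last passage through radius r₀ the path never returns inside, so the confinement to
  -- the cone applies on the whole remaining interval.
  obtain ⟨t₀, ht₀, he₀, hl₀⟩ := exists_last_eq (f := fun t => ‖z t‖) (r := r₀) hT hcn
    (by simpa [z0] using hq) (by simp only [hzTn]; exact hr.trans hR)
  obtain ⟨t₁, ht₁, he₁, hf₁⟩ := exists_first_eq (f := fun t => ‖z t‖) (r := r₁) ht₀.2
    (hcn.mono (Icc_subset_Icc_left ht₀.1)) (by simpa [he₀] using hr) (by simpa only [hzTn] using hR)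
  have hz₀ : IsH1 t₀ T z := hz.mono ht₀.1 le_rfl
  have h0' : ∀ t ∈ Icc t₀ T, z t ≠ 0 := fun t ht => h0 t ⟨ht₀.1.trans ht.1, ht.2⟩
  have hsplit := integral_lag_add (V := V) ht₀.1 ht₀.2 hz h0
  have hin := Potential.rad_sub_le (V := V) hV ht₀.1 (hz.mono le_rfl ht₀.2)
    fun t ht => h0 t ⟨ht.1, ht.2.trans ht₀.2⟩
  rw [he₀, z0] at hin
  have hout : (∫ t in t₀..T, V.lag z t) < V.rad R - V.rad r₀ + K := by linarith
  have hstay := dev_lt_of_lag_lt hV hδ hμ hr₀ hnd hd hdδ hz₀ hl₀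
    (by rw [zT]; exact dev_smul_self hRpos) (by rw [hzTn, he₀]; linarith)
  -- Otherwise the logarithmic bound between the radii r₀ and r₁ already exceeds the excess K.
  obtain ⟨t, ht, hts⟩ : ∃ t ∈ Icc t₀ t₁, ‖z t‖ ^ V.β * dev ξ (z t) < σ := by
    by_contra! hcon
    have h1 := rad_sub_add_log_le hV hδ hσ hc hcμ hnd ht₁.1 (hz₀.mono le_rfl ht₁.2)
      (fun t ht => h0' t ⟨ht.1, ht.2.trans ht₁.2⟩)
      (fun t ht => (hstay t ⟨ht.1, ht.2.trans ht₁.2⟩).trans hdδ) hcon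
    have h2 := Potential.rad_sub_le (V := V) hV ht₁.2 (hz₀.mono ht₁.1 le_rfl)
      fun t ht => h0' t ⟨ht₁.1.trans ht.1, ht.2⟩
    have h3 := integral_lag_add (V := V) ht₁.1 ht₁.2 hz₀ h0'
    rw [he₁, he₀] at h1
    rw [he₁, hzTn] at h2
    linarith
  have htT : t ∈ Icc t₀ T := ⟨ht.1, ht.2.trans ht₁.2⟩
  have htT' : t ∈ Icc 0 T := ⟨ht₀.1.trans ht.1, htT.2⟩
  refine ⟨z t, hl₀ t htT, hf₁ t ht, hts, hstay t htT, ?_⟩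
  have h1 := Reach.of_path_lag (V := V) hV hρ htT'.1 (hz.mono le_rfl htT'.2)
    fun s hs => hzρ s ⟨hs.1, hs.2.trans htT'.2⟩
  rw [z0] at h1
  refine h1.mono le_rfl ?_
  have h2 := Potential.rad_sub_le (V := V) hV htT'.2 (hz.mono htT'.1 le_rfl)
    fun s hs => h0 s ⟨htT'.1.trans hs.1, hs.2⟩
  have h3 := integral_lag_add (V := V) htT'.1 htT'.2 hz h0
  rw [hzTn] at h2
  linarith

end Potential

end AnisotropicKepler

end

/-! ### Explicit paths: segments, radial motion, interpolation of directions. -/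

noncomputable section

namespace AnisotropicKepler

theorem IsH1.of_hasDerivAt {n : ℕ} {a b : ℝ} {x x' : ℝ → Space n}
    (hd : ∀ t ∈ Icc a b, HasDerivAt x (x' t) t) (hc : ContinuousOn x' (Icc a b)) : IsH1 a b x := by
  have he : ∀ t ∈ Icc a b, deriv x t = x' t := fun t ht => (hd t ht).deriv
  have hc' : ContinuousOn (deriv x) (Icc a b) := hc.congr he
  refine IsH1.of_sub ?_ fun t ht => ?_
  · rw [memLp_two_iff_integrable_sq_norm (stronglyMeasurable_deriv x).aestronglyMeasurable]
    exact ((hc'.norm.pow 2).integrableOn_Icc).mono_set Ioc_subset_Icc_self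
  · have hsub : uIcc a t ⊆ Icc a b := by
      rw [uIcc_of_le ht.1]; exact Icc_subset_Icc_right ht.2
    symm
    refine intervalIntegral.integral_eq_sub_of_hasDerivAt (fun s hs => ?_)
      (hc'.mono hsub).intervalIntegrable
    rw [he s (hsub hs)]
    exact hd s (hsub hs)

namespace Potential

variable {n : ℕ} {ξm ξp : USphere n} {Vmin : ℝ} {V : Potential ξm ξp Vmin}

theorem pot_le {C : ℝ} (hC : ∀ s, V.ang s ≤ C) {y : Space n} (hy : y ≠ 0) :
    V.pot y ≤ C * ‖y‖ ^ (-V.α) := by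
  rw [pot, radialExt_of_ne hy]
  exact mul_le_mul_of_nonneg_right (hC _) (Real.rpow_nonneg (norm_nonneg _) _)

theorem Reach.segment (hV : 0 < Vmin) {C ρ : ℝ} (hC0 : 0 < C) (hC : ∀ s, V.ang s ≤ C) (hρ : 0 < ρ)
    {p q : Space n} (hseg : ∀ τ ∈ Icc (0 : ℝ) 1, ρ ≤ ‖p + τ • (q - p)‖) :
    V.Reach ρ p q ((1 / 2 + C * ρ ^ (-V.α)) * ‖q - p‖) := by
  by_cases hpq : q = p
  · subst hpq
    simpa using Reach.refl (V := V) (p := q) (ρ := ρ) (by simpa using hseg 0 (by simp))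
  have hT : 0 < ‖q - p‖ := norm_pos_iff.2 (sub_ne_zero.2 hpq)
  set T := ‖q - p‖
  set z : ℝ → Space n := fun t => p + (t / T) • (q - p)
  have hd : ∀ t, HasDerivAt z (T⁻¹ • (q - p)) t := fun t => by
    have h1 : HasDerivAt (fun t : ℝ => t / T) T⁻¹ t := by
      simpa using (hasDerivAt_id t).div_const T
    exact (h1.smul_const (q - p)).const_add p
  have hz : IsH1 0 T z := IsH1.of_hasDerivAt (fun t _ => hd t) continuousOn_const
  have hzρ : ∀ t ∈ Icc 0 T, ρ ≤ ‖z t‖ := fun t ht =>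
    hseg _ ⟨div_nonneg ht.1 hT.le, (div_le_one hT).2 ht.2⟩
  have h0 : ∀ t ∈ Icc 0 T, z t ≠ 0 := fun t ht => norm_pos_iff.1 (hρ.trans_le (hzρ t ht))
  have h1 := Reach.of_path_lag (V := V) hV hρ hT.le hz hzρ
  have e0 : z 0 = p := by simp [z]
  have eT : z T = q := by simp [z, hT.ne']
  rw [e0, eT] at h1
  refine h1.mono le_rfl ?_
  have h2 : (∫ t in (0 : ℝ)..T, V.lag z t) ≤ ∫ _t in (0 : ℝ)..T, (1 / 2 + C * ρ ^ (-V.α)) := by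
    refine intervalIntegral.integral_mono_on hT.le (intervalIntegrable_lag hT.le hz h0)
      intervalIntegrable_const fun t ht => ?_
    rw [lag, (hd t).deriv, norm_smul, norm_inv, Real.norm_eq_abs, abs_of_pos hT,
      inv_mul_cancel₀ hT.ne']
    have h3 := pot_le hC (h0 t ht)
    have h4 : ‖z t‖ ^ (-V.α) ≤ ρ ^ (-V.α) :=
      Real.rpow_le_rpow_of_nonpos hρ (hzρ t ht) (neg_nonpos.2 V.α_pos.le)
    have h5 := mul_le_mul_of_nonneg_left h4 hC0.le
    linarith
  refine h2.trans (le_of_eq ?_)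
  simp
  ring

theorem exists_reach_of_ne_neg (hV : 0 < Vmin) {p q : USphere n} (h : (q : Space n) ≠ -p) :
    ∃ ρ > 0, ∃ A, V.Reach ρ (p : Space n) q A := by
  obtain ⟨C, hC0, hC⟩ := V.exists_ang_le
  have hne : ∀ τ ∈ Icc (0 : ℝ) 1, (p : Space n) + τ • ((q : Space n) - p) ≠ 0 := by
    intro τ hτ h0
    have h1 : τ • (q : Space n) = -((1 - τ) • (p : Space n)) := by
      rw [smul_sub] at h0
      rw [sub_smul, one_smul, ← sub_eq_zero, ← h0]; abel
    have h2 := congrArg norm h1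
    rw [norm_neg, norm_smul, norm_smul, norm_coe, norm_coe, Real.norm_eq_abs, Real.norm_eq_abs,
      abs_of_nonneg hτ.1, abs_of_nonneg (sub_nonneg.2 hτ.2)] at h2
    have h3 : τ = 1 / 2 := by linarith
    rw [h3, show (1 - 1 / 2 : ℝ) = 1 / 2 by norm_num, ← smul_neg] at h1
    exact h (smul_right_injective _ (by norm_num : (1 / 2 : ℝ) ≠ 0) h1)
  have hcont : ContinuousOn (fun τ : ℝ => ‖(p : Space n) + τ • ((q : Space n) - p)‖) (Icc 0 1) := by
    fun_prop
  obtain ⟨τ₀, hτ₀, hmin⟩ := isCompact_Icc.exists_isMinOn (nonempty_Icc.2 zero_le_one) hcont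
  exact ⟨_, norm_pos_iff.2 (hne τ₀ hτ₀), _, Reach.segment hV hC0 hC (norm_pos_iff.2 (hne τ₀ hτ₀))
    fun τ hτ => hmin hτ⟩

/-- Only for antipodal points does the segment meet the origin; then a detour through an orthogonal
direction is used, which exists because the dimension n + 1 is at least 2. -/
theorem exists_reach_sphere (hV : 0 < Vmin) (hn : 1 ≤ n) (p q : USphere n) :
    ∃ ρ > 0, ∃ A, V.Reach ρ (p : Space n) q A := by
  by_cases h : (q : Space n) = -p
  · have := Fact.mk (@finrank_euclideanSpace_fin ℝ _ (n + 1))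
    have hfr : 0 < Module.finrank ℝ ((Submodule.span ℝ {(p : Space n)})ᗮ : Submodule ℝ (Space n)) := by
      rw [Submodule.finrank_orthogonal_span_singleton (n := n) (coe_ne_zero p)]; omega
    obtain ⟨⟨w, hw⟩, hw0⟩ := Module.finrank_pos_iff_exists_ne_zero.1 hfr
    have hw0' : w ≠ 0 := fun h0 => hw0 (by ext1; exact h0)
    have hpw : inner ℝ (p : Space n) w = 0 := by
      rw [Submodule.mem_orthogonal_singleton_iff_inner_right] at hw; exact hw
    have hpd : inner ℝ (p : Space n) (dir w hw0' : Space n) = 0 := by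
      simp [dir, real_inner_smul_right, hpw]
    have hpp : inner ℝ (p : Space n) (p : Space n) = (1 : ℝ) := by
      rw [real_inner_self_eq_norm_sq, norm_coe]; norm_num
    have h1 : ((dir w hw0' : USphere n) : Space n) ≠ -p := fun he => by
      rw [he, inner_neg_right, hpp] at hpd; norm_num at hpd
    have h2 : (q : Space n) ≠ -(dir w hw0' : USphere n) := fun he => by
      rw [h, neg_inj] at he
      rw [← he, hpp] at hpd; norm_num at hpd
    obtain ⟨ρ₁, hρ₁, A₁, hA₁⟩ := exists_reach_of_ne_neg (V := V) hV h1
    obtain ⟨ρ₂, hρ₂, A₂, hA₂⟩ := exists_reach_of_ne_neg (V := V) hV h2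
    exact ⟨min ρ₁ ρ₂, lt_min hρ₁ hρ₂, A₁ + A₂, (hA₁.mono (min_le_left _ _) le_rfl).trans
      (hA₂.mono (min_le_right _ _) le_rfl)⟩
  · exact exists_reach_of_ne_neg hV h

/-- The radius at time `t` of the parabolic radial motion starting at radius `1`. -/
def radius (V : Potential ξm ξp Vmin) (t : ℝ) : ℝ :=
  (1 + √(2 * Vmin) * (2 + V.α) / 2 * t) ^ (2 / (2 + V.α))

section Radius

theorem radius_base_pos {t : ℝ} (ht : 0 ≤ t) : 1 ≤ 1 + √(2 * Vmin) * (2 + V.α) / 2 * t := by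
  have := V.α_pos
  have h : 0 ≤ √(2 * Vmin) * (2 + V.α) / 2 * t := by positivity
  linarith

theorem radius_zero : V.radius 0 = 1 := by simp [radius]

theorem one_le_radius {t : ℝ} (ht : 0 ≤ t) : 1 ≤ V.radius t := by
  have := V.α_pos
  exact Real.one_le_rpow (radius_base_pos ht) (by positivity)

theorem radius_pos {t : ℝ} (ht : 0 ≤ t) : 0 < V.radius t := zero_lt_one.trans_le (one_le_radius ht)

theorem hasDerivAt_radius {t : ℝ} (ht : 0 ≤ t) :
    HasDerivAt V.radius (√(2 * Vmin) * V.radius t ^ (-V.α / 2)) t := by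
  have hα := V.α_pos
  have hb : 0 < 1 + √(2 * Vmin) * (2 + V.α) / 2 * t := zero_lt_one.trans_le (radius_base_pos ht)
  have h1 : HasDerivAt (fun t => 1 + √(2 * Vmin) * (2 + V.α) / 2 * t)
      (√(2 * Vmin) * (2 + V.α) / 2) t := by
    simpa using ((hasDerivAt_id t).const_mul (√(2 * Vmin) * (2 + V.α) / 2)).const_add 1
  have h2 := h1.rpow_const (p := 2 / (2 + V.α)) (Or.inl hb.ne')
  refine h2.congr_deriv ?_
  rw [radius, ← Real.rpow_mul hb.le]
  have e : 2 / (2 + V.α) - 1 = 2 / (2 + V.α) * (-V.α / 2) := by field_simp; ring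
  rw [e]
  field_simp

theorem continuousOn_radius_deriv (T : ℝ) :
    ContinuousOn (fun t => √(2 * Vmin) * V.radius t ^ (-V.α / 2)) (Icc 0 T) := by
  refine continuousOn_const.mul (ContinuousOn.rpow_const (fun t ht =>
    (hasDerivAt_radius ht.1).continuousAt.continuousWithinAt) fun t ht => ?_)
  exact Or.inl (radius_pos ht.1).ne'

theorem radius_mono {s t : ℝ} (hs : 0 ≤ s) (hst : s ≤ t) : V.radius s ≤ V.radius t := by
  have := V.α_pos
  have h := radius_base_pos (V := V) hs
  unfold radius
  gcongr

theorem exists_radius_eq (hV : 0 < Vmin) {R : ℝ} (hR : 1 ≤ R) : ∃ T, 0 ≤ T ∧ V.radius T = R := by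
  have hα := V.α_pos
  have hκ : 0 < √(2 * Vmin) := Real.sqrt_pos.2 (by positivity)
  have h1 : 1 ≤ R ^ ((2 + V.α) / 2) := Real.one_le_rpow hR (by positivity)
  refine ⟨(R ^ ((2 + V.α) / 2) - 1) / (√(2 * Vmin) * (2 + V.α) / 2),
    div_nonneg (by linarith) (by positivity), ?_⟩
  rw [radius, mul_div_cancel₀ _ (by positivity), add_sub_cancel, ← Real.rpow_mul (by linarith)]
  have : (2 + V.α) / 2 * (2 / (2 + V.α)) = 1 := by field_simp
  rw [this, Real.rpow_one]

/-- At energy zero the Lagrangian is twice the potential, and along the radial motion it is the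
derivative of the Jacobi length. This is the equality case of the radial calibration. -/
theorem integral_radius_rpow (hV : 0 < Vmin) {T : ℝ} (hT : 0 ≤ T) :
    ∫ t in (0 : ℝ)..T, 2 * Vmin * V.radius t ^ (-V.α) = V.rad (V.radius T) - V.rad 1 := by
  have hd : ∀ t ∈ uIcc 0 T, HasDerivAt (fun t => V.rad (V.radius t))
      (2 * Vmin * V.radius t ^ (-V.α)) t := by
    intro t ht
    rw [uIcc_of_le hT] at ht
    have hp := radius_pos (V := V) ht.1
    refine ((hasDerivAt_rad hp).comp t (hasDerivAt_radius ht.1)).congr_deriv ?_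
    linear_combination (V.radius t ^ (-V.α / 2)) ^ 2 * sqrt_sq_two hV
      + 2 * Vmin * rpow_half_sq hp (-V.α)
  have := intervalIntegral.integral_eq_sub_of_hasDerivAt hd ?_
  · rw [this, radius_zero]
  · refine ContinuousOn.intervalIntegrable ?_
    rw [uIcc_of_le hT]
    refine continuousOn_const.mul (ContinuousOn.rpow_const (fun t ht =>
      (hasDerivAt_radius ht.1).continuousAt.continuousWithinAt) fun t ht => ?_)
    exact Or.inl (radius_pos ht.1).ne'

end Radius

/-- Chords replace geodesics of the sphere: the defect of the norm from 1 is quadratic in the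
distance of the end points, and so is the scalar product of a point of the chord with its direction.
-/
theorem norm_chord {s₀ s₁ : USphere n} {τ : ℝ} :
    ‖(s₀ : Space n) + τ • ((s₁ : Space n) - s₀)‖ ^ 2
      = 1 - τ * (1 - τ) * ‖(s₁ : Space n) - s₀‖ ^ 2 := by
  have h1 := norm_coe s₀
  have h2 := norm_coe s₁
  rw [norm_add_sq_real, norm_smul, mul_pow, Real.norm_eq_abs, sq_abs, real_inner_smul_right,
    inner_sub_right, real_inner_self_eq_norm_sq, norm_sub_sq_real, h1, h2,
    real_inner_comm (s₁ : Space n) s₀]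
  ring

theorem inner_chord {s₀ s₁ : USphere n} {τ : ℝ} :
    inner ℝ ((s₀ : Space n) + τ • ((s₁ : Space n) - s₀)) ((s₁ : Space n) - s₀)
      = (2 * τ - 1) / 2 * ‖(s₁ : Space n) - s₀‖ ^ 2 := by
  have h1 := norm_coe s₀
  have h2 := norm_coe s₁
  rw [inner_add_left, real_inner_smul_left, real_inner_self_eq_norm_sq, inner_sub_right,
    real_inner_self_eq_norm_sq, norm_sub_sq_real, h1, h2,
    real_inner_comm (s₁ : Space n) s₀]
  ring

theorem rpow_neg_le_one_add {v α e : ℝ} (hα : α < 2) (hv : 0 < v) (hv1 : v ≤ 1)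
    (he : e ^ 2 ≤ 1 / 2) (hve : 1 - e ^ 2 ≤ v ^ 2) : v ^ (-α) ≤ 1 + 2 * e ^ 2 := by
  have h1 : v ^ (-α) ≤ v ^ (-(2 : ℝ)) :=
    Real.rpow_le_rpow_of_exponent_ge hv hv1 (by linarith)
  refine h1.trans ?_
  rw [Real.rpow_neg hv.le, show (2 : ℝ) = ((2 : ℕ) : ℝ) by norm_num, Real.rpow_natCast]
  have h2 : 0 < v ^ 2 := by positivity
  rw [inv_le_iff_one_le_mul₀ h2]
  push_cast
  nlinarith [sq_nonneg e]

set_option maxHeartbeats 1000000 in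
/-- The directions `s₀` at radius `1` and `s₁` at radius `radius T`, both close to `ξ`, can be joined
at a cost which exceeds the radial one quadratically. -/
theorem exists_reach_interp (hV : 0 < Vmin) {ξ : USphere n} (hξ : V.ang ξ = Vmin) :
    ∃ δ > 0, δ ≤ 1 / 2 ∧ ∀ T > 0, ∃ C ≥ 0, ∀ (s₀ s₁ : USphere n) (e : ℝ), 0 ≤ e → e < δ →
      dist s₀ ξ ≤ e → dist s₁ ξ ≤ e →
      V.Reach (1 - e) (s₀ : Space n) (V.radius T • (s₁ : Space n))
        (V.rad (V.radius T) - V.rad 1 + C * e ^ 2) := by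
  obtain ⟨δ, hδ, hδ1, C, hC, hF⟩ :=
    exists_radialExt_le V.isAngular.contMDiff V.isAngular.le hξ
  refine ⟨min δ (1 / 2), by positivity, min_le_right _ _, fun T hT => ?_⟩
  set κ := √(2 * Vmin)
  have hκ : 0 < κ := Real.sqrt_pos.2 (by positivity)
  set G := V.radius T
  have hG1 : 1 ≤ G := one_le_radius hT.le
  refine ⟨(2 * κ * G / T + 2 * G ^ 2 / T ^ 2 + 2 * Vmin + 2 * C) * T, by positivity, ?_⟩
  intro s₀ s₁ e he0 he hs₀ hs₁
  have he' : e < δ := he.trans_le (min_le_left _ _)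
  have he2 : e ≤ 1 / 2 := (he.trans_le (min_le_right _ _)).le
  have hesq : e ^ 2 ≤ 1 / 2 := by nlinarith
  rw [Subtype.dist_eq, dist_eq_norm] at hs₀ hs₁
  set w : Space n := (s₁ : Space n) - s₀
  have hw : ‖w‖ ≤ 2 * e := by
    have : w = ((s₁ : Space n) - ξ) - ((s₀ : Space n) - ξ) := by simp [w]
    rw [this]
    exact (norm_sub_le _ _).trans (by linarith)
  have hw2 : ‖w‖ ^ 2 ≤ 4 * e ^ 2 := by nlinarith [norm_nonneg w]
  -- The directions are interpolated along the chord without normalization, and the radius follows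
  -- the parabolic motion; the loss in the norm is what makes 1 - e appear as the radius to be
  -- avoided.
  set v : ℝ → Space n := fun t => (s₀ : Space n) + (t / T) • w
  set z : ℝ → Space n := fun t => V.radius t • v t
  have hτ : ∀ t ∈ Icc 0 T, t / T ∈ Icc (0 : ℝ) 1 := fun t ht =>
    ⟨div_nonneg ht.1 hT.le, (div_le_one hT).2 ht.2⟩
  have hvd : ∀ t, HasDerivAt v (T⁻¹ • w) t := fun t => by
    have h1 : HasDerivAt (fun t : ℝ => t / T) T⁻¹ t := by
      simpa using (hasDerivAt_id t).div_const T
    exact (h1.smul_const w).const_add _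
  have hzd : ∀ t ∈ Icc 0 T, HasDerivAt z
      (V.radius t • (T⁻¹ • w) + (κ * V.radius t ^ (-V.α / 2)) • v t) t := fun t ht =>
    (hasDerivAt_radius ht.1).smul (hvd t)
  have hvc : Continuous v := continuous_iff_continuousAt.2 fun t => (hvd t).continuousAt
  have hz : IsH1 0 T z := by
    refine IsH1.of_hasDerivAt hzd ?_
    refine ContinuousOn.add (ContinuousOn.smul (fun t ht =>
      (hasDerivAt_radius ht.1).continuousAt.continuousWithinAt) continuousOn_const) ?_
    exact (continuousOn_radius_deriv T).smul hvc.continuousOn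
  have hvn : ∀ t ∈ Icc 0 T, 1 - e ^ 2 ≤ ‖v t‖ ^ 2 ∧ ‖v t‖ ≤ 1 := fun t ht => by
    have h1 := hτ t ht
    have h2 : ‖v t‖ ^ 2 = _ := norm_chord (s₀ := s₀) (s₁ := s₁) (τ := t / T)
    have h3 : t / T * (1 - t / T) ≤ 1 / 4 := by nlinarith [sq_nonneg (t / T - 1 / 2)]
    have h4 : 0 ≤ t / T * (1 - t / T) := mul_nonneg h1.1 (by linarith [h1.2])
    have h5 : 0 ≤ ‖w‖ ^ 2 := by positivity
    constructor
    · rw [h2]; nlinarith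
    · refine le_of_sq_le_sq ?_ zero_le_one
      rw [h2]; nlinarith
  have hvξ : ∀ t ∈ Icc 0 T, ‖v t - ξ‖ ≤ e := fun t ht => by
    have h1 := hτ t ht
    have : v t - ξ = (1 - t / T) • ((s₀ : Space n) - ξ) + (t / T) • ((s₁ : Space n) - ξ) := by
      simp only [v, w, smul_sub, sub_smul, one_smul]; abel
    rw [this]
    refine (norm_add_le _ _).trans ?_
    rw [norm_smul, norm_smul, Real.norm_eq_abs, Real.norm_eq_abs, abs_of_nonneg h1.1,
      abs_of_nonneg (by linarith [h1.2])]
    nlinarith [h1.1, h1.2]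
  have hvpos : ∀ t ∈ Icc 0 T, 1 - e ≤ ‖v t‖ := fun t ht => by
    refine le_of_sq_le_sq ?_ (norm_nonneg _)
    nlinarith [(hvn t ht).1]
  have hzn : ∀ t ∈ Icc 0 T, ‖z t‖ = V.radius t * ‖v t‖ := fun t ht => by
    rw [norm_smul, Real.norm_eq_abs, abs_of_pos (radius_pos ht.1)]
  have hzρ : ∀ t ∈ Icc 0 T, 1 - e ≤ ‖z t‖ := fun t ht => by
    rw [hzn t ht]
    have := one_le_radius (V := V) ht.1
    have := hvpos t ht
    nlinarith
  have hρ : 0 < 1 - e := by linarith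
  have h0 : ∀ t ∈ Icc 0 T, z t ≠ 0 := fun t ht => norm_pos_iff.1 (hρ.trans_le (hzρ t ht))
  have h1 := Reach.of_path_lag (V := V) hV hρ hT.le hz hzρ
  have e0 : z 0 = s₀ := by simp [z, v, radius_zero]
  have eT : z T = G • (s₁ : Space n) := by
    simp only [z, v, w, div_self hT.ne', one_smul, add_sub_cancel, G]
  rw [e0, eT] at h1
  refine h1.mono le_rfl ?_
  set M := 2 * κ * G / T + 2 * G ^ 2 / T ^ 2 + 2 * Vmin + 2 * C
  have hlag : ∀ t ∈ Icc 0 T, V.lag z t ≤ 2 * Vmin * V.radius t ^ (-V.α) + M * e ^ 2 := by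
    intro t ht
    set g := V.radius t
    have hg1 : 1 ≤ g := one_le_radius ht.1
    have hgG : g ≤ G := radius_mono ht.1 ht.2
    have hgpos : 0 < g := by linarith
    set P := g ^ (-V.α)
    have hP0 : 0 ≤ P := Real.rpow_nonneg hgpos.le _
    have hP1 : P ≤ 1 := Real.rpow_le_one_of_one_le_of_nonpos hg1 (neg_nonpos.2 V.α_pos.le)
    set h := g ^ (-V.α / 2)
    have hh0 : 0 ≤ h := Real.rpow_nonneg hgpos.le _
    have hh1 : h ≤ 1 := Real.rpow_le_one_of_one_le_of_nonpos hg1 (by linarith [V.α_pos])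
    have hhP : h ^ 2 = P := rpow_half_sq hgpos _
    have hκ2 : κ ^ 2 = 2 * Vmin := sqrt_sq_two hV
    have hkin : ‖deriv z t‖ ^ 2 / 2 ≤ Vmin * P + (2 * κ * G / T + 2 * G ^ 2 / T ^ 2) * e ^ 2 := by
      rw [(hzd t ht).deriv, norm_add_sq_real]
      have i1 : ‖g • (T⁻¹ • w)‖ ^ 2 = g ^ 2 / T ^ 2 * ‖w‖ ^ 2 := by
        rw [norm_smul, norm_smul, Real.norm_eq_abs, Real.norm_eq_abs, mul_pow, mul_pow, sq_abs,
          sq_abs]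
        field_simp
      have i2 : ‖(κ * h) • v t‖ ^ 2 ≤ 2 * Vmin * P := by
        rw [norm_smul, mul_pow, Real.norm_eq_abs, sq_abs, mul_pow, hκ2, hhP]
        have : ‖v t‖ ^ 2 ≤ 1 := by nlinarith [(hvn t ht).2, norm_nonneg (v t)]
        exact mul_le_of_le_one_right (by positivity) this
      -- The mixed term of the kinetic energy could spoil the quadratic estimate; it is itself
      -- quadratic because the chord is almost orthogonal to its points.
      have i3 : inner ℝ (g • (T⁻¹ • w)) ((κ * h) • v t) ≤ 2 * κ * G / T * e ^ 2 := by
        have hin : inner ℝ (v t) w = _ := inner_chord (s₀ := s₀) (s₁ := s₁) (τ := t / T)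
        rw [real_inner_smul_left, real_inner_smul_left, real_inner_smul_right, real_inner_comm, hin]
        have h1 := hτ t ht
        have h5 : (2 * (t / T) - 1) / 2 * ‖w‖ ^ 2 ≤ 2 * e ^ 2 := by
          nlinarith [h1.2, sq_nonneg ‖w‖]
        have h6 : g * (T⁻¹ * (κ * h * ((2 * (t / T) - 1) / 2 * ‖w‖ ^ 2)))
            ≤ g * (T⁻¹ * (κ * h * (2 * e ^ 2))) := by gcongr
        have h7 : g * (T⁻¹ * (κ * h * (2 * e ^ 2))) ≤ G * (T⁻¹ * (κ * 1 * (2 * e ^ 2))) := by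
          gcongr
        refine (h6.trans h7).trans (le_of_eq ?_)
        field_simp
      have i4 : g ^ 2 / T ^ 2 * ‖w‖ ^ 2 ≤ G ^ 2 / T ^ 2 * (4 * e ^ 2) := by gcongr
      rw [i1]
      have : (2 * κ * G / T + 2 * G ^ 2 / T ^ 2) * e ^ 2
        = 2 * κ * G / T * e ^ 2 + G ^ 2 / T ^ 2 * (4 * e ^ 2) / 2 := by ring
      rw [this]
      linarith
    have hpot : V.pot (z t) ≤ Vmin * P + (2 * Vmin + 2 * C) * e ^ 2 := by
      have j1 : V.pot (z t) = P * (radialExt V.ang (v t) * ‖v t‖ ^ (-V.α)) := pot_smul hgpos _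
      have j2 : radialExt V.ang (v t) ≤ Vmin + C * e ^ 2 := by
        refine (hF _ (by rw [dist_eq_norm]; exact (hvξ t ht).trans_lt he')).trans ?_
        have := hvξ t ht
        gcongr
      have j3 : ‖v t‖ ^ (-V.α) ≤ 1 + 2 * e ^ 2 :=
        rpow_neg_le_one_add V.α_lt_two (hρ.trans_le (hvpos t ht)) (hvn t ht).2 hesq
          (hvn t ht).1
      have j4 : 0 ≤ ‖v t‖ ^ (-V.α) := Real.rpow_nonneg (norm_nonneg _) _
      rw [j1]
      calc P * (radialExt V.ang (v t) * ‖v t‖ ^ (-V.α))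
          ≤ P * ((Vmin + C * e ^ 2) * (1 + 2 * e ^ 2)) := by gcongr
        _ = Vmin * P + P * (2 * Vmin + C * (1 + 2 * e ^ 2)) * e ^ 2 := by ring
        _ ≤ Vmin * P + 1 * (2 * Vmin + C * (1 + 1)) * e ^ 2 := by
          gcongr; linarith
        _ = _ := by ring
    have hM : M * e ^ 2 = (2 * κ * G / T + 2 * G ^ 2 / T ^ 2) * e ^ 2 + (2 * Vmin + 2 * C) * e ^ 2 := by
      simp only [M]; ring
    rw [lag, hM]
    linarith
  have hInt : IntervalIntegrable (fun t => 2 * Vmin * V.radius t ^ (-V.α)) volume 0 T := by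
    refine ContinuousOn.intervalIntegrable ?_
    rw [uIcc_of_le hT.le]
    refine continuousOn_const.mul (ContinuousOn.rpow_const (fun t ht =>
      (hasDerivAt_radius ht.1).continuousAt.continuousWithinAt) fun t ht => ?_)
    exact Or.inl (radius_pos ht.1).ne'
  calc (∫ t in (0 : ℝ)..T, V.lag z t)
      ≤ ∫ t in (0 : ℝ)..T, (2 * Vmin * V.radius t ^ (-V.α) + M * e ^ 2) :=
        intervalIntegral.integral_mono_on hT.le (intervalIntegrable_lag hT.le hz h0)
          (hInt.add intervalIntegrable_const) hlag
    _ = V.rad G - V.rad 1 + M * T * e ^ 2 := by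
        rw [intervalIntegral.integral_add hInt intervalIntegrable_const,
          integral_radius_rpow hV hT.le]
        simp; ring

end Potential

end AnisotropicKepler

end

/-! ### Joining points to the rays, and the excess. -/

noncomputable section

namespace AnisotropicKepler

namespace Potential

variable {n : ℕ} {ξm ξp : USphere n} {Vmin : ℝ} {V : Potential ξm ξp Vmin}

/-- The interpolation with both directions equal to ξ and error e = 0 is the pure radial motion, so
its cost is exact; it is transported from radius 1 to radius r by homothety. -/
theorem Reach.radial (hV : 0 < Vmin) {ξ : USphere n} (hξ : V.ang ξ = Vmin) {r R : ℝ} (hr : 0 < r)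
    (hrR : r ≤ R) : V.Reach r (r • (ξ : Space n)) (R • (ξ : Space n)) (V.rad R - V.rad r) := by
  have hRr : 1 ≤ R / r := (one_le_div hr).2 hrR
  obtain ⟨T, hT, hTR⟩ := exists_radius_eq (V := V) hV hRr
  rcases hT.eq_or_lt with h | h
  · rw [← h, radius_zero, eq_comm, div_eq_one_iff_eq hr.ne'] at hTR
    rw [hTR, sub_self]
    exact Reach.refl (by rw [norm_smul, norm_coe, Real.norm_eq_abs, abs_of_pos hr, mul_one])
  · obtain ⟨δ, hδ, -, hi⟩ := exists_reach_interp (V := V) hV hξ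
    obtain ⟨C, -, hC⟩ := hi T h
    have h1 := (hC ξ ξ 0 le_rfl hδ (by simp) (by simp)).scale hr
    rw [hTR] at h1
    have e1 : r • (R / r) • (ξ : Space n) = R • (ξ : Space n) := by
      rw [smul_smul, mul_div_cancel₀ _ hr.ne']
    have e2 : r ^ V.β * (V.rad (R / r) - V.rad 1 + C * 0 ^ 2) = V.rad R - V.rad r := by
      have h2 := rad_mul (V := V) hr.le (by positivity : 0 ≤ R / r)
      have h3 := rad_mul (V := V) hr.le zero_le_one
      rw [mul_div_cancel₀ _ hr.ne'] at h2
      rw [mul_one] at h3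
      rw [h2, h3]; ring
    rw [e1, e2] at h1
    exact h1.mono (by simp) le_rfl

/-- Joining a point whose direction is close to `ξ` to the ray through `ξ`, outwards and inwards. -/
theorem exists_reach_ray (hV : 0 < Vmin) {ξ : USphere n} (hξ : V.ang ξ = Vmin) :
    ∃ lam ≥ 1, ∃ δ > 0, ∃ C ≥ 0, ∀ y : Space n, y ≠ 0 → dev ξ y < δ →
      (∀ R, lam * ‖y‖ ≤ R → V.Reach (‖y‖ / 2) y (R • (ξ : Space n))
        (V.rad R - V.rad ‖y‖ + C * (‖y‖ ^ V.β * dev ξ y))) ∧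
      ∀ r, 0 < r → 2 * lam * r ≤ ‖y‖ → V.Reach r y (r • (ξ : Space n))
        (V.rad ‖y‖ - V.rad r + C * (‖y‖ ^ V.β * dev ξ y)) := by
  obtain ⟨δ, hδ, hδ2, hi⟩ := exists_reach_interp (V := V) hV hξ
  obtain ⟨C, hC0, hC⟩ := hi 1 one_pos
  set lam := V.radius 1
  have hlam : 1 ≤ lam := one_le_radius zero_le_one
  have hlam0 : 0 < lam := by linarith
  refine ⟨lam, hlam, δ ^ 2, by positivity, C, hC0, fun y hy hdev => ?_⟩
  have hypos : 0 < ‖y‖ := norm_pos_iff.2 hy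
  have hβ := V.β_pos
  set s := dir y hy
  have hsy : ‖y‖ • (s : Space n) = y := norm_smul_dir hy
  have hde : dev ξ y = dist s ξ ^ 2 := dev_eq_dist hy
  have hsδ : dist s ξ < δ := lt_of_pow_lt_pow_left₀ 2 hδ.le (hde ▸ hdev)
  constructor
  · intro R hR
    have h1 := (hC s ξ (dist s ξ) dist_nonneg hsδ le_rfl (by simp)).scale hypos
    rw [hsy, smul_smul, ← hde] at h1
    have h2 := Reach.radial (V := V) hV hξ (r := ‖y‖ * lam) (R := R) (by positivity) (by linarith)
    -- The interpolation stays outside radius (1 - e)‖y‖, and e ≤ 1/2.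
    have h3 := (h1.mono (ρ' := ‖y‖ / 2) (by nlinarith) le_rfl).trans
      (h2.mono (ρ' := ‖y‖ / 2) (by nlinarith) le_rfl)
    refine h3.mono le_rfl (le_of_eq ?_)
    have e2 := rad_mul (V := V) hypos.le hlam0.le
    have e3 := rad_mul (V := V) hypos.le zero_le_one
    rw [mul_one] at e3
    rw [e2, e3]; ring
  · intro r hr hry
    have hq : 0 < ‖y‖ / lam := by positivity
    -- Inwards, the interpolation is run backwards from y to the ray at radius ‖y‖ / lam. It may dip
    -- to half of that radius, which explains the factor 2 in the hypothesis on r.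
    have h1 := (hC ξ s (dist s ξ) dist_nonneg hsδ (by simp) le_rfl).scale hq
    rw [smul_smul, div_mul_cancel₀ _ hlam0.ne', hsy, ← hde] at h1
    have hrq : 2 * r ≤ ‖y‖ / lam := by rw [le_div_iff₀ hlam0]; linarith
    have h2 := Reach.radial (V := V) hV hξ (r := r) (R := ‖y‖ / lam) hr (by linarith)
    have h3 := (h1.mono (ρ' := r) (by nlinarith) le_rfl).symm.trans h2.symm
    refine h3.mono le_rfl ?_
    have e2 := rad_mul (V := V) hq.le hlam0.le
    have e3 := rad_mul (V := V) hq.le zero_le_one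
    rw [mul_one] at e3
    rw [div_mul_cancel₀ _ hlam0.ne'] at e2
    have h4 : (‖y‖ / lam) ^ V.β ≤ ‖y‖ ^ V.β := by
      gcongr; exact div_le_self hypos.le hlam
    have h5 : (‖y‖ / lam) ^ V.β * (C * dev ξ y) ≤ ‖y‖ ^ V.β * (C * dev ξ y) :=
      mul_le_mul_of_nonneg_right h4 (mul_nonneg hC0 dev_nonneg)
    rw [e2, e3]
    linarith

/-- There is a path from `p` to `q` whose minimal distance from the origin is `ε`, of action at
most `A`. -/
def Cross (V : Potential ξm ξp Vmin) (ε : ℝ) (p q : Space n) (A : ℝ) : Prop :=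
  ∃ (w : Space n) (A₁ A₂ : ℝ), ‖w‖ = ε ∧ V.Reach ε p w A₁ ∧ V.Reach ε w q A₂ ∧ A₁ + A₂ ≤ A

namespace Cross

variable {ε A B : ℝ} {p q r : Space n}

theorem of_path {a b : ℝ} {x : ℝ → Space n} (hx : IsH1 a b x) (hA : 0 ≤ A)
    (hmin : HasMinNorm x (Icc a b) ε) (hact : V.action a b x ≤ ENNReal.ofReal A) :
    V.Cross ε (x a) (x b) A := by
  obtain ⟨⟨t, ht, hte⟩, hle⟩ := hmin
  have hle' : ∀ s ∈ Icc a b, ε ≤ ‖x s‖ := fun s hs => hle ⟨s, hs, rfl⟩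
  have hfin : V.action a t x + V.action t b x ≠ ⊤ := by
    rw [← action_add ht.1 ht.2]; exact (hact.trans_lt ENNReal.ofReal_lt_top).ne
  obtain ⟨hf1, hf2⟩ := ENNReal.add_ne_top.1 hfin
  refine ⟨x t, (V.action a t x).toReal, (V.action t b x).toReal, hte, ?_, ?_, ?_⟩
  · exact Reach.of_path ht.1 (hx.mono le_rfl ht.2) (fun s hs => hle' s ⟨hs.1, hs.2.trans ht.2⟩)
      ENNReal.toReal_nonneg (by rw [ENNReal.ofReal_toReal hf1])
  · exact Reach.of_path ht.2 (hx.mono ht.1 le_rfl) (fun s hs => hle' s ⟨ht.1.trans hs.1, hs.2⟩)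
      ENNReal.toReal_nonneg (by rw [ENNReal.ofReal_toReal hf2])
  · rw [← ENNReal.toReal_add hf1 hf2, ← action_add ht.1 ht.2]
    exact ENNReal.toReal_le_of_le_ofReal hA hact

theorem exists_path (h : V.Cross ε p q A) : ∃ T : ℝ, 0 ≤ T ∧ ∃ z : ℝ → Space n, IsH1 0 T z ∧
    z 0 = p ∧ z T = q ∧ HasMinNorm z (Icc 0 T) ε ∧ V.action 0 T z ≤ ENNReal.ofReal A := by
  obtain ⟨w, A₁, A₂, hw, h₁, h₂, hle⟩ := h
  obtain ⟨T, hT, f, hf, h0, hT', ⟨t, ht, htw⟩, hρ, hA⟩ := h₁.exists_concat h₂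
  refine ⟨T, hT, f, hf, h0, hT', ⟨⟨t, ht, by simp [htw, hw]⟩, ?_⟩,
    hA.trans (ENNReal.ofReal_le_ofReal hle)⟩
  rintro _ ⟨s, hs, rfl⟩
  exact hρ s hs

theorem nonneg (h : V.Cross ε p q A) : 0 ≤ A := by
  obtain ⟨w, A₁, A₂, hw, h₁, h₂, hle⟩ := h
  exact (add_nonneg h₁.1 h₂.1).trans hle

theorem mono (h : V.Cross ε p q A) (hAB : A ≤ B) : V.Cross ε p q B := by
  obtain ⟨w, A₁, A₂, hw, h₁, h₂, hle⟩ := h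
  exact ⟨w, A₁, A₂, hw, h₁, h₂, hle.trans hAB⟩

theorem reach (h : V.Cross ε p q A) : V.Reach ε p q A := by
  obtain ⟨w, A₁, A₂, hw, h₁, h₂, hle⟩ := h
  exact (h₁.trans h₂).mono le_rfl hle

theorem trans (h : V.Cross ε p q A) (h' : V.Reach ε q r B) : V.Cross ε p r (A + B) := by
  obtain ⟨w, A₁, A₂, hw, h₁, h₂, hle⟩ := h
  exact ⟨w, A₁, A₂ + B, hw, h₁, h₂.trans h', by linarith⟩

theorem symm (h : V.Cross ε p q A) : V.Cross ε q p A := by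
  obtain ⟨w, A₁, A₂, hw, h₁, h₂, hle⟩ := h
  exact ⟨w, A₂, A₁, hw, h₂.symm, h₁.symm, by linarith⟩

theorem scale {lam : ℝ} (hlam : 0 < lam) (h : V.Cross ε p q A) :
    V.Cross (lam * ε) (lam • p) (lam • q) (lam ^ V.β * A) := by
  obtain ⟨w, A₁, A₂, hw, h₁, h₂, hle⟩ := h
  refine ⟨lam • w, _, _, ?_, h₁.scale hlam, h₂.scale hlam, ?_⟩
  · rw [norm_smul, Real.norm_eq_abs, abs_of_pos hlam, hw]
  · rw [← mul_add]
    exact mul_le_mul_of_nonneg_left hle (Real.rpow_nonneg hlam.le _)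

end Cross

/-- There is a path from `R ξ⁻` to `R ξ⁺` with minimal distance `1` from the origin, whose action
exceeds that of the path through the origin by at most `E`. -/
def Exc (V : Potential ξm ξp Vmin) (R E : ℝ) : Prop :=
  V.Cross 1 (R • (ξm : Space n)) (R • (ξp : Space n)) (2 * V.rad R + E)

/-- The infimum of the excess of the paths with minimal distance `1` from the origin. -/
def excess (V : Potential ξm ξp Vmin) : ℝ := sInf {E | ∃ R : ℝ, 1 ≤ R ∧ V.Exc R E}

namespace Exc

variable {R R' E E' : ℝ}

theorem mono (h : V.Exc R E) (hE : E ≤ E') : V.Exc R E' := Cross.mono h (by linarith)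

/-- Radial prolongations cost exactly the increase of 2 `V.rad`, so the outer radius can be enlarged
at will without changing the excess. -/
theorem extend (hV : 0 < Vmin) (h : V.Exc R E) (hR : 1 ≤ R) (hRR : R ≤ R') : V.Exc R' E := by
  have h1 := Reach.radial (V := V) hV V.isAngular.min_left (zero_lt_one.trans_le hR) hRR
  have h2 := Reach.radial (V := V) hV V.isAngular.min_right (zero_lt_one.trans_le hR) hRR
  have h3 := ((Cross.trans h (h2.mono hR le_rfl)).symm.trans (h1.mono hR le_rfl)).symm
  exact h3.mono (by linarith)

/-- Each half goes from radius 1 to radius R and pays the radial cost. This makes the infimum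
defining the excess a genuine one. -/
theorem neg_le (hV : 0 < Vmin) (h : V.Exc R E) (hR : 1 ≤ R) : -(2 * V.rad 1) ≤ E := by
  obtain ⟨w, A₁, A₂, hw, h₁, h₂, hle⟩ := h
  have e1 := h₁.symm.rad_sub_le hV one_pos
  have e2 := h₂.rad_sub_le hV one_pos
  rw [hw, norm_smul, norm_coe, Real.norm_eq_abs, abs_of_nonneg (by linarith), mul_one] at e1 e2
  linarith

theorem cross {ε : ℝ} (hε : 0 < ε) (h : V.Exc R E) (hR : 0 ≤ R) :
    V.Cross ε ((ε * R) • (ξm : Space n)) ((ε * R) • (ξp : Space n))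
      (2 * V.rad (ε * R) + ε ^ V.β * E) := by
  have h1 := Cross.scale hε h
  rw [mul_one, smul_smul, smul_smul] at h1
  refine h1.mono (le_of_eq ?_)
  rw [rad_mul hε.le hR]; ring

theorem of_cross {ε : ℝ} (hε : 0 < ε) (hR : 0 ≤ R)
    (h : V.Cross ε (R • (ξm : Space n)) (R • (ξp : Space n)) (2 * V.rad R + E)) :
    V.Exc (R / ε) (E / ε ^ V.β) := by
  have h1 := Cross.scale (inv_pos.2 hε) h
  rw [inv_mul_cancel₀ hε.ne', smul_smul, smul_smul, inv_mul_eq_div] at h1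
  refine h1.mono (le_of_eq ?_)
  have := rad_mul (V := V) (inv_nonneg.2 hε.le) hR
  rw [inv_mul_eq_div] at this
  rw [this, Real.inv_rpow hε.le]
  have : 0 < ε ^ V.β := Real.rpow_pos_of_pos hε _
  field_simp

end Exc

/-- A path joining ξ⁻ to ξ⁺ away from the origin is dilated until it avoids the unit ball. A radial
excursion from R ξ⁻ to ξ⁻ and back makes the minimal distance exactly 1. -/
theorem exists_exc (hV : 0 < Vmin) (hn : 1 ≤ n) (V : Potential ξm ξp Vmin) :
    ∃ R E, 1 ≤ R ∧ V.Exc R E := by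
  obtain ⟨ρ, hρ, A, hA⟩ := exists_reach_sphere (V := V) hV hn ξm ξp
  set R := max 1 (1 / ρ)
  have hR1 : 1 ≤ R := le_max_left _ _
  have hR0 : 0 < R := by linarith
  have hRρ : 1 ≤ R * ρ := by
    have : 1 / ρ ≤ R := le_max_right _ _
    rwa [div_le_iff₀ hρ] at this
  have h1 := (hA.scale hR0).mono hRρ le_rfl
  have h2 := Reach.radial (V := V) hV V.isAngular.min_left one_pos hR1
  rw [one_smul] at h2
  refine ⟨R, R ^ V.β * A - 2 * V.rad 1, hR1, ξm, _, _, norm_coe ξm, h2.symm, h2.trans h1, ?_⟩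
  linarith

theorem bddBelow_exc (hV : 0 < Vmin) : BddBelow {E | ∃ R : ℝ, 1 ≤ R ∧ V.Exc R E} :=
  ⟨-(2 * V.rad 1), by rintro E ⟨R, hR, h⟩; exact h.neg_le hV hR⟩

theorem excess_le (hV : 0 < Vmin) {R E : ℝ} (hR : 1 ≤ R) (h : V.Exc R E) : V.excess ≤ E := by
  refine csInf_le (bddBelow_exc hV) ?_
  exact ⟨R, hR, h⟩

theorem exists_exc_of_excess_lt (hV : 0 < Vmin) (hn : 1 ≤ n) {E : ℝ} (h : V.excess < E) :
    ∃ R, 1 ≤ R ∧ V.Exc R E := by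
  obtain ⟨R, E', hR, hE⟩ := exists_exc hV hn V
  obtain ⟨E₁, ⟨R₁, hR₁, hE₁⟩, hlt⟩ := exists_lt_of_csInf_lt
    (s := {E | ∃ R : ℝ, 1 ≤ R ∧ V.Exc R E}) ⟨E', R, hR, hE⟩ h
  exact ⟨R₁, hR₁, hE₁.mono hlt.le⟩

theorem m_le_of_cross (hξ : ξp ≠ ξm) {ε A : ℝ}
    (h : V.Cross ε (ξm : Space n) (ξp : Space n) A) : V.m ε ≤ ENNReal.ofReal A := by
  obtain ⟨T, hT, z, hz, h0, hT', hmin, hA⟩ := h.exists_path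
  have hTpos : 0 < T := by
    rcases hT.eq_or_lt with h | h
    · rw [← h] at hT'
      exact absurd (Subtype.ext (hT'.symm.trans h0)) hξ
    · exact h
  have hm : (fun t => 1 * t + T / 2) ⁻¹' Icc 0 T = Icc (-(T / 2)) (T / 2) := by
    ext t; simp only [mem_preimage, mem_Icc]
    constructor <;> rintro ⟨h1, h2⟩ <;> constructor <;> linarith
  have himg : (fun t => ‖z (t + T / 2)‖) '' Icc (-(T / 2)) (T / 2) = (fun t => ‖z t‖) '' Icc 0 T := by
    ext v
    constructor
    · rintro ⟨t, ht, rfl⟩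
      exact ⟨t + T / 2, ⟨by linarith [ht.1], by linarith [ht.2]⟩, rfl⟩
    · rintro ⟨t, ht, rfl⟩
      exact ⟨t - T / 2, ⟨by linarith [ht.1], by linarith [ht.2]⟩, by simp⟩
  refine (sInf_le (a := V.action (-(T / 2)) (T / 2) fun t => z (t + T / 2)) ?_).trans ?_
  · refine ⟨T / 2, fun t => z (t + T / 2), by positivity, ?_, by simp [h0], by simp [hT'], ?_, rfl⟩
    · simpa using hz.affine one_ne_zero hm 1
    · unfold HasMinNorm at hmin ⊢; rwa [himg]
  · rw [action_comp_add]; simpa using hA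

theorem cross_of_m_lt {ε A : ℝ} (hA : 0 ≤ A) (h : V.m ε < ENNReal.ofReal A) :
    V.Cross ε (ξm : Space n) (ξp : Space n) A := by
  obtain ⟨B, ⟨T, x, hT, hx, h1, h2, hmin, rfl⟩, hB⟩ := sInf_lt_iff.1 h
  have := Cross.of_path hx hA hmin hB.le
  rwa [h1, h2] at this

theorem c_le_of_reach (hξ : ξp ≠ ξm) {ρ A : ℝ}
    (h : V.Reach ρ (ξm : Space n) (ξp : Space n) A) : V.c ≤ ENNReal.ofReal A := by
  obtain ⟨hA, T, hT, z, hz, z0, zT, -, hzA⟩ := h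
  have hTpos : 0 < T := by
    rcases hT.eq_or_lt with h | h
    · rw [← h] at zT
      exact absurd (Subtype.ext (zT.symm.trans z0)) hξ
    · exact h
  refine (sInf_le (a := V.action 0 T z) ?_).trans hzA
  exact ⟨0, T, z, hTpos, hz, z0, zT, rfl⟩

theorem c_le_m (ε : ℝ) : V.c ≤ V.m ε := by
  refine le_sInf ?_
  rintro A ⟨T, x, hT, hx, h1, h2, -, rfl⟩
  refine sInf_le ?_
  exact ⟨-T, T, x, by linarith, hx, h1, h2, rfl⟩

/-- The origin can be reached with finite action. -/
theorem exists_reach_zero (hV : 0 < Vmin) (ξ : USphere n) :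
    ∃ A, V.Reach 0 (0 : Space n) (ξ : Space n) A := by
  have hα := V.α_pos
  have hα2 := V.α_lt_two
  -- The exponent of the zero energy collision motion: kinetic and potential terms both behave like
  -- t^(2q - 2), which is integrable because α < 2 gives q > 1/2.
  set q := 2 / (2 + V.α) with hq
  have hq0 : 0 < q := by positivity
  have hqα : -V.α * q = 2 * q - 2 := by rw [hq]; field_simp; ring
  have hq1 : -1 < 2 * q - 2 := by
    have : 1 / 2 < q := by rw [hq, div_lt_div_iff₀ (by norm_num) (by positivity)]; linarith
    linarith
  set z : ℝ → Space n := fun t => (t ^ q) • (ξ : Space n)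
  have hzd : ∀ t, 0 < t → HasDerivAt z ((q * t ^ (q - 1)) • (ξ : Space n)) t := fun t ht =>
    (Real.hasDerivAt_rpow_const (Or.inl ht.ne')).smul_const _
  have hkin : ∀ t ∈ Ioc (0 : ℝ) 1, ‖deriv z t‖ ^ 2 / 2 = q ^ 2 / 2 * t ^ (2 * q - 2) := by
    intro t ht
    have hp : 0 < t ^ (q - 1) := Real.rpow_pos_of_pos ht.1 _
    rw [(hzd t ht.1).deriv, norm_smul, norm_coe, mul_one, Real.norm_eq_abs, sq_abs, mul_pow,
      ← Real.rpow_natCast (t ^ (q - 1)), ← Real.rpow_mul ht.1.le]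
    have : (q - 1) * ((2 : ℕ) : ℝ) = 2 * q - 2 := by push_cast; ring
    rw [this]; ring
  have hlagint : IntegrableOn (fun t : ℝ => (q ^ 2 / 2 + V.ang ξ) * t ^ (2 * q - 2)) (Ioc 0 1) := by
    have := (intervalIntegral.intervalIntegrable_rpow' (a := 0) (b := 1) hq1).const_mul
      (q ^ 2 / 2 + V.ang ξ)
    rwa [intervalIntegrable_iff_integrableOn_Ioc_of_le zero_le_one] at this
  have hUξ : 0 ≤ V.ang ξ := hV.le.trans (V.isAngular.le ξ)
  have hact : V.action 0 1 z = ENNReal.ofReal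
      (∫ t in Ioc (0 : ℝ) 1, (q ^ 2 / 2 + V.ang ξ) * t ^ (2 * q - 2)) := by
    rw [ofReal_integral_eq_lintegral_ofReal hlagint, action]
    · refine setLIntegral_congr_fun measurableSet_Ioc fun t ht => ?_
      have hzt : z t ≠ 0 := smul_ne_zero (Real.rpow_pos_of_pos ht.1 _).ne' (coe_ne_zero ξ)
      have hpz : V.pot (z t) = V.ang ξ * t ^ (2 * q - 2) := by
        simp only [z]
        rw [pot_smul (Real.rpow_pos_of_pos ht.1 _), ← Real.rpow_mul ht.1.le, mul_comm q, hqα,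
          pot, radialExt_coe, norm_coe, Real.one_rpow]
        ring
      rw [hkin t ht, eval_of_ne hzt, hpz, ← ENNReal.ofReal_add
        (by have := ht.1; positivity) (by have := ht.1; positivity)]
      congr 1; ring
    · refine (ae_restrict_mem measurableSet_Ioc).mono fun t ht => ?_
      have := ht.1
      simp only [Pi.zero_apply]
      positivity
  have hz : IsH1 0 1 z := by
    refine IsH1.of_sub ?_ fun t ht => ?_
    · rw [IsH1.memLp_deriv_iff]
      refine lt_of_le_of_lt ?_ (show V.action 0 1 z < ⊤ by rw [hact]; exact ENNReal.ofReal_lt_top)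
      exact lintegral_mono fun t => le_self_add
    · have h1 : (∫ τ in (0 : ℝ)..t, deriv z τ)
          = ∫ τ in (0 : ℝ)..t, (q * τ ^ (q - 1)) • (ξ : Space n) := by
        refine intervalIntegral.integral_congr_ae (Eventually.of_forall fun τ hτ => ?_)
        rw [uIoc_of_le ht.1] at hτ
        exact (hzd τ hτ.1).deriv
      rw [h1, intervalIntegral.integral_smul_const, intervalIntegral.integral_const_mul,
        integral_rpow (Or.inl (by linarith))]
      simp only [z, sub_add_cancel, Real.zero_rpow hq0.ne', zero_smul, sub_zero]
      congr 1
      field_simp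
  have h := Reach.of_path (V := V) (ρ := 0) zero_le_one hz (fun t _ => norm_nonneg _)
    (integral_nonneg_of_ae ((ae_restrict_mem measurableSet_Ioc).mono fun t ht => by
      have := ht.1
      simp only [Pi.zero_apply]
      positivity)) hact.le
  simp only [z, Real.zero_rpow hq0.ne', zero_smul, Real.one_rpow, one_smul] at h
  exact ⟨_, h⟩

/-- The collision path needs no optimization: shrunk by a homothety of ratio r it costs r^β A, which
is negligible, and the ray from r ξ to ξ is optimal. -/
theorem reach_zero_lt (hV : 0 < Vmin) {ξ : USphere n} (hξ : V.ang ξ = Vmin) {e : ℝ} (he : 0 < e) :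
    V.Reach 0 (0 : Space n) (ξ : Space n) (V.rad 1 + e) := by
  obtain ⟨A, hA⟩ := exists_reach_zero (V := V) hV ξ
  have hlim : Tendsto (fun r : ℝ => r ^ V.β * A) (𝓝[>] 0) (𝓝 ((0 : ℝ) ^ V.β * A)) :=
    (((Real.continuous_rpow_const V.β_pos.le).mul_const A).tendsto 0).mono_left nhdsWithin_le_nhds
  rw [Real.zero_rpow V.β_pos.ne', zero_mul] at hlim
  obtain ⟨r, hr1, hr0, hr⟩ := ((hlim.eventually_lt_const he).and
    (Ioo_mem_nhdsGT (zero_lt_one' ℝ))).exists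
  have h1 := hA.scale hr0
  have h2 := Reach.radial (V := V) hV hξ hr0 hr.le
  rw [one_smul] at h2
  rw [smul_zero, mul_zero] at h1
  have h3 := h1.trans (h2.mono hr0.le le_rfl)
  have := rad_nonneg (V := V) hr0.le
  exact h3.mono le_rfl (by linarith)

theorem m_zero (hV : 0 < Vmin) (hξ : ξp ≠ ξm) : V.m 0 = ENNReal.ofReal (2 * V.rad 1) := by
  refine le_antisymm ?_ ?_
  · refine ENNReal.le_of_forall_pos_le_add fun e he _ => ?_
    have he2 : (0 : ℝ) < e / 2 := by positivity
    have h1 := reach_zero_lt (V := V) hV V.isAngular.min_left he2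
    have h2 := reach_zero_lt (V := V) hV V.isAngular.min_right he2
    have h3 : V.Cross 0 (ξm : Space n) (ξp : Space n) (2 * V.rad 1 + e) :=
      ⟨0, _, _, norm_zero, h1.symm, h2, by linarith⟩
    refine (m_le_of_cross hξ h3).trans ?_
    rw [ENNReal.ofReal_add (by have := rad_nonneg (V := V) zero_le_one; positivity)
      (NNReal.coe_nonneg e), ENNReal.ofReal_coe_nnreal]
  · by_contra! h
    obtain ⟨A, hA0, hlt1, hlt2⟩ : ∃ A : ℝ, 0 ≤ A ∧ V.m 0 < ENNReal.ofReal A ∧ A < 2 * V.rad 1 := by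
      obtain ⟨B, h1, h2⟩ := exists_between h
      refine ⟨B.toReal, ENNReal.toReal_nonneg, ?_, ?_⟩
      · rwa [ENNReal.ofReal_toReal h2.ne_top]
      · exact (ENNReal.lt_ofReal_iff_toReal_lt h2.ne_top).1 h2
    obtain ⟨w, A₁, A₂, hw, h₁, h₂, hle⟩ := cross_of_m_lt hA0 hlt1
    rw [norm_eq_zero] at hw
    subst hw
    have e1 := h₁.rad_le_of_zero hV
    have e2 := h₂.symm.rad_le_of_zero hV
    rw [norm_coe] at e1 e2
    linarith

theorem mem_out_iff : V ∈ Out ξm ξp Vmin ↔ V.c < ENNReal.ofReal (2 * V.rad 1) := by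
  rw [two_rad_one]; rfl

/-- Paths through the origin are admissible for c(V) and have infimum 2 `V.rad 1`, so c(V) never
exceeds this value and the two alternatives are complementary. -/
theorem mem_in_iff (hV : 0 < Vmin) (hξ : ξp ≠ ξm) :
    V ∈ In ξm ξp Vmin ↔ V ∉ Out ξm ξp Vmin := by
  rw [mem_out_iff, not_lt]
  have h1 : V ∈ In ξm ξp Vmin ↔ V.c = ENNReal.ofReal (2 * V.rad 1) := by rw [two_rad_one]; rfl
  rw [h1]
  exact ⟨fun h => h.ge, fun h => le_antisymm ((c_le_m 0).trans (m_zero hV hξ).le) h⟩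

theorem mem_out_of_reach (hξ : ξp ≠ ξm) {R A ρ : ℝ} (hR : 0 < R)
    (h : V.Reach ρ (R • (ξm : Space n)) (R • (ξp : Space n)) A) (hA : A < 2 * V.rad R) :
    V ∈ Out ξm ξp Vmin := by
  rw [mem_out_iff]
  have h1 := h.scale (inv_pos.2 hR)
  rw [smul_smul, smul_smul, inv_mul_cancel₀ hR.ne', one_smul, one_smul] at h1
  refine (c_le_of_reach hξ h1).trans_lt ?_
  have hpos : 0 < R⁻¹ ^ V.β := Real.rpow_pos_of_pos (inv_pos.2 hR) _
  have h2 := rad_mul (V := V) (inv_nonneg.2 hR.le) hR.le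
  rw [inv_mul_cancel₀ hR.ne'] at h2
  have h3 : R⁻¹ ^ V.β * A < 2 * V.rad 1 := by
    rw [h2]; nlinarith
  exact (ENNReal.ofReal_lt_ofReal_iff_of_nonneg h1.1).2 h3

/-- A path from ξ⁻ to ξ⁺ cheaper than 2 `V.rad 1` cannot meet the origin, so its minimal distance ε
is positive; dilation by 1/ε turns the gain into a negative excess. Conversely a path of negative
excess is shrunk until it ends on the unit sphere. -/
theorem mem_out_iff_excess (hV : 0 < Vmin) (hn : 1 ≤ n) (hξ : ξp ≠ ξm) :
    V ∈ Out ξm ξp Vmin ↔ V.excess < 0 := by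
  constructor
  · intro h
    rw [mem_out_iff] at h
    obtain ⟨_, ⟨a, b, x, hab, hx, ha, hb, rfl⟩, hlt⟩ := sInf_lt_iff.1 h
    obtain ⟨t, ht, hmin⟩ := isCompact_Icc.exists_isMinOn (nonempty_Icc.2 hab.le)
      hx.continuousOn.norm
    have hm : HasMinNorm x (Icc a b) ‖x t‖ :=
      ⟨⟨t, ht, rfl⟩, by rintro _ ⟨s, hs, rfl⟩; exact hmin hs⟩
    set A := (V.action a b x).toReal
    have hfin : V.action a b x ≠ ⊤ := hlt.ne_top
    have hA : A < 2 * V.rad 1 := (ENNReal.lt_ofReal_iff_toReal_lt hfin).1 hlt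
    have hc := Cross.of_path (V := V) (A := A) hx ENNReal.toReal_nonneg hm
      (by rw [ENNReal.ofReal_toReal hfin])
    rw [ha, hb] at hc
    have hε : 0 < ‖x t‖ := by
      by_contra h0
      have h0' : ‖x t‖ = 0 := le_antisymm (not_lt.1 h0) (norm_nonneg _)
      rw [h0'] at hc
      obtain ⟨w, A₁, A₂, hw, h₁, h₂, hle⟩ := hc
      rw [norm_eq_zero] at hw
      subst hw
      have e1 := h₁.rad_le_of_zero hV
      have e2 := h₂.symm.rad_le_of_zero hV
      rw [norm_coe] at e1 e2
      linarith
    have hε1 : ‖x t‖ ≤ 1 := by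
      have : ‖x t‖ ≤ ‖x a‖ := hmin (left_mem_Icc.2 hab.le)
      rwa [ha, norm_coe] at this
    have h1 := Exc.of_cross (V := V) (R := 1) (E := A - 2 * V.rad 1) hε zero_le_one
      (by rw [one_smul, one_smul]; exact hc.mono (by linarith))
    refine (excess_le hV ((one_le_div hε).2 hε1) h1).trans_lt ?_
    exact div_neg_of_neg_of_pos (by linarith) (Real.rpow_pos_of_pos hε _)
  · intro h
    obtain ⟨R, hR, hE⟩ := exists_exc_of_excess_lt (V := V) (E := V.excess / 2) hV hn (by linarith)
    exact mem_out_of_reach hξ (by linarith) (Cross.reach hE) (by linarith)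

/-- Dilation by 1/ε identifies (m(V, ε) - m(V, 0))/ε^β with the infimum of the excess of paths
between the points ξ⁻/ε and ξ⁺/ε. This is at least the excess, and any path with outer radius R
competes as soon as ε ≤ 1/R. -/
theorem tendsto_gamma (hV : 0 < Vmin) (hn : 1 ≤ n) (hξ : ξp ≠ ξm) :
    Tendsto V.gamma (𝓝[>] 0) (𝓝 V.excess) := by
  have hm0 : (V.m 0).toReal = 2 * V.rad 1 := by
    rw [m_zero hV hξ, ENNReal.toReal_ofReal]
    have := rad_nonneg (V := V) zero_le_one
    positivity
  have hup : ∀ {R E ε : ℝ}, 1 ≤ R → V.Exc R E → 0 < ε → ε ≤ R⁻¹ →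
      V.m ε ≤ ENNReal.ofReal (2 * V.rad 1 + ε ^ V.β * E) ∧ 0 ≤ 2 * V.rad 1 + ε ^ V.β * E := by
    intro R E ε hR h hε hεR
    have h1 : R ≤ ε⁻¹ := (le_inv_comm₀ hε (by linarith)).1 hεR
    have h2 := (h.extend hV hR h1).cross hε (inv_nonneg.2 hε.le)
    rw [mul_inv_cancel₀ hε.ne', one_smul, one_smul] at h2
    exact ⟨m_le_of_cross hξ h2, h2.nonneg⟩
  obtain ⟨R₀, E₀, hR₀, hE₀⟩ := exists_exc hV hn V
  have hev : ∀ R : ℝ, 1 ≤ R → ∀ᶠ ε : ℝ in 𝓝[>] 0, 0 < ε ∧ ε ≤ R⁻¹ := fun R hR =>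
    Ioc_mem_nhdsGT (inv_pos.2 (by linarith))
  refine tendsto_order.2 ⟨fun E hE => ?_, fun E hE => ?_⟩
  · filter_upwards [hev R₀ hR₀] with ε hε
    by_contra! hlt
    have hpos : 0 < ε ^ V.β := Real.rpow_pos_of_pos hε.1 _
    obtain ⟨E', hE1, hE2⟩ := exists_between hE
    have hfin : V.m ε ≠ ⊤ :=
      ((hup hR₀ hE₀ hε.1 hε.2).1.trans_lt ENNReal.ofReal_lt_top).ne
    have h1 : (V.m ε).toReal < 2 * V.rad 1 + ε ^ V.β * E' := by
      have h2 : V.gamma ε = ((V.m ε).toReal - 2 * V.rad 1) / ε ^ V.β := by rw [gamma, hm0]; rfl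
      rw [h2, div_le_iff₀ hpos] at hlt
      nlinarith
    have h0 : 0 ≤ 2 * V.rad 1 + ε ^ V.β * E' := ENNReal.toReal_nonneg.trans h1.le
    have h3 : V.Cross ε (ξm : Space n) (ξp : Space n) (2 * V.rad 1 + ε ^ V.β * E') :=
      cross_of_m_lt h0 ((ENNReal.lt_ofReal_iff_toReal_lt hfin).2 h1)
    have h4 := Exc.of_cross (V := V) (R := 1) hε.1 zero_le_one (by rwa [one_smul, one_smul])
    rw [mul_div_cancel_left₀ _ hpos.ne'] at h4
    have h5 : (1 : ℝ) ≤ 1 / ε := by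
      rw [one_le_div hε.1]
      exact hε.2.trans (inv_le_one_of_one_le₀ hR₀)
    exact absurd (excess_le hV h5 h4) (not_le.2 hE2)
  · obtain ⟨E', hE1, hE2⟩ := exists_between hE
    obtain ⟨R, hR, h⟩ := exists_exc_of_excess_lt hV hn hE1
    filter_upwards [hev R hR] with ε hε
    have hpos : 0 < ε ^ V.β := Real.rpow_pos_of_pos hε.1 _
    obtain ⟨h1, h0⟩ := hup hR h hε.1 hε.2
    have h2 : V.gamma ε = ((V.m ε).toReal - 2 * V.rad 1) / ε ^ V.β := by rw [gamma, hm0]; rfl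
    rw [h2, div_lt_iff₀ hpos]
    have h3 := ENNReal.toReal_le_of_le_ofReal h0 h1
    nlinarith

theorem tendsto_gamma_zero_iff (hV : 0 < Vmin) (hn : 1 ≤ n) (hξ : ξp ≠ ξm) :
    Tendsto V.gamma (𝓝[>] 0) (𝓝 0) ↔ V.excess = 0 :=
  ⟨fun h => tendsto_nhds_unique (tendsto_gamma hV hn hξ) h,
    fun h => by simpa [h] using tendsto_gamma (V := V) hV hn hξ⟩

theorem mem_separatingSet_iff (hV : 0 < Vmin) (hξ : ξp ≠ ξm) :
    V ∈ separatingSet ξm ξp Vmin ↔ V ∈ frontier (Out ξm ξp Vmin) := by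
  have h : In ξm ξp Vmin = (Out ξm ξp Vmin)ᶜ := by
    ext W; exact mem_in_iff hV hξ
  rw [separatingSet, h, frontier_compl, inter_self]

end Potential

end AnisotropicKepler

end

/-! ### Stretching the angular potential: zero excess lies in the closure of Out. -/

noncomputable section

namespace AnisotropicKepler

theorem edist_le_iff_norm {E : Type*} [SeminormedAddCommGroup E] (a b : E) {r : ℝ} (hr : 0 ≤ r) :
    edist a b ≤ ENNReal.ofReal r ↔ ‖a - b‖ ≤ r := by
  rw [edist_le_ofReal hr, dist_eq_norm]

theorem edist_jet_le {n : ℕ} {U W : USphere n → ℝ} {r : ℝ} (hr : 0 ≤ r) :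
    edist (jet U) (jet W) ≤ ENNReal.ofReal r ↔ ∀ s : USphere n, |U s - W s| ≤ r ∧
      ‖fderiv ℝ (radialExt U) s - fderiv ℝ (radialExt W) s‖ ≤ r ∧
      ‖fderiv ℝ (fderiv ℝ (radialExt U)) s - fderiv ℝ (fderiv ℝ (radialExt W)) s‖ ≤ r := by
  rw [UniformFun.edist_le]
  refine forall_congr' fun s => ?_
  refine max_le_iff.trans (and_congr (edist_le_iff_norm (U s) (W s) hr)
    (max_le_iff.trans (and_congr ?_ ?_)))
  · exact edist_le_iff_norm (fderiv ℝ (radialExt U) s) (fderiv ℝ (radialExt W) s) hr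
  · exact edist_le_iff_norm (fderiv ℝ (fderiv ℝ (radialExt U)) s)
      (fderiv ℝ (fderiv ℝ (radialExt W)) s) hr
theorem norm_smul_sub_self {E : Type*} [SeminormedAddCommGroup E] [NormedSpace ℝ E] (c : ℝ) (a : E) :
    ‖c • a - a‖ = |c - 1| * ‖a‖ := by
  rw [← Real.norm_eq_abs, ← norm_smul, sub_smul, one_smul]

namespace Potential

variable {n : ℕ} {ξm ξp : USphere n} {Vmin : ℝ} {V W : Potential ξm ξp Vmin}

section Stretch

/-- The potential with angular part `V_min + θ (V - V_min)`. -/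
def stretch (V : Potential ξm ξp Vmin) (θ : ℝ) (hθ : 0 < θ) : Potential ξm ξp Vmin where
  ang s := Vmin + θ * (V.ang s - Vmin)
  α := V.α
  α_mem := V.α_mem
  isAngular :=
    { contMDiff := by
        have h : ContDiff ℝ 2 fun y : ℝ => Vmin + θ * (y - Vmin) := by fun_prop
        exact h.contMDiff.comp V.isAngular.contMDiff
      min_left := by simp [V.isAngular.min_left]
      min_right := by simp [V.isAngular.min_right]
      le := fun s => by
        have := V.isAngular.le s
        have := mul_nonneg hθ.le (sub_nonneg.2 this)
        linarith
      nondeg_left := by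
        obtain ⟨δ, hδ, μ, hμ, h⟩ := V.isAngular.nondeg_left
        refine ⟨δ, hδ, θ * μ, by positivity, fun s hs => ?_⟩
        have := mul_le_mul_of_nonneg_left (h s hs) hθ.le
        linarith
      nondeg_right := by
        obtain ⟨δ, hδ, μ, hμ, h⟩ := V.isAngular.nondeg_right
        refine ⟨δ, hδ, θ * μ, by positivity, fun s hs => ?_⟩
        have := mul_le_mul_of_nonneg_left (h s hs) hθ.le
        linarith }

variable {θ : ℝ} {hθ : 0 < θ}

theorem stretch_rad (r : ℝ) : (V.stretch θ hθ).rad r = V.rad r := rfl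

theorem stretch_radialExt {x : Space n} (hx : x ≠ 0) :
    radialExt (V.stretch θ hθ).ang x = Vmin + θ * (radialExt V.ang x - Vmin) := by
  rw [radialExt_of_ne hx, radialExt_of_ne hx]; rfl

theorem stretch_pot {x : Space n} (hx : x ≠ 0) :
    (V.stretch θ hθ).pot x = V.pot x + (θ - 1) * (V.pot x - Vmin * ‖x‖ ^ (-V.α)) := by
  rw [pot, stretch_radialExt hx, pot]
  have : (V.stretch θ hθ).α = V.α := rfl
  rw [this]; ring

theorem fderiv_stretch {x : Space n} (hx : x ≠ 0) :
    fderiv ℝ (radialExt (V.stretch θ hθ).ang) x = θ • fderiv ℝ (radialExt V.ang) x := by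
  have h1 : radialExt (V.stretch θ hθ).ang =ᶠ[𝓝 x] fun y => Vmin + θ * (radialExt V.ang y - Vmin) := by
    filter_upwards [isOpen_compl_singleton.mem_nhds hx] with y hy using stretch_radialExt hy
  rw [h1.fderiv_eq]
  exact ((((differentiableAt_radialExt V.isAngular.contMDiff hx).hasFDerivAt.sub_const
    Vmin).const_mul θ).const_add Vmin).fderiv

theorem fderiv_fderiv_stretch {x : Space n} (hx : x ≠ 0) :
    fderiv ℝ (fderiv ℝ (radialExt (V.stretch θ hθ).ang)) x
      = θ • fderiv ℝ (fderiv ℝ (radialExt V.ang)) x := by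
  have h1 : fderiv ℝ (radialExt (V.stretch θ hθ).ang) =ᶠ[𝓝 x]
      fun y => θ • fderiv ℝ (radialExt V.ang) y := by
    filter_upwards [isOpen_compl_singleton.mem_nhds hx] with y hy using fderiv_stretch hy
  rw [h1.fderiv_eq]
  exact (((((contDiffAt_radialExt V.isAngular.contMDiff hx).fderiv_right (m := 1)
      (by norm_num)).differentiableAt (by norm_num)).hasFDerivAt).const_smul θ).fderiv

theorem edist_def (V W : Potential ξm ξp Vmin) :
    edist V W = max (edist (jet V.ang) (jet W.ang)) (edist V.α W.α) := rfl

theorem exists_edist_stretch_le (V : Potential ξm ξp Vmin) :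
    ∃ M : ℝ, 0 ≤ M ∧ ∀ (θ : ℝ) (hθ : 0 < θ), edist (V.stretch θ hθ) V ≤ ENNReal.ofReal (|θ - 1| * M) := by
  have : CompactSpace (USphere n) := isCompact_iff_compactSpace.1 (isCompact_sphere _ _)
  have h1 : Continuous fun s : USphere n => V.ang s - Vmin :=
    V.isAngular.contMDiff.continuous.sub continuous_const
  have h2 : Continuous fun s : USphere n => fderiv ℝ (radialExt V.ang) s := by
    refine continuous_iff_continuousAt.2 fun s => ?_
    exact (continuousAt_fderiv_radialExt V.isAngular.contMDiff (coe_ne_zero s)).comp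
      continuous_subtype_val.continuousAt
  have h3 : Continuous fun s : USphere n => ‖fderiv ℝ (fderiv ℝ (radialExt V.ang)) s‖ := by
    refine continuous_iff_continuousAt.2 fun s => ?_
    have h := ((contDiffAt_radialExt V.isAngular.contMDiff (coe_ne_zero s)).fderiv_right (m := 1)
      (by norm_num)).fderiv_right (m := 0) (by norm_num)
    exact ContinuousAt.comp (f := fun s : USphere n => (s : Space n)) (h.continuousAt.norm)
      continuous_subtype_val.continuousAt
  obtain ⟨M, hM'⟩ := (isCompact_range (h1.norm.max (h2.norm.max h3))).bddAbove
  have hM0 : 0 ≤ M :=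
    (norm_nonneg (V.ang ξm - Vmin)).trans ((le_max_left _ _).trans (hM' ⟨ξm, rfl⟩))
  refine ⟨M, hM0, fun θ hθ => ?_⟩
  rw [edist_def, max_le_iff]
  constructor
  · refine (edist_jet_le (by positivity)).2 fun s => ?_
    have hs := hM' ⟨s, rfl⟩
    simp only [max_le_iff] at hs
    rw [fderiv_stretch (coe_ne_zero s), fderiv_fderiv_stretch (coe_ne_zero s)]
    refine ⟨?_, (norm_smul_sub_self _ _).le.trans ?_, ?_⟩
    · have e : (V.stretch θ hθ).ang s - V.ang s = (θ - 1) * (V.ang s - Vmin) := by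
        simp only [stretch]; ring
      rw [e, abs_mul]
      exact mul_le_mul_of_nonneg_left hs.1 (abs_nonneg _)
    · exact mul_le_mul_of_nonneg_left hs.2.1 (abs_nonneg _)
    · have h := norm_smul_sub_self θ (fderiv ℝ (fderiv ℝ (radialExt V.ang)) (s : Space n))
      exact h.le.trans (mul_le_mul_of_nonneg_left hs.2.2 (abs_nonneg _))
  · have : (V.stretch θ hθ).α = V.α := rfl
    rw [this, edist_self]; exact zero_le

/-- On a fixed path the action is affine in θ, with slope the integral of the angular surplus V -
Vmin |x|^(-α). -/
theorem integral_lag_stretch {a b : ℝ} {x : ℝ → Space n} (hab : a ≤ b) (hx : IsH1 a b x)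
    (h0 : ∀ t ∈ Icc a b, x t ≠ 0) :
    (∫ t in a..b, (V.stretch θ hθ).lag x t) = (∫ t in a..b, V.lag x t)
      + (θ - 1) * ∫ t in a..b, (V.pot (x t) - Vmin * ‖x t‖ ^ (-V.α)) := by
  have hc : ContinuousOn (fun t => V.pot (x t) - Vmin * ‖x t‖ ^ (-V.α)) (Icc a b) :=
    (continuousOn_pot_comp hx h0).sub (continuousOn_const.mul
      (hx.continuousOn.norm.rpow_const fun t ht => Or.inl (norm_ne_zero_iff.2 (h0 t ht))))
  have hi : IntervalIntegrable (fun t => V.pot (x t) - Vmin * ‖x t‖ ^ (-V.α)) volume a b := by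
    refine ContinuousOn.intervalIntegrable ?_
    rwa [uIcc_of_le hab]
  rw [← intervalIntegral.integral_const_mul, ← intervalIntegral.integral_add
    (intervalIntegrable_lag hab hx h0) (hi.const_mul _)]
  refine intervalIntegral.integral_congr fun t ht => ?_
  rw [uIcc_of_le hab] at ht
  simp only [lag, stretch_pot (h0 t ht)]
  ring

/-- A path whose excess is small, and which starts on the unit sphere, starts close to `ξ`. -/
theorem Reach.dev_lt (hV : 0 < Vmin) {ξ : USphere n} {δ μ d R A : ℝ} {w : Space n} (hδ : 0 < δ)
    (hμ : 0 < μ) (hnd : ∀ s : USphere n, dist s ξ < δ → μ * dist s ξ ^ 2 ≤ V.ang s - Vmin)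
    (hd : 0 < d) (hdδ : d < δ ^ 2) (hR : 1 ≤ R) (hw : ‖w‖ = 1)
    (h : V.Reach 1 w (R • (ξ : Space n)) A)
    (hA : A < V.rad R - V.rad 1 + √(μ / 2) * d) : dev ξ w < d := by
  obtain ⟨T, hT, z, hz, z0, zT, hzρ, hzA⟩ := h.exists_path hV one_pos
  have hR0 : 0 < R := by linarith
  have := dev_lt_of_lag_lt hV hδ hμ one_pos hnd hd hdδ hz hzρ
    (by rw [zT]; exact dev_smul_self hR0) (by
      rw [zT, z0, hw, norm_smul, norm_coe, Real.norm_eq_abs, abs_of_pos hR0, mul_one,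
        Real.one_rpow, mul_one]
      linarith) 0 ⟨le_rfl, hT⟩
  rwa [z0] at this

/-- For a steep angular potential the paths with minimal distance `1` have excess at least `1`. -/
theorem exists_stretch_excess (hV : 0 < Vmin) (hξ : ξp ≠ ξm) (V : Potential ξm ξp Vmin) :
    ∃ θ > 1, ∃ hθ : 0 < θ, ∀ R E, 1 ≤ R → (V.stretch θ hθ).Exc R E → 1 ≤ E := by
  obtain ⟨δ₁, hδ₁, μ₁, hμ₁, h₁⟩ := V.isAngular.nondeg_left
  obtain ⟨δ₂, hδ₂, μ₂, hμ₂, h₂⟩ := V.isAngular.nondeg_right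
  set δ := min δ₁ δ₂
  set μ := min μ₁ μ₂
  have hδ : 0 < δ := lt_min hδ₁ hδ₂
  have hμ : 0 < μ := lt_min hμ₁ hμ₂
  have hdist : 0 < dist ξp ξm := dist_pos.2 hξ
  obtain ⟨d, hd, hdδ, hdd⟩ : ∃ d > 0, d < δ ^ 2 ∧ d < (dist ξp ξm / 2) ^ 2 := by
    refine ⟨min (δ ^ 2) ((dist ξp ξm / 2) ^ 2) / 2, by positivity, ?_, ?_⟩
    · have : min (δ ^ 2) ((dist ξp ξm / 2) ^ 2) ≤ δ ^ 2 := min_le_left _ _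
      have : 0 < δ ^ 2 := by positivity
      linarith
    · have : min (δ ^ 2) ((dist ξp ξm / 2) ^ 2) ≤ (dist ξp ξm / 2) ^ 2 := min_le_right _ _
      have : 0 < (dist ξp ξm / 2) ^ 2 := by positivity
      linarith
  -- If E < 1, subtracting the radial lower bound `V.rad R - V.rad 1` of one half shows that the
  -- other half exceeds its own by less than K.
  set K := 2 * V.rad 1 + 1
  have hK : 0 < K := by have := rad_nonneg (V := V) zero_le_one; positivity
  -- Chosen so that √(θμ/2) d ≥ K: turning from deviation d to the axis is then too expensive, and
  -- the contact point would have to be close to both ξ⁻ and ξ⁺.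
  set θ := 2 / μ * (K / d) ^ 2 + 2
  have hθ0 : 0 < θ := by positivity
  have hθ1 : 1 < θ := by
    have : 0 ≤ 2 / μ * (K / d) ^ 2 := by positivity
    simp only [θ]; linarith
  have hsq : K ≤ √(θ * μ / 2) * d := by
    rw [← div_le_iff₀ hd]
    refine Real.le_sqrt_of_sq_le ?_
    have : θ * μ / 2 = (K / d) ^ 2 + μ := by simp only [θ]; field_simp
    rw [this]; linarith
  refine ⟨θ, hθ1, hθ0, fun R E hR hE => ?_⟩
  by_contra! hE1
  have hnd : ∀ ξ : USphere n, V.ang ξ = Vmin →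
      (∀ s, dist s ξ < δ → μ * dist s ξ ^ 2 ≤ V.ang s - V.ang ξ) →
      ∀ s, dist s ξ < δ → θ * μ * dist s ξ ^ 2 ≤ (V.stretch θ hθ0).ang s - Vmin := by
    intro ξ hξ h s hs
    have h3 := mul_le_mul_of_nonneg_left (h s hs) hθ0.le
    rw [hξ] at h3
    simp only [stretch]
    linarith
  have hndm := hnd ξm V.isAngular.min_left fun s hs =>
    (mul_le_mul_of_nonneg_right (min_le_left _ _) (sq_nonneg _)).trans
      (h₁ s (hs.trans_le (min_le_left _ _)))
  have hndp := hnd ξp V.isAngular.min_right fun s hs =>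
    (mul_le_mul_of_nonneg_right (min_le_right _ _) (sq_nonneg _)).trans
      (h₂ s (hs.trans_le (min_le_right _ _)))
  obtain ⟨w, A₁, A₂, hw, hr₁, hr₂, hle⟩ := hE
  have e1 := hr₁.symm.rad_sub_le hV one_pos
  have e2 := hr₂.rad_sub_le hV one_pos
  rw [hw, norm_smul, norm_coe, Real.norm_eq_abs, abs_of_nonneg (by linarith), mul_one] at e1 e2
  simp only [stretch_rad] at e1 e2 hle
  have d1 := hr₁.symm.dev_lt hV hδ (by positivity) hndm hd hdδ hR hw
    (by simp only [stretch_rad, K] at hsq ⊢; linarith)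
  have d2 := hr₂.dev_lt hV hδ (by positivity) hndp hd hdδ hR hw
    (by simp only [stretch_rad, K] at hsq ⊢; linarith)
  have hw0 : w ≠ 0 := fun h => by simp [h] at hw
  rw [dev_eq_dist hw0] at d1 d2
  have f1 := lt_of_pow_lt_pow_left₀ 2 (by positivity) (d1.trans hdd)
  have f2 := lt_of_pow_lt_pow_left₀ 2 (by positivity) (d2.trans hdd)
  have := dist_triangle_left ξp ξm (dir w hw0)
  linarith

/-- Take a path of excess at most E for V. For a fixed large θ its excess is at least 1, and the
action is affine in θ, so its slope X is at least (1 - E)/(θ - 1). Lowering the parameter from 1 to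
1 - t gains tX, which beats E once E is small compared with t; hence arbitrarily small flattenings
of V lie in Out. -/
theorem mem_closure_out (hV : 0 < Vmin) (hn : 1 ≤ n) (hξ : ξp ≠ ξm) (h : V.excess = 0) :
    V ∈ closure (Out ξm ξp Vmin) := by
  obtain ⟨θ, hθ1, hθ, hbig⟩ := exists_stretch_excess hV hξ V
  obtain ⟨M, hM0, hM⟩ := exists_edist_stretch_le V
  have hout : ∀ t, 0 < t → ∀ ht1 : 0 < 1 - t, V.stretch (1 - t) ht1 ∈ Out ξm ξp Vmin := by
    intro t ht ht1
    obtain ⟨E, hE0, hE1⟩ : ∃ E > 0, E < t * (1 - E) / (θ - 1) := by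
      have hlim : Tendsto (fun E : ℝ => t * (1 - E) / (θ - 1) - E) (𝓝[>] 0)
          (𝓝 (t * (1 - 0) / (θ - 1) - 0)) :=
        ((by fun_prop : Continuous fun E : ℝ => t * (1 - E) / (θ - 1) - E).tendsto 0).mono_left
          nhdsWithin_le_nhds
      have hpos : 0 < t * (1 - 0) / (θ - 1) - 0 := by
        have : 0 < θ - 1 := by linarith
        simp only [sub_zero, mul_one]; positivity
      obtain ⟨E, h1, h2⟩ := ((hlim.eventually_const_lt hpos).and self_mem_nhdsWithin).exists
      exact ⟨E, h2, by linarith⟩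
    obtain ⟨R, hR, hRE⟩ := exists_exc_of_excess_lt (V := V) (E := E) hV hn (by linarith)
    obtain ⟨T, hT, z, hz, z0, zT, hmin, hA⟩ := Cross.exists_path hRE
    have hz1 : ∀ s ∈ Icc 0 T, 1 ≤ ‖z s‖ := fun s hs => hmin.2 ⟨s, hs, rfl⟩
    have hz0 : ∀ s ∈ Icc 0 T, z s ≠ 0 := fun s hs => norm_pos_iff.1 (one_pos.trans_le (hz1 s hs))
    rw [action_eq hV hT hz hz0, ENNReal.ofReal_le_ofReal_iff hRE.nonneg] at hA
    set X := ∫ s in (0 : ℝ)..T, (V.pot (z s) - Vmin * ‖z s‖ ^ (-V.α))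
    have hact : ∀ θ (hθ : 0 < θ), (∫ s in (0 : ℝ)..T, (V.stretch θ hθ).lag z s)
        = (∫ s in (0 : ℝ)..T, V.lag z s) + (θ - 1) * X := fun θ hθ =>
      integral_lag_stretch hT hz hz0
    have hX : 1 - E ≤ (θ - 1) * X := by
      have hc := Cross.of_path (V := V.stretch θ hθ) hz (integral_lag_nonneg hV hT) hmin
        (action_eq hV hT hz hz0).le
      rw [z0, zT] at hc
      have := hbig R ((∫ s in (0 : ℝ)..T, (V.stretch θ hθ).lag z s) - 2 * V.rad R) hR
        (hc.mono (by rw [stretch_rad]; linarith))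
      rw [hact θ hθ] at this
      linarith
    have hX2 : (1 - E) / (θ - 1) ≤ X := by
      rw [div_le_iff₀ (by linarith)]; linarith
    have hr := Reach.of_path_lag (V := V.stretch (1 - t) ht1) hV one_pos hT hz hz1
    rw [z0, zT] at hr
    refine mem_out_of_reach hξ (by linarith) hr ?_
    rw [hact (1 - t) ht1, stretch_rad]
    have h3 := mul_le_mul_of_nonneg_left hX2 ht.le
    rw [← mul_div_assoc] at h3
    linarith
  rw [EMetric.mem_closure_iff]
  intro ε hε
  have hlim : Tendsto (fun t : ℝ => ENNReal.ofReal (t * M)) (𝓝[>] 0) (𝓝 (ENNReal.ofReal (0 * M))) :=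
    ENNReal.tendsto_ofReal (((by fun_prop : Continuous fun t : ℝ => t * M).tendsto 0).mono_left
      nhdsWithin_le_nhds)
  rw [zero_mul, ENNReal.ofReal_zero] at hlim
  obtain ⟨t, ht1, ht0, ht2⟩ := ((hlim.eventually_lt_const hε).and
    (Ioo_mem_nhdsGT (zero_lt_one' ℝ))).exists
  have hpos : 0 < 1 - t := by linarith
  refine ⟨V.stretch (1 - t) hpos, hout t ht0 hpos, ?_⟩
  rw [edist_comm]
  refine (hM (1 - t) hpos).trans_lt ?_
  rwa [show |1 - t - 1| = t by rw [sub_right_comm, sub_self, zero_sub, abs_neg, abs_of_pos ht0]]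

end Stretch

end Potential

end AnisotropicKepler

end

/-! ### Nearby potentials: openness of Out and the excess on its closure. -/

noncomputable section

namespace AnisotropicKepler

section Hessian

variable {E : Type*} [NormedAddCommGroup E] [NormedSpace ℝ E]

/-- The mean value inequality is applied twice to the difference F₁ - F₂, whose gradient vanishes at
ξ. -/
theorem abs_sub_le_of_hessian {F₁ F₂ : E → ℝ} {ξ s : E} {r M : ℝ} (hs : s ∈ Metric.ball ξ r)
    (h₁ : ∀ y ∈ Metric.ball ξ r, ContDiffAt ℝ 2 F₁ y)
    (h₂ : ∀ y ∈ Metric.ball ξ r, ContDiffAt ℝ 2 F₂ y)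
    (hM : ∀ y ∈ Metric.ball ξ r,
      ‖fderiv ℝ (fderiv ℝ F₁) y - fderiv ℝ (fderiv ℝ F₂) y‖ ≤ M)
    (h₀ : fderiv ℝ F₁ ξ = fderiv ℝ F₂ ξ) :
    |F₁ s - F₂ s - (F₁ ξ - F₂ ξ)| ≤ M * ‖s - ξ‖ ^ 2 := by
  have hξ : ξ ∈ Metric.ball ξ r := Metric.mem_ball_self (dist_nonneg.trans_lt hs)
  have hM0 : 0 ≤ M :=
    (norm_nonneg (fderiv ℝ (fderiv ℝ F₁) ξ - fderiv ℝ (fderiv ℝ F₂) ξ)).trans (hM ξ hξ)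
  have hd : ∀ {F : E → ℝ} {y : E}, ContDiffAt ℝ 2 F y → HasFDerivAt F (fderiv ℝ F y) y :=
    fun h => (h.differentiableAt (by norm_num)).hasFDerivAt
  have hd2 : ∀ {F : E → ℝ} {y : E}, ContDiffAt ℝ 2 F y →
      HasFDerivAt (fderiv ℝ F) (fderiv ℝ (fderiv ℝ F) y) y :=
    fun h => ((h.fderiv_right (m := 1) (by norm_num)).differentiableAt (by norm_num)).hasFDerivAt
  have hgrad : ∀ y ∈ Metric.ball ξ r, ‖fderiv ℝ F₁ y - fderiv ℝ F₂ y‖ ≤ M * ‖y - ξ‖ := by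
    intro y hy
    have := Convex.norm_image_sub_le_of_norm_hasFDerivWithin_le
      (f := fun y => fderiv ℝ F₁ y - fderiv ℝ F₂ y)
      (fun z hz => ((hd2 (h₁ z hz)).sub (hd2 (h₂ z hz))).hasFDerivWithinAt) hM
      (convex_ball ξ r) hξ hy
    simpa only [h₀, sub_self, sub_zero] using this
  have hsub : Metric.closedBall ξ ‖s - ξ‖ ⊆ Metric.ball ξ r := by
    rw [← dist_eq_norm]; exact Metric.closedBall_subset_ball hs
  have := Convex.norm_image_sub_le_of_norm_hasFDerivWithin_le (C := M * ‖s - ξ‖)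
    (f := fun y => F₁ y - F₂ y) (s := Metric.closedBall ξ ‖s - ξ‖) (x := ξ) (y := s)
    (fun z hz => ((hd (h₁ z (hsub hz))).sub (hd (h₂ z (hsub hz)))).hasFDerivWithinAt)
    (fun z hz => (hgrad z (hsub hz)).trans (by
      rw [mem_closedBall_iff_norm] at hz
      exact mul_le_mul_of_nonneg_left hz hM0))
    (convex_closedBall ξ _) (Metric.mem_closedBall_self (norm_nonneg _))
    (by rw [mem_closedBall_iff_norm])
  rw [Real.norm_eq_abs, mul_assoc, ← sq] at this
  exact this

theorem fderiv_smul_of_homogeneous {F : Type*} [NormedAddCommGroup F] [NormedSpace ℝ F]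
    {f : E → F} {c k : ℝ} (hc : c ≠ 0) (h : ∀ x, f (c • x) = k • f x) (x : E) :
    fderiv ℝ f (c • x) = (c⁻¹ * k) • fderiv ℝ f x := by
  have h1 : (fun y => f (c • y)) = fun y => k • f y := funext h
  have h2 := fderiv_comp_smul (𝕜 := ℝ) (f := f) (x := x) c
  rw [h1] at h2
  have h3 : fderiv ℝ (fun y => k • f y) x = k • fderiv ℝ f x :=
    congrFun (fderiv_const_smul_field (𝕜 := ℝ) (f := f) k) x
  rw [h3] at h2
  rw [mul_smul, h2, smul_smul, inv_mul_cancel₀ hc, one_smul]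

theorem norm_smul_sub_smul_le {c C η : ℝ} (a b : E) (hc : 0 ≤ c) (hcC : c ≤ C)
    (hab : ‖a - b‖ ≤ η) : ‖c • a - c • b‖ ≤ C * η := by
  rw [← smul_sub, norm_smul, Real.norm_eq_abs, abs_of_nonneg hc]
  exact mul_le_mul hcC hab (norm_nonneg _) (hc.trans hcC)

end Hessian

/-- The distance of potentials sees the Hessians on the sphere only. They are homogeneous of degree
-2, which gives the factor 4 down to radius 1/2, as needed on balls around a point of the sphere. -/
theorem norm_hessian_sub_le {n : ℕ} {U₁ U₂ : USphere n → ℝ} {η : ℝ}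
    (h : ∀ s : USphere n,
      ‖fderiv ℝ (fderiv ℝ (radialExt U₁)) s - fderiv ℝ (fderiv ℝ (radialExt U₂)) s‖ ≤ η)
    {y : Space n} (hy : 1 / 2 ≤ ‖y‖) :
    ‖fderiv ℝ (fderiv ℝ (radialExt U₁)) y - fderiv ℝ (fderiv ℝ (radialExt U₂)) y‖ ≤ 4 * η := by
  have hpos : 0 < ‖y‖ := by linarith
  have hy0 : y ≠ 0 := norm_pos_iff.1 hpos
  have key : ∀ U : USphere n → ℝ, fderiv ℝ (fderiv ℝ (radialExt U)) y
      = (‖y‖⁻¹ * ‖y‖⁻¹) • fderiv ℝ (fderiv ℝ (radialExt U)) (dir y hy0 : Space n) := fun U => by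
    have := fderiv_smul_of_homogeneous (f := fderiv ℝ (radialExt U)) (k := ‖y‖⁻¹) hpos.ne'
      (fun x => fderiv_radialExt_smul (U := U) hpos x) (dir y hy0 : Space n)
    rwa [norm_smul_dir] at this
  rw [key, key]
  refine norm_smul_sub_smul_le (fderiv ℝ (fderiv ℝ (radialExt U₁)) (dir y hy0 : Space n))
    (fderiv ℝ (fderiv ℝ (radialExt U₂)) (dir y hy0 : Space n)) (by positivity) ?_ (h (dir y hy0))
  have : ‖y‖⁻¹ ≤ 2 := by
    rw [inv_le_comm₀ hpos two_pos]; linarith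
  have h0 : 0 ≤ ‖y‖⁻¹ := by positivity
  nlinarith

namespace Potential

variable {n : ℕ} {ξm ξp : USphere n} {Vmin : ℝ} {V W : Potential ξm ξp Vmin}

section Nearby

theorem eventually_edist_le (V : Potential ξm ξp Vmin) {η : ℝ} (hη : 0 < η) :
    ∀ᶠ W in 𝓝 V, |W.α - V.α| ≤ η ∧ ∀ s : USphere n, |W.ang s - V.ang s| ≤ η ∧
      ‖fderiv ℝ (fderiv ℝ (radialExt W.ang)) s - fderiv ℝ (fderiv ℝ (radialExt V.ang)) s‖ ≤ η := by
  have h := Metric.closedEBall_mem_nhds V (ENNReal.ofReal_pos.2 hη)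
  filter_upwards [h] with W hW
  have hW' : edist W V ≤ ENNReal.ofReal η := hW
  rw [edist_def, max_le_iff] at hW'
  refine ⟨(edist_le_iff_norm _ _ hη.le).1 hW'.2, fun s => ?_⟩
  have := (edist_jet_le hη.le).1 hW'.1 s
  exact ⟨this.1, this.2.2⟩

theorem tendsto_α (V : Potential ξm ξp Vmin) :
    Tendsto (fun W : Potential ξm ξp Vmin => W.α) (𝓝 V) (𝓝 V.α) := by
  rw [Metric.tendsto_nhds]
  intro e he
  filter_upwards [V.eventually_edist_le (half_pos he)] with W hW
  exact hW.1.trans_lt (half_lt_self he)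

theorem tendsto_β (V : Potential ξm ξp Vmin) :
    Tendsto (fun W : Potential ξm ξp Vmin => W.β) (𝓝 V) (𝓝 V.β) :=
  (tendsto_const_nhds.sub V.tendsto_α).div_const 2

theorem tendsto_rad_nhds (V : Potential ξm ξp Vmin) {r : ℝ} (hr : 0 < r) :
    Tendsto (fun W : Potential ξm ξp Vmin => W.rad r) (𝓝 V) (𝓝 (V.rad r)) :=
  tendsto_const_nhds.mul ((tendsto_const_nhds.rpow V.tendsto_β (Or.inl hr.ne')).div V.tendsto_β
    V.β_pos.ne')

/-- The difference of two potentials of the class vanishes to first order at ξ, so Hessians closer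
than μ/8 change the quadratic lower bound by at most 4(μ/8)|s - ξ|² and half of it survives. The
uniformity in W is what the C² distance is for. -/
theorem eventually_nondeg (V : Potential ξm ξp Vmin) {ξ : USphere n}
    (hξ : ∀ W : Potential ξm ξp Vmin, W.ang ξ = Vmin) (hnd : NondegenerateAt V.ang ξ) :
    ∃ δ > 0, ∃ μ > 0, (∀ᶠ W in 𝓝 V, ∀ s : USphere n, dist s ξ < δ →
      μ * dist s ξ ^ 2 ≤ W.ang s - Vmin) := by
  obtain ⟨δ, hδ, μ, hμ, h⟩ := hnd
  refine ⟨min δ (1 / 2), by positivity, μ / 2, by positivity, ?_⟩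
  filter_upwards [V.eventually_edist_le (show 0 < μ / 8 by positivity)] with W hW s hs
  have hsδ := h s (hs.trans_le (min_le_left _ _))
  have hs2 : dist (s : Space n) ξ < 1 / 2 := hs.trans_le (min_le_right _ _)
  have hball : ∀ y ∈ Metric.ball (ξ : Space n) (1 / 2), 1 / 2 ≤ ‖y‖ := fun y hy => by
    rw [mem_ball_iff_norm] at hy
    have := norm_sub_norm_le (ξ : Space n) y
    rw [norm_coe, norm_sub_rev] at this
    linarith
  have hne : ∀ y ∈ Metric.ball (ξ : Space n) (1 / 2), y ≠ 0 := fun y hy =>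
    norm_pos_iff.1 (by have := hball y hy; linarith)
  have key := abs_sub_le_of_hessian (F₁ := radialExt W.ang) (F₂ := radialExt V.ang) hs2
    (fun y hy => contDiffAt_radialExt W.isAngular.contMDiff (hne y hy))
    (fun y hy => contDiffAt_radialExt V.isAngular.contMDiff (hne y hy))
    (fun y hy => norm_hessian_sub_le (fun s => (hW.2 s).2) (hball y hy))
    (by rw [fderiv_radialExt_min W.isAngular.le (hξ W), fderiv_radialExt_min V.isAngular.le (hξ V)])
  simp only [radialExt_coe, hξ W, hξ V, sub_self, sub_zero] at key
  rw [hξ V] at hsδ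
  have hd : ‖(s : Space n) - ξ‖ = dist s ξ := by rw [← dist_eq_norm]; rfl
  rw [hd] at key
  have := (abs_le.1 key).1
  linarith

theorem rpow_le_rpow_abs {L r e η : ℝ} (hL : 1 ≤ L) (h1 : L⁻¹ ≤ r) (h2 : r ≤ L) (he : |e| ≤ η) :
    r ^ e ≤ L ^ η := by
  have hL0 : 0 < L := by linarith
  have hr : 0 < r := (inv_pos.2 hL0).trans_le h1
  rcases le_total 0 e with h | h
  · rw [abs_of_nonneg h] at he
    exact (Real.rpow_le_rpow hr.le h2 h).trans (Real.rpow_le_rpow_of_exponent_le hL he)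
  · rw [abs_of_nonpos h] at he
    calc r ^ e = (r⁻¹) ^ (-e) := by rw [Real.inv_rpow hr.le, Real.rpow_neg hr.le, inv_inv]
      _ ≤ L ^ (-e) := Real.rpow_le_rpow (by positivity) ((inv_le_comm₀ hL0 hr).1 h1) (by linarith)
      _ ≤ L ^ η := Real.rpow_le_rpow_of_exponent_le hL he

theorem pot_le_of_near (hV : 0 < Vmin) {L η : ℝ} (hL : 1 ≤ L) (hη : 0 ≤ η)
    (hα : |W.α - V.α| ≤ η) (hang : ∀ s, |W.ang s - V.ang s| ≤ η) {y : Space n} (h1 : L⁻¹ ≤ ‖y‖)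
    (h2 : ‖y‖ ≤ L) : W.pot y ≤ (1 + η / Vmin) * L ^ η * V.pot y := by
  have hy : 0 < ‖y‖ := (inv_pos.2 (by linarith)).trans_le h1
  have hy0 := norm_pos_iff.1 hy
  have e1 : radialExt W.ang y ≤ (1 + η / Vmin) * radialExt V.ang y := by
    have h3 := V.le_radialExt hy0
    rw [radialExt_of_ne hy0] at h3 ⊢
    rw [radialExt_of_ne hy0]
    have h4 := (abs_le.1 (hang (dir y hy0))).2
    have h5 : η ≤ η / Vmin * V.ang (dir y hy0) := by
      rw [div_mul_eq_mul_div, le_div_iff₀ hV]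
      exact mul_le_mul_of_nonneg_left h3 hη
    linarith
  have e2 : ‖y‖ ^ (-W.α) ≤ L ^ η * ‖y‖ ^ (-V.α) := by
    have : ‖y‖ ^ (-W.α) = ‖y‖ ^ (V.α - W.α) * ‖y‖ ^ (-V.α) := by
      rw [← Real.rpow_add hy]; congr 1; ring
    rw [this]
    refine mul_le_mul_of_nonneg_right (rpow_le_rpow_abs hL h1 h2 ?_) (by positivity)
    rwa [abs_sub_comm]
  calc W.pot y ≤ ((1 + η / Vmin) * radialExt V.ang y) * (L ^ η * ‖y‖ ^ (-V.α)) :=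
        mul_le_mul e1 e2 (by positivity) (mul_nonneg (by positivity)
          (hV.le.trans (V.le_radialExt hy0)))
    _ = _ := by rw [pot]; ring

/-- The exponents differ, so a ratio close to 1 is available on a compact annulus only; this is why
paths must first be confined. -/
theorem eventually_pot_le (hV : 0 < Vmin) (V : Potential ξm ξp Vmin) {L lam : ℝ} (hL : 1 ≤ L)
    (hlam : 1 < lam) : ∀ᶠ W in 𝓝 V, ∀ y : Space n, L⁻¹ ≤ ‖y‖ → ‖y‖ ≤ L →
      W.pot y ≤ lam * V.pot y ∧ V.pot y ≤ lam * W.pot y := by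
  have hlim : Tendsto (fun η : ℝ => (1 + η / Vmin) * L ^ η) (𝓝[>] 0)
      (𝓝 ((1 + 0 / Vmin) * L ^ (0 : ℝ))) := by
    have : Continuous fun η : ℝ => (1 + η / Vmin) * L ^ η :=
      (by fun_prop : Continuous fun η : ℝ => 1 + η / Vmin).mul
        (Real.continuous_const_rpow (by linarith))
    exact (this.tendsto 0).mono_left nhdsWithin_le_nhds
  have h1 : (1 + 0 / Vmin) * L ^ (0 : ℝ) < lam := by simpa using hlam
  obtain ⟨η, hη, hη0⟩ := ((hlim.eventually_lt_const h1).and self_mem_nhdsWithin).exists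
  have hη0' : 0 < η := hη0
  filter_upwards [V.eventually_edist_le hη0'] with W hW y hy1 hy2
  constructor
  · exact (pot_le_of_near hV hL hη0'.le hW.1 (fun s => (hW.2 s).1) hy1 hy2).trans
      (mul_le_mul_of_nonneg_right hη.le (pot_nonneg hV y))
  · exact (pot_le_of_near hV hL hη0'.le (by rw [abs_sub_comm]; exact hW.1)
      (fun s => by rw [abs_sub_comm]; exact (hW.2 s).1) hy1 hy2).trans
      (mul_le_mul_of_nonneg_right hη.le (pot_nonneg hV y))

theorem eventually_rad_le (V : Potential ξm ξp Vmin) {L lam : ℝ} (hL : 1 ≤ L)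
    (hlam : 1 < lam) : ∀ᶠ W in 𝓝 V, ∀ r, 1 ≤ r → r ≤ L → W.rad r ≤ lam * V.rad r := by
  have hlim : Tendsto (fun W : Potential ξm ξp Vmin => L ^ |W.β - V.β| * (V.β / W.β)) (𝓝 V)
      (𝓝 (L ^ |V.β - V.β| * (V.β / V.β))) :=
    (tendsto_const_nhds.rpow (V.tendsto_β.sub_const _).abs (Or.inl (by linarith))).mul
      (tendsto_const_nhds.div V.tendsto_β V.β_pos.ne')
  have h1 : L ^ |V.β - V.β| * (V.β / V.β) < lam := by
    rw [div_self V.β_pos.ne']; simpa using hlam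
  filter_upwards [hlim.eventually_lt_const h1] with W hW r hr1 hr2
  have hr : 0 < r := by linarith
  have e : W.rad r = r ^ (W.β - V.β) * (V.β / W.β) * V.rad r := by
    have h3 : r ^ W.β = r ^ (W.β - V.β) * r ^ V.β := by rw [← Real.rpow_add hr]; congr 1; ring
    have := V.β_pos.ne'
    have := W.β_pos.ne'
    rw [rad, rad, h3]; field_simp
  rw [e]
  refine mul_le_mul_of_nonneg_right (le_trans ?_ hW.le) (rad_nonneg hr.le)
  refine mul_le_mul_of_nonneg_right (rpow_le_rpow_abs hL ?_ hr2 le_rfl)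
    (div_nonneg V.β_pos.le W.β_pos.le)
  exact (inv_le_one_of_one_le₀ hL).trans hr1

theorem lt_of_rad_lt {r s : ℝ} (hs : 0 ≤ s) (h : V.rad r < V.rad s) : r < s := by
  by_contra! hle
  exact absurd (rad_mono hs hle) (not_le.2 h)

/-- A path can be used for every potential which is comparable in the region it visits. -/
theorem Reach.transfer (hV : 0 < Vmin) {L lam ρ A : ℝ} {p q : Space n} (hL : 1 ≤ L)
    (hlam : 1 ≤ lam)
    (hpot : ∀ y : Space n, L⁻¹ ≤ ‖y‖ → ‖y‖ ≤ L → W.pot y ≤ lam * V.pot y) (hρ : L⁻¹ ≤ ρ)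
    (hA : V.rad ‖p‖ + A < V.rad L) (h : V.Reach ρ p q A) : W.Reach ρ p q (lam * A) := by
  have hL0 : 0 < L := by linarith
  have hρ0 : 0 < ρ := (inv_pos.2 hL0).trans_le hρ
  obtain ⟨T, hT, z, hz, z0, zT, hzρ, hzA⟩ := h.exists_path hV hρ0
  have h0 : ∀ t ∈ Icc 0 T, z t ≠ 0 := fun t ht => norm_pos_iff.1 (hρ0.trans_le (hzρ t ht))
  -- By the radial calibration a path of bounded action cannot travel beyond radius L, so the
  -- comparison of the potentials applies along all of it.
  have hbd : ∀ t ∈ Icc 0 T, ‖z t‖ ≤ L := fun t ht => by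
    have h1 := Potential.rad_sub_le (V := V) hV ht.1 (hz.mono le_rfl ht.2)
      fun s hs => h0 s ⟨hs.1, hs.2.trans ht.2⟩
    have h2 := integral_lag_add (V := V) ht.1 ht.2 hz h0
    have h3 := integral_lag_nonneg (V := V) (x := z) hV ht.2
    rw [z0] at h1
    exact (lt_of_rad_lt (V := V) hL0.le (by linarith)).le
  have hr := Reach.of_path_lag (V := W) hV hρ0 hT hz hzρ
  rw [z0, zT] at hr
  refine hr.mono le_rfl (le_trans ?_ (mul_le_mul_of_nonneg_left hzA (by linarith)))
  rw [← intervalIntegral.integral_const_mul]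
  refine intervalIntegral.integral_mono_on hT (intervalIntegrable_lag hT hz h0)
    ((intervalIntegrable_lag hT hz h0).const_mul _) fun t ht => ?_
  have h1 := hpot (z t) (hρ.trans (hzρ t ht)) (hbd t ht)
  have h2 : 0 ≤ ‖deriv z t‖ ^ 2 / 2 := by positivity
  simp only [lag]
  nlinarith

/-- A single path of negative excess stays in a compact annulus; there the potentials are comparable
with ratio close to 1, and `W.rad R` is close to `V.rad R`, so the strict inequality persists. -/
theorem isOpen_out (hV : 0 < Vmin) (hn : 1 ≤ n) (hξ : ξp ≠ ξm) : IsOpen (Out ξm ξp Vmin) := by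
  rw [isOpen_iff_mem_nhds]
  intro V hVO
  rw [mem_out_iff_excess hV hn hξ] at hVO
  obtain ⟨R, hR, h⟩ := exists_exc_of_excess_lt (V := V) (E := V.excess / 2) hV hn (by linarith)
  have hR0 : 0 < R := by linarith
  set A := 2 * V.rad R + V.excess / 2 with hAdef
  have hr : V.Reach 1 (R • (ξm : Space n)) (R • (ξp : Space n)) A := h.reach
  have hA0 : 0 ≤ A := h.nonneg
  obtain ⟨L, hL1, hL2⟩ := ((tendsto_rad (V := V) hV).eventually_gt_atTop
    (V.rad ‖R • (ξm : Space n)‖ + A) |>.and (eventually_ge_atTop 1)).exists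
  obtain ⟨lam, hlam, hlamA⟩ : ∃ lam > 1, lam * A < 2 * V.rad R + V.excess / 4 := by
    have hlim : Tendsto (fun l : ℝ => l * A) (𝓝[>] 1) (𝓝 (1 * A)) :=
      ((by fun_prop : Continuous fun l : ℝ => l * A).tendsto 1).mono_left nhdsWithin_le_nhds
    obtain ⟨l, h1, h2⟩ := ((hlim.eventually_lt_const
      (show 1 * A < 2 * V.rad R + V.excess / 4 by linarith)).and self_mem_nhdsWithin).exists
    exact ⟨l, h2, h1⟩
  filter_upwards [eventually_pot_le hV V hL2 hlam, (V.tendsto_rad_nhds hR0).eventually_const_lt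
    (show V.rad R + V.excess / 8 < V.rad R by linarith)] with W hW1 hW2
  have := hr.transfer hV hL2 hlam.le (fun y h1 h2 => (hW1 y h1 h2).1) (inv_le_one_of_one_le₀ hL2) hL1
  exact mem_out_of_reach hξ hR0 this (by linarith)

-- A potential W in Out near V has a path of negative excess, but its outer radius is not
-- controlled, and far out V and W are not comparable. Both halves of the path however come close to
-- the rays between radii r₀ and r₁ that do not depend on W. The path is cut there, its inner part
-- is reused for V, and the tails are replaced by interpolations and rays for V, at a cost
-- proportional to r^β dev.
set_option maxHeartbeats 1000000 in
theorem excess_le_of_mem_closure (hV : 0 < Vmin) (hn : 1 ≤ n) (hξ : ξp ≠ ξm)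
    (h : V ∈ closure (Out ξm ξp Vmin)) {e : ℝ} (he : 0 < e) : V.excess ≤ e := by
  obtain ⟨δm, hδm, μm, hμm, hndm⟩ := V.eventually_nondeg (fun W => W.isAngular.min_left)
    V.isAngular.nondeg_left
  obtain ⟨δp, hδp, μp, hμp, hndp⟩ := V.eventually_nondeg (fun W => W.isAngular.min_right)
    V.isAngular.nondeg_right
  obtain ⟨lm, hlm, dm, hdm, Cm, hCm, hraym⟩ := exists_reach_ray (V := V) hV V.isAngular.min_left
  obtain ⟨lp, hlp, dp, hdp, Cp, hCp, hrayp⟩ := exists_reach_ray (V := V) hV V.isAngular.min_right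
  set μ := min μm μp
  have hμ : 0 < μ := lt_min hμm hμp
  set δ := min δm δp
  have hδ : 0 < δ := lt_min hδm hδp
  set d := min (min dm dp) (δ ^ 2 / 2)
  have hd : 0 < d := lt_min (lt_min hdm hdp) (by positivity)
  have hdδ : d < δ ^ 2 := (min_le_right _ _).trans_lt (by linarith [sq_pos_of_pos hδ])
  -- The cut points satisfy r^β dev ≤ 2σ for the exponent of V, so the new tails cost at most 2(Cm +
  -- Cp)σ ≤ e/2 above the radial cost.
  set σ := e / (4 * (Cm + Cp + 1))
  have hσ : 0 < σ := by positivity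
  have hσC : (Cm + Cp) * σ ≤ e / 4 := by
    have : (Cm + Cp + 1) * σ = e / 4 := by
      simp only [σ]; field_simp
    nlinarith
  obtain ⟨c, hc, hcμ⟩ : ∃ c > 0, 2 * √(2 * Vmin) * c + 4 * c ^ 2 ≤ 2 * μ := by
    have hlim : Tendsto (fun c : ℝ => 2 * √(2 * Vmin) * c + 4 * c ^ 2) (𝓝[>] 0)
        (𝓝 (2 * √(2 * Vmin) * 0 + 4 * 0 ^ 2)) :=
      ((by fun_prop : Continuous fun c : ℝ => 2 * √(2 * Vmin) * c + 4 * c ^ 2).tendsto 0).mono_left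
        nhdsWithin_le_nhds
    obtain ⟨c, h1, h2⟩ := ((hlim.eventually_lt_const
      (show 2 * √(2 * Vmin) * 0 + 4 * 0 ^ 2 < 2 * μ by simpa using hμ)).and
      self_mem_nhdsWithin).exists
    exact ⟨c, h2, h1.le⟩
  set K := 3 * V.rad 1 + 1
  have hK : 0 < K := by have := V.rad_nonneg zero_le_one; positivity
  have hb := V.β_pos
  -- The exponent β/2 is smaller than the exponent of every W close to V, so r₀ can be fixed before
  -- W; r₀ ≥ 2 keeps the new tails outside the unit ball.
  obtain ⟨r₀, hr₀K, hr₀⟩ : ∃ r₀, K ≤ √(μ / 2) * r₀ ^ (V.β / 2) * d ∧ 2 ≤ r₀ := by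
    have hlim : Tendsto (fun r : ℝ => √(μ / 2) * r ^ (V.β / 2) * d) atTop atTop :=
      ((tendsto_rpow_atTop (by positivity)).const_mul_atTop (by positivity)).atTop_mul_const hd
    exact ((hlim.eventually_ge_atTop K).and (eventually_ge_atTop 2)).exists
  have hr₀pos : 0 < r₀ := by linarith
  -- The ratio r₁/r₀ is such that the logarithmic cost cσ log(r₁/r₀) equals K.
  set r₁ := r₀ * Real.exp (K / (c * σ))
  have hr₁ : r₀ ≤ r₁ := le_mul_of_one_le_right hr₀pos.le (Real.one_le_exp (by positivity))
  have hlog : K ≤ c * σ * (Real.log r₁ - Real.log r₀) := by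
    rw [Real.log_mul hr₀pos.ne' (Real.exp_pos _).ne', Real.log_exp, add_sub_cancel_left]
    field_simp; rfl
  have hr₁pos : 0 < r₁ := by linarith
  have hrad₁ : 0 ≤ V.rad r₁ := V.rad_nonneg hr₁pos.le
  obtain ⟨L, hLr, hL1, hLr₁⟩ := ((tendsto_rad (V := V) hV).eventually_gt_atTop
    (V.rad r₁ + 3 * V.rad 1) |>.and ((eventually_ge_atTop 1).and (eventually_ge_atTop r₁))).exists
  -- One factor lam comes from comparing the potentials along the inner part, the other from
  -- comparing `W.rad` with `V.rad` at the cut points.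
  obtain ⟨lam, hlam, hlamA⟩ : ∃ lam > 1, (lam * lam - 1) * (2 * V.rad r₁) < e / 4 := by
    have hlim : Tendsto (fun l : ℝ => (l * l - 1) * (2 * V.rad r₁)) (𝓝[>] 1)
        (𝓝 ((1 * 1 - 1) * (2 * V.rad r₁))) :=
      ((by fun_prop : Continuous fun l : ℝ => (l * l - 1) * (2 * V.rad r₁)).tendsto 1).mono_left
        nhdsWithin_le_nhds
    obtain ⟨l, h1, h2⟩ := ((hlim.eventually_lt_const
      (show (1 * 1 - 1) * (2 * V.rad r₁) < e / 4 by norm_num; exact he)).and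
        self_mem_nhdsWithin).exists
    exact ⟨l, h2, h1⟩
  have hev : ∀ᶠ W in 𝓝 V, W.rad r₁ + 3 * W.rad 1 < W.rad L := by
    have h1 := (V.tendsto_rad_nhds (hr₁pos.trans_le hLr₁)).sub
      ((V.tendsto_rad_nhds hr₁pos).add ((V.tendsto_rad_nhds one_pos).const_mul 3))
    filter_upwards [h1.eventually_const_lt (sub_pos.2 hLr)] with W hW
    linarith
  have hevb : ∀ᶠ W in 𝓝 V, V.β / 2 < W.β := V.tendsto_β.eventually_const_lt (by linarith)
  have hevp : ∀ᶠ W in 𝓝 V, L ^ |V.β - W.β| < 2 := by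
    have h1 : Tendsto (fun W : Potential ξm ξp Vmin => L ^ |V.β - W.β|) (𝓝 V)
        (𝓝 (L ^ |V.β - V.β|)) :=
      tendsto_const_nhds.rpow (tendsto_const_nhds.sub V.tendsto_β).abs (Or.inl (by linarith))
    exact h1.eventually_lt_const (by simp)
  have hevr : ∀ᶠ W in 𝓝 V, 3 * W.rad 1 < K :=
    ((V.tendsto_rad_nhds one_pos).const_mul 3).eventually_lt_const (by simp only [K]; linarith)
  obtain ⟨W, hWO, ⟨⟨hWm, hWp⟩, hWpot, hWrad⟩, hWL, hWb, hWr, hWp2⟩ :=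
    ((mem_closure_iff_frequently.1 h).and_eventually
      (((hndm.and hndp).and ((eventually_pot_le hV V hL1 hlam).and
        (V.eventually_rad_le hL1 hlam))).and (hev.and (hevb.and (hevr.and hevp))))).exists
  rw [mem_out_iff_excess hV hn hξ] at hWO
  obtain ⟨R₀, hR₀, hexc⟩ := exists_exc_of_excess_lt (E := 0) hV hn hWO
  set R := max R₀ r₁
  obtain ⟨w, A₁, A₂, hw, h₁, h₂, hA⟩ := hexc.extend hV hR₀ (le_max_left R₀ r₁)
  have hR0 : 0 < R := by have := le_max_left R₀ r₁; linarith
  have hnR : ∀ ξ : USphere n, ‖R • (ξ : Space n)‖ = R := fun ξ => by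
    rw [norm_smul, norm_coe, mul_one, Real.norm_eq_abs, abs_of_pos hR0]
  have hW1 : 0 ≤ W.rad 1 := W.rad_nonneg zero_le_one
  have g₁ := h₁.symm.rad_sub_le hV one_pos
  have g₂ := h₂.rad_sub_le hV one_pos
  rw [hnR, hw] at g₁ g₂
  have hK₁ : K ≤ √(μ / 2) * r₀ ^ W.β * d := hr₀K.trans (by
    gcongr
    linarith)
  have near : ∀ (ξ : USphere n) (A : ℝ), (∀ s : USphere n, dist s ξ < δ →
      μ * dist s ξ ^ 2 ≤ W.ang s - Vmin) → W.Reach 1 w (R • (ξ : Space n)) A →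
      A ≤ W.rad R + W.rad 1 →
      ∃ y : Space n, r₀ ≤ ‖y‖ ∧ ‖y‖ ≤ r₁ ∧ ‖y‖ ^ W.β * dev ξ y < σ ∧ dev ξ y < d ∧
        W.Reach 1 w y (A - (W.rad R - W.rad ‖y‖)) := fun ξ A hnd hr hAle =>
    hr.exists_near hV hδ hμ hnd hd hdδ hσ hc hcμ one_pos (by rw [hw]; linarith) hr₀pos hr₁
      (le_max_right _ _) (by rw [hw]; linarith) hK₁ hlog
  obtain ⟨y₁, hy₁0, hy₁1, hy₁σ, hy₁d, hr₁'⟩ := near ξm A₁ (fun s hs =>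
    (mul_le_mul_of_nonneg_right (min_le_left _ _) (sq_nonneg _)).trans
      (hWm s (hs.trans_le (min_le_left _ _)))) h₁.symm (by linarith)
  obtain ⟨y₂, hy₂0, hy₂1, hy₂σ, hy₂d, hr₂'⟩ := near ξp A₂ (fun s hs =>
    (mul_le_mul_of_nonneg_right (min_le_right _ _) (sq_nonneg _)).trans
      (hWp s (hs.trans_le (min_le_right _ _)))) h₂ (by linarith)
  have hbig : ∀ (ξ : USphere n) (y : Space n), r₀ ≤ ‖y‖ → ‖y‖ ≤ r₁ → ‖y‖ ^ W.β * dev ξ y < σ →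
      ‖y‖ ^ V.β * dev ξ y ≤ 2 * σ := fun ξ y hy0 hy1 hyσ => by
    have hypos : 0 < ‖y‖ := by linarith
    have h1 : ‖y‖ ^ V.β = ‖y‖ ^ (V.β - W.β) * ‖y‖ ^ W.β := by
      rw [← Real.rpow_add hypos]; congr 1; ring
    have h2 : ‖y‖ ^ (V.β - W.β) ≤ 2 := (rpow_le_rpow_abs hL1
      ((inv_le_one_of_one_le₀ hL1).trans (by linarith)) (hy1.trans hLr₁) le_rfl).trans hWp2.le
    rw [h1, mul_assoc]
    exact mul_le_mul h2 hyσ.le (mul_nonneg (by positivity) dev_nonneg) (by norm_num)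
  have hbound : ∀ (y : Space n) (A : ℝ), r₀ ≤ ‖y‖ → ‖y‖ ≤ r₁ → A ≤ W.rad R + W.rad 1 →
      W.Reach 1 w y (A - (W.rad R - W.rad ‖y‖)) →
      V.Reach 1 w y (lam * (A - (W.rad R - W.rad ‖y‖))) := fun y A hy0 hy1 hAle hr => by
    have h1 : W.rad ‖y‖ ≤ W.rad r₁ := rad_mono (norm_nonneg _) hy1
    exact hr.transfer hV hL1 hlam.le (fun y h1 h2 => (hWpot y h1 h2).2)
      (inv_le_one_of_one_le₀ hL1) (by rw [hw]; linarith)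
  have s₁ := hbound y₁ A₁ hy₁0 hy₁1 (by linarith) hr₁'
  have s₂ := hbound y₂ A₂ hy₂0 hy₂1 (by linarith) hr₂'
  have hnz : ∀ y : Space n, r₀ ≤ ‖y‖ → y ≠ 0 := fun y hy => norm_pos_iff.1 (by linarith)
  set R' := max lm lp * r₁
  have hlm1 : 1 ≤ max lm lp := le_max_of_le_left hlm
  have t₁ := (hraym y₁ (hnz y₁ hy₁0) (hy₁d.trans_le ((min_le_left _ _).trans (min_le_left _ _)))).1 R'
    (mul_le_mul (le_max_left _ _) hy₁1 (norm_nonneg _) (by linarith))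
  have t₂ := (hrayp y₂ (hnz y₂ hy₂0) (hy₂d.trans_le ((min_le_left _ _).trans (min_le_right _ _)))).1
    R' (mul_le_mul (le_max_right _ _) hy₂1 (norm_nonneg _) (by linarith))
  have u₁ := s₁.trans (t₁.mono (ρ' := 1) (by linarith) le_rfl)
  have u₂ := s₂.trans (t₂.mono (ρ' := 1) (by linarith) le_rfl)
  have hR' : 1 ≤ R' := one_le_mul_of_one_le_of_one_le hlm1 (by linarith)
  refine excess_le hV hR' ⟨w, _, _, hw, u₁.symm, u₂, ?_⟩
  have b₁ := hbig ξm y₁ hy₁0 hy₁1 hy₁σ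
  have b₂ := hbig ξp y₂ hy₂0 hy₂1 hy₂σ
  have c₁ := mul_le_mul_of_nonneg_left b₁ hCm
  have c₂ := mul_le_mul_of_nonneg_left b₂ hCp
  have d₁ := hWrad ‖y₁‖ (by linarith) (hy₁1.trans hLr₁)
  have d₂ := hWrad ‖y₂‖ (by linarith) (hy₂1.trans hLr₁)
  have e₁ : V.rad ‖y₁‖ ≤ V.rad r₁ := rad_mono (norm_nonneg _) hy₁1
  have e₂ : V.rad ‖y₂‖ ≤ V.rad r₁ := rad_mono (norm_nonneg _) hy₂1
  have f₁ : lam * (A₁ - (W.rad R - W.rad ‖y₁‖)) + lam * (A₂ - (W.rad R - W.rad ‖y₂‖))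
      ≤ lam * (lam * V.rad ‖y₁‖ + lam * V.rad ‖y₂‖) := by
    rw [← mul_add]
    exact mul_le_mul_of_nonneg_left (by linarith) (by linarith)
  have f₂ : (lam * lam - 1) * (V.rad ‖y₁‖ + V.rad ‖y₂‖) ≤ (lam * lam - 1) * (2 * V.rad r₁) :=
    mul_le_mul_of_nonneg_left (by linarith) (by nlinarith)
  linarith

/-- The separating set is the set of potentials of zero excess. -/
theorem mem_separatingSet_iff_excess (hV : 0 < Vmin) (hn : 1 ≤ n) (hξ : ξp ≠ ξm) :
    V ∈ separatingSet ξm ξp Vmin ↔ V.excess = 0 := by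
  rw [mem_separatingSet_iff hV hξ, (isOpen_out hV hn hξ).frontier_eq]
  constructor
  · rintro ⟨h1, h2⟩
    rw [mem_out_iff_excess hV hn hξ, not_lt] at h2
    exact le_antisymm (le_of_forall_pos_le_add fun e he => by
      rw [zero_add]; exact excess_le_of_mem_closure hV hn hξ h1 he) h2
  · intro h
    refine ⟨mem_closure_out hV hn hξ h, ?_⟩
    rw [mem_out_iff_excess hV hn hξ, h]
    exact lt_irrefl _

end Nearby

end Potential

end AnisotropicKepler

end

/-! ### Compactness and lower semicontinuity for paths of bounded energy. -/

noncomputable section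

namespace AnisotropicKepler

section WeakLimit

/-- Limits along an ultrafilter exist for all times, and for all test vectors, simultaneously; no
diagonal extraction of subsequences is needed. -/
theorem exists_ultrafilter_lim {ι X : Type*} [TopologicalSpace X] (𝒰 : Ultrafilter ι)
    {K : Set X} (hK : IsCompact K) {f : ι → X} (hf : ∀ᶠ k in (𝒰 : Filter ι), f k ∈ K) :
    ∃ x ∈ K, Tendsto f 𝒰 (𝓝 x) :=
  hK.ultrafilter_le_nhds (𝒰.map f) (le_principal_iff.2 hf)

/-- Bounded sequences in a Hilbert space converge weakly along ultrafilters. -/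
theorem exists_weak_lim {ι H : Type*} [NormedAddCommGroup H] [InnerProductSpace ℝ H]
    [CompleteSpace H] (𝒰 : Ultrafilter ι) (u : ι → H) {C : ℝ} (hu : ∀ k, ‖u k‖ ≤ C) :
    ∃ v : H, ∀ w, Tendsto (fun k => inner ℝ (u k) w) 𝒰 (𝓝 (inner ℝ v w)) := by
  have hbd : ∀ w k, |inner ℝ (u k) w| ≤ C * ‖w‖ := fun w k =>
    (abs_real_inner_le_norm _ _).trans (mul_le_mul_of_nonneg_right (hu k) (norm_nonneg _))
  have hex : ∀ w, ∃ l ∈ Icc (-(C * ‖w‖)) (C * ‖w‖),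
      Tendsto (fun k => inner ℝ (u k) w) 𝒰 (𝓝 l) := fun w =>
    exists_ultrafilter_lim 𝒰 isCompact_Icc
      (Eventually.of_forall fun k => abs_le.1 (hbd w k))
  choose l hl hlim using hex
  let L : H →ₗ[ℝ] ℝ :=
    { toFun := l
      map_add' := fun w w' => tendsto_nhds_unique (hlim (w + w')) (by
        simpa only [inner_add_right] using (hlim w).add (hlim w'))
      map_smul' := fun c w => tendsto_nhds_unique (hlim (c • w)) (by
        simpa only [inner_smul_right, RingHom.id_apply, smul_eq_mul] using (hlim w).const_mul c) }
  let Lc : StrongDual ℝ H := L.mkContinuous C fun w => abs_le.2 (hl w)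
  refine ⟨(InnerProductSpace.toDual ℝ H).symm Lc, fun w => ?_⟩
  rw [InnerProductSpace.toDual_symm_apply]
  exact hlim w

end WeakLimit

namespace IsH1

variable {n : ℕ} {a b : ℝ} {x : ℝ → Space n}

theorem intervalIntegrable_kinetic (hab : a ≤ b) (hx : IsH1 a b x) :
    IntervalIntegrable (fun t => ‖deriv x t‖ ^ 2 / 2) volume a b :=
  (intervalIntegrable_iff_integrableOn_Ioc_of_le hab).2 (Potential.integrableOn_kinetic hx)

/-- Young's inequality with a free parameter l in place of Cauchy-Schwarz keeps the bound linear in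
both the duration and the energy. -/
theorem norm_sub_le (hab : a ≤ b) (hx : IsH1 a b x) {l : ℝ} (hl : 0 < l) :
    ‖x b - x a‖ ≤ l / 2 * (b - a) + l⁻¹ * ∫ t in a..b, ‖deriv x t‖ ^ 2 / 2 := by
  have hk := hx.intervalIntegrable_kinetic hab
  rw [hx.sub_eq (left_mem_Icc.2 hab) (right_mem_Icc.2 hab)]
  calc ‖∫ t in a..b, deriv x t‖ ≤ ∫ t in a..b, ‖deriv x t‖ :=
        intervalIntegral.norm_integral_le_integral_norm hab
    _ ≤ ∫ t in a..b, (l / 2 + l⁻¹ * (‖deriv x t‖ ^ 2 / 2)) := by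
        refine intervalIntegral.integral_mono_on hab (hx.intervalIntegrable hab).norm
          (intervalIntegrable_const.add (hk.const_mul _)) fun t _ => ?_
        have h1 : l⁻¹ * (‖deriv x t‖ ^ 2 / 2) = (‖deriv x t‖ ^ 2 * l⁻¹) / 2 := by ring
        have h2 : 0 ≤ l⁻¹ * (‖deriv x t‖ - l) ^ 2 := by positivity
        have h3 : l⁻¹ * (‖deriv x t‖ - l) ^ 2
            = ‖deriv x t‖ ^ 2 * l⁻¹ - 2 * ‖deriv x t‖ + l := by field_simp; ring
        rw [h1]; linarith
    _ = _ := by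
        rw [intervalIntegral.integral_add intervalIntegrable_const (hk.const_mul _),
          intervalIntegral.integral_const, intervalIntegral.integral_const_mul, smul_eq_mul]
        ring

theorem integral_kinetic_nonneg (hab : a ≤ b) : 0 ≤ ∫ t in a..b, ‖deriv x t‖ ^ 2 / 2 :=
  intervalIntegral.integral_nonneg hab fun _ _ => by positivity

theorem integral_kinetic_mono (hx : IsH1 a b x) {s t : ℝ} (hs : a ≤ s) (hst : s ≤ t) (ht : t ≤ b) :
    ∫ τ in s..t, ‖deriv x τ‖ ^ 2 / 2 ≤ ∫ τ in a..b, ‖deriv x τ‖ ^ 2 / 2 :=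
  intervalIntegral.integral_mono_interval hs hst ht
    (Eventually.of_forall fun _ => by positivity)
    (hx.intervalIntegrable_kinetic (hs.trans (hst.trans ht)))

theorem norm_toLp_sq (hab : a ≤ b) (hx : IsH1 a b x) :
    ‖hx.1.toLp‖ ^ 2 = 2 * ∫ t in a..b, ‖deriv x t‖ ^ 2 / 2 := by
  rw [← real_inner_self_eq_norm_sq, L2.inner_def, ← intervalIntegral.integral_const_mul,
    intervalIntegral.integral_of_le hab]
  refine integral_congr_ae ?_
  filter_upwards [hx.1.coeFn_toLp] with t ht
  rw [ht, real_inner_self_eq_norm_sq]; ring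

/-- A primitive of a square integrable function. -/
theorem of_sub_eq_integral (hab : a ≤ b) {v : ℝ → Space n}
    (hv : MemLp v 2 (volume.restrict (Ioc a b)))
    (h : ∀ t ∈ Icc a b, x t - x a = ∫ s in a..t, v s) :
    IsH1 a b x ∧ deriv x =ᵐ[volume.restrict (Ioc a b)] v := by
  have hi : IntervalIntegrable v volume a b :=
    (intervalIntegrable_iff_integrableOn_Ioc_of_le hab).2 (hv.integrable (by norm_num))
  have hae : deriv x =ᵐ[volume.restrict (Ioc a b)] v := by
    have h1 := hi.ae_hasDerivAt_integral
    rw [← restrict_Ioo_eq_restrict_Ioc]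
    refine (ae_restrict_iff' measurableSet_Ioo).2 ?_
    filter_upwards [h1] with t ht htm
    have hu : t ∈ uIcc a b := by rw [uIcc_of_le hab]; exact Ioo_subset_Icc_self htm
    have h2 := (ht hu a left_mem_uIcc).const_add (x a)
    refine (h2.congr_of_eventuallyEq ?_).deriv
    filter_upwards [Icc_mem_nhds htm.1 htm.2] with s hs
    rw [← h s hs]; abel
  refine ⟨of_sub (hv.ae_eq hae.symm) fun t ht => ?_, hae⟩
  rw [h t ht, intervalIntegral.integral_of_le ht.1, intervalIntegral.integral_of_le ht.1]
  exact integral_congr_ae (ae_restrict_of_ae_restrict_of_subset (Ioc_subset_Ioc_right ht.2) hae.symm)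

theorem setIntegral_toLp (hx : IsH1 a b x) {t : ℝ} (ht : t ∈ Icc a b) :
    ∫ s in Ioc a t, (hx.1.toLp : ℝ → Space n) s ∂(volume.restrict (Ioc a b)) = x t - x a := by
  rw [hx.sub_eq (left_mem_Icc.2 (ht.1.trans ht.2)) ht, intervalIntegral.integral_of_le ht.1]
  have h1 : ∫ s in Ioc a t, (hx.1.toLp : ℝ → Space n) s ∂(volume.restrict (Ioc a b))
      = ∫ s in Ioc a t, deriv x s ∂(volume.restrict (Ioc a b)) :=
    integral_congr_ae (ae_restrict_of_ae hx.1.coeFn_toLp)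
  rw [h1, Measure.restrict_restrict measurableSet_Ioc,
    inter_eq_left.2 (Ioc_subset_Ioc_right ht.2)]

/-- Pointwise limits of paths of bounded energy, and lower semicontinuity of the energy. -/
theorem of_tendsto {ι : Type*} (𝒰 : Ultrafilter ι) {y : ι → ℝ → Space n} {C : ℝ} (hab : a ≤ b)
    (hy : ∀ k, IsH1 a b (y k)) (hC : ∀ k, ∫ t in a..b, ‖deriv (y k) t‖ ^ 2 / 2 ≤ C)
    (hlim : ∀ t ∈ Icc a b, Tendsto (fun k => y k t) 𝒰 (𝓝 (x t))) :
    IsH1 a b x ∧ ∀ η > 0, ∀ᶠ k in (𝒰 : Filter ι),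
      ∫ t in a..b, ‖deriv x t‖ ^ 2 / 2 ≤ (∫ t in a..b, ‖deriv (y k) t‖ ^ 2 / 2) + η := by
  obtain ⟨v, hv⟩ := exists_weak_lim 𝒰 (fun k => (hy k).1.toLp) (C := √(2 * C)) fun k => by
    refine Real.le_sqrt_of_sq_le ?_
    rw [norm_toLp_sq hab (hy k)]
    linarith [hC k]
  -- Testing the weak limit v against vectors supported on [a, t] identifies it as the derivative of
  -- the pointwise limit.
  have hsub : ∀ t ∈ Icc a b, x t - x a = ∫ s in a..t, v s := fun t ht => by
    refine ext_inner_left ℝ fun e => ?_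
    have hfin : (volume.restrict (Ioc a b)) (Ioc a t) ≠ ⊤ := measure_ne_top _ _
    have h1 := hv (indicatorConstLp 2 measurableSet_Ioc hfin e)
    have h2 : Tendsto (fun k => inner ℝ e (y k t - y k a)) 𝒰 (𝓝 (inner ℝ e (x t - x a))) :=
      tendsto_const_nhds.inner ((hlim t ht).sub (hlim a (left_mem_Icc.2 hab)))
    have h3 : ∀ f : Lp (Space n) 2 (volume.restrict (Ioc a b)),
        inner ℝ f (indicatorConstLp 2 measurableSet_Ioc hfin e)
          = inner ℝ e (∫ s in Ioc a t, f s ∂(volume.restrict (Ioc a b))) := fun f => by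
      rw [real_inner_comm, L2.inner_indicatorConstLp_eq_inner_setIntegral]
    simp only [h3, setIntegral_toLp (hy _) ht] at h1
    rw [tendsto_nhds_unique h2 h1, Measure.restrict_restrict measurableSet_Ioc,
      inter_eq_left.2 (Ioc_subset_Ioc_right ht.2), intervalIntegral.integral_of_le ht.1]
  obtain ⟨hx, hae⟩ := of_sub_eq_integral hab (Lp.memLp v) hsub
  refine ⟨hx, fun η hη => ?_⟩
  have hnv : ‖v‖ ^ 2 = 2 * ∫ t in a..b, ‖deriv x t‖ ^ 2 / 2 := by
    rw [← norm_toLp_sq hab hx]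
    congr 2
    exact Lp.ext (hae.symm.trans hx.1.coeFn_toLp.symm)
  -- Weak lower semicontinuity of the norm, from the nonnegative square of the distance to v.
  have h1 := hv v
  rw [real_inner_self_eq_norm_sq] at h1
  filter_upwards [h1.eventually_const_lt (show ‖v‖ ^ 2 - η < ‖v‖ ^ 2 by linarith)] with k hk
  have h2 := norm_toLp_sq hab (hy k)
  have h3 := norm_sub_sq_real ((hy k).1.toLp) v
  have h4 : 0 ≤ ‖(hy k).1.toLp - v‖ ^ 2 := by positivity
  linarith

/-- Pointwise convergence of paths of bounded energy is uniform. -/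
theorem eventually_norm_sub_lt {ι : Type*} {l : Filter ι} {y : ι → ℝ → Space n} {C : ℝ}
    (hx : IsH1 a b x)
    (hy : ∀ k, IsH1 a b (y k)) (hC : ∀ k, ∫ t in a..b, ‖deriv (y k) t‖ ^ 2 / 2 ≤ C)
    (hlim : ∀ t ∈ Icc a b, Tendsto (fun k => y k t) l (𝓝 (x t))) {η : ℝ} (hη : 0 < η) :
    ∀ᶠ k in l, ∀ t ∈ Icc a b, ‖y k t - x t‖ < η := by
  set D := max (max C (∫ t in a..b, ‖deriv x t‖ ^ 2 / 2)) 1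
  have hD : 0 < D := lt_max_of_lt_right one_pos
  obtain ⟨h, hh, hmod⟩ : ∃ h > 0, ∀ z : ℝ → Space n, IsH1 a b z →
      (∫ t in a..b, ‖deriv z t‖ ^ 2 / 2) ≤ D → ∀ s t, a ≤ s → s ≤ t → t ≤ b → t - s ≤ h →
      ‖z t - z s‖ < η / 3 := by
    -- With l = 12D/η the energy term of the displacement bound is at most η/12 and the time term at
    -- most η/24, uniformly over paths of energy at most D. This equicontinuity reduces the claim to
    -- finitely many times.
    refine ⟨(η / 12) * (η / (12 * D)), by positivity, fun z hz hzD s t hs hst ht hts => ?_⟩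
    have h1 := (hz.mono hs ht).norm_sub_le hst (l := 12 * D / η) (by positivity)
    have h2 := hz.integral_kinetic_mono hs hst ht
    have h3 : (12 * D / η)⁻¹ * ∫ τ in s..t, ‖deriv z τ‖ ^ 2 / 2 ≤ (12 * D / η)⁻¹ * D :=
      mul_le_mul_of_nonneg_left (h2.trans hzD) (by positivity)
    have h4 : 12 * D / η / 2 * (t - s) ≤ 12 * D / η / 2 * ((η / 12) * (η / (12 * D))) :=
      mul_le_mul_of_nonneg_left hts (by positivity)
    have h5 : (12 * D / η)⁻¹ * D = η / 12 := by field_simp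
    have h6 : 12 * D / η / 2 * ((η / 12) * (η / (12 * D))) = η / 24 := by field_simp; norm_num
    linarith
  obtain ⟨N, hN⟩ := exists_nat_gt ((b - a) / h)
  have hfin : ∀ᶠ k in l, ∀ i ∈ Finset.range (N + 1), a + i * h ≤ b →
      ‖y k (a + i * h) - x (a + i * h)‖ < η / 3 := by
    refine (Filter.eventually_all_finset _).2 fun i _ => ?_
    by_cases hi : a + i * h ≤ b
    · have := hlim (a + i * h) ⟨by have : 0 ≤ (i : ℝ) * h := by positivity
                                   linarith, hi⟩
      rw [tendsto_iff_norm_sub_tendsto_zero] at this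
      filter_upwards [this.eventually_lt_const (show (0 : ℝ) < η / 3 by positivity)] with k hk _
        using hk
    · exact Eventually.of_forall fun k h => absurd h hi
  filter_upwards [hfin] with k hk t ht
  set i := ⌊(t - a) / h⌋₊
  have hi0 : 0 ≤ (t - a) / h := div_nonneg (by linarith [ht.1]) hh.le
  have hi1 : (i : ℝ) * h ≤ t - a := by
    rw [← le_div_iff₀ hh]; exact Nat.floor_le hi0
  have hi2 : t - a < (i + 1) * h := by
    rw [← div_lt_iff₀ hh]; exact Nat.lt_floor_add_one _
  have hiN : i ∈ Finset.range (N + 1) := by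
    rw [Finset.mem_range]
    have : (i : ℝ) < N := by
      refine lt_of_le_of_lt ?_ hN
      refine (Nat.floor_le hi0).trans ?_
      gcongr
      exact ht.2
    have : i < N := by exact_mod_cast this
    omega
  have hpos : 0 ≤ (i : ℝ) * h := by positivity
  have e1 := hk i hiN (by linarith [ht.2])
  have e2 := hmod (y k) (hy k) ((hC k).trans ((le_max_left _ _).trans (le_max_left _ _)))
    (a + i * h) t (by linarith) (by linarith) ht.2 (by linarith)
  have e3 := hmod x hx ((le_max_right _ _).trans (le_max_left _ _))
    (a + i * h) t (by linarith) (by linarith) ht.2 (by linarith)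
  have e4 : y k t - x t = (y k t - y k (a + i * h)) + (y k (a + i * h) - x (a + i * h))
      - (x t - x (a + i * h)) := by abel
  rw [e4]
  refine (_root_.norm_sub_le _ _).trans_lt ?_
  refine (add_le_add_left (norm_add_le _ _) _).trans_lt ?_
  linarith

end IsH1

end AnisotropicKepler

end

/-! ### A priori bounds on half paths, and near minimizers. -/

noncomputable section

namespace AnisotropicKepler

theorem IsH1.comp_neg {n : ℕ} {a b : ℝ} {x : ℝ → Space n} (hx : IsH1 (-b) (-a) x) :
    IsH1 a b fun t => x (-t) := by
  simpa using hx.affine (by norm_num : (-1 : ℝ) ≠ 0) (Potential.preimage_neg a b) 1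

theorem IsH1.comp_add {n : ℕ} {a b : ℝ} {x : ℝ → Space n} (h : ℝ) (hx : IsH1 (a + h) (b + h) x) :
    IsH1 a b fun t => x (t + h) := by
  have := Potential.preimage_affine_of_pos (h := h) one_pos a b
  simp only [one_mul] at this
  simpa using hx.affine one_ne_zero (by simp) 1

theorem IsH1.zero {n : ℕ} (a b : ℝ) : IsH1 a b fun _ => (0 : Space n) :=
  IsH1.of_hasDerivAt (x' := fun _ => 0) (fun t _ => hasDerivAt_const t 0) continuousOn_const

namespace Potential

variable {n : ℕ} {ξm ξp : USphere n} {Vmin : ℝ} {V : Potential ξm ξp Vmin}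

theorem lag_comp_neg (x : ℝ → Space n) (t : ℝ) : V.lag (fun t => x (-t)) t = V.lag x (-t) := by
  simp only [lag, deriv_comp_neg, norm_neg]

theorem lag_comp_add (x : ℝ → Space n) (h t : ℝ) :
    V.lag (fun t => x (t + h)) t = V.lag x (t + h) := by
  simp only [lag, deriv_comp_add_const]

theorem integral_kinetic_le (hV : 0 < Vmin) {a b : ℝ} {x : ℝ → Space n} (hab : a ≤ b)
    (hx : IsH1 a b x) (h0 : ∀ t ∈ Icc a b, x t ≠ 0) :
    ∫ t in a..b, ‖deriv x t‖ ^ 2 / 2 ≤ ∫ t in a..b, V.lag x t := by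
  refine intervalIntegral.integral_mono_on hab (hx.intervalIntegrable_kinetic hab)
    (intervalIntegrable_lag hab hx h0) fun t _ => ?_
  simp only [lag]
  linarith [V.pot_nonneg hV (x t)]

section HalfPath

variable {ε c : ℝ}

/-- Since β < 1 the Jacobi length is sublinear, whereas reaching distance r in bounded time costs
about r at least; this bounds paths of small excess on bounded times. -/
theorem exists_rad_le_half (V : Potential ξm ξp Vmin) : ∃ M : ℝ, ∀ r, M ≤ r → V.rad r ≤ r / 2 := by
  have h1 : Tendsto (fun r : ℝ => √(2 * Vmin) / V.β * r ^ (-(1 - V.β))) atTop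
      (𝓝 (√(2 * Vmin) / V.β * 0)) :=
    (tendsto_rpow_neg_atTop (by linarith [V.β_lt_one])).const_mul _
  rw [mul_zero] at h1
  obtain ⟨M, hM⟩ := ((h1.eventually_lt_const (show (0 : ℝ) < 1 / 2 by norm_num)).and
    (eventually_gt_atTop 0)).exists_forall_of_atTop
  refine ⟨M, fun r hr => ?_⟩
  obtain ⟨h2, h3⟩ := hM r hr
  have h4 : V.rad r = √(2 * Vmin) / V.β * r ^ (-(1 - V.β)) * r := by
    have : r ^ V.β = r ^ (-(1 - V.β)) * r := by
      rw [← Real.rpow_add_one h3.ne']; congr 1; ring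
    rw [rad, this]; ring
  rw [h4]
  nlinarith

/-- Paths of small excess stay bounded in bounded time. -/
theorem exists_norm_le (hV : 0 < Vmin) (V : Potential ξm ξp Vmin) (hε : 0 < ε) (c N : ℝ) :
    ∃ M, ∀ (z : ℝ → Space n) (t : ℝ), 0 ≤ t → t ≤ N → IsH1 0 t z →
      (∀ s ∈ Icc 0 t, ε ≤ ‖z s‖) → ‖z 0‖ = ε → (∫ s in (0 : ℝ)..t, V.lag z s) ≤ V.rad ‖z t‖ + c →
      ‖z t‖ ≤ M := by
  obtain ⟨M, hM⟩ := V.exists_rad_le_half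
  refine ⟨max M (2 * (ε + N + |c|)), fun z t ht htN hz hzε hz0 hlag => ?_⟩
  by_contra! hlt
  have h1 := hM _ ((le_max_left _ _).trans hlt.le)
  have h2 := (le_max_right M (2 * (ε + N + |c|))).trans_lt hlt
  have h3 := hz.norm_sub_le ht one_pos
  have h4 := integral_kinetic_le (V := V) hV ht hz fun s hs =>
    norm_pos_iff.1 (hε.trans_le (hzε s hs))
  have h5 := norm_sub_norm_le (z t) (z 0)
  rw [hz0] at h5
  have h6 := le_abs_self c
  have h7 : (0 : ℝ) ≤ N := ht.trans htN
  rw [inv_one, one_mul] at h3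
  linarith

/-- Paths of small excess leave every ball in bounded time. -/
theorem exists_lt_norm (hV : 0 < Vmin) (V : Potential ξm ξp Vmin) (hε : 0 < ε) (c r₀ : ℝ) :
    ∃ τ, ∀ (z : ℝ → Space n) (t : ℝ), 0 ≤ t → τ < t → IsH1 0 t z →
      (∀ s ∈ Icc 0 t, ε ≤ ‖z s‖) → ‖z 0‖ = ε → (∫ s in (0 : ℝ)..t, V.lag z s) ≤ V.rad ‖z t‖ + c →
      r₀ < ‖z t‖ := by
  -- If the end point is within r₀, the bounded action confines the whole path to radius M. The
  -- potential is bounded below there, so the action grows linearly with the duration, which is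
  -- thereby bounded.
  obtain ⟨M, hM, hM0⟩ := ((tendsto_rad (V := V) hV).eventually_gt_atTop
    (V.rad ε + (V.rad r₀ + c)) |>.and (eventually_gt_atTop 0)).exists
  have hpos : 0 < Vmin * M ^ (-V.α) := by positivity
  refine ⟨(V.rad r₀ + c) / (Vmin * M ^ (-V.α)), fun z t ht htτ hz hzε hz0 hlag => ?_⟩
  by_contra! hle
  have hr : V.rad ‖z t‖ ≤ V.rad r₀ := rad_mono (norm_nonneg _) hle
  have h0 : ∀ s ∈ Icc 0 t, z s ≠ 0 := fun s hs => norm_pos_iff.1 (hε.trans_le (hzε s hs))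
  have hbd : ∀ s ∈ Icc 0 t, ‖z s‖ ≤ M := fun s hs => by
    have h1 := rad_sub_le (V := V) hV hs.1 (hz.mono le_rfl hs.2)
      fun u hu => h0 u ⟨hu.1, hu.2.trans hs.2⟩
    have h2 := integral_lag_add (V := V) hs.1 hs.2 hz h0
    have h3 := integral_lag_nonneg (V := V) (x := z) hV hs.2
    rw [hz0] at h1
    exact (lt_of_rad_lt (V := V) hM0.le (by linarith)).le
  have h1 : Vmin * M ^ (-V.α) * t ≤ ∫ s in (0 : ℝ)..t, V.lag z s := by
    have : ∫ s in (0 : ℝ)..t, Vmin * M ^ (-V.α) = Vmin * M ^ (-V.α) * t := by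
      rw [intervalIntegral.integral_const, smul_eq_mul]; ring
    rw [← this]
    refine intervalIntegral.integral_mono_on ht intervalIntegrable_const
      (intervalIntegrable_lag ht hz h0) fun s hs => ?_
    have h2 := V.le_pot (h0 s hs)
    have h3 : M ^ (-V.α) ≤ ‖z s‖ ^ (-V.α) :=
      Real.rpow_le_rpow_of_nonpos (norm_pos_iff.2 (h0 s hs)) (hbd s hs) (by linarith [V.α_pos])
    have h4 := mul_le_mul_of_nonneg_left h3 hV.le
    have h5 : 0 ≤ ‖deriv z s‖ ^ 2 / 2 := by positivity
    simp only [lag]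
    linarith
  rw [div_lt_iff₀ hpos] at htτ
  linarith

variable {z : ℝ → Space n} {b R : ℝ} {ξ : USphere n}

/-- The rest of the path pays at least the radial cost, so every initial piece inherits the bound c
on the excess. -/
theorem integral_lag_le_of_half (hV : 0 < Vmin) (hε : 0 < ε) (hR : 0 < R) (hz : IsH1 0 b z)
    (hzε : ∀ s ∈ Icc 0 b, ε ≤ ‖z s‖) (hzb : z b = R • (ξ : Space n))
    (hlag : (∫ s in (0 : ℝ)..b, V.lag z s) ≤ V.rad R + c) {t : ℝ} (ht : t ∈ Icc 0 b) :
    (∫ s in (0 : ℝ)..t, V.lag z s) ≤ V.rad ‖z t‖ + c := by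
  have h0 : ∀ s ∈ Icc 0 b, z s ≠ 0 := fun s hs => norm_pos_iff.1 (hε.trans_le (hzε s hs))
  have h1 := integral_lag_add (V := V) ht.1 ht.2 hz h0
  have h2 := rad_sub_le (V := V) hV ht.2 (hz.mono ht.1 le_rfl) fun s hs => h0 s ⟨ht.1.trans hs.1, hs.2⟩
  rw [hzb, norm_smul, norm_coe, mul_one, Real.norm_eq_abs, abs_of_pos hR] at h2
  linarith

/-- Half paths of small excess approach the direction `ξ`. -/
theorem exists_dev_lt (hV : 0 < Vmin) (V : Potential ξm ξp Vmin) (hε : 0 < ε) (c : ℝ)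
    (hξ : V.ang ξ = Vmin) (hnd : NondegenerateAt V.ang ξ) {d : ℝ} (hd : 0 < d) :
    ∃ τ, ∀ (z : ℝ → Space n) (b R t : ℝ), 0 < R → IsH1 0 b z → (∀ s ∈ Icc 0 b, ε ≤ ‖z s‖) →
      ‖z 0‖ = ε → z b = R • (ξ : Space n) → (∫ s in (0 : ℝ)..b, V.lag z s) ≤ V.rad R + c →
      t ∈ Icc 0 b → τ < t → dev ξ (z t) < d := by
  obtain ⟨δ, hδ, μ, hμ, hnd⟩ := hnd
  rw [hξ] at hnd
  set d' := min d (δ ^ 2 / 2)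
  have hd' : 0 < d' := lt_min hd (by positivity)
  have hdδ : d' < δ ^ 2 := (min_le_right _ _).trans_lt (by linarith [sq_pos_of_pos hδ])
  obtain ⟨r₀, hr₀, hr₀pos⟩ : ∃ r₀, c + V.rad ε < √(μ / 2) * r₀ ^ V.β * d' ∧ 0 < r₀ := by
    have hlim : Tendsto (fun r : ℝ => √(μ / 2) * r ^ V.β * d') atTop atTop :=
      ((tendsto_rpow_atTop V.β_pos).const_mul_atTop (by positivity)).atTop_mul_const hd'
    exact ((hlim.eventually_gt_atTop _).and (eventually_gt_atTop 0)).exists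
  obtain ⟨τ, hτ⟩ := exists_lt_norm hV V hε c r₀
  refine ⟨τ, fun z b R t hR hz hzε hz0 hzb hlag ht htτ => ?_⟩
  have h0 : ∀ s ∈ Icc 0 b, z s ≠ 0 := fun s hs => norm_pos_iff.1 (hε.trans_le (hzε s hs))
  have hfar : ∀ s ∈ Icc t b, r₀ ≤ ‖z s‖ := fun s hs => by
    have hs0 : s ∈ Icc 0 b := ⟨ht.1.trans hs.1, hs.2⟩
    exact (hτ z s hs0.1 (htτ.trans_le hs.1) (hz.mono le_rfl hs.2)
      (fun u hu => hzε u ⟨hu.1, hu.2.trans hs.2⟩) hz0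
      (integral_lag_le_of_half hV hε hR hz hzε hzb hlag hs0)).le
  have hn : ‖z b‖ = R := by
    rw [hzb, norm_smul, norm_coe, mul_one, Real.norm_eq_abs, abs_of_pos hR]
  have h1 := integral_lag_add (V := V) ht.1 ht.2 hz h0
  have h2 := rad_sub_le (V := V) hV ht.1 (hz.mono le_rfl ht.2) fun s hs => h0 s ⟨hs.1, hs.2.trans ht.2⟩
  rw [hz0] at h2
  refine (dev_lt_of_lag_lt hV hδ hμ hr₀pos hnd hd' hdδ (hz.mono ht.1 le_rfl) hfar
    (by rw [hzb]; exact dev_smul_self hR) (by rw [hn]; linarith) t ⟨le_rfl, ht.2⟩).trans_le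
    (min_le_left _ _)

end HalfPath

/-- Nearby points outside a ball can be joined outside that ball at a small cost. -/
theorem exists_reach_short (hV : 0 < Vmin) (V : Potential ξm ξp Vmin) {ε e : ℝ} (hε : 0 < ε)
    {p : Space n} (hp : ε ≤ ‖p‖) (he : 0 < e) :
    ∃ δ > 0, ∀ q : Space n, ε ≤ ‖q‖ → ‖q - p‖ < δ → V.Reach ε p q e := by
  obtain ⟨C, hC0, hC⟩ := V.exists_ang_le
  set P := 1 / 2 + C * ε ^ (-V.α)
  have hP : 0 < P := by positivity
  have hseg : ∀ {p q : Space n}, (∀ τ ∈ Icc (0 : ℝ) 1, ε ≤ ‖p + τ • (q - p)‖) →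
      V.Reach ε p q (P * ‖q - p‖) := fun h => Reach.segment hV hC0 hC hε h
  -- The segment from p to q may enter the ball, so both points are first pushed outwards along
  -- their rays by the factor 1 + η, and the displaced points are joined. The last bound on ‖q - p‖
  -- below keeps that segment outside.
  set η := min 1 (e / (2 * P * (2 * ‖p‖ + 1)))
  have hη : 0 < η := lt_min one_pos (by positivity)
  have hη1 : η ≤ 1 := min_le_left _ _
  have hη2 : P * (η * (2 * ‖p‖ + 1)) ≤ e / 2 := by
    have := min_le_right 1 (e / (2 * P * (2 * ‖p‖ + 1)))
    rw [le_div_iff₀ (by positivity)] at this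
    linarith
  refine ⟨min 1 (min (e / (4 * P)) (η * ε / (1 + η))), by positivity, fun q hq hqp => ?_⟩
  have hq1 : ‖q - p‖ < 1 := hqp.trans_le (min_le_left _ _)
  have hq2 : ‖q - p‖ < e / (4 * P) := hqp.trans_le ((min_le_right _ _).trans (min_le_left _ _))
  have hq3 : ‖q - p‖ < η * ε / (1 + η) := hqp.trans_le ((min_le_right _ _).trans (min_le_right _ _))
  rw [lt_div_iff₀ (by positivity)] at hq2 hq3
  have hray : ∀ p : Space n, ε ≤ ‖p‖ → V.Reach ε p ((1 + η) • p) (P * (η * ‖p‖)) := fun p hp => by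
    have h := hseg (p := p) (q := (1 + η) • p) fun τ hτ => by
      have : p + τ • ((1 + η) • p - p) = (1 + τ * η) • p := by module
      have h2 : 0 ≤ τ * η := mul_nonneg hτ.1 hη.le
      rw [this, norm_smul, Real.norm_eq_abs, abs_of_nonneg (by linarith)]
      nlinarith [norm_nonneg p]
    have h2 : (1 + η) • p - p = η • p := by module
    rwa [h2, norm_smul, Real.norm_eq_abs, abs_of_pos hη] at h
  have hmid := hseg (p := (1 + η) • p) (q := (1 + η) • q) fun τ hτ => by
    have e1 : (1 + η) • p + τ • ((1 + η) • q - (1 + η) • p) = (1 + η) • (p + τ • (q - p)) := by module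
    rw [e1, norm_smul, Real.norm_eq_abs, abs_of_pos (by linarith)]
    have h1 : ‖p‖ - ‖q - p‖ ≤ ‖p + τ • (q - p)‖ := by
      have := norm_sub_norm_le p (-(τ • (q - p)))
      rw [norm_neg, sub_neg_eq_add, norm_smul, Real.norm_eq_abs, abs_of_nonneg hτ.1] at this
      nlinarith [norm_nonneg (q - p), hτ.2]
    nlinarith
  have e2 : ‖(1 + η) • q - (1 + η) • p‖ = (1 + η) * ‖q - p‖ := by
    rw [← smul_sub, norm_smul, Real.norm_eq_abs, abs_of_pos (by linarith)]
  rw [e2] at hmid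
  refine (((hray p hp).trans hmid).trans (hray q hq).symm).mono le_rfl ?_
  have h3 : ‖q‖ ≤ ‖p‖ + 1 := by
    have := norm_sub_norm_le q p
    linarith
  have h4 : P * (η * ‖q‖) ≤ P * (η * (‖p‖ + 1)) := by gcongr
  have h5 : P * ((1 + η) * ‖q - p‖) ≤ P * (2 * ‖q - p‖) := by gcongr; linarith
  linarith

section NearMinimizers

variable {ε : ℝ}

theorem le_of_cross (hV : 0 < Vmin) (hε : 0 < ε) {R A : ℝ} (hR : ε ≤ R)
    (h : V.Cross ε (R • (ξm : Space n)) (R • (ξp : Space n)) A) :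
    2 * V.rad R + ε ^ V.β * V.excess ≤ A := by
  have h1 := Exc.of_cross (E := A - 2 * V.rad R) hε (hε.le.trans hR) (h.mono (by linarith))
  have h2 := excess_le hV ((one_le_div hε).2 hR) h1
  rw [le_div_iff₀ (by positivity)] at h2
  linarith

/-- Time is translated so that the contact takes place at 0. The contact therefore survives in any
pointwise limit, and no minimizing sequence can lose it. -/
theorem exists_near_minimizer (hV : 0 < Vmin) (hn : 1 ≤ n) (V : Potential ξm ξp Vmin) (hε : 0 < ε)
    (R₁ : ℝ) {e : ℝ} (he : 0 < e) :
    ∃ (R a b : ℝ) (y : ℝ → Space n), R₁ ≤ R ∧ ε ≤ R ∧ a ≤ 0 ∧ 0 ≤ b ∧ IsH1 a b y ∧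
      y a = R • (ξm : Space n) ∧ y b = R • (ξp : Space n) ∧ ‖y 0‖ = ε ∧
      (∀ t ∈ Icc a b, ε ≤ ‖y t‖) ∧
      (∫ t in a..b, V.lag y t) ≤ 2 * V.rad R + ε ^ V.β * V.excess + e := by
  obtain ⟨R₀, hR₀, hexc⟩ := exists_exc_of_excess_lt (V := V) (E := V.excess + e / ε ^ V.β) hV hn
    (by have : 0 < e / ε ^ V.β := by positivity
        linarith)
  set R := max R₀ (R₁ / ε)
  have hRR : R₀ ≤ R := le_max_left _ _
  have h1 := (hexc.extend hV hR₀ hRR).cross hε (by linarith)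
  obtain ⟨T, hT, z, hz, z0, zT, hmin, hact⟩ := h1.exists_path
  obtain ⟨⟨τ, hτ, hτε⟩, hlow⟩ := hmin
  have hzε : ∀ t ∈ Icc 0 T, ε ≤ ‖z t‖ := fun t ht => hlow ⟨t, ht, rfl⟩
  have h0 : ∀ t ∈ Icc 0 T, z t ≠ 0 := fun t ht => norm_pos_iff.1 (hε.trans_le (hzε t ht))
  rw [action_eq hV hT hz h0, ENNReal.ofReal_le_ofReal_iff h1.nonneg] at hact
  refine ⟨ε * R, 0 - τ, T - τ, fun t => z (t + τ), ?_, ?_, by linarith [hτ.1], by linarith [hτ.2],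
    IsH1.comp_add τ (by simpa using hz), by simpa using z0, by simpa using zT, by simpa using hτε,
    fun t ht => hzε _ ⟨by linarith [ht.1], by linarith [ht.2]⟩, ?_⟩
  · have := mul_le_mul_of_nonneg_left (le_max_right R₀ (R₁ / ε)) hε.le
    rwa [mul_div_cancel₀ _ hε.ne'] at this
  · exact le_mul_of_one_le_right hε.le (by linarith)
  · simp only [lag_comp_add]
    rw [intervalIntegral.integral_comp_add_right (fun t => V.lag z t)]
    simp only [sub_add_cancel]
    refine hact.trans (le_of_eq ?_)
    field_simp
    ring

/-- Near minimizers nearly minimize on each subinterval. -/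
theorem integral_lag_le_of_near_minimizer (hV : 0 < Vmin) (hε : 0 < ε) {R a b e : ℝ}
    {y : ℝ → Space n} (hR : ε ≤ R) (hy : IsH1 a b y) (ha0 : a ≤ 0) (hb0 : 0 ≤ b)
    (hya : y a = R • (ξm : Space n)) (hyb : y b = R • (ξp : Space n)) (hy0 : ‖y 0‖ = ε)
    (hyε : ∀ t ∈ Icc a b, ε ≤ ‖y t‖)
    (hlag : (∫ t in a..b, V.lag y t) ≤ 2 * V.rad R + ε ^ V.β * V.excess + e)
    {s t B : ℝ} (hs : a ≤ s) (hst : s ≤ t) (ht : t ≤ b)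
    (h : V.Cross ε (y s) (y t) B ∨ ((0 : ℝ) ∉ Icc s t ∧ V.Reach ε (y s) (y t) B)) :
    (∫ u in s..t, V.lag y u) ≤ B + e := by
  have h0 : ∀ t ∈ Icc a b, y t ≠ 0 := fun t ht => norm_pos_iff.1 (hε.trans_le (hyε t ht))
  have hreach : ∀ u v, a ≤ u → u ≤ v → v ≤ b → V.Reach ε (y u) (y v) (∫ τ in u..v, V.lag y τ) :=
    fun u v hu huv hv => Reach.of_path_lag hV hε huv (hy.mono hu hv)
      fun τ hτ => hyε τ ⟨hu.trans hτ.1, hτ.2.trans hv⟩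
  have hadd : ∀ u v w, a ≤ u → u ≤ v → v ≤ w → w ≤ b → (∫ τ in u..w, V.lag y τ)
      = (∫ τ in u..v, V.lag y τ) + ∫ τ in v..w, V.lag y τ := fun u v w hu huv hvw hw =>
    integral_lag_add huv hvw (hy.mono hu hw) fun τ hτ => h0 τ ⟨hu.trans hτ.1, hτ.2.trans hw⟩
  have r₁ := hreach a s le_rfl hs (hst.trans ht)
  have r₂ := hreach t b (hs.trans hst) ht le_rfl
  have s₁ := hadd a s b le_rfl hs (hst.trans ht) le_rfl
  have s₂ := hadd s t b hs hst ht le_rfl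
  -- A replaced piece must leave the minimal distance equal to ε: either the new piece touches the
  -- sphere itself, or the contact at time 0 lies outside the replaced interval and is kept.
  have key : V.Cross ε (y a) (y b)
      ((∫ τ in a..s, V.lag y τ) + B + ∫ τ in t..b, V.lag y τ) := by
    rcases h with h | ⟨h0', h⟩
    · exact ((h.symm.trans r₁.symm).symm.trans r₂).mono (by linarith)
    · rw [mem_Icc, not_and_or, not_le, not_le] at h0'
      rcases h0' with h0' | h0'
      · have c : V.Cross ε (y a) (y s) (∫ τ in a..s, V.lag y τ) :=
          ⟨y 0, _, _, hy0, hreach a 0 le_rfl ha0 hb0, hreach 0 s ha0 h0'.le (hst.trans ht),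
            (hadd a 0 s le_rfl ha0 h0'.le (hst.trans ht)).ge⟩
        exact (c.trans h).trans r₂
      · have c : V.Cross ε (y t) (y b) (∫ τ in t..b, V.lag y τ) :=
          ⟨y 0, _, _, hy0, hreach t 0 (hs.trans hst) h0'.le hb0, hreach 0 b ha0 hb0 le_rfl,
            (hadd t 0 b (hs.trans hst) h0'.le hb0 le_rfl).ge⟩
        exact ((c.symm.trans h.symm).trans r₁.symm).symm.mono (by linarith)
  rw [hya, hyb] at key
  have := le_of_cross hV hε hR key
  linarith

/-- Each half is bounded by subtracting the radial lower bound of the opposite half from the total.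
-/
theorem integral_lag_half_le (hV : 0 < Vmin) (hε : 0 < ε) {R a b e : ℝ} {y : ℝ → Space n}
    (hR : ε ≤ R) (hy : IsH1 a b y) (ha0 : a ≤ 0) (hb0 : 0 ≤ b)
    (hya : y a = R • (ξm : Space n)) (hyb : y b = R • (ξp : Space n)) (hy0 : ‖y 0‖ = ε)
    (hyε : ∀ t ∈ Icc a b, ε ≤ ‖y t‖)
    (hlag : (∫ t in a..b, V.lag y t) ≤ 2 * V.rad R + e) :
    (∫ t in (0 : ℝ)..b, V.lag y t) ≤ V.rad R + (V.rad ε + e) ∧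
      (∫ t in (0 : ℝ)..(-a), V.lag (fun t => y (-t)) t) ≤ V.rad R + (V.rad ε + e) := by
  have h0 : ∀ t ∈ Icc a b, y t ≠ 0 := fun t ht => norm_pos_iff.1 (hε.trans_le (hyε t ht))
  have hR0 : 0 < R := hε.trans_le hR
  have hn : ∀ ξ : USphere n, ‖R • (ξ : Space n)‖ = R := fun ξ => by
    rw [norm_smul, norm_coe, mul_one, Real.norm_eq_abs, abs_of_pos hR0]
  have h1 := integral_lag_add (V := V) ha0 hb0 hy h0
  have h2 := rad_sub_le (V := V) hV hb0 (hy.mono ha0 le_rfl) fun t ht => h0 t ⟨ha0.trans ht.1, ht.2⟩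
  have h3 := rad_sub_le' (V := V) hV ha0 (hy.mono le_rfl hb0) fun t ht => h0 t ⟨ht.1, ht.2.trans hb0⟩
  rw [hyb, hn, hy0] at h2
  rw [hya, hn, hy0] at h3
  simp only [lag_comp_neg]
  rw [intervalIntegral.integral_comp_neg (fun t => V.lag y t), neg_neg, neg_zero]
  constructor <;> linarith

end NearMinimizers

end Potential

end AnisotropicKepler

end

/-! ### Existence of constrained Morse minimizers. -/

noncomputable section

namespace AnisotropicKepler

namespace Potential

variable {n : ℕ} {ξm ξp : USphere n} {Vmin : ℝ} {V : Potential ξm ξp Vmin} {ε c : ℝ}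

/-- Escape to infinity and convergence of the direction hold for the approximating paths after times
independent of k; closed inequalities of this kind pass to the pointwise limit. -/
theorem tendsto_of_half_paths (hV : 0 < Vmin) (hε : 0 < ε) {ι : Type*} {l : Filter ι} [l.NeBot]
    {ξ : USphere n} (hξ : V.ang ξ = Vmin) (hnd : NondegenerateAt V.ang ξ) {z : ι → ℝ → Space n}
    {b R : ι → ℝ} {x : ℝ → Space n} (hR : ∀ k, 0 < R k) (hz : ∀ k, IsH1 0 (b k) (z k))
    (hzε : ∀ k, ∀ t ∈ Icc 0 (b k), ε ≤ ‖z k t‖) (hz0 : ∀ k, ‖z k 0‖ = ε)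
    (hzb : ∀ k, z k (b k) = R k • (ξ : Space n))
    (hlag : ∀ k, (∫ s in (0 : ℝ)..(b k), V.lag (z k) s) ≤ V.rad (R k) + c)
    (hb : ∀ N, ∀ᶠ k in l, N ≤ b k)
    (hlim : ∀ t, 0 ≤ t → Tendsto (fun k => z k t) l (𝓝 (x t))) :
    Tendsto (fun t => ‖x t‖) atTop atTop ∧
      Tendsto (fun t => ‖x t‖⁻¹ • x t) atTop (𝓝 (ξ : Space n)) := by
  have hx0 : ∀ t, 0 ≤ t → x t ≠ 0 := fun t ht => norm_pos_iff.1 (hε.trans_le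
    (ge_of_tendsto (hlim t ht).norm ((hb t).mono fun k hk => hzε k t ⟨ht, hk⟩)))
  constructor
  · refine tendsto_atTop.2 fun r₀ => ?_
    obtain ⟨τ, hτ⟩ := exists_lt_norm hV V hε c r₀
    filter_upwards [eventually_gt_atTop τ, eventually_ge_atTop 0] with t ht ht0
    refine ge_of_tendsto (hlim t ht0).norm ((hb t).mono fun k hk => ?_)
    exact (hτ (z k) t ht0 ht ((hz k).mono le_rfl hk)
      (fun s hs => hzε k s ⟨hs.1, hs.2.trans hk⟩) (hz0 k)
      (integral_lag_le_of_half hV hε (hR k) (hz k) (hzε k) (hzb k) (hlag k) ⟨ht0, hk⟩)).le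
  · rw [Metric.tendsto_nhds]
    intro e he
    obtain ⟨τ, hτ⟩ := exists_dev_lt hV V hε c hξ hnd (show 0 < (e / 2) ^ 2 by positivity)
    filter_upwards [eventually_gt_atTop τ, eventually_ge_atTop 0] with t ht ht0
    have h1 : dev ξ (x t) ≤ (e / 2) ^ 2 := by
      refine le_of_tendsto ((continuousAt_dev (hx0 t ht0)).tendsto.comp (hlim t ht0))
        ((hb t).mono fun k hk => ?_)
      exact (hτ (z k) (b k) (R k) t (hR k) (hz k) (hzε k) (hz0 k) (hzb k) (hlag k) ⟨ht0, hk⟩ ht).le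
    have h2 := abs_le_of_sq_le_sq h1 (by positivity)
    rw [abs_of_nonneg (norm_nonneg _)] at h2
    rw [dist_eq_norm]
    linarith

/-- Lower semicontinuity of the action along pointwise limits. -/
theorem integral_lag_le_of_tendsto (hV : 0 < Vmin) {ι : Type*} (𝒰 : Ultrafilter ι)
    {y : ι → ℝ → Space n} {x : ℝ → Space n} {a b C : ℝ} (hab : a ≤ b)
    (hy : ∀ᶠ k in (𝒰 : Filter ι), IsH1 a b (y k) ∧ (∀ t ∈ Icc a b, y k t ≠ 0) ∧
      ∫ t in a..b, V.lag (y k) t ≤ C)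
    (hlim : ∀ t ∈ Icc a b, Tendsto (fun k => y k t) 𝒰 (𝓝 (x t)))
    (h0 : ∀ t ∈ Icc a b, x t ≠ 0) :
    IsH1 a b x ∧ ∀ η > 0, ∀ᶠ k in (𝒰 : Filter ι),
      ∫ t in a..b, V.lag x t ≤ (∫ t in a..b, V.lag (y k) t) + η := by
  classical
  set P : ι → Prop := fun k => IsH1 a b (y k) ∧ (∀ t ∈ Icc a b, y k t ≠ 0) ∧
      ∫ t in a..b, V.lag (y k) t ≤ C
  -- The compactness lemma asks for bounds at every index, so the paths are replaced by 0 at the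
  -- indices where the bounds fail, which are negligible for the ultrafilter.
  set y' : ι → ℝ → Space n := fun k => if P k then y k else fun _ => 0
  have hy'1 : ∀ k, P k → y' k = y k := fun k hk => if_pos hk
  have hy'2 : ∀ k, ¬ P k → y' k = fun _ => 0 := fun k hk => if_neg hk
  have h1 : ∀ k, IsH1 a b (y' k) := fun k => by
    by_cases hk : P k
    · rw [hy'1 k hk]; exact hk.1
    · rw [hy'2 k hk]; exact IsH1.zero a b
  have h2 : ∀ k, ∫ t in a..b, ‖deriv (y' k) t‖ ^ 2 / 2 ≤ max C 0 := fun k => by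
    by_cases hk : P k
    · rw [hy'1 k hk]
      exact (integral_kinetic_le hV hab hk.1 hk.2.1).trans (hk.2.2.trans (le_max_left _ _))
    · rw [hy'2 k hk]; simp
  have h3 : ∀ t ∈ Icc a b, Tendsto (fun k => y' k t) 𝒰 (𝓝 (x t)) := fun t ht =>
    (hlim t ht).congr' (hy.mono fun k hk => (congrFun (hy'1 k hk) t).symm)
  obtain ⟨hx, hkin⟩ := IsH1.of_tendsto 𝒰 hab h1 h2 h3
  refine ⟨hx, fun η hη => ?_⟩
  set η' := η / (2 * (b - a + 1))
  have hba : 0 < b - a + 1 := by linarith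
  have hη' : 0 < η' := by positivity
  have hcomp : IsCompact (x '' Icc a b) := isCompact_Icc.image_of_continuousOn hx.continuousOn
  -- The kinetic part is weakly lower semicontinuous; for the potential part, uniform convergence
  -- and uniform continuity near the compact range of the limit suffice.
  have huni := hcomp.uniformContinuousAt_of_continuousAt V.pot
    (by rintro _ ⟨t, ht, rfl⟩; exact continuousAt_pot (h0 t ht)) (Metric.dist_mem_uniformity hη')
  obtain ⟨δ, hδ, hδu⟩ := Metric.mem_uniformity_dist.1 huni
  filter_upwards [hy, hkin (η / 2) (half_pos hη), IsH1.eventually_norm_sub_lt hx h1 h2 h3 hδ]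
    with k hk1 hk2 hk3
  rw [hy'1 k hk1] at hk2 hk3
  have hsplit : ∀ w : ℝ → Space n, IsH1 a b w → (∀ t ∈ Icc a b, w t ≠ 0) →
      ∫ t in a..b, V.lag w t
        = (∫ t in a..b, ‖deriv w t‖ ^ 2 / 2) + ∫ t in a..b, V.pot (w t) := fun w hw hw0 =>
    intervalIntegral.integral_add (hw.intervalIntegrable_kinetic hab)
      ((intervalIntegrable_iff_integrableOn_Ioc_of_le hab).2 (integrableOn_pot hw hw0))
  rw [hsplit x hx h0, hsplit (y k) hk1.1 hk1.2.1]
  have hp : ∫ t in a..b, V.pot (x t) ≤ ∫ t in a..b, (V.pot (y k t) + η') := by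
    refine intervalIntegral.integral_mono_on hab
      ((intervalIntegrable_iff_integrableOn_Ioc_of_le hab).2 (integrableOn_pot hx h0))
      (((intervalIntegrable_iff_integrableOn_Ioc_of_le hab).2
        (integrableOn_pot hk1.1 hk1.2.1)).add intervalIntegrable_const) fun t ht => ?_
    have h4 : dist (x t) (y k t) < δ := by rw [dist_comm, dist_eq_norm]; exact hk3 t ht
    have h5 : dist (V.pot (x t)) (V.pot (y k t)) < η' := hδu h4 ⟨t, ht, rfl⟩
    rw [Real.dist_eq] at h5
    linarith [(abs_lt.1 h5).2]
  rw [intervalIntegral.integral_add ((intervalIntegrable_iff_integrableOn_Ioc_of_le hab).2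
      (integrableOn_pot hk1.1 hk1.2.1)) intervalIntegrable_const,
    intervalIntegral.integral_const, smul_eq_mul] at hp
  have h6 : (b - a) * η' ≤ η / 2 := by
    have : (b - a + 1) * η' = η / 2 := by simp only [η']; field_simp
    nlinarith
  linarith

/-- The direct method. Near minimizers between the points of radius R k on the two rays, with
contact at time 0, are bounded on bounded times, and their domains exhaust the line. They converge
along an ultrafilter. Minimality passes to the limit because a competitor with the end points of the
limit can be attached to the approximating paths by short arcs of small cost. -/
theorem exists_isConstrainedMorse (hV : 0 < Vmin) (hn : 1 ≤ n) (V : Potential ξm ξp Vmin)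
    (hε : 0 < ε) : ∃ x, V.IsConstrainedMorse ε x := by
  choose R a b y hRk hRε ha hb hy hya hyb hy0 hyε hlag using fun k : ℕ =>
    exists_near_minimizer hV hn V hε (k : ℝ) (e := 1 / ((k : ℝ) + 1)) (by positivity)
  set c := V.rad ε + (ε ^ V.β * V.excess + 1)
  have hR0 : ∀ k, 0 < R k := fun k => hε.trans_le (hRε k)
  have hhalf : ∀ k, (∫ t in (0 : ℝ)..(b k), V.lag (y k) t) ≤ V.rad (R k) + c ∧
      (∫ t in (0 : ℝ)..(-a k), V.lag (fun t => y k (-t)) t) ≤ V.rad (R k) + c := fun k =>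
    integral_lag_half_le hV hε (hRε k) (hy k) (ha k) (hb k) (hya k) (hyb k) (hy0 k) (hyε k) (by
      have h1 := hlag k
      have h2 : 1 / ((k : ℝ) + 1) ≤ 1 := by
        rw [div_le_one (by positivity)]
        have : (0 : ℝ) ≤ k := by positivity
        linarith
      linarith)
  have hyr : ∀ k, IsH1 0 (b k) (y k) := fun k => (hy k).mono (ha k) le_rfl
  have hyl : ∀ k, IsH1 0 (-a k) fun t => y k (-t) := fun k =>
    IsH1.comp_neg (by simpa using (hy k).mono le_rfl (hb k))
  have hrε : ∀ k, ∀ t ∈ Icc 0 (b k), ε ≤ ‖y k t‖ := fun k t ht => hyε k t ⟨(ha k).trans ht.1, ht.2⟩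
  have hlε : ∀ k, ∀ t ∈ Icc 0 (-a k), ε ≤ ‖y k (-t)‖ := fun k t ht =>
    hyε k (-t) ⟨by linarith [ht.2], by linarith [ht.1, hb k]⟩
  have hl0 : ∀ k, ‖y k (-0)‖ = ε := fun k => by rw [neg_zero]; exact hy0 k
  have hlb : ∀ k, y k (- -a k) = R k • (ξm : Space n) := fun k => by rw [neg_neg]; exact hya k
  have lagr : ∀ k t, t ∈ Icc 0 (b k) →
      (∫ s in (0 : ℝ)..t, V.lag (y k) s) ≤ V.rad ‖y k t‖ + c := fun k t ht =>
    integral_lag_le_of_half hV hε (hR0 k) (hyr k) (hrε k) (hyb k) (hhalf k).1 ht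
  have lagl : ∀ k t, t ∈ Icc 0 (-a k) →
      (∫ s in (0 : ℝ)..t, V.lag (fun t => y k (-t)) s) ≤ V.rad ‖y k (-t)‖ + c := fun k t ht =>
    integral_lag_le_of_half hV hε (hR0 k) (hyl k) (hlε k) (hlb k) (hhalf k).2 ht
  have hbound : ∀ N : ℝ, ∃ M, ∀ k, ∀ t ∈ Icc (a k) (b k), |t| ≤ N → ‖y k t‖ ≤ M := fun N => by
    obtain ⟨M, hM⟩ := exists_norm_le hV V hε c N
    refine ⟨M, fun k t ht htN => ?_⟩
    rcases le_total 0 t with h | h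
    · rw [abs_of_nonneg h] at htN
      exact hM (y k) t h htN ((hyr k).mono le_rfl ht.2)
        (fun s hs => hrε k s ⟨hs.1, hs.2.trans ht.2⟩) (hy0 k) (lagr k t ⟨h, ht.2⟩)
    · rw [abs_of_nonpos h] at htN
      have hta : -t ≤ -a k := neg_le_neg ht.1
      have := hM (fun t => y k (-t)) (-t) (by linarith) htN ((hyl k).mono le_rfl hta)
        (fun s hs => hlε k s ⟨hs.1, hs.2.trans hta⟩) (hl0 k) (lagl k (-t) ⟨by linarith, hta⟩)
      simpa using this
  have hnR : ∀ k (ξ : USphere n), ‖R k • (ξ : Space n)‖ = R k := fun k ξ => by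
    rw [norm_smul, norm_coe, mul_one, Real.norm_eq_abs, abs_of_pos (hR0 k)]
  -- The end points have norm R k ≥ k while the paths are bounded on bounded times, so the end times
  -- tend to infinity.
  have hdom : ∀ N : ℝ, ∀ᶠ k in atTop, a k ≤ -N ∧ N ≤ b k := fun N => by
    obtain ⟨M, hM⟩ := hbound N
    filter_upwards [tendsto_natCast_atTop_atTop.eventually_gt_atTop M] with k hk
    constructor
    · by_contra! hlt
      have := hM k (a k) ⟨le_rfl, (ha k).trans (hb k)⟩ (by
        rw [abs_of_nonpos (ha k)]; linarith)
      rw [hya, hnR] at this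
      linarith [hRk k]
    · by_contra! hlt
      have := hM k (b k) ⟨(ha k).trans (hb k), le_rfl⟩ (by
        rw [abs_of_nonneg (hb k)]; linarith)
      rw [hyb, hnR] at this
      linarith [hRk k]
  set 𝒰 : Ultrafilter ℕ := hyperfilter ℕ
  have h𝒰 : (𝒰 : Filter ℕ) ≤ atTop := Nat.hyperfilter_le_atTop
  have hdom' : ∀ N : ℝ, ∀ᶠ k in (𝒰 : Filter ℕ), a k ≤ -N ∧ N ≤ b k := fun N => h𝒰 (hdom N)
  have hmemN : ∀ {k : ℕ} {N t : ℝ}, |t| ≤ N → a k ≤ -N ∧ N ≤ b k → t ∈ Icc (a k) (b k) :=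
    fun ht hk => ⟨hk.1.trans (neg_le_of_abs_le ht), (le_of_abs_le ht).trans hk.2⟩
  have hex : ∀ t, ∃ p : Space n, Tendsto (fun k => y k t) 𝒰 (𝓝 p) := fun t => by
    obtain ⟨M, hM⟩ := hbound |t|
    obtain ⟨p, -, hp⟩ := exists_ultrafilter_lim 𝒰 (isCompact_closedBall (0 : Space n) M)
      (f := fun k => y k t) ((hdom' |t|).mono fun k hk => by
        rw [mem_closedBall_zero_iff]
        exact hM k t (hmemN le_rfl hk) le_rfl)
    exact ⟨p, hp⟩
  choose x hx using hex
  have hxε : ∀ t, ε ≤ ‖x t‖ := fun t => ge_of_tendsto (hx t).norm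
    ((hdom' |t|).mono fun k hk => hyε k t (hmemN le_rfl hk))
  have hx0 : ‖x 0‖ = ε := tendsto_nhds_unique (hx 0).norm (by simp only [hy0]; exact tendsto_const_nhds)
  have hxne : ∀ t, x t ≠ 0 := fun t => norm_pos_iff.1 (hε.trans_le (hxε t))
  have hyne : ∀ k, ∀ t ∈ Icc (a k) (b k), y k t ≠ 0 := fun k t ht =>
    norm_pos_iff.1 (hε.trans_le (hyε k t ht))
  have hlsc : ∀ s t : ℝ, s ≤ t → IsH1 s t x ∧ ∀ η > 0, ∀ᶠ k in (𝒰 : Filter ℕ),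
      ∫ u in s..t, V.lag x u ≤ (∫ u in s..t, V.lag (y k) u) + η := fun s t hst => by
    set N := max |s| |t|
    have hN0 : 0 ≤ N := (abs_nonneg s).trans (le_max_left _ _)
    have hsN : -N ≤ s := neg_le_of_abs_le (le_max_left _ _)
    have htN : t ≤ N := le_of_abs_le (le_max_right _ _)
    obtain ⟨M, hM⟩ := hbound N
    refine integral_lag_le_of_tendsto (C := 2 * (V.rad M + c)) hV 𝒰 hst
      ((hdom' N).mono fun k hk => ⟨(hy k).mono (hk.1.trans hsN) (htN.trans hk.2),
        fun u hu => hyne k u ⟨hk.1.trans (hsN.trans hu.1), hu.2.trans (htN.trans hk.2)⟩, ?_⟩)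
      (fun u _ => hx u) fun u _ => hxne u
    have hyN := (hy k).mono hk.1 hk.2
    have hyN0 : ∀ u ∈ Icc (-N) N, y k u ≠ 0 := fun u hu =>
      hyne k u ⟨hk.1.trans hu.1, hu.2.trans hk.2⟩
    have e1 : ∫ u in s..t, V.lag (y k) u ≤ ∫ u in (-N)..N, V.lag (y k) u :=
      intervalIntegral.integral_mono_interval hsN hst htN
        (Eventually.of_forall fun u => lag_nonneg hV (y k) u)
        (intervalIntegrable_lag (by linarith) hyN hyN0)
    have e2 := integral_lag_add (V := V) (neg_nonpos.2 hN0) hN0 hyN hyN0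
    have e3 := lagr k N ⟨hN0, hk.2⟩
    have e4 := lagl k N ⟨hN0, by linarith [hk.1]⟩
    simp only [lag_comp_neg] at e4
    rw [intervalIntegral.integral_comp_neg (fun t => V.lag (y k) t), neg_zero] at e4
    have e5 : V.rad ‖y k N‖ ≤ V.rad M := rad_mono (norm_nonneg _)
      (hM k N (hmemN (abs_of_nonneg hN0).le hk) (abs_of_nonneg hN0).le)
    have hNabs : |(-N)| ≤ N := by rw [abs_neg, abs_of_nonneg hN0]
    have e6 : V.rad ‖y k (-N)‖ ≤ V.rad M := rad_mono (norm_nonneg _)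
      (hM k (-N) (hmemN hNabs hk) hNabs)
    linarith
  obtain ⟨hr1, hr2⟩ := tendsto_of_half_paths hV hε V.isAngular.min_right V.isAngular.nondeg_right
    (l := (𝒰 : Filter ℕ)) (x := x) hR0 hyr hrε hy0 hyb (fun k => (hhalf k).1)
    (fun N => (hdom' N).mono fun k hk => hk.2) fun t _ => hx t
  obtain ⟨hl1, hl2⟩ := tendsto_of_half_paths hV hε V.isAngular.min_left V.isAngular.nondeg_left
    (l := (𝒰 : Filter ℕ)) (x := fun t => x (-t)) hR0 hyl hlε hl0 hlb (fun k => (hhalf k).2)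
    (fun N => (hdom' N).mono fun k hk => by linarith [hk.1]) fun t _ => hx (-t)
  refine ⟨x, fun s t hst => (hlsc s t hst.le).1, ⟨⟨0, mem_univ _, hx0⟩, ?_⟩, ⟨?_, hr1, ?_, hr2⟩, ?_⟩
  · rintro _ ⟨t, -, rfl⟩
    exact hxε t
  · have := hl1.comp tendsto_neg_atBot_atTop
    simpa only [Function.comp_def, neg_neg] using this
  · have := hl2.comp tendsto_neg_atBot_atTop
    simpa only [Function.comp_def, neg_neg] using this
  intro s t s' t' z hst hst' hz hzs hzt hρ
  obtain ⟨ρ, hzρ, hxρ⟩ := hρ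
  obtain ⟨hxH, hxl⟩ := hlsc s t hst.le
  rcases eq_or_ne (V.action s' t' z) ⊤ with htop | htop
  · rw [htop]; exact le_top
  set A := (V.action s' t' z).toReal
  have hA : V.action s' t' z = ENNReal.ofReal A := (ENNReal.ofReal_toReal htop).symm
  have hA0 : 0 ≤ A := ENNReal.toReal_nonneg
  have hερ : ε ≤ ρ := by
    obtain ⟨u, -, hu⟩ := hxρ.1
    rw [← hu]; exact hxε u
  -- If the common minimal distance is ε, the competitor touches the sphere; if it is larger, the
  -- contact time 0 is not in the interval and only staying outside the ball matters.
  have hcase : V.Cross ε (x s) (x t) A ∨ ((0 : ℝ) ∉ Icc s t ∧ V.Reach ε (x s) (x t) A) := by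
    rw [← hzs, ← hzt]
    rcases hερ.eq_or_lt with h | h
    · left
      rw [← h] at hzρ
      exact Cross.of_path hz hA0 hzρ hA.le
    · right
      refine ⟨fun h0 => ?_, ?_⟩
      · have : ρ ≤ ‖x 0‖ := hxρ.2 ⟨0, h0, rfl⟩
        linarith
      · exact Reach.of_path hst'.le hz (fun u hu => hερ.trans (hzρ.2 ⟨u, hu, rfl⟩)) hA0 hA.le
  rw [action_eq hV hst.le hxH fun u _ => hxne u, hA]
  refine ENNReal.ofReal_le_ofReal (le_of_forall_pos_le_add fun e he => ?_)
  obtain ⟨δ₁, hδ₁, hs₁⟩ := exists_reach_short hV V hε (hxε s) (show 0 < e / 4 by positivity)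
  obtain ⟨δ₂, hδ₂, hs₂⟩ := exists_reach_short hV V hε (hxε t) (show 0 < e / 4 by positivity)
  have hlim1 := (tendsto_iff_norm_sub_tendsto_zero.1 (hx s)).eventually_lt_const hδ₁
  have hlim2 := (tendsto_iff_norm_sub_tendsto_zero.1 (hx t)).eventually_lt_const hδ₂
  have hlim3 : ∀ᶠ k : ℕ in (𝒰 : Filter ℕ), 1 / ((k : ℝ) + 1) < e / 4 :=
    h𝒰 (tendsto_one_div_add_atTop_nhds_zero_nat.eventually_lt_const (by positivity))
  obtain ⟨k, hk1, hk2, hk3, hk4, hk5, hk6⟩ := (hlim1.and (hlim2.and (hlim3.and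
    ((hdom' |s|).and ((hdom' |t|).and (hxl (e / 4) (by positivity))))))).exists
  have hsk : s ∈ Icc (a k) (b k) := hmemN le_rfl hk4
  have htk : t ∈ Icc (a k) (b k) := hmemN le_rfl hk5
  have r₁ := hs₁ (y k s) (hyε k s hsk) hk1
  have r₂ := hs₂ (y k t) (hyε k t htk) hk2
  have := integral_lag_le_of_near_minimizer (B := A + e / 4 + e / 4) hV hε (hRε k) (hy k) (ha k) (hb k)
    (hya k) (hyb k) (hy0 k) (hyε k) (hlag k) hsk.1 hst.le htk.2 (by
      rcases hcase with h | ⟨h0, h⟩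
      · left
        exact (((h.symm.trans r₁).symm).trans r₂).mono le_rfl
      · right
        exact ⟨h0, ((r₁.symm.trans h).trans r₂).mono le_rfl (by linarith)⟩)
  linarith

end Potential

end AnisotropicKepler

end

/-! ### First variation and the equation of motion. -/

noncomputable section

namespace AnisotropicKepler

section IntegralLemmas

theorem integrable_inner_of_memLp {n : ℕ} {μ : Measure ℝ} {f g : ℝ → Space n} (hf : MemLp f 2 μ)
    (hg : MemLp g 2 μ) : Integrable (fun t => inner ℝ (f t) (g t)) μ := by
  refine (L2.integrable_inner (𝕜 := ℝ) hf.toLp hg.toLp).congr ?_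
  filter_upwards [hf.coeFn_toLp, hg.coeFn_toLp] with t h1 h2
  rw [h1, h2]

theorem integral_primitive_mul {f g : ℝ → ℝ} {p q : ℝ} (hf : IntervalIntegrable f volume p q)
    (hg : IntervalIntegrable g volume p q) :
    ∫ t in p..q, (∫ s in p..t, f s) * g t
      = (∫ t in p..q, f t) * (∫ t in p..q, g t) - ∫ t in p..q, f t * ∫ s in p..t, g s := by
  have h := (hf.absolutelyContinuousOnInterval_intervalIntegral
    left_mem_uIcc).integral_mul_deriv_eq_deriv_mul
      (hg.absolutelyContinuousOnInterval_intervalIntegral left_mem_uIcc)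
  simp only [intervalIntegral.integral_same, mul_zero, sub_zero] at h
  have e1 : ∫ t in p..q, (∫ s in p..t, f s) * g t
      = ∫ t in p..q, (∫ s in p..t, f s) * deriv (fun t => ∫ s in p..t, g s) t := by
    refine intervalIntegral.integral_congr_ae ?_
    filter_upwards [hg.ae_hasDerivAt_integral] with t ht htm
    rw [(ht (uIoc_subset_uIcc htm) p left_mem_uIcc).deriv]
  have e2 : ∫ t in p..q, f t * ∫ s in p..t, g s
      = ∫ t in p..q, deriv (fun t => ∫ s in p..t, f s) t * ∫ s in p..t, g s := by
    refine intervalIntegral.integral_congr_ae ?_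
    filter_upwards [hf.ae_hasDerivAt_integral] with t ht htm
    rw [(ht (uIoc_subset_uIcc htm) p left_mem_uIcc).deriv]
  rw [e1, e2, h]

end IntegralLemmas

namespace Potential

variable {n : ℕ} {ξm ξp : USphere n} {Vmin : ℝ} {V : Potential ξm ξp Vmin}

/-- The gradient of the potential. -/
def grad (V : Potential ξm ξp Vmin) (x : Space n) : Space n :=
  (InnerProductSpace.toDual ℝ (Space n)).symm (fderiv ℝ V.pot x)

theorem inner_grad (x v : Space n) : inner ℝ (V.grad x) v = fderiv ℝ V.pot x v :=
  InnerProductSpace.toDual_symm_apply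

theorem continuousAt_grad {x : Space n} (hx : x ≠ 0) : ContinuousAt V.grad x :=
  (InnerProductSpace.toDual ℝ (Space n)).symm.continuous.continuousAt.comp
    (continuousAt_fderiv_pot hx)

theorem exists_taylor_pot (V : Potential ξm ξp Vmin) {K : Set (Space n)} (hK : IsCompact K) {ρ : ℝ}
    (hρ : 0 < ρ) (hKρ : ∀ y ∈ K, ρ ≤ ‖y‖) {η : ℝ} (hη : 0 < η) :
    ∃ δ > 0, ∀ y ∈ K, ∀ u : Space n, ‖u‖ < δ →
      |V.pot (y + u) - V.pot y - inner ℝ (V.grad y) u| ≤ η * ‖u‖ := by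
  have hne : ∀ y ∈ K, y ≠ 0 := fun y hy => norm_pos_iff.1 (hρ.trans_le (hKρ y hy))
  have huni := hK.uniformContinuousAt_of_continuousAt (fderiv ℝ V.pot)
    (fun y hy => continuousAt_fderiv_pot (hne y hy)) (Metric.dist_mem_uniformity hη)
  obtain ⟨δ, hδ, hδu⟩ := Metric.mem_uniformity_dist.1 huni
  refine ⟨min δ ρ, lt_min hδ hρ, fun y hy u hu => ?_⟩
  have hball : ∀ w ∈ Metric.ball y (min δ ρ), w ≠ 0 := fun w hw => by
    rintro rfl
    rw [Metric.mem_ball, dist_zero_left] at hw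
    exact absurd (hw.trans_le (min_le_right _ _)) (not_lt.2 (hKρ y hy))
  have := (convex_ball y (min δ ρ)).norm_image_sub_le_of_norm_hasFDerivWithin_le'
    (f := V.pot) (φ := fderiv ℝ V.pot y) (C := η) (x := y) (y := y + u)
    (fun w hw => (differentiableAt_pot (hball w hw)).hasFDerivAt.hasFDerivWithinAt)
    (fun w hw => by
      have h1 : dist y w < δ := by
        rw [dist_comm]; exact lt_of_lt_of_le hw (min_le_left _ _)
      have h2 : dist (fderiv ℝ V.pot y) (fderiv ℝ V.pot w) < η := hδu h1 hy
      rw [dist_comm, dist_eq_norm] at h2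
      exact h2.le)
    (Metric.mem_ball_self (lt_min hδ hρ)) (by simpa [mem_ball_iff_norm] using hu)
  rwa [add_sub_cancel_left, ← inner_grad, Real.norm_eq_abs] at this

section EulerLagrange

variable {p q ρ : ℝ} {x : ℝ → Space n}

/-- The first variation of the action at a minimizer. -/
theorem first_variation_nonneg (hV : 0 < Vmin) (hρ : 0 < ρ) (hpq : p ≤ q) (hx : IsH1 p q x)
    (hxρ : ∀ t ∈ Icc p q, ρ < ‖x t‖)
    (hloc : ∀ B, V.Reach ρ (x p) (x q) B → ∫ t in p..q, V.lag x t ≤ B)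
    {κ : ℝ → Space n} (hκ : MemLp κ 2 (volume.restrict (Ioc p q))) (hκ0 : ∫ t in p..q, κ t = 0) :
    0 ≤ ∫ t in p..q,
      (inner ℝ (deriv x t) (κ t) + inner ℝ (V.grad (x t)) (∫ s in p..t, κ s)) := by
  set φ : ℝ → Space n := fun t => ∫ s in p..t, κ s
  have hi : IntervalIntegrable κ volume p q :=
    (intervalIntegrable_iff_integrableOn_Ioc_of_le hpq).2 (hκ.integrable (by norm_num))
  have h0 : ∀ t ∈ Icc p q, x t ≠ 0 := fun t ht => norm_pos_iff.1 (hρ.trans (hxρ t ht))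
  have hφc : ContinuousOn φ (Icc p q) := by
    have := intervalIntegral.continuousOn_primitive_interval' hi (a := p) left_mem_uIcc
    rwa [uIcc_of_le hpq] at this
  obtain ⟨M, hM⟩ := isCompact_Icc.exists_bound_of_continuousOn hφc
  have hM0 : 0 ≤ M := (norm_nonneg _).trans (hM p (left_mem_Icc.2 hpq))
  -- The path stays at a positive distance γ from the constraint, so all small variations are
  -- admissible.
  obtain ⟨γ, hγ, hγx⟩ : ∃ γ > 0, ∀ t ∈ Icc p q, ρ + γ ≤ ‖x t‖ := by
    obtain ⟨t, ht, hmin⟩ := isCompact_Icc.exists_isMinOn (nonempty_Icc.2 hpq) hx.continuousOn.norm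
    refine ⟨‖x t‖ - ρ, sub_pos.2 (hxρ t ht), fun s hs => ?_⟩
    have h1 : ‖x t‖ ≤ ‖x s‖ := hmin hs
    linarith
  have hcomp : IsCompact (x '' Icc p q) := isCompact_Icc.image_of_continuousOn hx.continuousOn
  have hgc : ContinuousOn (fun t => inner ℝ (V.grad (x t)) (φ t)) (Icc p q) :=
    ContinuousOn.inner (fun t ht =>
      (continuousAt_grad (h0 t ht)).comp_continuousWithinAt (hx.continuousOn t ht)) hφc
  have hgi : IntervalIntegrable (fun t => inner ℝ (V.grad (x t)) (φ t)) volume p q := by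
    refine ContinuousOn.intervalIntegrable ?_
    rwa [uIcc_of_le hpq]
  have hvi : IntervalIntegrable (fun t => inner ℝ (deriv x t) (κ t)) volume p q :=
    (intervalIntegrable_iff_integrableOn_Ioc_of_le hpq).2 (integrable_inner_of_memLp hx.1 hκ)
  have hκi : IntervalIntegrable (fun t => ‖κ t‖ ^ 2 / 2) volume p q :=
    (intervalIntegrable_iff_integrableOn_Ioc_of_le hpq).2
      (((memLp_two_iff_integrable_sq_norm hκ.1).1 hκ).div_const 2)
  set a := ∫ t in p..q, (inner ℝ (deriv x t) (κ t) + inner ℝ (V.grad (x t)) (φ t)) with ha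
  set Q := ∫ t in p..q, ‖κ t‖ ^ 2 / 2
  have key : ∀ η > 0, ∀ᶠ s in 𝓝[>] (0 : ℝ), 0 ≤ a + s * Q + η * M * (q - p) := by
    intro η hη
    obtain ⟨δ, hδ, htay⟩ := V.exists_taylor_pot hcomp hρ
      (by rintro _ ⟨t, ht, rfl⟩; exact (hxρ t ht).le) hη
    have hsm : ∀ᶠ s in 𝓝[>] (0 : ℝ), s * M < min γ δ := by
      have : Tendsto (fun s : ℝ => s * M) (𝓝[>] 0) (𝓝 (0 * M)) :=
        ((by fun_prop : Continuous fun s : ℝ => s * M).tendsto 0).mono_left nhdsWithin_le_nhds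
      exact this.eventually_lt_const (by rw [zero_mul]; exact lt_min hγ hδ)
    filter_upwards [hsm, self_mem_nhdsWithin] with s hs hs0
    have hs0' : 0 < s := hs0
    have hsφ : ∀ t ∈ Icc p q, ‖s • φ t‖ ≤ s * M := fun t ht => by
      rw [norm_smul, Real.norm_eq_abs, abs_of_pos hs0']
      exact mul_le_mul_of_nonneg_left (hM t ht) hs0'.le
    set z : ℝ → Space n := fun t => x t + s • φ t
    have hmem : MemLp (fun t => deriv x t + s • κ t) 2 (volume.restrict (Ioc p q)) :=
      hx.1.add (hκ.const_smul s)
    obtain ⟨hz, hzd⟩ := IsH1.of_sub_eq_integral (x := z) hpq hmem fun t ht => by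
      have hsub : uIcc p t ⊆ uIcc p q := by
        rw [uIcc_of_le hpq, uIcc_of_le ht.1]; exact Icc_subset_Icc_right ht.2
      rw [intervalIntegral.integral_add ((hx.intervalIntegrable hpq).mono_set hsub)
        (show IntervalIntegrable (fun t => s • κ t) volume p t from (hi.mono_set hsub).smul s),
        intervalIntegral.integral_smul,
        ← hx.sub_eq (left_mem_Icc.2 hpq) ht]
      simp only [z, φ, intervalIntegral.integral_same, smul_zero]
      abel
    have hzρ : ∀ t ∈ Icc p q, ρ ≤ ‖z t‖ := fun t ht => by
      have h1 := norm_sub_norm_le (x t) (-(s • φ t))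
      rw [norm_neg, sub_neg_eq_add] at h1
      have h2 := hγx t ht
      have h3 := hsφ t ht
      have h4 := hs.trans_le (min_le_left γ δ)
      simp only [z]
      linarith
    have hz0 : ∀ t ∈ Icc p q, z t ≠ 0 := fun t ht => norm_pos_iff.1 (hρ.trans_le (hzρ t ht))
    have hmin := hloc _ (by
      have := Reach.of_path_lag (V := V) hV hρ hpq hz hzρ
      have e1 : z p = x p := by simp [z, φ]
      have e2 : z q = x q := by simp only [z, φ, hκ0, smul_zero, add_zero]
      rwa [e1, e2] at this)
    have hle : ∫ t in p..q, V.lag z t ≤ ∫ t in p..q, (V.lag x t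
        + (s * (inner ℝ (deriv x t) (κ t) + inner ℝ (V.grad (x t)) (φ t))
          + (s ^ 2 * (‖κ t‖ ^ 2 / 2) + η * (s * M)))) := by
      refine intervalIntegral.integral_mono_ae_restrict hpq (intervalIntegrable_lag hpq hz hz0)
        ((intervalIntegrable_lag hpq hx h0).add (((hvi.add hgi).const_mul s).add
          ((hκi.const_mul _).add intervalIntegrable_const))) ?_
      have hzd' : deriv z =ᵐ[volume.restrict (Icc p q)] fun t => deriv x t + s • κ t := by
        rwa [Measure.restrict_congr_set Ioc_ae_eq_Icc] at hzd
      filter_upwards [hzd', ae_restrict_mem measurableSet_Icc] with t ht htm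
      have h1 := htay (x t) ⟨t, htm, rfl⟩ (s • φ t)
        ((hsφ t htm).trans_lt (hs.trans_le (min_le_right _ _)))
      have h2 := (abs_le.1 h1).2
      have h3 : η * ‖s • φ t‖ ≤ η * (s * M) := mul_le_mul_of_nonneg_left (hsφ t htm) hη.le
      rw [real_inner_smul_right] at h2
      have h4 : ‖deriv x t + s • κ t‖ ^ 2 = ‖deriv x t‖ ^ 2 + 2 * (s * inner ℝ (deriv x t) (κ t))
          + s ^ 2 * ‖κ t‖ ^ 2 := by
        rw [norm_add_sq_real, real_inner_smul_right, norm_smul, Real.norm_eq_abs, mul_pow, sq_abs]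
      simp only [lag, ht, h4, z]
      linarith
    rw [intervalIntegral.integral_add (intervalIntegrable_lag hpq hx h0)
        (((hvi.add hgi).const_mul s).add ((hκi.const_mul _).add intervalIntegrable_const)),
      intervalIntegral.integral_add ((hvi.add hgi).const_mul s)
        ((hκi.const_mul _).add intervalIntegrable_const),
      intervalIntegral.integral_add (hκi.const_mul _) intervalIntegrable_const,
      intervalIntegral.integral_const_mul, intervalIntegral.integral_const_mul,
      intervalIntegral.integral_const, smul_eq_mul] at hle
    have hfin : 0 ≤ s * (a + s * Q + η * M * (q - p)) := by
      have : s * (a + s * Q + η * M * (q - p))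
          = s * a + (s ^ 2 * Q + (q - p) * (η * (s * M))) := by ring
      rw [this]
      linarith
    exact nonneg_of_mul_nonneg_right hfin hs0'
  have key2 : ∀ η > 0, 0 ≤ a + η * M * (q - p) := fun η hη => by
    have hlim : Tendsto (fun s : ℝ => a + s * Q + η * M * (q - p)) (𝓝[>] 0)
        (𝓝 (a + 0 * Q + η * M * (q - p))) :=
      ((by fun_prop : Continuous fun s : ℝ => a + s * Q + η * M * (q - p)).tendsto 0).mono_left
        nhdsWithin_le_nhds
    have := ge_of_tendsto hlim (key η hη)
    linarith
  have hlim : Tendsto (fun η : ℝ => a + η * M * (q - p)) (𝓝[>] 0) (𝓝 (a + 0 * M * (q - p))) :=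
    ((by fun_prop : Continuous fun η : ℝ => a + η * M * (q - p)).tendsto 0).mono_left
      nhdsWithin_le_nhds
  have := ge_of_tendsto hlim (eventually_nhdsWithin_of_forall fun η hη => key2 η hη)
  linarith

/-- Minimizers are twice differentiable off the constraint, and solve the equation of motion. -/
theorem exists_eulerLagrange (hV : 0 < Vmin) (hρ : 0 < ρ) (hpq : p < q) (hx : IsH1 p q x)
    (hxρ : ∀ t ∈ Icc p q, ρ < ‖x t‖)
    (hloc : ∀ B, V.Reach ρ (x p) (x q) B → ∫ t in p..q, V.lag x t ≤ B) :
    ∃ w : ℝ → Space n, ∀ t ∈ Ioo p q, HasDerivAt x (w t) t ∧ HasDerivAt w (V.grad (x t)) t := by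
  have h0 : ∀ t ∈ Icc p q, x t ≠ 0 := fun t ht => norm_pos_iff.1 (hρ.trans (hxρ t ht))
  have hgc : ContinuousOn (fun t => V.grad (x t)) (Icc p q) := fun t ht =>
    (continuousAt_grad (h0 t ht)).comp_continuousWithinAt (hx.continuousOn t ht)
  have hgi : IntervalIntegrable (fun t => V.grad (x t)) volume p q := by
    refine ContinuousOn.intervalIntegrable ?_
    rwa [uIcc_of_le hpq.le]
  set G : ℝ → Space n := fun t => ∫ s in p..t, V.grad (x s)
  have hGd : ∀ t ∈ Ioo p q, HasDerivAt G (V.grad (x t)) t := fun t ht => by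
    have hsub : uIcc p t ⊆ uIcc p q := by
      rw [uIcc_of_le hpq.le, uIcc_of_le ht.1.le]; exact Icc_subset_Icc_right ht.2.le
    refine intervalIntegral.integral_hasDerivAt_right (hgi.mono_set hsub) ?_
      (hgc.continuousAt (Icc_mem_nhds ht.1 ht.2))
    exact (hgc.mono Ioo_subset_Icc_self).stronglyMeasurableAtFilter isOpen_Ioo t ht
  have hGc : ContinuousOn G (Icc p q) := by
    have := intervalIntegral.continuousOn_primitive_interval' hgi (a := p) left_mem_uIcc
    rwa [uIcc_of_le hpq.le] at this
  have hGi : IntervalIntegrable G volume p q := by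
    refine ContinuousOn.intervalIntegrable ?_
    rwa [uIcc_of_le hpq.le]
  have hvi := hx.intervalIntegrable hpq.le
  set m : Space n := (q - p)⁻¹ • ∫ t in p..q, (deriv x t - G t)
  have hqp : q - p ≠ 0 := by linarith
  have hGL : MemLp G 2 (volume.restrict (Ioc p q)) := by
    obtain ⟨M, hM⟩ := isCompact_Icc.exists_bound_of_continuousOn hGc
    refine MemLp.of_bound ((hGc.mono Ioc_subset_Icc_self).aestronglyMeasurable measurableSet_Ioc) M ?_
    filter_upwards [ae_restrict_mem measurableSet_Ioc] with t ht using hM t (Ioc_subset_Icc_self ht)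
  -- The argument of du Bois-Reymond: r is the difference between the velocity and the primitive of
  -- the force, minus its mean, and is to be shown to vanish almost everywhere.
  set r : ℝ → Space n := fun t => deriv x t - G t - m
  have hr : MemLp r 2 (volume.restrict (Ioc p q)) := (hx.1.sub hGL).sub (memLp_const m)
  have hri : IntervalIntegrable r volume p q := (hvi.sub hGi).sub intervalIntegrable_const
  have hr0 : ∫ t in p..q, r t = 0 := by
    simp only [r]
    rw [intervalIntegral.integral_sub (hvi.sub hGi) intervalIntegrable_const,
      intervalIntegral.integral_const, smul_smul, mul_inv_cancel₀ hqp, one_smul, sub_self]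
  have hzero : ∀ e : Space n, (fun t => inner ℝ (r t) e) =ᵐ[volume.restrict (Ioc p q)] 0 := by
    intro e
    set k : ℝ → ℝ := fun t => inner ℝ (r t) e
    have hinner : ∀ {f : ℝ → Space n} {a b : ℝ}, IntervalIntegrable f volume a b →
        ∫ t in a..b, inner ℝ (f t) e = inner ℝ (∫ t in a..b, f t) e := fun {f a b} hf => by
      have := (innerSL ℝ e).intervalIntegral_comp_comm hf
      simp only [innerSL_apply_apply] at this
      simp only [real_inner_comm e]
      exact this
    have hkL : MemLp k 2 (volume.restrict (Ioc p q)) := hr.inner_const e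
    have hki : IntervalIntegrable k volume p q :=
      (intervalIntegrable_iff_integrableOn_Ioc_of_le hpq.le).2 (hkL.integrable (by norm_num))
    have hk0 : ∫ t in p..q, k t = 0 := by rw [hinner hri, hr0, inner_zero_left]
    -- The variation is built from the component of r itself; its mean is zero, so it fixes the end
    -- points. After integration by parts the inequality says that the integral of k² is at most 0.
    have hvar := first_variation_nonneg (κ := fun t => -k t • e) hV hρ hpq.le hx hxρ hloc
      ((ContinuousLinearMap.toSpanSingleton ℝ e).comp_memLp' hkL.neg) (by
        rw [intervalIntegral.integral_smul_const, intervalIntegral.integral_neg, hk0, neg_zero,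
          zero_smul])
    have hge : IntervalIntegrable (fun t => inner ℝ (V.grad (x t)) e) volume p q := by
      refine ContinuousOn.intervalIntegrable ?_
      rw [uIcc_of_le hpq.le]
      exact hgc.inner continuousOn_const
    have hIBP := integral_primitive_mul hge hki
    rw [hk0, mul_zero, zero_sub] at hIBP
    have hsub : ∀ t ∈ Icc p q, uIcc p t ⊆ uIcc p q := fun t ht => by
      rw [uIcc_of_le hpq.le, uIcc_of_le ht.1]; exact Icc_subset_Icc_right ht.2
    have e1 : ∫ t in p..q, (∫ s in p..t, inner ℝ (V.grad (x s)) e) * k t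
        = ∫ t in p..q, inner ℝ (G t) e * k t := by
      refine intervalIntegral.integral_congr fun t ht => ?_
      rw [uIcc_of_le hpq.le] at ht
      simp only [hinner (hgi.mono_set (hsub t ht)), G]
    rw [e1] at hIBP
    have hψc : ContinuousOn (fun t => ∫ s in p..t, k s) (Icc p q) := by
      have := intervalIntegral.continuousOn_primitive_interval' hki (a := p) left_mem_uIcc
      rwa [uIcc_of_le hpq.le] at this
    have i1 : IntervalIntegrable (fun t => inner ℝ (V.grad (x t)) e * ∫ s in p..t, k s) volume p q := by
      refine ContinuousOn.intervalIntegrable ?_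
      rw [uIcc_of_le hpq.le]
      exact (hgc.inner continuousOn_const).mul hψc
    have i2 : IntervalIntegrable (fun t => inner ℝ (deriv x t) e * k t) volume p q :=
      (intervalIntegrable_iff_integrableOn_Ioc_of_le hpq.le).2
        ((hx.1.inner_const e).integrable_mul hkL)
    have i3 : IntervalIntegrable (fun t => inner ℝ (G t) e * k t) volume p q :=
      (intervalIntegrable_iff_integrableOn_Ioc_of_le hpq.le).2
        ((hGL.inner_const e).integrable_mul hkL)
    have e2 : ∫ t in p..q, (inner ℝ (deriv x t) (-k t • e)
          + inner ℝ (V.grad (x t)) (∫ s in p..t, -k s • e))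
        = -((∫ t in p..q, inner ℝ (deriv x t) e * k t)
          + ∫ t in p..q, inner ℝ (V.grad (x t)) e * ∫ s in p..t, k s) := by
      rw [← intervalIntegral.integral_add i2 i1, ← intervalIntegral.integral_neg]
      refine intervalIntegral.integral_congr fun t _ => ?_
      simp only [intervalIntegral.integral_smul_const, intervalIntegral.integral_neg,
        real_inner_smul_right]
      ring
    rw [e2] at hvar
    have e3 : ∫ t in p..q, k t ^ 2 = (∫ t in p..q, inner ℝ (deriv x t) e * k t)
        - (∫ t in p..q, inner ℝ (G t) e * k t) - inner ℝ m e * ∫ t in p..q, k t := by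
      rw [← intervalIntegral.integral_const_mul, ← intervalIntegral.integral_sub i2 i3,
        ← intervalIntegral.integral_sub (i2.sub i3) (hki.const_mul _)]
      refine intervalIntegral.integral_congr fun t _ => ?_
      simp only [k, r, inner_sub_left]
      ring
    have hk2 : ∫ t in p..q, k t ^ 2 = 0 := by
      refine le_antisymm ?_ (intervalIntegral.integral_nonneg hpq.le fun t _ => sq_nonneg _)
      rw [e3, hk0, mul_zero]
      linarith
    rw [intervalIntegral.integral_eq_zero_iff_of_le_of_nonneg_ae hpq.le
      (Eventually.of_forall fun t => sq_nonneg _)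
      ((intervalIntegrable_iff_integrableOn_Ioc_of_le hpq.le).2 hkL.integrable_sq)] at hk2
    filter_upwards [hk2] with t ht
    exact pow_eq_zero_iff two_ne_zero |>.1 ht
  set w : ℝ → Space n := fun t => G t + m
  have hwc : ContinuousOn w (Icc p q) := hGc.add continuousOn_const
  have hwi : IntervalIntegrable w volume p q := hGi.add intervalIntegrable_const
  have hxw : ∀ t ∈ Icc p q, x t = x p + ∫ s in p..t, w s := fun t ht => by
    have hsub : uIcc p t ⊆ uIcc p q := by
      rw [uIcc_of_le hpq.le, uIcc_of_le ht.1]; exact Icc_subset_Icc_right ht.2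
    have h1 : ∫ s in p..t, r s = 0 := by
      refine ext_inner_left ℝ fun e => ?_
      have := (innerSL ℝ e).intervalIntegral_comp_comm (hri.mono_set hsub)
      simp only [innerSL_apply_apply] at this
      rw [← this, inner_zero_right, intervalIntegral.integral_of_le ht.1]
      refine integral_eq_zero_of_ae ?_
      filter_upwards [ae_restrict_of_ae_restrict_of_subset (Ioc_subset_Ioc_right ht.2) (hzero e)]
        with s hs
      rw [real_inner_comm]
      exact hs
    have h2 : ∫ s in p..t, r s = (∫ s in p..t, deriv x s) - ∫ s in p..t, w s := by
      rw [← intervalIntegral.integral_sub (hvi.mono_set hsub) (hwi.mono_set hsub)]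
      refine intervalIntegral.integral_congr fun s _ => ?_
      simp only [r, w]; abel
    rw [h1, ← hx.sub_eq (left_mem_Icc.2 hpq.le) ht] at h2
    rw [← sub_eq_zero, h2]; abel
  refine ⟨w, fun t ht => ⟨?_, ?_⟩⟩
  · have hsub : uIcc p t ⊆ uIcc p q := by
      rw [uIcc_of_le hpq.le, uIcc_of_le ht.1.le]; exact Icc_subset_Icc_right ht.2.le
    have h1 := intervalIntegral.integral_hasDerivAt_right (hwi.mono_set hsub)
      ((hwc.mono Ioo_subset_Icc_self).stronglyMeasurableAtFilter isOpen_Ioo t ht)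
      (hwc.continuousAt (Icc_mem_nhds ht.1 ht.2))
    refine (h1.const_add (x p)).congr_of_eventuallyEq ?_
    filter_upwards [Icc_mem_nhds ht.1 ht.2] with s hs using hxw s hs
  · exact (hGd t ht).add_const m

end EulerLagrange

end Potential

end AnisotropicKepler

end

/-! ### Minimality, smoothness and energy of Morse minimizers. -/

noncomputable section

namespace AnisotropicKepler

namespace Potential

variable {n : ℕ} {ξm ξp : USphere n} {Vmin : ℝ} {V : Potential ξm ξp Vmin} {ε : ℝ} {x : ℝ → Space n}

theorem integral_lag_const (y : Space n) (τ : ℝ) :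
    ∫ t in (0 : ℝ)..τ, V.lag (fun _ => y) t = τ * V.pot y := by
  simp [lag]

theorem isH1_of_forall_lt (h : ∀ a b : ℝ, a < b → IsH1 a b x) (a b : ℝ) : IsH1 a b x :=
  (h (min a b - 1) (max a b + 1) (by have := min_le_max (a := a) (b := b); linarith)).mono
    (by have := min_le_left a b; linarith) (by have := le_max_right a b; linarith)

theorem continuous_of_forall_isH1 (h : ∀ a b : ℝ, a < b → IsH1 a b x) : Continuous x :=
  continuous_iff_continuousAt.2 fun t =>
    (isH1_of_forall_lt h (t - 1) (t + 1)).continuousOn.continuousAt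
      (Icc_mem_nhds (by linarith) (by linarith))

theorem lag_pos (hV : 0 < Vmin) {t : ℝ} (ht : x t ≠ 0) : 0 < V.lag x t := by
  have h1 := pot_pos (V := V) hV ht
  have h2 : 0 ≤ ‖deriv x t‖ ^ 2 / 2 := by positivity
  simp only [lag]
  linarith

/-- Passage from local descriptions of the velocity to `deriv`. -/
theorem hasDerivAt_of_exists {p q : ℝ}
    (h : ∃ w : ℝ → Space n, ∀ t ∈ Ioo p q, HasDerivAt x (w t) t ∧ HasDerivAt w (V.grad (x t)) t)
    {t : ℝ} (ht : t ∈ Ioo p q) :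
    HasDerivAt x (deriv x t) t ∧ HasDerivAt (deriv x) (V.grad (x t)) t := by
  obtain ⟨w, hw⟩ := h
  refine ⟨(hw t ht).1.differentiableAt.hasDerivAt, (hw t ht).2.congr_of_eventuallyEq ?_⟩
  filter_upwards [Ioo_mem_nhds ht.1 ht.2] with s hs using (hw s hs).1.deriv

namespace IsConstrainedMorse

theorem isH1 (h : V.IsConstrainedMorse ε x) (a b : ℝ) : IsH1 a b x := isH1_of_forall_lt h.h1 a b

theorem continuous (h : V.IsConstrainedMorse ε x) : Continuous x := continuous_of_forall_isH1 h.h1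

theorem le_norm (h : V.IsConstrainedMorse ε x) (t : ℝ) : ε ≤ ‖x t‖ := h.min_eq.2 ⟨t, mem_univ _, rfl⟩

theorem ne_zero (h : V.IsConstrainedMorse ε x) (hε : 0 < ε) (t : ℝ) : x t ≠ 0 :=
  norm_pos_iff.1 (hε.trans_le (h.le_norm t))

theorem exists_contact (h : V.IsConstrainedMorse ε x) : ∃ t, ‖x t‖ = ε := by
  obtain ⟨t, -, ht⟩ := h.min_eq.1
  exact ⟨t, ht⟩

theorem integral_lag_le (hV : 0 < Vmin) (hε : 0 < ε) (h : V.IsConstrainedMorse ε x)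
    {p q p' q' ρ : ℝ} {z : ℝ → Space n} (hpq : p < q) (hpq' : p' < q') (hz : IsH1 p' q' z)
    (hp : z p' = x p) (hq : z q' = x q) (hzρ : HasMinNorm z (Icc p' q') ρ)
    (hxρ : HasMinNorm x (Icc p q) ρ) :
    ∫ t in p..q, V.lag x t ≤ ∫ t in p'..q', V.lag z t := by
  have h1 := h.minimal p q p' q' z hpq hpq' hz hp hq ⟨ρ, hzρ, hxρ⟩
  have hρ : 0 < ρ := by
    obtain ⟨t, -, ht⟩ := hxρ.1
    rw [← ht]; exact hε.trans_le (h.le_norm t)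
  rw [action_eq hV hpq.le (h.isH1 p q) fun t _ => h.ne_zero hε t,
    action_eq hV hpq'.le hz fun t ht => norm_pos_iff.1 (hρ.trans_le (hzρ.2 ⟨t, ht, rfl⟩)),
    ENNReal.ofReal_le_ofReal_iff (integral_lag_nonneg hV hpq'.le)] at h1
  exact h1

theorem integral_lag_le_of_cross (hV : 0 < Vmin) (hε : 0 < ε) (h : V.IsConstrainedMorse ε x)
    {p q t₀ B : ℝ} (hpq : p < q) (ht₀ : t₀ ∈ Icc p q) (hc : ‖x t₀‖ = ε)
    (hB : V.Cross ε (x p) (x q) B) : ∫ t in p..q, V.lag x t ≤ B := by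
  have hxmin : HasMinNorm x (Icc p q) ε :=
    ⟨⟨t₀, ht₀, hc⟩, by rintro _ ⟨t, -, rfl⟩; exact h.le_norm t⟩
  obtain ⟨T, hT, z, hz, z0, zT, hmin, hact⟩ := hB.exists_path
  rcases hT.eq_or_lt with hT0 | hT0
  -- Paths of zero duration are not admissible competitors; a constant path of duration τ tending to
  -- 0 takes their place.
  · rw [← hT0] at zT hmin
    have hzε : ‖z 0‖ = ε := by
      obtain ⟨⟨t, ht, hte⟩, -⟩ := hmin
      rw [Icc_self, mem_singleton_iff] at ht
      rw [← ht]; exact hte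
    have key : ∀ τ > 0, ∫ t in p..q, V.lag x t ≤ τ * V.pot (z 0) := fun τ hτ => by
      rw [← integral_lag_const]
      refine h.integral_lag_le (ρ := ε) hV hε hpq hτ ?_ z0 zT ?_ hxmin
      · exact IsH1.of_hasDerivAt (x' := fun _ => 0) (fun t _ => hasDerivAt_const t _)
          continuousOn_const
      · exact ⟨⟨0, ⟨le_rfl, hτ.le⟩, hzε⟩, by rintro _ ⟨t, -, rfl⟩; exact hzε.ge⟩
    have hlim : Tendsto (fun τ : ℝ => τ * V.pot (z 0)) (𝓝[>] 0) (𝓝 (0 * V.pot (z 0))) :=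
      ((by fun_prop : Continuous fun τ : ℝ => τ * V.pot (z 0)).tendsto 0).mono_left
        nhdsWithin_le_nhds
    have := ge_of_tendsto hlim (eventually_nhdsWithin_of_forall fun τ hτ => key τ hτ)
    have := hB.nonneg
    linarith
  · have h1 := h.integral_lag_le hV hε hpq hT0 hz z0 zT hmin hxmin
    rw [action_eq hV hT hz fun t ht => norm_pos_iff.1 (hε.trans_le (hmin.2 ⟨t, ht, rfl⟩)),
      ENNReal.ofReal_le_ofReal_iff hB.nonneg] at hact
    exact h1.trans hact

theorem reach (hV : 0 < Vmin) (hε : 0 < ε) (h : V.IsConstrainedMorse ε x) {p q : ℝ} (hpq : p ≤ q) :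
    V.Reach ε (x p) (x q) (∫ t in p..q, V.lag x t) :=
  Reach.of_path_lag hV hε hpq (h.isH1 p q) fun t _ => h.le_norm t

theorem integral_add (hε : 0 < ε) (h : V.IsConstrainedMorse ε x) {a b c : ℝ} (hab : a ≤ b)
    (hbc : b ≤ c) :
    (∫ t in a..c, V.lag x t) = (∫ t in a..b, V.lag x t) + ∫ t in b..c, V.lag x t :=
  integral_lag_add hab hbc (h.isH1 a c) fun t _ => h.ne_zero hε t

/-- When a contact time lies outside the open interval, the interval is enlarged up to it. The
enlarged competitor keeps that contact, so on the smaller interval every path outside the ball may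
compete. -/
theorem integral_lag_le_of_reach (hV : 0 < Vmin) (hε : 0 < ε) (h : V.IsConstrainedMorse ε x)
    {p q t₀ B : ℝ} (hpq : p < q) (ht₀ : t₀ ∉ Ioo p q) (hc : ‖x t₀‖ = ε)
    (hB : V.Reach ε (x p) (x q) B) : ∫ t in p..q, V.lag x t ≤ B := by
  rw [mem_Ioo, not_and_or, not_lt, not_lt] at ht₀
  rcases ht₀ with ht | ht
  · have := h.integral_lag_le_of_cross hV hε (ht.trans_lt hpq) ⟨le_rfl, ht.trans hpq.le⟩ hc
      ⟨x t₀, 0, _, hc, Reach.refl hc.ge, (h.reach hV hε ht).trans hB, (zero_add _).le⟩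
    have h2 := h.integral_add hε ht hpq.le
    linarith
  · have := h.integral_lag_le_of_cross hV hε (hpq.trans_le ht) ⟨hpq.le.trans ht, le_rfl⟩ hc
      ⟨x t₀, _, 0, hc, hB.trans (h.reach hV hε ht), Reach.refl hc.ge, (add_zero _).le⟩
    have h2 := h.integral_add hε hpq.le ht
    linarith

theorem hasDerivAt (hV : 0 < Vmin) (hε : 0 < ε) (h : V.IsConstrainedMorse ε x) {t : ℝ}
    (ht : ε < ‖x t‖) :
    HasDerivAt x (deriv x t) t ∧ HasDerivAt (deriv x) (V.grad (x t)) t := by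
  have hopen : IsOpen {s | ε < ‖x s‖} := isOpen_lt continuous_const h.continuous.norm
  obtain ⟨r, hr, hball⟩ := Metric.isOpen_iff.1 hopen t ht
  have hsub : ∀ s ∈ Icc (t - r / 2) (t + r / 2), ε < ‖x s‖ := fun s hs => by
    refine hball ?_
    rw [Metric.mem_ball, Real.dist_eq, abs_lt]
    constructor <;> linarith [hs.1, hs.2]
  obtain ⟨t₀, ht₀⟩ := h.exists_contact
  refine hasDerivAt_of_exists (p := t - r / 2) (q := t + r / 2) ?_ ⟨by linarith, by linarith⟩
  refine exists_eulerLagrange hV hε (by linarith) (h.isH1 _ _) hsub fun B hB =>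
    h.integral_lag_le_of_reach hV hε (by linarith) (fun hmem => ?_) ht₀ hB
  exact absurd (hsub t₀ (Ioo_subset_Icc_self hmem)) (not_lt.2 ht₀.le)

theorem exists_hasMinNorm (h : V.IsConstrainedMorse ε x) {p q : ℝ} (hpq : p ≤ q) :
    ∃ ρ, HasMinNorm x (Icc p q) ρ :=
  (isCompact_Icc.image_of_continuousOn h.continuous.norm.continuousOn).exists_isLeast
    ((nonempty_Icc.2 hpq).image _)

/-- The path x(l t) has the same trace, hence the same minimal distance, and action lK + P/l.
Minimality at l = 1 forces K = P, on every interval and even across the contact set. -/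
theorem integral_kinetic_eq (hV : 0 < Vmin) (hε : 0 < ε) (h : V.IsConstrainedMorse ε x) {p q : ℝ}
    (hpq : p < q) : ∫ t in p..q, ‖deriv x t‖ ^ 2 / 2 = ∫ t in p..q, V.pot (x t) := by
  obtain ⟨ρ, hρ⟩ := h.exists_hasMinNorm hpq.le
  have hki := (h.isH1 p q).intervalIntegrable_kinetic hpq.le
  have hpi : IntervalIntegrable (fun t => V.pot (x t)) volume p q :=
    (intervalIntegrable_iff_integrableOn_Ioc_of_le hpq.le).2
      (integrableOn_pot (h.isH1 p q) fun t _ => h.ne_zero hε t)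
  set K := ∫ t in p..q, ‖deriv x t‖ ^ 2 / 2
  set P := ∫ t in p..q, V.pot (x t)
  have hKP : ∫ t in p..q, V.lag x t = K + P := intervalIntegral.integral_add hki hpi
  have key : ∀ l > 0, K + P ≤ l * K + l⁻¹ * P := fun l hl => by
    have e : ∀ r, l * (r / l) = r := fun r => by field_simp
    have hmap := preimage_affine_of_pos (h := 0) hl (p / l) (q / l)
    simp only [e, add_zero] at hmap
    have hz : IsH1 (p / l) (q / l) fun t => x (l * t) := by
      simpa using (h.isH1 p q).affine (h := 0) hl.ne' (by simpa only [add_zero] using hmap) 1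
    have himg : (fun t => ‖x (l * t)‖) '' Icc (p / l) (q / l) = (fun t => ‖x t‖) '' Icc p q := by
      ext v
      constructor
      · rintro ⟨t, ht, rfl⟩
        rw [← hmap] at ht
        exact ⟨l * t, ht, rfl⟩
      · rintro ⟨t, ht, rfl⟩
        refine ⟨t / l, ?_, by simp only [e]⟩
        rw [← hmap, mem_preimage, e]
        exact ht
    have h1 := h.integral_lag_le hV hε hpq (div_lt_div_of_pos_right hpq hl) hz (by simp only [e])
      (by simp only [e]) (show HasMinNorm (fun t => x (l * t)) (Icc (p / l) (q / l)) ρ by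
        unfold HasMinNorm; rw [himg]; exact hρ) hρ
    have h2 : ∀ t, V.lag (fun t => x (l * t)) t
        = (fun s => l ^ 2 * (‖deriv x s‖ ^ 2 / 2) + V.pot (x s)) (l * t) := fun t => by
      simp only [lag, deriv_comp_mul_left, norm_smul, Real.norm_eq_abs, mul_pow, sq_abs]
      ring
    simp only [h2] at h1
    rw [intervalIntegral.integral_comp_mul_left
      (fun s => l ^ 2 * (‖deriv x s‖ ^ 2 / 2) + V.pot (x s)) hl.ne', e, e,
      intervalIntegral.integral_add (hki.const_mul _) hpi, intervalIntegral.integral_const_mul,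
      hKP, smul_eq_mul] at h1
    refine h1.trans (le_of_eq ?_)
    simp only [K, P]
    field_simp
  have hK : 0 ≤ K := IsH1.integral_kinetic_nonneg hpq.le
  -- With l = 1 + s the inequality becomes s(P - K) ≤ s²K; dividing by small s of either sign gives
  -- equality.
  have key2 : ∀ s : ℝ, -1 < s → s * (P - K) ≤ s ^ 2 * K := fun s hs => by
    have hs1 : 0 < 1 + s := by linarith
    have h1 := mul_le_mul_of_nonneg_left (key (1 + s) hs1) hs1.le
    have h2 : (1 + s) * ((1 + s) * K + (1 + s)⁻¹ * P) = (1 + s) ^ 2 * K + P := by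
      field_simp
    rw [h2] at h1
    nlinarith
  have hlim : ∀ c : ℝ, Tendsto (fun s : ℝ => s * c) (𝓝[>] 0) (𝓝 (0 * c)) := fun c =>
    ((by fun_prop : Continuous fun s : ℝ => s * c).tendsto 0).mono_left nhdsWithin_le_nhds
  have u1 : P - K ≤ 0 := by
    have := ge_of_tendsto (hlim K) (b := P - K) (by
      filter_upwards [self_mem_nhdsWithin] with s hs
      have hs' : (0 : ℝ) < s := hs
      have := key2 s (by linarith)
      rw [sq, mul_assoc] at this
      exact le_of_mul_le_mul_left this hs')
    linarith
  have u2 : K - P ≤ 0 := by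
    have := ge_of_tendsto (hlim K) (b := K - P) (by
      filter_upwards [Ioo_mem_nhdsGT (zero_lt_one' ℝ)] with s hs
      have := key2 (-s) (by linarith [hs.2])
      have h3 : s * (K - P) ≤ s * (s * K) := by linarith [sq s]
      exact le_of_mul_le_mul_left h3 hs.1)
    linarith
  linarith

/-- Conservation of energy, at the energy zero. -/
theorem norm_deriv_sq (hV : 0 < Vmin) (hε : 0 < ε) (h : V.IsConstrainedMorse ε x) {t : ℝ}
    (hc : ∀ᶠ s in 𝓝 t, ContinuousAt (deriv x) s) : ‖deriv x t‖ ^ 2 = 2 * V.pot (x t) := by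
  set f : ℝ → ℝ := fun s => ‖deriv x s‖ ^ 2 / 2 - V.pot (x s)
  have hpc : Continuous fun s => V.pot (x s) := continuous_iff_continuousAt.2 fun s =>
    (continuousAt_pot (h.ne_zero hε s)).comp h.continuous.continuousAt
  obtain ⟨r, hr, hball⟩ := Metric.eventually_nhds_iff_ball.1 hc
  have hfc : ContinuousOn f (Metric.ball t r) := fun s hs =>
    ((((hball s hs).norm.pow 2).div_const 2).sub hpc.continuousAt).continuousWithinAt
  have hzero : ∀ s, t - 1 < s → ∫ u in (t - 1)..s, f u = 0 := fun s hs => by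
    rw [intervalIntegral.integral_sub ((h.isH1 _ _).intervalIntegrable_kinetic hs.le)
      (hpc.intervalIntegrable _ _), h.integral_kinetic_eq hV hε hs, sub_self]
  have hfi : IntervalIntegrable f volume (t - 1) t :=
    ((h.isH1 _ _).intervalIntegrable_kinetic (by linarith)).sub (hpc.intervalIntegrable _ _)
  have hmem : t ∈ Metric.ball t r := Metric.mem_ball_self hr
  have h1 := intervalIntegral.integral_hasDerivAt_right hfi
    (hfc.stronglyMeasurableAtFilter Metric.isOpen_ball t hmem)
    (hfc.continuousAt (Metric.isOpen_ball.mem_nhds hmem))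
  have h2 : HasDerivAt (fun s => ∫ u in (t - 1)..s, f u) 0 t := by
    refine (hasDerivAt_const t (0 : ℝ)).congr_of_eventuallyEq ?_
    filter_upwards [Ioi_mem_nhds (show t - 1 < t by linarith)] with s hs using hzero s hs
  have h3 := h1.unique h2
  simp only [f] at h3
  linarith

theorem norm_deriv_sq_of_lt (hV : 0 < Vmin) (hε : 0 < ε) (h : V.IsConstrainedMorse ε x) {t : ℝ}
    (ht : ε < ‖x t‖) : ‖deriv x t‖ ^ 2 = 2 * V.pot (x t) := by
  refine h.norm_deriv_sq hV hε ?_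
  have hopen : IsOpen {s | ε < ‖x s‖} := isOpen_lt continuous_const h.continuous.norm
  filter_upwards [hopen.mem_nhds ht] with s hs using (h.hasDerivAt hV hε hs).2.continuousAt

end IsConstrainedMorse

namespace IsFreeMorse

theorem isConstrainedMorse (h : V.IsFreeMorse x) {ρ : ℝ} (hρ : HasMinNorm x univ ρ) :
    V.IsConstrainedMorse ρ x where
  h1 := h.h1
  min_eq := hρ
  asymptotics := h.asymptotics
  minimal a b a' b' z hab hab' hz h1 h2 _ := h.minimal a b a' b' z hab hab' hz h1 h2

/-- Without the constraint any positive radius ρ may be used, even below the minimal distance of the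
path; taking half of that distance gives the equation of motion at all times, the contact included.
-/
theorem integral_lag_le_of_reach (hV : 0 < Vmin) (h : V.IsFreeMorse x) {p q ρ B : ℝ} (hpq : p < q)
    (hρ : 0 < ρ) (hB : V.Reach ρ (x p) (x q) B) : ∫ t in p..q, V.lag x t ≤ B := by
  obtain ⟨ρ₀, hρ₀, hmin⟩ := h.min_pos
  have hx0 : ∀ t, x t ≠ 0 := (h.isConstrainedMorse hmin).ne_zero hρ₀
  have hx := (h.isConstrainedMorse hmin).isH1 p q
  obtain ⟨T, hT, z, hz, z0, zT, hzρ, hzB⟩ := hB.exists_path hV hρ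
  have main : ∀ (T : ℝ) (z : ℝ → Space n), 0 < T → IsH1 0 T z → z 0 = x p → z T = x q →
      (∀ t ∈ Icc 0 T, z t ≠ 0) → ∫ t in p..q, V.lag x t ≤ ∫ t in (0 : ℝ)..T, V.lag z t :=
    fun T z hT hz z0 zT hz0 => by
      have h1 := h.minimal p q 0 T z hpq hT hz z0 zT
      rwa [action_eq hV hpq.le hx fun t _ => hx0 t, action_eq hV hT.le hz hz0,
        ENNReal.ofReal_le_ofReal_iff (integral_lag_nonneg hV hT.le)] at h1
  rcases hT.eq_or_lt with hT0 | hT0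
  · rw [← hT0] at zT
    have key : ∀ τ > 0, ∫ t in p..q, V.lag x t ≤ τ * V.pot (z 0) := fun τ hτ => by
      rw [← integral_lag_const]
      exact main τ (fun _ => z 0) hτ (IsH1.of_hasDerivAt (x' := fun _ => 0)
        (fun t _ => hasDerivAt_const t _) continuousOn_const) z0 zT fun t _ => by
          rw [z0]; exact hx0 p
    have hlim : Tendsto (fun τ : ℝ => τ * V.pot (z 0)) (𝓝[>] 0) (𝓝 (0 * V.pot (z 0))) :=
      ((by fun_prop : Continuous fun τ : ℝ => τ * V.pot (z 0)).tendsto 0).mono_left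
        nhdsWithin_le_nhds
    have := ge_of_tendsto hlim (eventually_nhdsWithin_of_forall fun τ hτ => key τ hτ)
    have := hB.1
    linarith
  · exact (main T z hT0 hz z0 zT fun t ht => norm_pos_iff.1 (hρ.trans_le (hzρ t ht))).trans hzB

theorem hasDerivAt (hV : 0 < Vmin) (h : V.IsFreeMorse x) (t : ℝ) :
    HasDerivAt x (deriv x t) t ∧ HasDerivAt (deriv x) (V.grad (x t)) t := by
  obtain ⟨ρ, hρ, hmin⟩ := h.min_pos
  have hc := h.isConstrainedMorse hmin
  refine hasDerivAt_of_exists (p := t - 1) (q := t + 1) ?_ ⟨by linarith, by linarith⟩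
  exact exists_eulerLagrange hV (half_pos hρ) (by linarith) (hc.isH1 _ _)
    (fun s _ => (half_lt_self hρ).trans_le (hc.le_norm s))
    fun B hB => h.integral_lag_le_of_reach hV (by linarith) (half_pos hρ) hB

end IsFreeMorse

end Potential

end AnisotropicKepler

end

/-! ### Asymptotics of zero energy solutions. -/

noncomputable section

namespace AnisotropicKepler

theorem antitoneOn_Ici_of_hasDerivAt {f f' : ℝ → ℝ} {T : ℝ} (h : ∀ t ≥ T, HasDerivAt f (f' t) t)
    (h' : ∀ t ≥ T, f' t ≤ 0) : AntitoneOn f (Ici T) := by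
  refine antitoneOn_of_deriv_nonpos (convex_Ici T)
    (fun t ht => (h t ht).continuousAt.continuousWithinAt) (fun t ht => ?_) fun t ht => ?_
  all_goals rw [interior_Ici] at ht
  · exact (h t (le_of_lt ht)).differentiableAt.differentiableWithinAt
  · rw [(h t (le_of_lt ht)).deriv]; exact h' t (le_of_lt ht)

namespace Potential

variable {n : ℕ} {ξm ξp : USphere n} {Vmin : ℝ} {V : Potential ξm ξp Vmin}

/-- The path `x`, with velocity `v`, is on `S` a solution of `ẍ = ∇V(x)` of energy zero. -/
structure IsSolution (V : Potential ξm ξp Vmin) (x v : ℝ → Space n) (S : Set ℝ) : Prop where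
  hasDerivAt : ∀ t ∈ S, HasDerivAt x (v t) t
  hasDerivAt_velocity : ∀ t ∈ S, HasDerivAt v (V.grad (x t)) t
  energy : ∀ t ∈ S, ‖v t‖ ^ 2 = 2 * V.pot (x t)
  ne_zero : ∀ t ∈ S, x t ≠ 0

namespace IsSolution

variable {x v : ℝ → Space n} {S : Set ℝ} {t : ℝ}

theorem mono {S' : Set ℝ} (h : V.IsSolution x v S) (hS : S' ⊆ S) : V.IsSolution x v S' :=
  ⟨fun t ht => h.1 t (hS ht), fun t ht => h.2 t (hS ht), fun t ht => h.3 t (hS ht),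
    fun t ht => h.4 t (hS ht)⟩

theorem comp_neg (h : V.IsSolution x v S) :
    V.IsSolution (fun t => x (-t)) (fun t => -v (-t)) (Neg.neg ⁻¹' S) where
  hasDerivAt t ht := by
    have h1 := (h.hasDerivAt (-t) ht).scomp t (hasDerivAt_neg t)
    rw [neg_one_smul] at h1
    exact h1
  hasDerivAt_velocity t ht := by
    have h1 := ((h.hasDerivAt_velocity (-t) ht).scomp t (hasDerivAt_neg t)).neg
    rw [neg_one_smul, neg_neg] at h1
    exact h1
  energy t ht := by rw [norm_neg]; exact h.energy (-t) ht
  ne_zero t ht := h.ne_zero (-t) ht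

/-- The Lagrange-Jacobi identity: at energy zero |v|² = 2V, and homogeneity gives ⟨x, ∇V⟩ = -αV. The
right side is β times the Lagrangian, so actions become boundary terms. -/
theorem hasDerivAt_inner (h : V.IsSolution x v S) (ht : t ∈ S) :
    HasDerivAt (fun t => inner ℝ (x t) (v t)) (2 * V.β * V.pot (x t)) t := by
  refine ((h.hasDerivAt t ht).inner ℝ (h.hasDerivAt_velocity t ht)).congr_deriv ?_
  rw [real_inner_comm, inner_grad, fderiv_pot_self (h.ne_zero t ht), real_inner_self_eq_norm_sq,
    h.energy t ht, V.α_eq]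
  ring

theorem hasDerivAt_norm (h : V.IsSolution x v S) (ht : t ∈ S) :
    HasDerivAt (fun t => ‖x t‖) (inner ℝ (x t) (v t) / ‖x t‖) t := by
  have h0 : ‖x t‖ ≠ 0 := norm_ne_zero_iff.2 (h.ne_zero t ht)
  have h1 := ((h.hasDerivAt t ht).norm_sq).sqrt (pow_ne_zero 2 h0)
  simp only [Real.sqrt_sq (norm_nonneg _)] at h1
  exact h1.congr_deriv (by field_simp)

theorem inner_div_sq_le : (inner ℝ (x t) (v t) / ‖x t‖) ^ 2 ≤ ‖v t‖ ^ 2 := by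
  rw [← sq_abs, abs_div, abs_norm]
  have h1 := abs_real_inner_le_norm (x t) (v t)
  have h2 : |inner ℝ (x t) (v t)| / ‖x t‖ ≤ ‖v t‖ :=
    div_le_of_le_mul₀ (norm_nonneg _) (norm_nonneg _) (by rwa [mul_comm])
  gcongr

/-- The product ⟨x, v⟩ is nondecreasing; were it never positive, ‖x‖ would be nonincreasing and
could not tend to infinity. -/
theorem eventually_inner_pos (hV : 0 < Vmin) {T₀ : ℝ} (h : V.IsSolution x v (Ioi T₀))
    (hr : Tendsto (fun t => ‖x t‖) atTop atTop) : ∀ᶠ t in atTop, 0 < inner ℝ (x t) (v t) := by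
  have hmono : ∀ s t, T₀ < s → s ≤ t → inner ℝ (x s) (v s) ≤ inner ℝ (x t) (v t) := by
    intro s t hs hst
    have := antitoneOn_Ici_of_hasDerivAt (f := fun t => -inner ℝ (x t) (v t)) (T := s)
      (fun u hu => (h.hasDerivAt_inner (lt_of_lt_of_le hs hu)).neg) (fun u hu => by
        have h1 := pot_nonneg (V := V) hV (x u)
        have h2 := V.β_pos
        have : 0 ≤ 2 * V.β * V.pot (x u) := by positivity
        linarith) (self_mem_Ici (a := s)) hst hst
    simpa using this
  by_contra hcon
  rw [not_eventually] at hcon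
  have hle : ∀ t, T₀ < t → inner ℝ (x t) (v t) ≤ 0 := fun t ht => by
    obtain ⟨s, hs1, hs2⟩ := (hcon.and_eventually (eventually_ge_atTop t)).exists
    exact (hmono t s ht hs2).trans (not_lt.1 hs1)
  have hanti := antitoneOn_Ici_of_hasDerivAt (f := fun t => ‖x t‖) (T := T₀ + 1)
    (fun u hu => h.hasDerivAt_norm (show T₀ < u by have : T₀ + 1 ≤ u := hu; linarith))
    (fun u hu => div_nonpos_of_nonpos_of_nonneg
      (hle u (by have : T₀ + 1 ≤ u := hu; linarith)) (norm_nonneg _))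
  obtain ⟨s, hs1, hs2⟩ := ((hr.eventually_gt_atTop ‖x (T₀ + 1)‖).and
    (eventually_ge_atTop (T₀ + 1))).exists
  exact absurd (hanti self_mem_Ici hs2 hs2) (not_le.2 hs1)

/-- The quantity `r² ċ`, for the cosine `c` of the angle between `x` and `ξ`. -/
def angular (ξ : USphere n) (x v : ℝ → Space n) (t : ℝ) : ℝ :=
  ‖x t‖ * inner ℝ (ξ : Space n) (v t)
    - inner ℝ (ξ : Space n) (x t) * (inner ℝ (x t) (v t) / ‖x t‖)

theorem hasDerivAt_cos (h : V.IsSolution x v S) (ht : t ∈ S) (ξ : USphere n) :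
    HasDerivAt (fun t => inner ℝ (ξ : Space n) (x t) / ‖x t‖) (angular ξ x v t / ‖x t‖ ^ 2) t := by
  have h0 : ‖x t‖ ≠ 0 := norm_ne_zero_iff.2 (h.ne_zero t ht)
  have h1 := ((hasDerivAt_const t (ξ : Space n)).inner ℝ (h.hasDerivAt t ht)).div
    (h.hasDerivAt_norm ht) h0
  refine h1.congr_deriv ?_
  simp only [angular, inner_zero_left, add_zero]
  ring

/-- Near the direction ξ both terms are nonpositive: the first by non-degeneracy of the minimum, the
second being minus the cosine times the squared tangential speed. -/
theorem hasDerivAt_angular (h : V.IsSolution x v S) (ht : t ∈ S) (ξ : USphere n) :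
    HasDerivAt (angular ξ x v)
      (‖x t‖ ^ (-V.α) * fderiv ℝ (radialExt V.ang) (dir (x t) (h.ne_zero t ht) : Space n) (ξ : Space n)
        - inner ℝ (ξ : Space n) (x t) / ‖x t‖
          * (‖v t‖ ^ 2 - (inner ℝ (x t) (v t) / ‖x t‖) ^ 2)) t := by
  have hx := h.ne_zero t ht
  have hpos : 0 < ‖x t‖ := norm_pos_iff.2 hx
  have h0 : ‖x t‖ ≠ 0 := hpos.ne'
  have hP := (hasDerivAt_const t (ξ : Space n)).inner ℝ (h.hasDerivAt t ht)
  have hP' := (hasDerivAt_const t (ξ : Space n)).inner ℝ (h.hasDerivAt_velocity t ht)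
  have hr := h.hasDerivAt_norm ht
  have hr' := (h.hasDerivAt_inner ht).div hr h0
  have h1 := (hr.mul hP').sub (hP.mul hr')
  refine h1.congr_deriv ?_
  have e1 : fderiv ℝ (radialExt V.ang) (dir (x t) hx : Space n) (ξ : Space n)
      = ‖x t‖ * fderiv ℝ (radialExt V.ang) (x t) (ξ : Space n) := by
    have := fderiv_radialExt_smul (U := V.ang) hpos (dir (x t) hx : Space n)
    rw [norm_smul_dir] at this
    have := congrArg (fun L : Space n →L[ℝ] ℝ => L (ξ : Space n)) this
    have e : fderiv ℝ (radialExt V.ang) (x t) (ξ : Space n)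
      = ‖x t‖⁻¹ * fderiv ℝ (radialExt V.ang) (dir (x t) hx : Space n) (ξ : Space n) := this
    rw [e]; field_simp
  have e2 : inner ℝ (ξ : Space n) (V.grad (x t)) = ‖x t‖ ^ (-V.α) * fderiv ℝ (radialExt V.ang) (x t) (ξ : Space n)
      - V.α * V.pot (x t) / ‖x t‖ ^ 2 * inner ℝ (ξ : Space n) (x t) := by
    rw [real_inner_comm, inner_grad, fderiv_pot_apply hx, pot, real_inner_comm (ξ : Space n),
      Real.rpow_sub hpos, Real.rpow_two]
    ring
  simp only [inner_zero_left, add_zero, Pi.div_apply]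
  rw [e1, e2, h.energy t ht, V.α_eq]
  field_simp
  ring

/-- Along a zero energy solution escaping in the direction of a nondegenerate minimum there are
arbitrarily late times at which the solution is almost radial. -/
theorem frequently_almost_radial {ξ : USphere n} (hξ : V.ang ξ = Vmin)
    (hnd : NondegenerateAt V.ang ξ) {T₀ : ℝ} (h : V.IsSolution x v (Ioi T₀))
    (hr : Tendsto (fun t => ‖x t‖) atTop atTop)
    (hs : Tendsto (fun t => ‖x t‖⁻¹ • x t) atTop (𝓝 (ξ : Space n))) {σ : ℝ} (hσ : 0 < σ) :
    ∃ᶠ t in atTop, ‖x t‖ ^ V.β * dev ξ (x t) < σ ∧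
      ‖x t‖ ^ (1 + V.α / 2) * (‖v t‖ ^ 2 - (inner ℝ (x t) (v t) / ‖x t‖) ^ 2) < σ := by
  obtain ⟨δ, hδ, -, c, hc, hF⟩ :=
    exists_fderiv_radialExt_le V.isAngular.contMDiff V.isAngular.le hξ hnd
  obtain ⟨M, hM, hMV⟩ := exists_ang_le V
  set cs : ℝ → ℝ := fun t => inner ℝ (ξ : Space n) (x t) / ‖x t‖ with hcs
  have hcs1 : Tendsto cs atTop (𝓝 1) := by
    have h1 := (tendsto_const_nhds (x := (ξ : Space n)) (f := (atTop : Filter ℝ))).inner (𝕜 := ℝ) hs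
    rw [real_inner_self_eq_norm_sq, norm_coe, one_pow] at h1
    refine h1.congr fun t => ?_
    rw [real_inner_smul_right, hcs]; ring
  have hdist : Tendsto (fun t => ‖‖x t‖⁻¹ • x t - (ξ : Space n)‖) atTop (𝓝 0) := by
    simpa using (hs.sub_const (ξ : Space n)).norm
  obtain ⟨T₁, hT₁⟩ := eventually_atTop.1 ((eventually_gt_atTop T₀).and
    ((hcs1.eventually_const_lt (show (1 / 2 : ℝ) < 1 by norm_num)).and
      (hdist.eventually_lt_const hδ)))
  have hmem : ∀ t ≥ T₁, t ∈ Ioi T₀ := fun t ht => (hT₁ t ht).1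
  set g : ℝ → ℝ := fun t => ‖v t‖ ^ 2 - (inner ℝ (x t) (v t) / ‖x t‖) ^ 2 with hg
  have hg0 : ∀ t, 0 ≤ g t := fun t => sub_nonneg.2 inner_div_sq_le
  set K' : ℝ → ℝ := deriv (angular ξ x v)
  have hK : ∀ t ≥ T₁, HasDerivAt (angular ξ x v) (K' t) t := fun t ht =>
    (h.hasDerivAt_angular (hmem t ht) ξ).differentiableAt.hasDerivAt
  have hK' : ∀ t ≥ T₁, K' t ≤ -(c * (‖x t‖ ^ (-V.α) * dev ξ (x t)) + 1 / 2 * g t) := by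
    intro t ht
    have hx := h.ne_zero t (hmem t ht)
    rw [show K' t = _ from (h.hasDerivAt_angular (hmem t ht) ξ).deriv]
    have h1 := hF (dir (x t) hx) (by
      rw [Subtype.dist_eq, dist_eq_norm]; exact (hT₁ t ht).2.2)
    rw [← dev_eq_dist hx] at h1
    have h2 := mul_le_mul_of_nonneg_left h1 (Real.rpow_nonneg (norm_nonneg (x t)) (-V.α))
    have h3 := mul_le_mul_of_nonneg_right (hT₁ t ht).2.1.le (hg0 t)
    simp only [hcs, hg] at h3 ⊢
    linarith
  have hK'0 : ∀ t ≥ T₁, K' t ≤ 0 := fun t ht => (hK' t ht).trans (by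
    have h1 : 0 ≤ ‖x t‖ ^ (-V.α) * dev ξ (x t) :=
      mul_nonneg (Real.rpow_nonneg (norm_nonneg _) _) dev_nonneg
    have h2 := hg0 t
    have := mul_nonneg hc.le h1
    linarith)
  have hKanti := antitoneOn_Ici_of_hasDerivAt hK hK'0
  have hcs_le : ∀ t ≥ T₁, cs t ≤ 1 := fun t ht => by
    have h1 := real_inner_le_norm (ξ : Space n) (x t)
    rw [norm_coe, one_mul] at h1
    exact div_le_one_of_le₀ h1 (norm_nonneg _)
  -- The angular quantity is nonincreasing. Were it negative once, the cosine would decrease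
  -- strictly from then on and could not converge to its maximal value 1.
  have hKnn : ∀ t ≥ T₁, 0 ≤ angular ξ x v t := by
    intro t ht
    by_contra! hneg
    have hstrict : StrictAntiOn cs (Ici t) := by
      refine strictAntiOn_of_deriv_neg (convex_Ici t) (fun s hs => (h.hasDerivAt_cos
        (hmem s (ht.trans hs)) ξ).continuousAt.continuousWithinAt) fun s hs => ?_
      rw [interior_Ici] at hs
      have hts : t ≤ s := le_of_lt hs
      have hmems := hmem s (ht.trans hts)
      rw [(h.hasDerivAt_cos hmems ξ).deriv]
      refine div_neg_of_neg_of_pos ((hKanti ht (ht.trans hts) hts).trans_lt hneg) ?_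
      have := norm_pos_iff.2 (h.ne_zero s hmems)
      positivity
    have h1 := hstrict self_mem_Ici (show t + 1 ∈ Ici t by simp) (by linarith)
    have h2 : 1 ≤ cs (t + 1) := by
      refine le_of_tendsto hcs1 ?_
      filter_upwards [eventually_ge_atTop (t + 1)] with s hs
      exact hstrict.antitoneOn (show t + 1 ∈ Ici t by simp)
        (show t ≤ s by linarith) hs
    linarith [hcs_le t ht]
  by_contra hcon
  rw [not_frequently] at hcon
  obtain ⟨T₂, hT₂⟩ := eventually_atTop.1 hcon
  -- If at all late times one of the two quantities is at least σ, the angular quantity decreases at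
  -- least A times as fast as log ‖x‖ increases; √(2M) comes from the energy bound on the speed.
  -- Since the logarithm diverges, nonnegativity is contradicted.
  set A := min c (1 / 2) * σ / √(2 * M)
  have hM' : 0 < √(2 * M) := Real.sqrt_pos.2 (by positivity)
  have hA : 0 < A := by positivity
  have hanti := antitoneOn_Ici_of_hasDerivAt (T := max T₁ T₂)
    (f := fun t => angular ξ x v t + A * Real.log ‖x t‖)
    (f' := fun t => K' t + A * (inner ℝ (x t) (v t) / ‖x t‖ / ‖x t‖))
    (fun t ht => (hK t ((le_max_left _ _).trans ht)).add
      (((h.hasDerivAt_norm (hmem t ((le_max_left _ _).trans ht))).log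
        (norm_ne_zero_iff.2 (h.ne_zero t (hmem t ((le_max_left _ _).trans ht))))).const_mul A))
    (fun t ht => by
      have ht1 : T₁ ≤ t := (le_max_left _ _).trans ht
      have hx := h.ne_zero t (hmem t ht1)
      have hpos : 0 < ‖x t‖ := norm_pos_iff.2 hx
      have hnot := hT₂ t ((le_max_right _ _).trans ht)
      set w := ‖x t‖ ^ (-(1 + V.α / 2)) with hw
      have hw0 : 0 < w := Real.rpow_pos_of_pos hpos _
      have e1 : w * ‖x t‖ ^ V.β = ‖x t‖ ^ (-V.α) := by
        rw [hw, ← Real.rpow_add hpos]; congr 1; unfold β; ring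
      have e2 : w * ‖x t‖ ^ (1 + V.α / 2) = 1 := by
        rw [hw, ← Real.rpow_add hpos, neg_add_cancel, Real.rpow_zero]
      have e3 : ‖x t‖ ^ (-V.α / 2) = w * ‖x t‖ := by
        rw [hw, ← Real.rpow_add_one hpos.ne']; congr 1; ring
      have hlow : min c (1 / 2) * σ * w ≤ c * (‖x t‖ ^ (-V.α) * dev ξ (x t)) + 1 / 2 * g t := by
        have k1 : 0 ≤ ‖x t‖ ^ (-V.α) * dev ξ (x t) :=
          mul_nonneg (Real.rpow_nonneg (norm_nonneg _) _) dev_nonneg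
        have k2 := hg0 t
        have m1 := min_le_left c (1 / 2)
        have m2 := min_le_right c (1 / 2)
        have m0 : 0 < min c (1 / 2) := by positivity
        have key : σ * w ≤ ‖x t‖ ^ (-V.α) * dev ξ (x t) + g t := by
          rw [not_and_or, not_lt, not_lt] at hnot
          rcases hnot with hn | hn
          · have := mul_le_mul_of_nonneg_left hn hw0.le
            rw [← mul_assoc, e1] at this
            linarith
          · have := mul_le_mul_of_nonneg_left hn hw0.le
            rw [← mul_assoc, e2, one_mul] at this
            linarith
        have := mul_le_mul_of_nonneg_left key m0.le
        have := mul_le_mul_of_nonneg_right m1 k1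
        have := mul_le_mul_of_nonneg_right m2 k2
        linarith
      have hv : ‖v t‖ ≤ √(2 * M) * ‖x t‖ ^ (-V.α / 2) := by
        refine abs_le_of_sq_le_sq' ?_ (by positivity) |>.2
        rw [h.energy t (hmem t ht1), mul_pow, Real.sq_sqrt (by positivity), rpow_half_sq hpos]
        linarith [pot_le hMV hx]
      have hI : inner ℝ (x t) (v t) / ‖x t‖ / ‖x t‖ ≤ √(2 * M) * w := by
        rw [div_div, div_le_iff₀ (by positivity)]
        have := real_inner_le_norm (x t) (v t)
        have := mul_le_mul_of_nonneg_left hv hpos.le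
        rw [e3] at this
        linarith
      have h5 := mul_le_mul_of_nonneg_left hI hA.le
      have h6 : A * (√(2 * M) * w) = min c (1 / 2) * σ * w := by
        simp only [A]; field_simp
      linarith [hK' t ht1])
  set T := max T₁ T₂
  have hlog : Tendsto (fun t => Real.log ‖x t‖) atTop atTop := Real.tendsto_log_atTop.comp hr
  obtain ⟨s, hs1, hs2⟩ := ((hlog.eventually_gt_atTop
    ((angular ξ x v T + A * Real.log ‖x T‖) / A)).and (eventually_ge_atTop T)).exists
  have h1 := hanti self_mem_Ici hs2 hs2
  have h2 := hKnn s ((le_max_left _ _).trans hs2)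
  rw [div_lt_iff₀ hA] at hs1
  simp only at h1
  linarith

end IsSolution

end Potential

end AnisotropicKepler

end

/-! ### Almost radial points, and the link between jumps, excess and freedom. -/

noncomputable section

namespace AnisotropicKepler

namespace Potential

variable {n : ℕ} {ξm ξp : USphere n} {Vmin : ℝ} {V : Potential ξm ξp Vmin} {ε : ℝ} {x : ℝ → Space n}

/-- The point `y` is far from the origin and close to the ray spanned by `ξ`, and the velocity `w`
is almost radial, up to a tolerance `σ`. -/
structure AlmostRadial (V : Potential ξm ξp Vmin) (ξ : USphere n) (σ : ℝ) (y w : Space n) : Prop where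
  rpow_mul_dev_lt : ‖y‖ ^ V.β * dev ξ y < σ
  rpow_mul_lt : ‖y‖ ^ (1 + V.α / 2) * (‖w‖ ^ 2 - (inner ℝ y w / ‖y‖) ^ 2) < σ
  dev_lt : dev ξ y < σ
  lt_norm : σ⁻¹ < ‖y‖
  inner_pos : 0 < inner ℝ y w

theorem IsSolution.exists_almostRadial (hV : 0 < Vmin) {v : ℝ → Space n} {ξ : USphere n}
    (hξ : V.ang ξ = Vmin) (hnd : NondegenerateAt V.ang ξ) {T₀ : ℝ} (h : V.IsSolution x v (Ioi T₀))
    (hr : Tendsto (fun t => ‖x t‖) atTop atTop)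
    (hs : Tendsto (fun t => ‖x t‖⁻¹ • x t) atTop (𝓝 (ξ : Space n))) {σ : ℝ} (hσ : 0 < σ) (T : ℝ) :
    ∃ t > T, V.AlmostRadial ξ σ (x t) (v t) := by
  have hdev : Tendsto (fun t => dev ξ (x t)) atTop (𝓝 0) := by
    simpa [dev] using ((hs.sub_const (ξ : Space n)).norm).pow 2
  obtain ⟨t, ⟨h1, h2⟩, h3, h4, h5, h6⟩ := ((h.frequently_almost_radial hξ hnd hr hs hσ).and_eventually
    ((hdev.eventually_lt_const hσ).and ((hr.eventually_gt_atTop σ⁻¹).and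
      ((h.eventually_inner_pos hV hr).and (eventually_gt_atTop T))))).exists
  exact ⟨t, h6, h1, h2, h3, h4, h5⟩

namespace AlmostRadial

theorem eventually_reach_out (hV : 0 < Vmin) {ξ : USphere n} (hξ : V.ang ξ = Vmin) {e : ℝ}
    (he : 0 < e) (ρ : ℝ) : ∀ᶠ σ in 𝓝[>] (0 : ℝ), ∀ y w, V.AlmostRadial ξ σ y w →
      ∃ R₀, ∀ R ≥ R₀, V.Reach ρ y (R • (ξ : Space n)) (V.rad R - V.rad ‖y‖ + e) := by
  obtain ⟨lam, -, δ, hδ, C, hC, H⟩ := exists_reach_ray (V := V) hV hξ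
  have hlim : Tendsto (fun σ : ℝ => C * σ) (𝓝[>] 0) (𝓝 (C * 0)) :=
    ((continuous_const_mul C).tendsto 0).mono_left nhdsWithin_le_nhds
  rw [mul_zero] at hlim
  filter_upwards [hlim.eventually_lt_const he, Ioo_mem_nhdsGT hδ,
    tendsto_inv_nhdsGT_zero.eventually_gt_atTop (2 * ρ), self_mem_nhdsWithin] with σ h1 h2 h3 h4 y w h
  have h4' : (0 : ℝ) < σ := h4
  have hy : 0 < ‖y‖ := (inv_pos.2 h4').trans h.lt_norm
  refine ⟨lam * ‖y‖, fun R hR => ((H y (norm_pos_iff.1 hy) (h.dev_lt.trans h2.2)).1 R hR).mono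
    (by linarith [h.lt_norm]) ?_⟩
  have := mul_le_mul_of_nonneg_left h.rpow_mul_dev_lt.le hC
  linarith

theorem eventually_reach_in (hV : 0 < Vmin) {ξ : USphere n} (hξ : V.ang ξ = Vmin) {e r : ℝ}
    (he : 0 < e) (hr : 0 < r) : ∀ᶠ σ in 𝓝[>] (0 : ℝ), ∀ y w, V.AlmostRadial ξ σ y w →
      V.Reach r y (r • (ξ : Space n)) (V.rad ‖y‖ - V.rad r + e) := by
  obtain ⟨lam, -, δ, hδ, C, hC, H⟩ := exists_reach_ray (V := V) hV hξ
  have hlim : Tendsto (fun σ : ℝ => C * σ) (𝓝[>] 0) (𝓝 (C * 0)) :=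
    ((continuous_const_mul C).tendsto 0).mono_left nhdsWithin_le_nhds
  rw [mul_zero] at hlim
  filter_upwards [hlim.eventually_lt_const he, Ioo_mem_nhdsGT hδ,
    tendsto_inv_nhdsGT_zero.eventually_gt_atTop (2 * lam * r), self_mem_nhdsWithin]
    with σ h1 h2 h3 h4 y w h
  have h4' : (0 : ℝ) < σ := h4
  have hy : 0 < ‖y‖ := (inv_pos.2 h4').trans h.lt_norm
  refine ((H y (norm_pos_iff.1 hy) (h.dev_lt.trans h2.2)).2 r hr (h3.trans h.lt_norm).le).mono
    le_rfl ?_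
  have := mul_le_mul_of_nonneg_left h.rpow_mul_dev_lt.le hC
  linarith

/-- At energy zero, ⟨y, w⟩² is 2|y|² V(y) minus the tangential part. Both deviations from 2 Vmin
|y|^(2β) are at most a constant times σ|y|^β, so after taking roots ⟨y, w⟩ differs from √(2 Vmin)
|y|^β = β `V.rad ‖y‖` by a multiple of σ, uniformly in |y|. -/
theorem eventually_abs_sub_le (hV : 0 < Vmin) {ξ : USphere n} (hξ : V.ang ξ = Vmin) {e : ℝ}
    (he : 0 < e) : ∀ᶠ σ in 𝓝[>] (0 : ℝ), ∀ y w, V.AlmostRadial ξ σ y w → ‖w‖ ^ 2 = 2 * V.pot y →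
      |inner ℝ y w / V.β - V.rad ‖y‖| ≤ e := by
  obtain ⟨δ, hδ, -, C, hC, hF⟩ :=
    exists_radialExt_le V.isAngular.contMDiff V.isAngular.le hξ
  have hβ := V.β_pos
  set κ := √(2 * Vmin) with hκ
  have hκ0 : 0 < κ := Real.sqrt_pos.2 (by positivity)
  have hκ2 : κ ^ 2 = 2 * Vmin := sqrt_sq_two hV
  have hlim : Tendsto (fun σ : ℝ => (C + 1) * σ) (𝓝[>] 0) (𝓝 ((C + 1) * 0)) :=
    ((continuous_const_mul (C + 1)).tendsto 0).mono_left nhdsWithin_le_nhds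
  rw [mul_zero] at hlim
  filter_upwards [hlim.eventually_lt_const (show 0 < e * κ * V.β by positivity),
    Ioo_mem_nhdsGT (show 0 < δ ^ 2 by positivity)] with σ h1 h2 y w h hw
  have hσ : 0 < σ := h2.1
  have hy : 0 < ‖y‖ := (inv_pos.2 hσ).trans h.lt_norm
  have hy0 := norm_pos_iff.1 hy
  set r := ‖y‖
  set b := r ^ V.β
  have hb : 0 < b := Real.rpow_pos_of_pos hy _
  have hI := h.inner_pos
  set I := inner ℝ y w
  set D := dev ξ y with hD
  have hD0 : 0 ≤ D := dev_nonneg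
  have eb : r ^ 2 * r ^ (-V.α) = b ^ 2 := by
    rw [← Real.rpow_natCast, ← Real.rpow_natCast, ← Real.rpow_mul hy.le, ← Real.rpow_add hy]
    congr 1; rw [V.α_eq]; push_cast; ring
  have eb2 : r ^ (1 + V.α / 2) * b = r ^ 2 := by
    rw [← Real.rpow_natCast, ← Real.rpow_add hy]
    congr 1; rw [V.α_eq]; push_cast; ring
  have hbD : b * D < σ := h.rpow_mul_dev_lt
  have hup : κ * I ≤ κ ^ 2 * b + C * σ := by
    have hF' : radialExt V.ang y ≤ Vmin + C * D := by
      rw [hD, dev, radialExt_of_ne hy0, ← radialExt_coe (U := V.ang)]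
      refine hF (dir y hy0 : Space n) ?_
      rw [dist_eq_norm]
      exact lt_of_pow_lt_pow_left₀ 2 hδ.le (h.dev_lt.trans h2.2)
    have hpot : V.pot y ≤ (Vmin + C * D) * r ^ (-V.α) :=
      mul_le_mul_of_nonneg_right hF' (Real.rpow_nonneg hy.le _)
    have hI2 : I ^ 2 ≤ (2 * Vmin + 2 * C * D) * b ^ 2 := by
      have h3 : I ^ 2 ≤ (r * ‖w‖) ^ 2 := by
        have := real_inner_le_norm y w
        gcongr
      rw [mul_pow, hw] at h3
      have h4 := mul_le_mul_of_nonneg_left hpot (sq_nonneg r)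
      rw [mul_comm (Vmin + C * D), ← mul_assoc, eb] at h4
      linarith
    have h5 : (κ * I) ^ 2 ≤ (κ ^ 2 * b + C * (b * D)) ^ 2 := by
      have h6 := mul_le_mul_of_nonneg_left hI2 (sq_nonneg κ)
      rw [← hκ2] at h6
      nlinarith [sq_nonneg (C * (b * D))]
    have h7 := abs_le_of_sq_le_sq' h5 (by positivity) |>.2
    have := mul_le_mul_of_nonneg_left hbD.le hC.le
    linarith
  have hlow : κ ^ 2 * b - σ ≤ κ * I := by
    have h3 := h.rpow_mul_lt
    have h4 : b * r ^ (1 + V.α / 2) * (‖w‖ ^ 2 - (I / r) ^ 2) < b * σ := by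
      rw [mul_assoc]; exact mul_lt_mul_of_pos_left h3 hb
    rw [mul_comm b, eb2] at h4
    have h5 : r ^ 2 * (‖w‖ ^ 2 - (I / r) ^ 2) = r ^ 2 * ‖w‖ ^ 2 - I ^ 2 := by
      field_simp
    rw [h5, hw] at h4
    have h6 := mul_le_mul_of_nonneg_left (le_pot (V := V) hy0) (sq_nonneg r)
    have h7 : r ^ 2 * (Vmin * r ^ (-V.α)) = Vmin * b ^ 2 := by rw [← eb]; ring
    rw [show ‖y‖ = r from rfl, h7] at h6
    have h8 : (κ * b) ^ 2 - I ^ 2 ≤ b * σ := by rw [mul_pow, hκ2]; linarith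
    by_cases hc : κ * b ≤ I
    · have := mul_le_mul_of_nonneg_left hc hκ0.le
      nlinarith
    · push Not at hc
      have h9 : (κ * b - I) * (κ * b) ≤ b * σ := by nlinarith
      have h10 : b * (κ * (κ * b - I)) ≤ b * σ := by linarith
      have := le_of_mul_le_mul_left h10 hb
      linarith
  have hrad : V.rad r = κ * b / V.β := by simp only [rad, κ, b]; ring
  rw [hrad, ← sub_div, abs_div, abs_of_pos hβ, div_le_iff₀ hβ]
  have hCσ : 0 ≤ C * σ := by positivity
  have hle : |κ * (I - κ * b)| ≤ κ * (e * V.β) := abs_le.2 ⟨by nlinarith, by nlinarith⟩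
  rw [abs_mul, abs_of_pos hκ0] at hle
  exact le_of_mul_le_mul_left hle hκ0

end AlmostRadial

namespace IsConstrainedMorse

theorem isSolution (hV : 0 < Vmin) (hε : 0 < ε) (h : V.IsConstrainedMorse ε x) :
    V.IsSolution x (deriv x) {t | ε < ‖x t‖} where
  hasDerivAt _ ht := (h.hasDerivAt hV hε ht).1
  hasDerivAt_velocity _ ht := (h.hasDerivAt hV hε ht).2
  energy _ ht := h.norm_deriv_sq_of_lt hV hε ht
  ne_zero t _ := h.ne_zero hε t

theorem exists_almostRadial_right (hV : 0 < Vmin) (hε : 0 < ε) (h : V.IsConstrainedMorse ε x)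
    {σ : ℝ} (hσ : 0 < σ) (T : ℝ) :
    ∃ t > T, ε < ‖x t‖ ∧ V.AlmostRadial ξp σ (x t) (deriv x t) := by
  obtain ⟨T₀, hT₀⟩ := eventually_atTop.1 (h.asymptotics.2.1.eventually_gt_atTop ε)
  obtain ⟨t, ht, hr⟩ := ((h.isSolution hV hε).mono (S' := Ioi T₀) fun t ht =>
    hT₀ t (le_of_lt ht)).exists_almostRadial hV V.isAngular.min_right V.isAngular.nondeg_right
    h.asymptotics.2.1 h.asymptotics.2.2.2 hσ (max T T₀)
  exact ⟨t, (le_max_left _ _).trans_lt ht, hT₀ t ((le_max_right _ _).trans ht.le), hr⟩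

theorem exists_almostRadial_left (hV : 0 < Vmin) (hε : 0 < ε) (h : V.IsConstrainedMorse ε x)
    {σ : ℝ} (hσ : 0 < σ) (T : ℝ) :
    ∃ t < T, ε < ‖x t‖ ∧ V.AlmostRadial ξm σ (x t) (-deriv x t) := by
  obtain ⟨T₀, hT₀⟩ := eventually_atBot.1 (h.asymptotics.1.eventually_gt_atTop ε)
  obtain ⟨t, ht, hr⟩ := ((h.isSolution hV hε).comp_neg.mono (S' := Ioi (-T₀)) fun t ht =>
    hT₀ (-t) (by have : -T₀ < t := ht; linarith)).exists_almostRadial hV V.isAngular.min_left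
    V.isAngular.nondeg_left (h.asymptotics.1.comp tendsto_neg_atTop_atBot)
    (h.asymptotics.2.2.1.comp tendsto_neg_atTop_atBot) hσ (max (-T) (-T₀))
  have h1 := le_max_left (-T) (-T₀)
  have h2 := le_max_right (-T) (-T₀)
  exact ⟨-t, by linarith, hT₀ (-t) (by linarith), hr⟩

/-- The action of a constrained minimizer between almost radial points. -/
theorem eventually_integral_lag_le (hV : 0 < Vmin) (hn : 1 ≤ n) (hε : 0 < ε)
    (h : V.IsConstrainedMorse ε x) {e : ℝ} (he : 0 < e) :
    ∀ᶠ σ in 𝓝[>] (0 : ℝ), ∀ a b t₀ w₁ w₂, a < b → t₀ ∈ Icc a b → ‖x t₀‖ = ε →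
      V.AlmostRadial ξm σ (x a) w₁ → V.AlmostRadial ξp σ (x b) w₂ →
      ∫ t in a..b, V.lag x t ≤ V.rad ‖x a‖ + V.rad ‖x b‖ + ε ^ V.β * V.excess + e := by
  have hεβ : 0 < ε ^ V.β := Real.rpow_pos_of_pos hε _
  obtain ⟨R, hR, hE⟩ := exists_exc_of_excess_lt (V := V) (E := V.excess + e / 3 / ε ^ V.β) hV hn
    (lt_add_of_pos_right _ (by positivity))
  have hc := hE.cross hε (by linarith)
  have hεR : ε ≤ ε * R := le_mul_of_one_le_right hε.le hR
  have hεR0 : 0 < ε * R := hε.trans_le hεR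
  have he3 : 0 < e / 3 := by positivity
  filter_upwards [AlmostRadial.eventually_reach_in (V := V) hV V.isAngular.min_left he3 hεR0,
    AlmostRadial.eventually_reach_in (V := V) hV V.isAngular.min_right he3 hεR0]
    with σ h1 h2 a b t₀ w₁ w₂ hab ht₀ hc₀ ha hb
  have k1 := (h1 _ _ ha).mono hεR le_rfl
  have k2 := (h2 _ _ hb).mono hεR le_rfl
  -- The competitor goes in along the first ray, crosses near the origin almost optimally at scale
  -- ε, and leaves along the second ray.
  have k3 := ((hc.trans k2.symm).symm.trans k1.symm).symm
  refine (h.integral_lag_le_of_cross hV hε hab ht₀ hc₀ k3).trans (le_of_eq ?_)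
  field_simp
  ring

/-- A constrained minimizer is free if the excess vanishes. -/
theorem isFreeMorse (hV : 0 < Vmin) (hn : 1 ≤ n) (hξ : ξp ≠ ξm) (hε : 0 < ε)
    (h : V.IsConstrainedMorse ε x) (hex : V.excess = 0) : V.IsFreeMorse x where
  h1 := h.h1
  min_pos := ⟨ε, hε, h.min_eq⟩
  asymptotics := h.asymptotics
  minimal a b a' b' z hab hab' hz hza hzb := by
    by_contra! hlt
    rw [action_eq hV hab.le (h.isH1 a b) fun t _ => h.ne_zero hε t] at hlt
    have hfin : V.action a' b' z ≠ ⊤ := (hlt.trans ENNReal.ofReal_lt_top).ne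
    set B := (V.action a' b' z).toReal with hB
    have hBz : V.action a' b' z = ENNReal.ofReal B := (ENNReal.ofReal_toReal hfin).symm
    have hB0 : 0 ≤ B := ENNReal.toReal_nonneg
    have hBlt : B < ∫ t in a..b, V.lag x t := by
      rw [hBz] at hlt
      exact (ENNReal.ofReal_lt_ofReal_iff_of_nonneg hB0).1 hlt
    have hr := Reach.of_path (V := V) (ρ := 0) hab'.le hz (fun t _ => norm_nonneg _) hB0 hBz.le
    rw [hza, hzb] at hr
    -- The assumed gain is 4e, whereas the action estimate and the two tails lose at most e each;
    -- the spliced path still costs less than 2 `V.rad R`.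
    set e := ((∫ t in a..b, V.lag x t) - B) / 4 with he
    have he0 : 0 < e := by rw [he]; linarith
    obtain ⟨t₀, ht₀⟩ := h.exists_contact
    obtain ⟨σ, h1, h2, h3, h4⟩ := ((h.eventually_integral_lag_le hV hn hε he0).and
      ((AlmostRadial.eventually_reach_out (V := V) hV V.isAngular.min_left he0 0).and
      ((AlmostRadial.eventually_reach_out (V := V) hV V.isAngular.min_right he0 0).and
        (self_mem_nhdsWithin (s := Ioi (0 : ℝ)))))).exists
    obtain ⟨a₁, ha₁, -, hra⟩ := h.exists_almostRadial_left hV hε h4 (min a t₀)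
    obtain ⟨b₁, hb₁, -, hrb⟩ := h.exists_almostRadial_right hV hε h4 (max b t₀)
    rw [lt_min_iff] at ha₁
    rw [gt_iff_lt, max_lt_iff] at hb₁
    have k1 := h1 a₁ b₁ t₀ _ _ (ha₁.2.trans hb₁.2) ⟨ha₁.2.le, hb₁.2.le⟩ ht₀ hra hrb
    rw [hex, mul_zero, add_zero, h.integral_add hε ha₁.1.le (hab.trans hb₁.1).le,
      h.integral_add hε hab.le hb₁.1.le] at k1
    obtain ⟨R₁, hR₁⟩ := h2 _ _ hra
    obtain ⟨R₂, hR₂⟩ := h3 _ _ hrb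
    set R := max 1 (max R₁ R₂)
    have q1 := hR₁ R ((le_max_left _ _).trans (le_max_right _ _))
    have q2 := hR₂ R ((le_max_right _ _).trans (le_max_right _ _))
    have q3 := (h.reach hV hε ha₁.1.le).mono hε.le le_rfl
    have q4 := (h.reach hV hε hb₁.1.le).mono hε.le le_rfl
    have hout := mem_out_of_reach (V := V) hξ (zero_lt_one.trans_le (le_max_left 1 (max R₁ R₂)))
      ((((q1.symm.trans q3).trans hr).trans q4).trans q2) (by linarith)
    rw [mem_out_iff_excess hV hn hξ, hex] at hout
    exact lt_irrefl _ hout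

/-- Integration of the Lagrange-Jacobi identity. One-sided limits at the ends are enough, which
allows an end to be a contact time where the velocity may be discontinuous. -/
theorem integral_lag_eq (hV : 0 < Vmin) (hε : 0 < ε) (h : V.IsConstrainedMorse ε x) {a b la lb : ℝ}
    (hab : a < b) (hlt : ∀ t ∈ Ioo a b, ε < ‖x t‖)
    (ha : Tendsto (fun t => inner ℝ (x t) (deriv x t)) (𝓝[>] a) (𝓝 la))
    (hb : Tendsto (fun t => inner ℝ (x t) (deriv x t)) (𝓝[<] b) (𝓝 lb)) :
    ∫ t in a..b, V.lag x t = (lb - la) / V.β := by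
  have hsol := h.isSolution hV hε
  have hder : ∀ t ∈ Ioo a b, HasDerivAt (fun t => inner ℝ (x t) (deriv x t)) (V.β * V.lag x t) t :=
    fun t ht => (hsol.hasDerivAt_inner (hlt t ht)).congr_deriv (by
      rw [lag, hsol.energy t (hlt t ht)]; ring)
  have h1 := intervalIntegral.integral_eq_sub_of_hasDerivAt_of_tendsto hab hder
    ((intervalIntegrable_lag hab.le (h.isH1 a b) fun t _ => h.ne_zero hε t).const_mul _) ha hb
  rw [intervalIntegral.integral_const_mul] at h1
  rw [← h1, mul_div_cancel_left₀ _ V.β_pos.ne']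

/-- If the jumps vanish, the contact set is a point, and the action is a boundary term. -/
theorem exists_integral_lag_eq (hV : 0 < Vmin) (hε : 0 < ε) (h : V.IsConstrainedMorse ε x)
    (hj : HasPathJumps V.α ε x 0 0) : ∃ t₀, ‖x t₀‖ = ε ∧ ∀ a b, a < t₀ → t₀ < b →
      ∫ t in a..b, V.lag x t
        = (inner ℝ (x b) (deriv x b) - inner ℝ (x a) (deriv x a)) / V.β := by
  obtain ⟨t₁, t₂, w₁, w₂, ht, hset, hw₁, hw₂, hp, hv⟩ := hj
  have hc : ∀ t, ‖x t‖ = ε ↔ t ∈ Icc t₁ t₂ := fun t => by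
    rw [← hset]; exact Iff.rfl
  have hc1 : ‖x t₁‖ = ε := (hc t₁).2 ⟨le_rfl, ht⟩
  have hxx : x t₂ = x t₁ := by
    rw [eq_comm, div_eq_zero_iff, norm_eq_zero, sub_eq_zero] at hp
    exact hp.resolve_right hε.ne'
  -- A nontrivial contact interval with equal end positions could be removed at zero cost, while its
  -- action is positive.
  have htt : t₁ = t₂ := by
    by_contra hne
    have hlt := lt_of_le_of_ne ht hne
    have h1 := h.integral_lag_le_of_cross hV hε (B := 0) hlt ⟨le_rfl, ht⟩ hc1 (by
      rw [hxx]
      exact ⟨x t₁, 0, 0, hc1, Reach.refl hc1.ge, Reach.refl hc1.ge, by norm_num⟩)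
    have h2 := intervalIntegral.intervalIntegral_pos_of_pos
      (intervalIntegrable_lag (V := V) hlt.le (h.isH1 t₁ t₂) fun t _ => h.ne_zero hε t)
      (fun t => lag_pos hV (h.ne_zero hε t)) hlt
    linarith
  subst htt
  refine ⟨t₁, hc1, fun a b ha hb => ?_⟩
  have hne : ∀ t, t ≠ t₁ → ε < ‖x t‖ := fun t ht => lt_of_le_of_ne (h.le_norm t) fun he => ht (by
    have := (hc t).1 he.symm
    rwa [Icc_self, mem_singleton_iff] at this)
  have hvel : inner ℝ w₂ (x t₁) = inner ℝ w₁ (x t₁) := by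
    rw [eq_comm, div_eq_zero_iff, sub_eq_zero] at hv
    exact hv.resolve_right (by positivity)
  have hcont : ∀ t, t ≠ t₁ → ContinuousAt (fun t => inner ℝ (x t) (deriv x t)) t := fun t ht =>
    ((h.isSolution hV hε).hasDerivAt_inner (hne t ht)).continuousAt
  have hxt : Tendsto x (𝓝 t₁) (𝓝 (x t₁)) := h.continuous.continuousAt
  have e1 := h.integral_lag_eq hV hε ha (fun t ht => hne t ht.2.ne)
    ((hcont a ha.ne).tendsto.mono_left nhdsWithin_le_nhds)
    ((hxt.mono_left nhdsWithin_le_nhds).inner hw₁)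
  have e2 := h.integral_lag_eq hV hε hb (fun t ht => hne t ht.1.ne')
    ((hxt.mono_left nhdsWithin_le_nhds).inner hw₂)
    ((hcont b hb.ne').tendsto.mono_left nhdsWithin_le_nhds)
  rw [h.integral_add hε ha.le hb.le, e1, e2, real_inner_comm w₂, hvel, real_inner_comm w₁]
  ring

/-- Between almost radial times the action is squeezed around `V.rad ‖x a‖ + V.rad ‖x b‖ + ε^β ·
excess`, from above by minimality and from below by the definition of the excess after prolongation
along the rays. Without jumps it is also close to the sum of the two radial terms alone. -/
theorem excess_eq_zero (hV : 0 < Vmin) (hn : 1 ≤ n) (hε : 0 < ε) (h : V.IsConstrainedMorse ε x)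
    (hj : HasPathJumps V.α ε x 0 0) : V.excess = 0 := by
  obtain ⟨t₀, ht₀, heq⟩ := h.exists_integral_lag_eq hV hε hj
  have hεβ : 0 < ε ^ V.β := Real.rpow_pos_of_pos hε _
  have key : ∀ e > 0, |ε ^ V.β * V.excess| ≤ 4 * e := fun e he => by
    obtain ⟨σ, h1, h2, h3, h4, h5, h6⟩ := ((h.eventually_integral_lag_le hV hn hε he).and
      ((AlmostRadial.eventually_reach_out (V := V) hV V.isAngular.min_left he ε).and
      ((AlmostRadial.eventually_reach_out (V := V) hV V.isAngular.min_right he ε).and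
      ((AlmostRadial.eventually_abs_sub_le (V := V) hV V.isAngular.min_left he).and
      ((AlmostRadial.eventually_abs_sub_le (V := V) hV V.isAngular.min_right he).and
        (self_mem_nhdsWithin (s := Ioi (0 : ℝ)))))))).exists
    obtain ⟨a, ha, hεa, hra⟩ := h.exists_almostRadial_left hV hε h6 t₀
    obtain ⟨b, hb, hεb, hrb⟩ := h.exists_almostRadial_right hV hε h6 t₀
    have hab := ha.trans hb
    have k1 := h1 a b t₀ _ _ hab ⟨ha.le, hb.le⟩ ht₀ hra hrb
    have k2 := abs_le.1 (h4 _ _ hra (by rw [norm_neg]; exact h.norm_deriv_sq_of_lt hV hε hεa))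
    have k3 := abs_le.1 (h5 _ _ hrb (h.norm_deriv_sq_of_lt hV hε hεb))
    rw [inner_neg_right, neg_div] at k2
    obtain ⟨R₁, hR₁⟩ := h2 _ _ hra
    obtain ⟨R₂, hR₂⟩ := h3 _ _ hrb
    set R := max ε (max R₁ R₂)
    have q1 := hR₁ R ((le_max_left _ _).trans (le_max_right _ _))
    have q2 := hR₂ R ((le_max_right _ _).trans (le_max_right _ _))
    have hcross : V.Cross ε (x a) (x b) (∫ t in a..b, V.lag x t) :=
      ⟨x t₀, _, _, ht₀, h.reach hV hε ha.le, h.reach hV hε (le_of_lt hb),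
        (h.integral_add hε ha.le (le_of_lt hb)).ge⟩
    have k4 := le_of_cross hV hε (le_max_left _ _) ((hcross.trans q2).symm.trans q1).symm
    rw [heq a b ha hb, sub_div] at k1 k4
    exact abs_le.2 ⟨by linarith, by linarith⟩
  have h0 : ε ^ V.β * V.excess = 0 := by
    by_contra hne
    have h1 := abs_pos.2 hne
    have := key (|ε ^ V.β * V.excess| / 8) (by positivity)
    linarith
  exact (mul_eq_zero.1 h0).resolve_left hεβ.ne'

end IsConstrainedMorse

/-- Free minimizers have no jumps. -/
theorem IsFreeMorse.hasPathJumps (hV : 0 < Vmin) (h : V.IsFreeMorse x) (hε : 0 < ε)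
    (hmin : HasMinNorm x univ ε) : HasPathJumps V.α ε x 0 0 := by
  have hc := h.isConstrainedMorse hmin
  have hsol : V.IsSolution x (deriv x) univ :=
    ⟨fun t _ => (h.hasDerivAt hV t).1, fun t _ => (h.hasDerivAt hV t).2, fun t _ =>
      hc.norm_deriv_sq hV hε (Eventually.of_forall fun s => (h.hasDerivAt hV s).2.continuousAt),
      fun t _ => hc.ne_zero hε t⟩
  -- At a contact the norm is minimal, so ⟨x, ẋ⟩ vanishes there; strict monotonicity allows only one
  -- such time.
  have hmono : StrictMono fun t => inner ℝ (x t) (deriv x t) :=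
    strictMono_of_deriv_pos fun t => by
      rw [(hsol.hasDerivAt_inner (mem_univ t)).deriv]
      have := V.β_pos
      have := pot_pos (V := V) hV (hc.ne_zero hε t)
      positivity
  have hzero : ∀ t, ‖x t‖ = ε → inner ℝ (x t) (deriv x t) = 0 := fun t ht => by
    have hloc : IsLocalMin (fun t => ‖x t‖) t :=
      Eventually.of_forall fun s => ht.le.trans (hc.le_norm s)
    have h1 := hloc.hasDerivAt_eq_zero (hsol.hasDerivAt_norm (mem_univ t))
    exact (div_eq_zero_iff.1 h1).resolve_right (norm_ne_zero_iff.2 (hc.ne_zero hε t))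
  obtain ⟨t₀, ht₀⟩ := hc.exists_contact
  have hcont : Tendsto (deriv x) (𝓝 t₀) (𝓝 (deriv x t₀)) := (h.hasDerivAt hV t₀).2.continuousAt
  refine ⟨t₀, t₀, deriv x t₀, deriv x t₀, le_rfl, ?_, hcont.mono_left nhdsWithin_le_nhds,
    hcont.mono_left nhdsWithin_le_nhds, by simp, by simp⟩
  rw [Icc_self]
  refine Subset.antisymm (fun t ht => ?_) (singleton_subset_iff.2 ht₀)
  exact hmono.injective ((hzero t ht).trans (hzero t₀ ht₀).symm)

end Potential

end AnisotropicKepler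

end

/-- Conditions 1 and 5 both become the vanishing of the excess. In 4 → 5 a single value of ε
suffices, and in 2 → 5 the free minimizer is used as a constrained one at its own minimal distance.
-/
theorem mainTheorem2 (n : ℕ) (hn : 1 ≤ n) (ξm ξp : AnisotropicKepler.USphere n) (hξ : ξp ≠ ξm)
    (Vmin : ℝ) (hVmin : 0 < Vmin) (V : AnisotropicKepler.Potential ξm ξp Vmin) :
    List.TFAE [
      V ∈ AnisotropicKepler.separatingSet ξm ξp Vmin,
      ∃ x, V.IsFreeMorse x,
      ∀ ε : ℝ, 0 < ε → ∀ x, V.IsConstrainedMorse ε x → V.IsFreeMorse x,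
      V.HasJumps 0 0,
      Tendsto V.gamma (𝓝[>] 0) (𝓝 0)] := by
  rw [AnisotropicKepler.Potential.mem_separatingSet_iff_excess hVmin hn hξ,
    AnisotropicKepler.Potential.tendsto_gamma_zero_iff hVmin hn hξ]
  tfae_have 1 → 3 := fun h ε hε x hx => hx.isFreeMorse hVmin hn hξ hε h
  tfae_have 3 → 2 := fun h => by
    obtain ⟨x, hx⟩ := AnisotropicKepler.Potential.exists_isConstrainedMorse hVmin hn V one_pos
    exact ⟨x, h 1 one_pos x hx⟩
  tfae_have 3 → 4 := fun h ε hε =>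
    ⟨AnisotropicKepler.Potential.exists_isConstrainedMorse hVmin hn V hε,
      fun x hx => (h ε hε x hx).hasPathJumps hVmin hε hx.min_eq⟩
  tfae_have 4 → 5 := fun h => by
    obtain ⟨⟨x, hx⟩, hj⟩ := h 1 one_pos
    exact hx.excess_eq_zero hVmin hn one_pos (hj x hx)
  tfae_have 2 → 5 := fun ⟨x, hx⟩ => by
    obtain ⟨ρ, hρ, hmin⟩ := hx.min_pos
    exact (hx.isConstrainedMorse hmin).excess_eq_zero hVmin hn hρ (hx.hasPathJumps hVmin hρ hmin)
  tfae_have 5 → 1 := id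
  tfae_finish
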